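/- **Target.** Let $W=\{\mathrm{im}(w)>0\}\subset\mathbb C$, $\theta_W=d\,\mathrm{re}(w)/\mathrm{im}(w)$, $\omega_W=d\theta_W$. For $\gamma=(\alpha,\beta)\in\mathfrak g_{\mathrm{aff}}$ (the Lie algebra of the orientation-preserving affine group of $\mathbb R$) put $X_\gamma=(\alpha w+\beta)\partial_w$ and $H_\gamma=\theta_W(X_\gamma)$. Let $M$ be a compact manifold with boundary, with a symplectic form $\omega_M=d\theta_M$ and a compatible almost complex structure $J_M$ such that any $J_M$-holomorphic curve touching $\partial M$ is contained in $\partial M$. Let $E$ be a manifold with boundary, with a symplectic form $\omega_E=d\theta_E$, and $\pi:E\to W$ a smooth proper map. Call $\pi$ symplectically locally trivial at $x$ if $D\pi_x$ is onto, $T_xE=TE^v_x\oplus TE^h_x$ with $TE^v=\ker D\pi$ and $TE^h$ its symplectic orthogonal complement, and $\pi^*\omega_W=\omega_E$ on $TE^h$ near $x$. We assume that $\pi$ is symplectically locally trivial outside $\pi^{-1}(V)$ for a closed disc $V\subset W$, and at each point of $\partial E$, where moreover $TE^h\subset T(\partial E)$; and that for some $\ast\in W\setminus V$ the fibre $E_\ast$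 is identified with $M$ compatibly with the one-forms $\theta$. Integrating $TE^h$ yields trivializations $U\times M\to\pi^{-1}(U)$ near infinity, a compactification $\bar E\to\bar W=W\cup\mathbb R\cup\{\infty\}$, and a collar $W\times\{\text{neighbourhood of }\partial M\}\to E$ of $\partial E$. * $\mathcal J(E)$ is the set of $\omega_E$-compatible almost complex structures on $E$ which are the product of $J_M$ and the complex structure of the base on some such collar, for which $D\pi$ is holomorphic outside the preimage of a compact subset of $W$, and which extend smoothly to $\bar E$. * $\mathcal H_\gamma(E)$ is the set of $H\in C^\infty(E,\mathbb R)$ with $H=H_\gamma\circ\pi$ outside a compact subset of $E\setminus\partial E$. The Hamiltonian vector field $X_H$ is defined by $\omega_E(X_H,\cdot)=-dH$. * Lagrangians are connected Lagrangian submanifolds $L\subset E\setminus\partial E$ such that $\theta_E|L$ is exact, $\pi|L$ is proper, and $\pi(L)$ lies in the union of a compact subset of $W$ and a segment $\{\mathrm{re}(w)=\lambda_L,\ 0<\mathrm{im}(w)<r\}$. **Surface.** Let $d\ge 1$, and let $S$ be a closed oriented disc minus boundary points $\zeta_0,\dots,\zeta_d$ (in cyclic order), with a complex structure, and with strip-like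 ends: holomorphic proper embeddings $\epsilon_0:\mathbb R^{\le0}\times[0,1]\to S$ and $\epsilon_1,\dots,\epsilon_d:\mathbb R^{\ge0}\times[0,1]\to S$ with disjoint images, $\epsilon_j^{-1}(\partial S)=\{t\in\{0,1\}\}$, and $\epsilon_j(s,\cdot)\to\zeta_j$ as $s\to\pm\infty$. **Data for the ends.** For each $j$ fix $(a_{j,t}\,dt,\lambda_{j,0},\lambda_{j,1})$, with $a_{j,t}\in\mathfrak g_{\mathrm{aff}}$ smooth in $t\in[0,1]$, such that $g_j^{-1}(\lambda_{j,1})<\lambda_{j,0}$, where $g_j$ is the parallel transport of $d-a_{j,t}dt$ along $[0,1]$; Lagrangians $L_{j,0},L_{j,1}$ with $\lambda_{L_{j,k}}=\lambda_{j,k}$; and smooth families $J_{j,t}\in\mathcal J(E)$, $H_{j,t}\in\mathcal H_{a_{j,t}}(E)$, such that $L_{j,0}$ is transverse to $\phi_j^{-1}(L_{j,1})$, $\phi_j$ being the time-one map of the Hamiltonian vector field $X_{j,t}$ of $H_{j,t}$. A chord is $x:[0,1]\to E$ with $dx/dt=X_{j,t}(x)$, $x(0)\in L_{j,0}$, $x(1)\in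 L_{j,1}$. **Data on $S$.** Fix a flat $A\in\Omega^1(S,\mathfrak g_{\mathrm{aff}})$ (that is, $-dA+\frac12[A,A]=0$, with the matrix commutator) and $\lambda\in C^\infty(\partial S,\mathbb R)$ which is covariantly constant for $d-A$; a smooth family $J_z\in\mathcal J(E)$, $z\in S$; a one-form $K\in\Omega^1(S,C^\infty(E,\mathbb R))$ with $K(\xi)\in\mathcal H_{A(\xi)}(E)$, the compact subset being locally uniform in $z\in S$; and a smooth family of Lagrangians $L_z$, $z\in\partial S$, with $\lambda_{L_z}=\lambda_z$, the properness and the behaviour at infinity being locally uniform in $z$. Let $X_K(\xi)$ be the Hamiltonian vector field of $K(\xi)$. On the ends, $\epsilon_j^*A=a_{j,t}dt$, $\epsilon_j^*K=H_{j,t}dt$, $\lambda_{\epsilon_j(s,k)}=\lambda_{j,k}$ and $L_{\epsilon_j(s,k)}=L_{j,k}$ for $k=0,1$; and $J_{\epsilon_j(s,t)}\to J_{j,t}$ exponentially fast in any $C^r$ topology as $s\to\pm\infty$, with equality outside a compact subset of $E\setminus\partial E$. **Lemma.** Fix all these data, and chords $x_0,\dots,x_d$ for the respective ends. Then there is a constant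 $C$ such that every smooth map $u:S\to E$ with $$(Du-X_K)^{0,1}=0\ \text{ with respect to } J_{z,u(z)},\qquad u(z)\in L_z\ \text{ for } z\in\partial S,\qquad \lim_{s\to\pm\infty}u(\epsilon_j(s,\cdot))=x_j\ \text{ for all } j$$ (uniform limits over $[0,1]$) satisfies $$E^{\mathrm{geom}}(u)=\int_S\|Du-X_K\|^2_{E,J_z}\le C.$$ Here the norm is that of the metric $\omega_E(\cdot,J_z\,\cdot)$, with the norm squared of a linear map $\eta$ on $T_zS$ normalized as $\frac12(\|\eta(e_1)\|^2+\|\eta(e_2)\|^2)$ for an orthonormal basis. -/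

import Mathlib

open Set Filter Topology Manifold ContDiff MeasureTheory

noncomputable section

namespace HalfPlaneFloer

/-! ## Manifolds with boundary, one-forms, symplectic forms -/

section Manifolds

variable {V : Type*} [NormedAddCommGroup V] [NormedSpace ℝ V]
  {B : Type*} [TopologicalSpace B] (I : ModelWithCorners ℝ V B)
  {X : Type*} [TopologicalSpace X] [ChartedSpace B X] [IsManifold I ∞ X]

/-- The model is a closed half-space `{φ ≥ 0}`. The functional `φ = 0` is allowed and gives manifolds
without boundary; this is how a manifold of dimension zero is covered. -/
def IsHalfSpaceModel : Prop :=
  ∃ φ : V →L[ℝ] ℝ, range I = {v | 0 ≤ φ v}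

/-- A smooth one-form (smooth as a function on the total space of the tangent bundle). -/
def SmoothOneForm (θ : ∀ x : X, TangentSpace I x →L[ℝ] ℝ) : Prop :=
  ContMDiff I.tangent 𝓘(ℝ, ℝ) ∞ (fun v : TangentBundle I X => θ v.1 v.2)

/-- The coordinate expression of a one-form in the preferred chart at `x`. -/
def oneFormInChart (θ : ∀ x : X, TangentSpace I x →L[ℝ] ℝ) (x : X) (e : V) : V →L[ℝ] ℝ :=
  (θ ((extChartAt I x).symm e)).comp
    (mfderivWithin 𝓘(ℝ, V) I (extChartAt I x).symm (range I) e)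

/-- The exterior derivative of a one-form, `dθ (v, w) = (D_v θ) w - (D_w θ) v` in the preferred chart
at `x`, which is the chart through which Mathlib identifies `TangentSpace I x` with `V`. -/
def extD (θ : ∀ x : X, TangentSpace I x →L[ℝ] ℝ) (x : X) (v w : TangentSpace I x) : ℝ :=
  fderivWithin ℝ (oneFormInChart I θ x) (range I) (extChartAt I x x) v w
    - fderivWithin ℝ (oneFormInChart I θ x) (range I) (extChartAt I x x) w v

/-- `θ` is a smooth one-form whose exterior derivative is a symplectic form. -/
def IsSymplecticPrimitive (θ : ∀ x : X, TangentSpace I x →L[ℝ] ℝ) : Prop :=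
  SmoothOneForm I θ ∧
    ∀ (x : X) (v : TangentSpace I x), (∀ w : TangentSpace I x, extD I θ x v w = 0) → v = 0

/-- The Hamiltonian vector field of `H` for `ω = dθ`, determined by `ω (X, ·) = -dH`. -/
def hamVF (θ : ∀ x : X, TangentSpace I x →L[ℝ] ℝ) (H : X → ℝ) (x : X) : TangentSpace I x :=
  Function.invFun (fun (v w : TangentSpace I x) => extD I θ x v w)
    (fun w => -(mfderiv I 𝓘(ℝ, ℝ) H x w : ℝ))

/-- A field of endomorphisms of the tangent bundle which is smooth over the set `s`. -/
def SmoothEndOn (s : Set X) (J : ∀ x : X, TangentSpace I x →L[ℝ] TangentSpace I x) : Prop :=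
  ContMDiffOn I.tangent I.tangent ∞
    (fun v : TangentBundle I X => (⟨v.1, J v.1 v.2⟩ : TangentBundle I X)) {v | v.1 ∈ s}

/-- A family of fields of endomorphisms, smooth jointly in the parameter `p ∈ T` and the point. -/
def SmoothEndFamilyOn {P : Type*} [NormedAddCommGroup P] [NormedSpace ℝ P] (T : Set P)
    (J : P → ∀ x : X, TangentSpace I x →L[ℝ] TangentSpace I x) : Prop :=
  ContMDiffOn (𝓘(ℝ, P).prod I.tangent) I.tangent ∞
    (fun q : P × TangentBundle I X => (⟨q.2.1, J q.1 q.2.1 q.2.2⟩ : TangentBundle I X)) (T ×ˢ univ)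

/-- `J` is a smooth almost complex structure compatible with the symplectic form `ω = dθ`:
`ω (·, J ·)` is a Riemannian metric. -/
def IsCompatibleACS (θ : ∀ x : X, TangentSpace I x →L[ℝ] ℝ)
    (J : ∀ x : X, TangentSpace I x →L[ℝ] TangentSpace I x) : Prop :=
  SmoothEndOn I univ J ∧
    ∀ (x : X) (v w : TangentSpace I x),
      J x (J x v) = -v ∧ extD I θ x v (J x w) = extD I θ x w (J x v) ∧
        (v ≠ 0 → 0 < extD I θ x v (J x v))

/-- Every `J`-holomorphic curve touching the boundary is contained in it. -/
def IsWeaklyConvex (J : ∀ x : X, TangentSpace I x →L[ℝ] TangentSpace I x) : Prop :=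
  ∀ (U : Set ℂ) (f : ℂ → X), IsOpen U → IsPreconnected U → ContMDiffOn 𝓘(ℝ, ℂ) I ∞ f U →
    (∀ z ∈ U, ∀ ξ : ℂ, mfderiv 𝓘(ℝ, ℂ) I f z (Complex.I * ξ : ℂ)
      = J (f z) (mfderiv 𝓘(ℝ, ℂ) I f z ξ)) →
    (∃ z ∈ U, f z ∈ I.boundary X) → ∀ z ∈ U, f z ∈ I.boundary X

/-- The tangent space of the boundary at a boundary point `x` (for a half-space model). -/
def boundaryTangent (x : X) : Set (TangentSpace I x) :=
  {v : V | extChartAt I x x + v ∈ range I ∧ extChartAt I x x - v ∈ range I}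

/-- The tangent vectors at `x` to a submanifold `L`: velocities of smooth curves in `L`. -/
def tangentTo (L : Set X) (x : X) : Set (TangentSpace I x) :=
  {v : V | ∃ c : ℝ → X, ContMDiffAt 𝓘(ℝ, ℝ) I ∞ c 0 ∧ (∀ᶠ t in 𝓝 (0 : ℝ), c t ∈ L) ∧
    c 0 = x ∧ (mfderiv 𝓘(ℝ, ℝ) I c 0 (1 : ℝ) : V) = v}

/-- `L` is a submanifold: locally a regular level set. -/
def IsSubmanifold (L : Set X) : Prop :=
  ∀ x ∈ L, ∃ (k : ℕ) (O : Set X) (g : X → (Fin k → ℝ)), IsOpen O ∧ x ∈ O ∧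
    ContMDiffOn I 𝓘(ℝ, Fin k → ℝ) ∞ g O ∧
    (∀ y ∈ O, Function.Surjective (mfderiv I 𝓘(ℝ, Fin k → ℝ) g y)) ∧
    L ∩ O = {y ∈ O | g y = 0}

/-- The coordinate expression, in the preferred chart at `x₀`, of a field of endomorphisms. -/
def endInChart (J : ∀ x : X, TangentSpace I x →L[ℝ] TangentSpace I x) (x₀ : X) (e : V) :
    V →L[ℝ] V :=
  (mfderiv I 𝓘(ℝ, V) (extChartAt I x₀) ((extChartAt I x₀).symm e)).comp
    ((J ((extChartAt I x₀).symm e)).comp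
      (mfderivWithin 𝓘(ℝ, V) I (extChartAt I x₀).symm (range I) e))

end Manifolds

/-! ## Affine transformations and the half-plane -/

/-- The Lie algebra of the affine group of the line; `(α, β)` is the vector field `(α x + β) ∂_x`. -/
abbrev LieAff := ℝ × ℝ

/-- The commutator of the matrices `(α β; 0 0)`. -/
def affBracket (γ γ' : LieAff) : LieAff := (0, γ.1 * γ'.2 - γ'.1 * γ.2)

/-- The open upper half-plane `W`. -/
def upperW : Set ℂ := {w | 0 < w.im}

/-- The hyperbolic area form at `w ∈ W`. -/
def omegaW (w v v' : ℂ) : ℝ := (v.re * v'.im - v.im * v'.re) / w.im ^ 2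

/-- The Hamiltonian `H_γ = θ_W (X_γ)`, where `θ_W = d re(w) / im(w)`, `X_γ = (α w + β) ∂_w`. -/
def affHam (γ : LieAff) (w : ℂ) : ℝ := (γ.1 * w.re + γ.2) / w.im

/-- `(a_t dt, lam₀, lam₁) ∈ P_aff([0,1])`: the preimage `y 0` of `lam₁` under the parallel transport of
`d - a_t dt` along `[0,1]` lies to the left of `lam₀`. -/
def IsAffTriple (a : ℝ → LieAff) (lam₀ lam₁ : ℝ) : Prop :=
  ContDiffOn ℝ ∞ a (Icc 0 1) ∧
    ∃ y : ℝ → ℝ, (∀ t ∈ Icc (0 : ℝ) 1,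
      HasDerivWithinAt y ((a t).1 * y t + (a t).2) (Icc 0 1) t) ∧ y 1 = lam₁ ∧ y 0 < lam₀

/-- Coordinates of the compactified half-plane near its points at infinity: `w ↦ p + w` near the real
point `p`, and `w ↦ -1/w` near `∞`. Both are hyperbolic isometries. -/
def IsBoundaryChart (κ : ℂ → ℂ) : Prop :=
  (∃ p : ℝ, κ = fun w => (p : ℂ) + w) ∨ κ = fun w => -w⁻¹

/-! ## The target space -/

section Target

variable {VE : Type*} [NormedAddCommGroup VE] [NormedSpace ℝ VE]
  {BE : Type*} [TopologicalSpace BE] (IE : ModelWithCorners ℝ VE BE)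
  (E : Type*) [TopologicalSpace E] [ChartedSpace BE E] [IsManifold IE ∞ E]
  {VM : Type*} [NormedAddCommGroup VM] [NormedSpace ℝ VM]
  {BM : Type*} [TopologicalSpace BM] (IM : ModelWithCorners ℝ VM BM)
  (M : Type*) [TopologicalSpace M] [ChartedSpace BM M] [IsManifold IM ∞ M]

/-- The data of an exact symplectic fibration with singularities over the half-plane. The symplectic
forms are the exterior derivatives of the given primitives. -/
structure FibrationData where
  thetaM : ∀ x : M, TangentSpace IM x →L[ℝ] ℝ
  JM : ∀ x : M, TangentSpace IM x →L[ℝ] TangentSpace IM x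
  thetaE : ∀ x : E, TangentSpace IE x →L[ℝ] ℝ
  proj : E → ℂ
  disc : Set ℂ
  base : ℂ
  fibreMap : M → E

namespace FibrationData

variable {IE E IM M} (F : FibrationData IE E IM M)

def omegaE (x : E) (v w : TangentSpace IE x) : ℝ := extD IE F.thetaE x v w

def omegaM (x : M) (v w : TangentSpace IM x) : ℝ := extD IM F.thetaM x v w

def dproj (x : E) (v : TangentSpace IE x) : ℂ := (mfderiv IE 𝓘(ℝ, ℂ) F.proj x v : ℂ)

/-- The vertical tangent space `ker Dπ`. -/
def vert (x : E) : Set (TangentSpace IE x) := {v | F.dproj x v = 0}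

/-- The horizontal tangent space: the symplectic orthogonal of the vertical one. -/
def hor (x : E) : Set (TangentSpace IE x) := {v | ∀ w ∈ F.vert x, F.omegaE x v w = 0}

/-- `π` is symplectically locally trivial at `x`. -/
def LocallyTrivialAt (x : E) : Prop :=
  Function.Surjective (F.dproj x) ∧
    (∀ v : TangentSpace IE x, ∃! p : TangentSpace IE x × TangentSpace IE x,
      p.1 ∈ F.vert x ∧ p.2 ∈ F.hor x ∧ v = p.1 + p.2) ∧
    ∀ᶠ y in 𝓝 x, ∀ v ∈ F.hor y, ∀ w ∈ F.hor y,
      F.omegaE y v w = omegaW (F.proj y) (F.dproj y v) (F.dproj y w)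

/-- The conditions imposed on the fibre `M`, the total space `E`, and the map `π : E → W`. -/
structure IsTarget : Prop where
  modelE : IsHalfSpaceModel IE
  modelM : IsHalfSpaceModel IM
  thetaM_symplectic : IsSymplecticPrimitive IM F.thetaM
  JM_compatible : IsCompatibleACS IM F.thetaM F.JM
  JM_convex : IsWeaklyConvex IM F.JM
  thetaE_symplectic : IsSymplecticPrimitive IE F.thetaE
  proj_smooth : ContMDiff IE 𝓘(ℝ, ℂ) ∞ F.proj
  proj_mem : ∀ x, F.proj x ∈ upperW
  proj_proper : ∀ C ⊆ upperW, IsCompact C → IsCompact (F.proj ⁻¹' C)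
  boundary_trivial : ∀ x ∈ IE.boundary E, F.LocallyTrivialAt x ∧ F.hor x ⊆ boundaryTangent IE x
  disc_subset : F.disc ⊆ upperW
  disc_homeo : Nonempty (F.disc ≃ₜ Metric.closedBall (0 : ℂ) 1)
  infinity_trivial : ∀ x, F.proj x ∉ F.disc → F.LocallyTrivialAt x
  base_mem : F.base ∈ upperW
  base_notMem : F.base ∉ F.disc
  fibreMap_smooth : ContMDiff IM IE ∞ F.fibreMap
  fibreMap_inj : Function.Injective F.fibreMap
  fibreMap_immersion : ∀ m, Function.Injective (mfderiv IM IE F.fibreMap m)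
  fibreMap_range : range F.fibreMap = F.proj ⁻¹' {F.base}
  fibreMap_theta : ∀ (m : M) (v : TangentSpace IM m),
    F.thetaE (F.fibreMap m) (mfderiv IM IE F.fibreMap m v) = F.thetaM m v

/-- A trivialization `Ψ : D × N → E` covering `κ : D → W` with `Ψ^* ω_E = ω_W + ω_M`, where `D ⊆ W`
and `N ⊆ M` are open, and `κ` is a hyperbolic isometry. Its slices `D × {m}` are horizontal, so that it
integrates the connection given by the horizontal subspaces. -/
structure IsFlatTrivialization (κ : ℂ → ℂ) (D : Set ℂ) (N : Set M) (Ψ : ℂ × M → E) : Prop where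
  smooth : ContMDiffOn (𝓘(ℝ, ℂ).prod IM) IE ∞ Ψ (D ×ˢ N)
  inj : InjOn Ψ (D ×ˢ N)
  proj_eq : ∀ p ∈ D ×ˢ N, F.proj (Ψ p) = κ p.1
  symplectic : ∀ p ∈ D ×ˢ N, ∀ v w : TangentSpace (𝓘(ℝ, ℂ).prod IM) p,
    F.omegaE (Ψ p) (mfderiv (𝓘(ℝ, ℂ).prod IM) IE Ψ p v) (mfderiv (𝓘(ℝ, ℂ).prod IM) IE Ψ p w)
      = omegaW p.1 (v.1 : ℂ) (w.1 : ℂ)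
        + F.omegaM p.2 (v.2 : TangentSpace IM p.2) (w.2 : TangentSpace IM p.2)

/-- Near `∂E`, the collar `W × {neighbourhood of ∂M} → E` takes the product of the complex structure
of the base and `J_M` to `J`. -/
def IsProductNearBoundary (J : ∀ x : E, TangentSpace IE x →L[ℝ] TangentSpace IE x) : Prop :=
  ∃ (N : Set M) (Ψ : ℂ × M → E), IsOpen N ∧ IM.boundary M ⊆ N ∧
    F.IsFlatTrivialization id upperW N Ψ ∧
    IsOpen (Ψ '' (upperW ×ˢ N)) ∧ IE.boundary E ⊆ Ψ '' (upperW ×ˢ N) ∧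
    (∀ m ∈ N, Ψ (F.base, m) = F.fibreMap m) ∧
    ∀ p ∈ upperW ×ˢ N, ∀ v : TangentSpace (𝓘(ℝ, ℂ).prod IM) p,
      J (Ψ p) (mfderiv (𝓘(ℝ, ℂ).prod IM) IE Ψ p v)
        = mfderiv (𝓘(ℝ, ℂ).prod IM) IE Ψ p
            ((Complex.I * (v.1 : ℂ) : ℂ), F.JM p.2 (v.2 : TangentSpace IM p.2))

/-- `J` extends smoothly to the compactification of `E`, which near a point at infinity is, via flat
trivializations, the product of `M` with a closed half-disc. -/
def ExtendsToInfinity (J : ∀ x : E, TangentSpace IE x →L[ℝ] TangentSpace IE x) : Prop :=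
  ∀ κ : ℂ → ℂ, IsBoundaryChart κ → ∃ r > (0 : ℝ), ∃ (Ψ : ℂ × M → E)
    (Jbar : ∀ p : ℂ × M, TangentSpace (𝓘(ℝ, ℂ).prod IM) p →L[ℝ] TangentSpace (𝓘(ℝ, ℂ).prod IM) p),
    F.IsFlatTrivialization κ (Metric.ball 0 r ∩ upperW) univ Ψ ∧
    Ψ '' ((Metric.ball 0 r ∩ upperW) ×ˢ univ) = F.proj ⁻¹' (κ '' (Metric.ball 0 r ∩ upperW)) ∧
    SmoothEndOn (𝓘(ℝ, ℂ).prod IM) ((Metric.ball 0 r ∩ {w | 0 ≤ w.im}) ×ˢ univ) Jbar ∧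
    ∀ p ∈ (Metric.ball 0 r ∩ upperW) ×ˢ (univ : Set M),
      ∀ v : TangentSpace (𝓘(ℝ, ℂ).prod IM) p,
      J (Ψ p) (mfderiv (𝓘(ℝ, ℂ).prod IM) IE Ψ p v)
        = mfderiv (𝓘(ℝ, ℂ).prod IM) IE Ψ p (Jbar p v)

/-- The class `𝒥(E)` of almost complex structures. -/
structure IsAdmissibleJ (J : ∀ x : E, TangentSpace IE x →L[ℝ] TangentSpace IE x) : Prop where
  compatible : IsCompatibleACS IE F.thetaE J
  product_near_boundary : F.IsProductNearBoundary J
  proj_holomorphic : ∃ C ⊆ upperW, IsCompact C ∧ ∀ x, F.proj x ∉ C →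
    ∀ v : TangentSpace IE x, F.dproj x (J x v) = Complex.I * F.dproj x v
  extends_to_infinity : F.ExtendsToInfinity J

/-- The class `ℋ_γ(E)` of Hamiltonians: outside a compact subset of `E ∖ ∂E`, pulled back from
`H_γ`. -/
def IsAdmissibleH (γ : LieAff) (H : E → ℝ) : Prop :=
  ContMDiff IE 𝓘(ℝ, ℝ) ∞ H ∧
    ∃ C : Set E, IsCompact C ∧ Disjoint C (IE.boundary E) ∧
      ∀ x, x ∉ C → H x = affHam γ (F.proj x)

/-- `L` is one of the Lagrangian submanifolds under consideration, with `λ_L = lam`. -/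
structure IsAdmissibleL (lam : ℝ) (L : Set E) : Prop where
  connected : IsConnected L
  submanifold : IsSubmanifold IE L
  lagrangian : ∀ x ∈ L, ∀ v : TangentSpace IE x,
    v ∈ tangentTo IE L x ↔ ∀ w ∈ tangentTo IE L x, F.omegaE x v w = 0
  disjoint_boundary : Disjoint L (IE.boundary E)
  proper : ∀ C ⊆ upperW, IsCompact C → IsCompact (L ∩ F.proj ⁻¹' C)
  at_infinity : ∃ C ⊆ upperW, IsCompact C ∧ ∃ r : ℝ,
    F.proj '' L ⊆ C ∪ {w | w.re = lam ∧ 0 < w.im ∧ w.im < r}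
  exact : ∃ P : E → ℝ, ContMDiff IE 𝓘(ℝ, ℝ) ∞ P ∧ ∀ x ∈ L, ∀ v ∈ tangentTo IE L x,
    (mfderiv IE 𝓘(ℝ, ℝ) P x v : ℝ) = F.thetaE x v

/-- A smooth family of such Lagrangian submanifolds `L τ`, with `λ_{L τ} = lam τ`, parametrized by an
open set `T` of real numbers. The `L τ` are the fibres of a submanifold of `T × E` which is submersive
over `T`, and the properness condition and the behaviour at infinity hold locally uniformly in `τ`. -/
structure IsLagrangianFamily (T : Set ℝ) (lam : ℝ → ℝ) (L : ℝ → Set E) : Prop where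
  admissible : ∀ τ ∈ T, F.IsAdmissibleL (lam τ) (L τ)
  subbundle : ∀ τ ∈ T, ∀ x ∈ L τ, ∃ (k : ℕ) (O : Set (ℝ × E)) (g : ℝ × E → (Fin k → ℝ)),
    IsOpen O ∧ (τ, x) ∈ O ∧ O ⊆ T ×ˢ univ ∧
    ContMDiffOn (𝓘(ℝ, ℝ).prod IE) 𝓘(ℝ, Fin k → ℝ) ∞ g O ∧
    (∀ q ∈ O, Function.Surjective (mfderiv IE 𝓘(ℝ, Fin k → ℝ) (fun y => g (q.1, y)) q.2)) ∧
    {q ∈ O | q.2 ∈ L q.1} = {q ∈ O | g q = 0}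
  proper : ∀ Z ⊆ T, IsCompact Z → ∀ C ⊆ upperW, IsCompact C →
    IsCompact {q : ℝ × E | q.1 ∈ Z ∧ q.2 ∈ L q.1 ∧ F.proj q.2 ∈ C}
  at_infinity : ∀ Z ⊆ T, IsCompact Z → ∃ C ⊆ upperW, IsCompact C ∧ ∃ r : ℝ, ∀ τ ∈ Z,
    F.proj '' L τ ⊆ C ∪ {w | w.re = lam τ ∧ 0 < w.im ∧ w.im < r}

end FibrationData

end Target

/-! ## Boundary-punctured discs -/

/-- The interval `ℝ^{≤ 0}` for the negative end `j = 0`, and `ℝ^{≥ 0}` for the positive ends. -/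
def endRay {d : ℕ} (j : Fin (d + 1)) : Set ℝ := if j = 0 then Iic 0 else Ici 0

/-- The filter `s → -∞` for the negative end `j = 0`, and `s → +∞` for the positive ends. -/
def endFilter {d : ℕ} (j : Fin (d + 1)) : Filter ℝ := if j = 0 then atBot else atTop

/-- The half-infinite strip with coordinates `(s, t)`. -/
def endStrip {d : ℕ} (j : Fin (d + 1)) : Set (ℝ × ℝ) := endRay j ×ˢ Icc 0 1

/-- A closed disc with `d + 1` boundary points `e^{i angle j}` in counterclockwise order, a complex
structure on their complement, and maps from half-infinite strips. -/
structure DiscData (d : ℕ) where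
  angle : Fin (d + 1) → ℝ
  cplx : ℂ → ℂ →L[ℝ] ℂ
  strip : Fin (d + 1) → ℝ × ℝ → ℂ

namespace DiscData

variable {d : ℕ} (S : DiscData d)

/-- The punctures `ζ_j`. -/
def puncture (j : Fin (d + 1)) : ℂ := Complex.exp (S.angle j * Complex.I)

/-- The surface `S`: the closed unit disc without the punctures. -/
def surface : Set ℂ := Metric.closedBall 0 1 \ range S.puncture

/-- The point `e^{iτ}` of the unit circle. -/
def bdryPt (τ : ℝ) : ℂ := Complex.exp (τ * Complex.I)

/-- The angles of points of `∂S`. -/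
def bdryAngles : Set ℝ := {τ | bdryPt τ ∉ range S.puncture}

def stripS (j : Fin (d + 1)) (q : ℝ × ℝ) : ℂ := fderivWithin ℝ (S.strip j) (endStrip j) q (1, 0)

def stripT (j : Fin (d + 1)) (q : ℝ × ℝ) : ℂ := fderivWithin ℝ (S.strip j) (endStrip j) q (0, 1)

/-- `S` is a Riemann surface with boundary which is a disc with `d + 1` boundary punctures, and is
equipped with strip-like ends. -/
structure IsPuncturedDisc : Prop where
  angle_mono : StrictMono S.angle
  angle_lt : S.angle (Fin.last d) < S.angle 0 + 2 * Real.pi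
  cplx_smooth : ContDiffOn ℝ ∞ S.cplx S.surface
  cplx_sq : ∀ z ∈ S.surface, ∀ ξ : ℂ, S.cplx z (S.cplx z ξ) = -ξ
  cplx_oriented : ∀ z ∈ S.surface, 0 < (S.cplx z 1).im
  strip_smooth : ∀ j, ContDiffOn ℝ ∞ (S.strip j) (endStrip j)
  strip_mapsTo : ∀ j, MapsTo (S.strip j) (endStrip j) S.surface
  strip_inj : ∀ j, InjOn (S.strip j) (endStrip j)
  strip_immersion : ∀ j, ∀ q ∈ endStrip j, S.stripS j q ≠ 0
  strip_holomorphic : ∀ j, ∀ q ∈ endStrip j, S.cplx (S.strip j q) (S.stripS j q) = S.stripT j q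
  strip_proper : ∀ j, ∀ C ⊆ S.surface, IsCompact C → IsCompact (endStrip j ∩ S.strip j ⁻¹' C)
  strip_boundary : ∀ j, ∀ q ∈ endStrip j, ‖S.strip j q‖ = 1 ↔ q.2 = 0 ∨ q.2 = 1
  strip_limit : ∀ j, Tendsto (S.strip j) (endFilter j ×ˢ 𝓟 (Icc 0 1)) (𝓝 (S.puncture j))
  strip_disjoint : ∀ i j, i ≠ j →
    Disjoint (S.strip i '' endStrip i) (S.strip j '' endStrip j)

end DiscData

/-! ## Data for the ends and on the surface, and the Cauchy-Riemann equation -/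

section Equation

variable {VE : Type*} [NormedAddCommGroup VE] [NormedSpace ℝ VE]
  {BE : Type*} [TopologicalSpace BE] {IE : ModelWithCorners ℝ VE BE}
  {E : Type*} [TopologicalSpace E] [ChartedSpace BE E] [IsManifold IE ∞ E]
  {VM : Type*} [NormedAddCommGroup VM] [NormedSpace ℝ VM]
  {BM : Type*} [TopologicalSpace BM] {IM : ModelWithCorners ℝ VM BM}
  {M : Type*} [TopologicalSpace M] [ChartedSpace BM M] [IsManifold IM ∞ M]

variable (IE E) in
/-- The data chosen for one strip-like end. -/
structure EndData where
  a : ℝ → LieAff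
  lam₀ : ℝ
  lam₁ : ℝ
  L₀ : Set E
  L₁ : Set E
  J : ℝ → ∀ x : E, TangentSpace IE x →L[ℝ] TangentSpace IE x
  H : ℝ → E → ℝ

/-- `c : [0,1] → E` satisfies `dc/dt = X_t`, where `X_t` is the Hamiltonian vector field of `H t`. -/
def IsHamiltonianArc (F : FibrationData IE E IM M) (H : ℝ → E → ℝ) (c : ℝ → E) : Prop :=
  ∀ t ∈ Icc (0 : ℝ) 1, HasMFDerivWithinAt 𝓘(ℝ, ℝ) IE c (Icc 0 1) t
    (ContinuousLinearMap.smulRight (1 : ℝ →L[ℝ] ℝ) (hamVF IE F.thetaE (H t) (c t)))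

/-- `φ` is the time-one map of the time-dependent Hamiltonian vector field of `H`. -/
def IsTimeOneMap (F : FibrationData IE E IM M) (H : ℝ → E → ℝ) (φ : E → E) : Prop :=
  ∀ x, ∃ c : ℝ → E, IsHamiltonianArc F H c ∧ c 0 = x ∧ c 1 = φ x

/-- The set `𝒞(H, L₀, L₁)` of chords. -/
def IsChord (F : FibrationData IE E IM M) (e : EndData IE E) (c : ℝ → E) : Prop :=
  IsHamiltonianArc F e.H c ∧ c 0 ∈ e.L₀ ∧ c 1 ∈ e.L₁

/-- The conditions on the data for one end. -/
structure EndData.IsAdmissible (F : FibrationData IE E IM M) (e : EndData IE E) : Prop where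
  triple : IsAffTriple e.a e.lam₀ e.lam₁
  L₀_admissible : F.IsAdmissibleL e.lam₀ e.L₀
  L₁_admissible : F.IsAdmissibleL e.lam₁ e.L₁
  J_smooth : SmoothEndFamilyOn IE (Icc (0 : ℝ) 1) e.J
  J_admissible : ∀ t ∈ Icc (0 : ℝ) 1, F.IsAdmissibleJ (e.J t)
  H_smooth : ContMDiffOn (𝓘(ℝ, ℝ).prod IE) 𝓘(ℝ, ℝ) ∞ (fun q : ℝ × E => e.H q.1 q.2)
    (Icc 0 1 ×ˢ univ)
  H_admissible : ∀ t ∈ Icc (0 : ℝ) 1, F.IsAdmissibleH (e.a t) (e.H t)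
  transverse : ∀ φ : E → E, IsTimeOneMap F e.H φ → ∀ x ∈ e.L₀ ∩ φ ⁻¹' e.L₁,
    ∀ w : TangentSpace IE x, ∃ v₀ ∈ tangentTo IE e.L₀ x, ∃ v₁ ∈ tangentTo IE (φ ⁻¹' e.L₁) x,
      w = v₀ + v₁

variable (IE E) in
/-- The data `(A, λ)` and `(J, K, L)` chosen on the surface. `K z x` is the covector `K(·)(x)` on
`T_z S`; the functions `lam` and `L` are only used at points of `∂S`. -/
structure SurfaceData where
  A : ℂ → ℂ →L[ℝ] LieAff
  lam : ℂ → ℝ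
  J : ℂ → ∀ x : E, TangentSpace IE x →L[ℝ] TangentSpace IE x
  K : ℂ → E → ℂ →L[ℝ] ℝ
  L : ℂ → Set E

/-- As `s → ±∞`, `J (ε (s,t))` converges to `Jend t` exponentially fast in any `C^r` topology. -/
def ConvergesExponentially {d : ℕ} (S : DiscData d) (j : Fin (d + 1))
    (J : ℂ → ∀ x : E, TangentSpace IE x →L[ℝ] TangentSpace IE x)
    (Jend : ℝ → ∀ x : E, TangentSpace IE x →L[ℝ] TangentSpace IE x) : Prop :=
  ∀ (x₀ : E) (Q : Set VE), Q ⊆ (extChartAt IE x₀).target → IsCompact Q → ∀ r : ℕ,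
    ∃ c > (0 : ℝ), ∃ C : ℝ, ∀ s ∈ endRay j, ∀ t ∈ Icc (0 : ℝ) 1, ∀ e ∈ Q,
      ‖iteratedFDerivWithin ℝ r
          (fun q : ℝ × VE => endInChart IE (J (S.strip j (s, q.1))) x₀ q.2
            - endInChart IE (Jend q.1) x₀ q.2)
          (Icc 0 1 ×ˢ range IE) (t, e)‖ ≤ C * Real.exp (-c * |s|)

/-- The conditions on the data chosen on the surface, including the compatibility with the data
chosen for the ends. -/
structure SurfaceData.IsAdmissible {d : ℕ} (F : FibrationData IE E IM M) (S : DiscData d)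
    (e : Fin (d + 1) → EndData IE E) (D : SurfaceData IE E) : Prop where
  A_smooth : ContDiffOn ℝ ∞ D.A S.surface
  A_flat : ∀ z ∈ S.surface,
    fderivWithin ℝ D.A S.surface z Complex.I 1 - fderivWithin ℝ D.A S.surface z 1 Complex.I
      + affBracket (D.A z 1) (D.A z Complex.I) = 0
  lam_smooth : ContDiffOn ℝ ∞ (fun τ => D.lam (DiscData.bdryPt τ)) S.bdryAngles
  lam_constant : ∀ τ ∈ S.bdryAngles, HasDerivAt (fun τ => D.lam (DiscData.bdryPt τ))
    ((D.A (DiscData.bdryPt τ) (Complex.I * DiscData.bdryPt τ)).1 * D.lam (DiscData.bdryPt τ)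
      + (D.A (DiscData.bdryPt τ) (Complex.I * DiscData.bdryPt τ)).2) τ
  A_end : ∀ j, ∀ q ∈ endStrip j, D.A (S.strip j q) (S.stripS j q) = 0 ∧
    D.A (S.strip j q) (S.stripT j q) = (e j).a q.2
  lam_end : ∀ j, ∀ s ∈ endRay j, D.lam (S.strip j (s, 0)) = (e j).lam₀ ∧
    D.lam (S.strip j (s, 1)) = (e j).lam₁
  J_smooth : SmoothEndFamilyOn IE S.surface D.J
  J_admissible : ∀ z ∈ S.surface, F.IsAdmissibleJ (D.J z)
  K_smooth : ContMDiffOn (𝓘(ℝ, ℂ).prod IE) 𝓘(ℝ, ℂ →L[ℝ] ℝ) ∞ (fun q : ℂ × E => D.K q.1 q.2)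
    (S.surface ×ˢ univ)
  /-- Each `K(ξ)` lies in `ℋ_{A(ξ)}(E)`, locally uniformly over the surface. -/
  K_admissible : ∀ Z ⊆ S.surface, IsCompact Z → ∃ C : Set E, IsCompact C ∧
    Disjoint C (IE.boundary E) ∧ ∀ z ∈ Z, ∀ x, x ∉ C → ∀ ξ : ℂ,
      D.K z x ξ = affHam (D.A z ξ) (F.proj x)
  L_family : F.IsLagrangianFamily S.bdryAngles (fun τ => D.lam (DiscData.bdryPt τ))
    (fun τ => D.L (DiscData.bdryPt τ))
  J_end : ∀ j, ConvergesExponentially S j D.J (e j).J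
  J_end_eq : ∀ j, ∃ C : Set E, IsCompact C ∧ Disjoint C (IE.boundary E) ∧
    ∀ q ∈ endStrip j, ∀ x, x ∉ C → D.J (S.strip j q) x = (e j).J q.2 x
  K_end : ∀ j, ∀ q ∈ endStrip j, ∀ x, D.K (S.strip j q) x (S.stripS j q) = 0 ∧
    D.K (S.strip j q) x (S.stripT j q) = (e j).H q.2 x
  L_end : ∀ j, ∀ s ∈ endRay j, D.L (S.strip j (s, 0)) = (e j).L₀ ∧
    D.L (S.strip j (s, 1)) = (e j).L₁

/-- The value `(Du - X_K)(ξ)` at `z`, for `ξ ∈ T_z S`. -/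
def covDeriv {d : ℕ} (F : FibrationData IE E IM M) (S : DiscData d) (D : SurfaceData IE E)
    (u : ℂ → E) (z ξ : ℂ) : TangentSpace IE (u z) :=
  mfderivWithin 𝓘(ℝ, ℂ) IE u S.surface z ξ - hamVF IE F.thetaE (fun y => D.K z y ξ) (u z)

/-- `u : S → E` is a solution of the inhomogeneous Cauchy-Riemann equation `(Du - X_K)^{0,1} = 0`
with boundary conditions `u(z) ∈ L_z`. -/
structure IsSolution {d : ℕ} (F : FibrationData IE E IM M) (S : DiscData d)
    (D : SurfaceData IE E) (u : ℂ → E) : Prop where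
  smooth : ContMDiffOn 𝓘(ℝ, ℂ) IE ∞ u S.surface
  equation : ∀ z ∈ S.surface, ∀ ξ : ℂ,
    covDeriv F S D u z (S.cplx z ξ) = D.J z (u z) (covDeriv F S D u z ξ)
  boundary : ∀ τ ∈ S.bdryAngles, u (DiscData.bdryPt τ) ∈ D.L (DiscData.bdryPt τ)

/-- `u (ε_j (s, ·)) → x_j` in the compact-open topology of maps `[0,1] → E`, as `s → ±∞`. -/
def HasLimits {d : ℕ} (S : DiscData d) (u : ℂ → E) (x : Fin (d + 1) → ℝ → E) : Prop :=
  ∀ j, ∀ t ∈ Icc (0 : ℝ) 1,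
    Tendsto (fun q : ℝ × ℝ => u (S.strip j q)) (endFilter j ×ˢ 𝓝[Icc 0 1] t) (𝓝 (x j t))

/-- The geometric energy `∫_S ‖Du - X_K‖²`, for the metric `ω_E (·, J_z ·)`. With respect to Lebesgue
measure on the disc, the integrand is
`(|(Du - X_K)(1)|² + |(Du - X_K)(j 1)|²) / (2 · area(1, j 1))`, where `j` is the complex structure. -/
def geomEnergy {d : ℕ} (F : FibrationData IE E IM M) (S : DiscData d) (D : SurfaceData IE E)
    (u : ℂ → E) : ENNReal :=
  ∫⁻ z in S.surface, ENNReal.ofReal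
    ((F.omegaE (u z) (covDeriv F S D u z 1) (D.J z (u z) (covDeriv F S D u z 1))
      + F.omegaE (u z) (covDeriv F S D u z (S.cplx z 1))
          (D.J z (u z) (covDeriv F S D u z (S.cplx z 1))))
      / (2 * (S.cplx z 1).im))

end Equation

end HalfPlaneFloer

end

set_option linter.unusedSectionVars false

noncomputable section

namespace HalfPlaneFloer

section VectorForms

variable {P : Type*} [NormedAddCommGroup P] [NormedSpace ℝ P]
  {V : Type*} [NormedAddCommGroup V] [NormedSpace ℝ V]

/-- The exterior derivative commutes with pullback, for one-forms on normed spaces. -/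
theorem fderivWithin_pullback_antisymm {β : V → V →L[ℝ] ℝ} {g : P → V} {s : Set P} {t : Set V}
    {p : P} (hg : ContDiffWithinAt ℝ 2 g s p) (hs : UniqueDiffOn ℝ s) (hp : p ∈ s)
    (hp' : p ∈ closure (interior s)) (hβ : DifferentiableWithinAt ℝ β t (g p))
    (hst : MapsTo g s t) (ξ η : P) :
    fderivWithin ℝ (fun q => (β (g q)).comp (fderivWithin ℝ g s q)) s p ξ η
      - fderivWithin ℝ (fun q => (β (g q)).comp (fderivWithin ℝ g s q)) s p η ξ
    = fderivWithin ℝ β t (g p) (fderivWithin ℝ g s p ξ) (fderivWithin ℝ g s p η)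
      - fderivWithin ℝ β t (g p) (fderivWithin ℝ g s p η) (fderivWithin ℝ g s p ξ) := by
  have h1 : HasFDerivWithinAt (fun q => β (g q))
      ((fderivWithin ℝ β t (g p)).comp (fderivWithin ℝ g s p)) s p :=
    hβ.hasFDerivWithinAt.comp p
      (hg.differentiableWithinAt (by norm_num)).hasFDerivWithinAt hst
  have h2 : HasFDerivWithinAt (fderivWithin ℝ g s) (fderivWithin ℝ (fderivWithin ℝ g s) s p) s p :=
    ((hg.fderivWithin_right (m := 1) hs (by norm_num) hp).differentiableWithinAt
      (by norm_num)).hasFDerivWithinAt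
  have h3 := (h1.clm_comp h2).fderivWithin (hs p hp)
  have hsym : IsSymmSndFDerivWithinAt ℝ g s p :=
    hg.isSymmSndFDerivWithinAt (by simp) hs hp' hp
  have e := hsym.eq ξ η
  rw [h3]
  simp only [_root_.add_apply, ContinuousLinearMap.comp_apply,
    ContinuousLinearMap.compL_apply, ContinuousLinearMap.flip_apply]
  rw [e]
  ring

end VectorForms

section Forms

variable {V : Type*} [NormedAddCommGroup V] [NormedSpace ℝ V]
  {B : Type*} [TopologicalSpace B] {I : ModelWithCorners ℝ V B}
  {X : Type*} [TopologicalSpace X] [ChartedSpace B X] [IsManifold I ∞ X]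
  {P : Type*} [NormedAddCommGroup P] [NormedSpace ℝ P]

/-- The pullback of a one-form by a map defined on a subset of a normed space. -/
def pullForm (θ : ∀ x : X, TangentSpace I x →L[ℝ] ℝ) (f : P → X) (s : Set P) (q : P) : P →L[ℝ] ℝ :=
  (θ (f q)).comp (mfderivWithin 𝓘(ℝ, P) I f s q)

theorem contDiffOn_pullForm [FiniteDimensional ℝ P] {θ : ∀ x : X, TangentSpace I x →L[ℝ] ℝ}
    (hθ : SmoothOneForm I θ) {f : P → X} {s : Set P} (hs : UniqueDiffOn ℝ s)
    (hf : ContMDiffOn 𝓘(ℝ, P) I ∞ f s) : ContDiffOn ℝ ∞ (pullForm θ f s) s := by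
  rw [contDiffOn_clm_apply]
  intro v
  have h1 : ContMDiffOn 𝓘(ℝ, P).tangent I.tangent ∞ (tangentMapWithin 𝓘(ℝ, P) I f s)
      (Bundle.TotalSpace.proj ⁻¹' s) :=
    hf.contMDiffOn_tangentMapWithin (by simp) hs.uniqueMDiffOn
  have h2 : ContMDiff 𝓘(ℝ, P) 𝓘(ℝ, P).tangent ∞ (fun q : P => (⟨q, v⟩ : TangentBundle 𝓘(ℝ, P) P)) := by
    exact contMDiff_vectorSpace_iff_contDiff.2 contDiff_const
  have h3 := (hθ.comp_contMDiffOn h1).comp (h2.contMDiffOn (s := s)) (fun q hq => hq)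
  exact h3.contDiffOn


theorem oneFormInChart_eq_pullForm (θ : ∀ x : X, TangentSpace I x →L[ℝ] ℝ) (x : X) :
    oneFormInChart I θ x = pullForm θ (extChartAt I x).symm (range I) := rfl

theorem contDiffOn_oneFormInChart [FiniteDimensional ℝ V] {θ : ∀ x : X, TangentSpace I x →L[ℝ] ℝ}
    (hθ : SmoothOneForm I θ) (x : X) :
    ContDiffOn ℝ ∞ (oneFormInChart I θ x) (extChartAt I x).target := by
  have h1 : UniqueDiffOn ℝ (extChartAt I x).target := uniqueDiffOn_extChartAt_target x
  refine (contDiffOn_pullForm hθ h1 (contMDiffOn_extChartAt_symm (n := ∞) x)).congr ?_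
  intro e he
  rw [oneFormInChart_eq_pullForm]
  unfold pullForm
  congr 1
  exact (mfderivWithin_congr_set (extChartAt_target_eventuallyEq_of_mem he)).symm

theorem differentiableWithinAt_oneFormInChart [FiniteDimensional ℝ V]
    {θ : ∀ x : X, TangentSpace I x →L[ℝ] ℝ} (hθ : SmoothOneForm I θ) (x : X) {e : V}
    (he : e ∈ (extChartAt I x).target) :
    DifferentiableWithinAt ℝ (oneFormInChart I θ x) (range I) e :=
  ((contDiffOn_oneFormInChart hθ x e he).differentiableWithinAt (by simp)).mono_of_mem_nhdsWithin
    (extChartAt_target_mem_nhdsWithin_of_mem he)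

/-- The pullback of a one-form in terms of its expression in a chart. -/
theorem pullForm_eq_chart (θ : ∀ x : X, TangentSpace I x →L[ℝ] ℝ) {f : P → X} {s : Set P} {q : P}
    (hs : UniqueDiffOn ℝ s) (hq : q ∈ s) (hf : MDifferentiableWithinAt 𝓘(ℝ, P) I f s q) {x : X}
    (hx : f q ∈ (extChartAt I x).source) :
    pullForm θ f s q = (oneFormInChart I θ x (extChartAt I x (f q))).comp
      (fderivWithin ℝ (fun q => extChartAt I x (f q)) s q) := by
  have h1 : mfderivWithin 𝓘(ℝ, P) 𝓘(ℝ, V) (fun q => extChartAt I x (f q)) s q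
      = (mfderiv I 𝓘(ℝ, V) (extChartAt I x) (f q)).comp (mfderivWithin 𝓘(ℝ, P) I f s q) :=
    mfderiv_comp_mfderivWithin q (mdifferentiableAt_extChartAt (by rwa [← extChartAt_source (I := I)]))
      hf (hs.uniqueMDiffOn q hq)
  rw [mfderivWithin_eq_fderivWithin] at h1
  have h2 := mfderivWithin_extChartAt_symm_comp_mfderiv_extChartAt' (I := I) hx
  have h3 : ∀ v : TangentSpace I (f q), mfderivWithin 𝓘(ℝ, V) I (extChartAt I x).symm (range I)
      (extChartAt I x (f q)) (mfderiv I 𝓘(ℝ, V) (extChartAt I x) (f q) v) = v :=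
    fun v => DFunLike.congr_fun h2 v
  have h4 : (extChartAt I x).symm (extChartAt I x (f q)) = f q := (extChartAt I x).left_inv hx
  ext v
  have h6 : ∀ v, fderivWithin ℝ (fun q => extChartAt I x (f q)) s q v
      = mfderiv I 𝓘(ℝ, V) (extChartAt I x) (f q) (mfderivWithin 𝓘(ℝ, P) I f s q v) :=
    fun v => DFunLike.congr_fun h1 v
  change θ (f q) (mfderivWithin 𝓘(ℝ, P) I f s q v)
    = θ ((extChartAt I x).symm (extChartAt I x (f q)))
      (mfderivWithin 𝓘(ℝ, V) I (extChartAt I x).symm (range I) (extChartAt I x (f q))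
        (fderivWithin ℝ (fun q => extChartAt I x (f q)) s q v))
  rw [h6]
  have h5 := h3 (mfderivWithin 𝓘(ℝ, P) I f s q v)
  generalize mfderivWithin 𝓘(ℝ, P) I f s q v = w at h5 ⊢
  revert h5
  generalize mfderiv I 𝓘(ℝ, V) (extChartAt I x) (f q) w = w'
  intro h5
  have : ∀ y, y = f q → θ y (mfderivWithin 𝓘(ℝ, V) I (extChartAt I x).symm (range I)
      (extChartAt I x (f q)) w' : V) = θ (f q) (mfderivWithin 𝓘(ℝ, V) I (extChartAt I x).symm (range I)
      (extChartAt I x (f q)) w' : V) := by rintro y rfl; rfl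
  refine (Eq.trans (this _ h4) ?_).symm
  exact congrArg (θ (f q)) h5

/-- The exterior derivative of a pullback, computed in a chart. -/
theorem fderivWithin_pullForm_chart [FiniteDimensional ℝ V]
    {θ : ∀ x : X, TangentSpace I x →L[ℝ] ℝ} (hθ : SmoothOneForm I θ) {f : P → X} {s : Set P} {p : P}
    (hs : UniqueDiffOn ℝ s) (hp : p ∈ s) (hp' : p ∈ closure (interior s))
    (hf : ContMDiffOn 𝓘(ℝ, P) I ∞ f s) {x : X} (hx : f p ∈ (extChartAt I x).source) (ξ η : P) :
    fderivWithin ℝ (pullForm θ f s) s p ξ η - fderivWithin ℝ (pullForm θ f s) s p η ξ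
    = fderivWithin ℝ (oneFormInChart I θ x) (range I) (extChartAt I x (f p))
        (fderivWithin ℝ (fun q => extChartAt I x (f q)) s p ξ)
        (fderivWithin ℝ (fun q => extChartAt I x (f q)) s p η)
      - fderivWithin ℝ (oneFormInChart I θ x) (range I) (extChartAt I x (f p))
        (fderivWithin ℝ (fun q => extChartAt I x (f q)) s p η)
        (fderivWithin ℝ (fun q => extChartAt I x (f q)) s p ξ) := by
  set g : P → V := fun q => extChartAt I x (f q) with hg
  have hev : ∀ᶠ q in 𝓝[s] p, f q ∈ (extChartAt I x).source :=
    (hf p hp).continuousWithinAt (extChartAt_source_mem_nhds' hx)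
  have hgs : ContDiffWithinAt ℝ 2 g s p := by
    have : ContMDiffWithinAt 𝓘(ℝ, P) 𝓘(ℝ, V) ∞ g s p :=
      (contMDiffAt_extChartAt' (by rwa [← extChartAt_source (I := I)])).comp_contMDiffWithinAt p (hf p hp)
    exact this.contDiffWithinAt.of_le (by exact WithTop.coe_le_coe.2 (le_top : (2 : ℕ∞) ≤ ⊤))
  have hcongr : pullForm θ f s =ᶠ[𝓝[s] p]
      fun q => (oneFormInChart I θ x (g q)).comp (fderivWithin ℝ g s q) := by
    filter_upwards [hev, self_mem_nhdsWithin] with q hq hqs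
    exact pullForm_eq_chart θ hs hqs ((hf q hqs).mdifferentiableWithinAt (by simp)) hq
  rw [hcongr.fderivWithin_eq (hcongr.self_of_nhdsWithin hp)]
  exact fderivWithin_pullback_antisymm hgs hs hp hp'
    (differentiableWithinAt_oneFormInChart hθ x ((extChartAt I x).map_source hx))
    (fun q _ => by simp [hg]) ξ η

theorem mfderivWithin_eq_fderivWithin_chart {f : P → X} {s : Set P} {p : P}
    (hs : UniqueDiffOn ℝ s) (hp : p ∈ s) (hf : MDifferentiableWithinAt 𝓘(ℝ, P) I f s p) (ξ : P) :
    mfderivWithin 𝓘(ℝ, P) I f s p ξ = fderivWithin ℝ (fun q => extChartAt I (f p) (f q)) s p ξ := by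
  obtain ⟨D, hD, h⟩ : ∃ D : P →L[ℝ] V, (∀ ξ : P, D ξ = mfderivWithin 𝓘(ℝ, P) I f s p ξ) ∧
      HasFDerivWithinAt (fun q => extChartAt I (f p) (f q)) D
        ((fun q : P => q) ⁻¹' s ∩ range (fun q : P => q)) p :=
    ⟨mfderivWithin 𝓘(ℝ, P) I f s p, fun _ => rfl, hf.hasMFDerivWithinAt.2⟩
  have h2 : (fun q : P => q) ⁻¹' s ∩ range (fun q : P => q) = s := by ext; simp
  rw [h2] at h
  rw [h.fderivWithin (hs p hp)]
  exact (hD ξ).symm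

/-- The exterior derivative is natural: `d (f^* θ) = f^* (dθ)`. -/
theorem fderivWithin_pullForm [FiniteDimensional ℝ V]
    {θ : ∀ x : X, TangentSpace I x →L[ℝ] ℝ} (hθ : SmoothOneForm I θ) {f : P → X} {s : Set P} {p : P}
    (hs : UniqueDiffOn ℝ s) (hp : p ∈ s) (hp' : p ∈ closure (interior s))
    (hf : ContMDiffOn 𝓘(ℝ, P) I ∞ f s) (ξ η : P) :
    fderivWithin ℝ (pullForm θ f s) s p ξ η - fderivWithin ℝ (pullForm θ f s) s p η ξ
    = extD I θ (f p) (mfderivWithin 𝓘(ℝ, P) I f s p ξ) (mfderivWithin 𝓘(ℝ, P) I f s p η) := by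
  rw [fderivWithin_pullForm_chart hθ hs hp hp' hf (mem_extChartAt_source (I := I) (f p))]
  have hd := (hf p hp).mdifferentiableWithinAt (by simp)
  rw [mfderivWithin_eq_fderivWithin_chart hs hp hd, mfderivWithin_eq_fderivWithin_chart hs hp hd]
  rfl

/-- The exterior derivative of the coordinate expression of a one-form. -/
def chartOmega (θ : ∀ x : X, TangentSpace I x →L[ℝ] ℝ) (x : X) (e : V) : V →L[ℝ] V →L[ℝ] ℝ :=
  fderivWithin ℝ (oneFormInChart I θ x) (range I) e
    - (fderivWithin ℝ (oneFormInChart I θ x) (range I) e).flip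

theorem chartOmega_apply (θ : ∀ x : X, TangentSpace I x →L[ℝ] ℝ) (x : X) (e v w : V) :
    chartOmega θ x e v w = fderivWithin ℝ (oneFormInChart I θ x) (range I) e v w
      - fderivWithin ℝ (oneFormInChart I θ x) (range I) e w v := rfl

/-- The two-form `dθ` at `x` as a bilinear map on the model space. -/
def extDL (θ : ∀ x : X, TangentSpace I x →L[ℝ] ℝ) (x : X) : V →L[ℝ] V →L[ℝ] ℝ :=
  chartOmega θ x (extChartAt I x x)

theorem extD_swap (θ : ∀ x : X, TangentSpace I x →L[ℝ] ℝ) (x : X) (v w : TangentSpace I x) :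
    extD I θ x w v = -extD I θ x v w := by unfold extD; ring

theorem extD_self (θ : ∀ x : X, TangentSpace I x →L[ℝ] ℝ) (x : X) (v : TangentSpace I x) :
    extD I θ x v v = 0 := by unfold extD; ring

theorem extD_add_left (θ : ∀ x : X, TangentSpace I x →L[ℝ] ℝ) (x : X) (v v' w : TangentSpace I x) :
    extD I θ x (v + v') w = extD I θ x v w + extD I θ x v' w := by
  have := DFunLike.congr_fun ((extDL θ x).map_add (v : V) (v' : V)) (w : V)
  exact this

theorem extD_smul_left (θ : ∀ x : X, TangentSpace I x →L[ℝ] ℝ) (x : X) (c : ℝ)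
    (v w : TangentSpace I x) : extD I θ x (c • v) w = c * extD I θ x v w := by
  have := DFunLike.congr_fun ((extDL θ x).map_smul c (v : V)) (w : V)
  exact this

theorem extD_add_right (θ : ∀ x : X, TangentSpace I x →L[ℝ] ℝ) (x : X) (v w w' : TangentSpace I x) :
    extD I θ x v (w + w') = extD I θ x v w + extD I θ x v w' :=
  (extDL θ x (v : V)).map_add (w : V) (w' : V)

theorem extD_smul_right (θ : ∀ x : X, TangentSpace I x →L[ℝ] ℝ) (x : X) (c : ℝ)
    (v w : TangentSpace I x) : extD I θ x v (c • w) = c * extD I θ x v w :=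
  (extDL θ x (v : V)).map_smul c (w : V)

theorem extD_neg_right (θ : ∀ x : X, TangentSpace I x →L[ℝ] ℝ) (x : X) (v w : TangentSpace I x) :
    extD I θ x v (-w) = -extD I θ x v w :=
  (extDL θ x (v : V)).map_neg (w : V)

theorem extD_sub_left (θ : ∀ x : X, TangentSpace I x →L[ℝ] ℝ) (x : X) (v v' w : TangentSpace I x) :
    extD I θ x (v - v') w = extD I θ x v w - extD I θ x v' w := by
  have := DFunLike.congr_fun ((extDL θ x).map_sub (v : V) (v' : V)) (w : V)
  exact this

theorem extD_sub_right (θ : ∀ x : X, TangentSpace I x →L[ℝ] ℝ) (x : X) (v w w' : TangentSpace I x) :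
    extD I θ x v (w - w') = extD I θ x v w - extD I θ x v w' :=
  (extDL θ x (v : V)).map_sub (w : V) (w' : V)

theorem extD_zero_right (θ : ∀ x : X, TangentSpace I x →L[ℝ] ℝ) (x : X) (v : TangentSpace I x) :
    extD I θ x v 0 = 0 :=
  (extDL θ x (v : V)).map_zero

theorem extD_zero_left (θ : ∀ x : X, TangentSpace I x →L[ℝ] ℝ) (x : X) (v : TangentSpace I x) :
    extD I θ x 0 v = 0 := by
  rw [extD_swap, extD_zero_right, neg_zero]

/-- The tangent vector in the coordinates of the preferred chart at `x₀`. -/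
def tcoord (I : ModelWithCorners ℝ V B) (x₀ x : X) : TangentSpace I x →L[ℝ] V :=
  mfderiv I 𝓘(ℝ, V) (extChartAt I x₀) x

/-- The tangent vector with given coordinates in the preferred chart at `x₀`. -/
def tvec (I : ModelWithCorners ℝ V B) (x₀ x : X) : V →L[ℝ] TangentSpace I x :=
  mfderivWithin 𝓘(ℝ, V) I (extChartAt I x₀).symm (range I) (extChartAt I x₀ x)

theorem tcoord_tvec {x₀ x : X} (hx : x ∈ (extChartAt I x₀).source) (v : V) :
    tcoord I x₀ x (tvec I x₀ x v) = v :=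
  DFunLike.congr_fun (mfderiv_extChartAt_comp_mfderivWithin_extChartAt_symm' (I := I) hx) v

theorem tvec_tcoord {x₀ x : X} (hx : x ∈ (extChartAt I x₀).source) (v : TangentSpace I x) :
    tvec I x₀ x (tcoord I x₀ x v) = v :=
  DFunLike.congr_fun (mfderivWithin_extChartAt_symm_comp_mfderiv_extChartAt' (I := I) hx) v

theorem oneFormInChart_tcoord (θ : ∀ x : X, TangentSpace I x →L[ℝ] ℝ) {x₀ x : X}
    (hx : x ∈ (extChartAt I x₀).source) (v : TangentSpace I x) :
    oneFormInChart I θ x₀ (extChartAt I x₀ x) (tcoord I x₀ x v) = θ x v := by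
  have h4 : (extChartAt I x₀).symm (extChartAt I x₀ x) = x := (extChartAt I x₀).left_inv hx
  have h5 := tvec_tcoord hx v
  change θ ((extChartAt I x₀).symm (extChartAt I x₀ x)) (tvec I x₀ x (tcoord I x₀ x v) : V) = θ x v
  have : ∀ y, y = x → θ y (tvec I x₀ x (tcoord I x₀ x v) : V)
      = θ x (tvec I x₀ x (tcoord I x₀ x v)) := by rintro y rfl; rfl
  rw [this _ h4, h5]

theorem extD_eq_chartOmega [FiniteDimensional ℝ V]
    {θ : ∀ x : X, TangentSpace I x →L[ℝ] ℝ} (hθ : SmoothOneForm I θ) {x₀ x : X}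
    (hx : x ∈ (extChartAt I x₀).source) (v w : TangentSpace I x) :
    extD I θ x v w = chartOmega θ x₀ (extChartAt I x₀ x) (tcoord I x₀ x v) (tcoord I x₀ x w) := by
  have ht := (extChartAt I x₀).map_source hx
  have h4 : (extChartAt I x₀).symm (extChartAt I x₀ x) = x := (extChartAt I x₀).left_inv hx
  have key := fderivWithin_pullForm hθ (P := V) (f := (extChartAt I x₀).symm)
    (uniqueDiffOn_extChartAt_target x₀) ht
    (extChartAt_target_subset_closure_interior ht)
    (contMDiffOn_extChartAt_symm (n := ∞) x₀) (tcoord I x₀ x v) (tcoord I x₀ x w)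
  have e1 : pullForm θ (extChartAt I x₀).symm (extChartAt I x₀).target
      =ᶠ[𝓝[(extChartAt I x₀).target] (extChartAt I x₀ x)] oneFormInChart I θ x₀ := by
    filter_upwards [self_mem_nhdsWithin] with e he
    rw [oneFormInChart_eq_pullForm]
    unfold pullForm
    congr 1
    exact mfderivWithin_congr_set (extChartAt_target_eventuallyEq_of_mem he)
  rw [e1.fderivWithin_eq (e1.self_of_nhdsWithin ht),
    fderivWithin_congr_set (extChartAt_target_eventuallyEq_of_mem ht)] at key
  rw [chartOmega_apply, key]
  have h6 : ∀ v : TangentSpace I x, (mfderivWithin 𝓘(ℝ, V) I (extChartAt I x₀).symm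
      (extChartAt I x₀).target (extChartAt I x₀ x) (tcoord I x₀ x v) : V) = v := by
    intro v
    rw [mfderivWithin_congr_set (extChartAt_target_eventuallyEq_of_mem ht)]
    exact tvec_tcoord hx v
  have h7 : ∀ y, y = x → ∀ v w : V, extD I θ x v w = extD I θ y v w := by rintro y rfl v w; rfl
  exact (h7 _ h4 v w).trans
    (congrArg₂ (fun a b : V => extD I θ ((extChartAt I x₀).symm (extChartAt I x₀ x)) a b)
      (h6 v).symm (h6 w).symm)

theorem contDiffOn_chartOmega [FiniteDimensional ℝ V] {θ : ∀ x : X, TangentSpace I x →L[ℝ] ℝ}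
    (hθ : SmoothOneForm I θ) (x : X) :
    ContDiffOn ℝ ∞ (chartOmega θ x) (extChartAt I x).target := by
  have h1 : ContDiffOn ℝ ∞ (fderivWithin ℝ (oneFormInChart I θ x) (extChartAt I x).target)
      (extChartAt I x).target :=
    (contDiffOn_oneFormInChart hθ x).fderivWithin (uniqueDiffOn_extChartAt_target x) (by simp)
  have h2 : ContDiffOn ℝ ∞ (fderivWithin ℝ (oneFormInChart I θ x) (range I))
      (extChartAt I x).target := h1.congr fun e he =>
    (fderivWithin_congr_set (extChartAt_target_eventuallyEq_of_mem he)).symm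
  refine h2.sub ?_
  rw [contDiffOn_clm_apply]
  intro v
  rw [contDiffOn_clm_apply]
  intro w
  exact (h2.clm_apply contDiffOn_const).clm_apply contDiffOn_const

theorem extDL_surjective [FiniteDimensional ℝ V] {θ : ∀ x : X, TangentSpace I x →L[ℝ] ℝ}
    (hθ : IsSymplecticPrimitive I θ) (x : X) (l : V →L[ℝ] ℝ) : ∃ v : V, extDL θ x v = l := by
  have hinj : Function.Injective ((extDL θ x : V →L[ℝ] V →L[ℝ] ℝ) : V →ₗ[ℝ] V →L[ℝ] ℝ) := by
    rw [← LinearMap.ker_eq_bot, LinearMap.ker_eq_bot']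
    intro v hv
    exact hθ.2 x v fun w => DFunLike.congr_fun hv (w : V)
  have hfr : Module.finrank ℝ V = Module.finrank ℝ (V →L[ℝ] ℝ) := by
    rw [LinearEquiv.finrank_eq (LinearMap.toContinuousLinearMap (𝕜 := ℝ) (E := V) (F' := ℝ)).symm]
    exact (Subspace.dual_finrank_eq (K := ℝ) (V := V)).symm
  exact (LinearMap.injective_iff_surjective_of_finrank_eq_finrank hfr).1 hinj l

theorem extD_hamVF [FiniteDimensional ℝ V] {θ : ∀ x : X, TangentSpace I x →L[ℝ] ℝ}
    (hθ : IsSymplecticPrimitive I θ) (H : X → ℝ) (x : X) (w : TangentSpace I x) :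
    extD I θ x (hamVF I θ H x) w = -(mfderiv I 𝓘(ℝ, ℝ) H x w : ℝ) := by
  have h : ∃ v : TangentSpace I x, (fun w => extD I θ x v w)
      = fun w => -(mfderiv I 𝓘(ℝ, ℝ) H x w : ℝ) := by
    obtain ⟨v, hv⟩ := extDL_surjective hθ x (-(mfderiv I 𝓘(ℝ, ℝ) H x : V →L[ℝ] ℝ))
    exact ⟨v, funext fun w => DFunLike.congr_fun hv (w : V)⟩
  exact congrFun (Function.invFun_eq (f := fun (v w : TangentSpace I x) => extD I θ x v w) h) w

theorem extD_left_unique {θ : ∀ x : X, TangentSpace I x →L[ℝ] ℝ}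
    (hθ : IsSymplecticPrimitive I θ) {x : X} {v v' : TangentSpace I x}
    (h : ∀ w, extD I θ x v w = extD I θ x v' w) : v = v' := by
  rw [← sub_eq_zero]
  exact hθ.2 x _ fun w => by rw [extD_sub_left, h, sub_self]

end Forms

section ChartDerivative

variable {V : Type*} [NormedAddCommGroup V] [NormedSpace ℝ V]
  {B : Type*} [TopologicalSpace B] {I : ModelWithCorners ℝ V B}
  {X : Type*} [TopologicalSpace X] [ChartedSpace B X] [IsManifold I ∞ X]
  {G : Type*} [NormedAddCommGroup G] [NormedSpace ℝ G]

/-- The differential of a function in the coordinates of a chart. -/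
theorem mfderiv_eq_fderivWithin_tcoord {h : X → G} {x₀ x : X} (hx : x ∈ (extChartAt I x₀).source)
    (hh : MDifferentiableAt I 𝓘(ℝ, G) h x) (w : TangentSpace I x) :
    (mfderiv I 𝓘(ℝ, G) h x w : G) = fderivWithin ℝ (fun e => h ((extChartAt I x₀).symm e))
      (extChartAt I x₀).target (extChartAt I x₀ x) (tcoord I x₀ x w) := by
  have hsrc : (extChartAt I x₀).source ∈ 𝓝 x := extChartAt_source_mem_nhds' hx
  have hx' : x ∈ (chartAt B x₀).source := by rwa [← extChartAt_source (I := I)]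
  have ht := (extChartAt I x₀).map_source hx
  have h4 : (extChartAt I x₀).symm (extChartAt I x₀ x) = x := (extChartAt I x₀).left_inv hx
  have hg : MDifferentiableWithinAt 𝓘(ℝ, V) 𝓘(ℝ, G) (fun e => h ((extChartAt I x₀).symm e))
      (extChartAt I x₀).target (extChartAt I x₀ x) := by
    have : MDifferentiableAt I 𝓘(ℝ, G) h ((extChartAt I x₀).symm (extChartAt I x₀ x)) := by rwa [h4]
    exact MDifferentiableAt.comp_mdifferentiableWithinAt (extChartAt I x₀ x) this
      (mdifferentiableOn_extChartAt_symm (x := x₀) _ ht)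
  have e1 : mfderiv I 𝓘(ℝ, G) h x = mfderivWithin I 𝓘(ℝ, G)
      ((fun e => h ((extChartAt I x₀).symm e)) ∘ (extChartAt I x₀)) (extChartAt I x₀).source x := by
    rw [mfderivWithin_of_mem_nhds hsrc]
    apply Filter.EventuallyEq.mfderiv_eq
    filter_upwards [hsrc] with y hy
    simp only [Function.comp_apply, (extChartAt I x₀).left_inv hy]
  have e2 := mfderivWithin_comp x hg
    (mdifferentiableAt_extChartAt (I := I) hx').mdifferentiableWithinAt
    (fun y hy => (extChartAt I x₀).map_source hy)
    ((isOpen_extChartAt_source x₀).uniqueMDiffWithinAt hx)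
  rw [mfderivWithin_of_mem_nhds (f := extChartAt I x₀) hsrc, mfderivWithin_eq_fderivWithin] at e2
  exact DFunLike.congr_fun (e1.trans e2) w

end ChartDerivative

namespace DiscData

variable {d : ℕ} (S : DiscData d)

theorem norm_puncture (j : Fin (d + 1)) : ‖S.puncture j‖ = 1 :=
  Complex.norm_exp_ofReal_mul_I _

theorem isClosed_range_puncture : IsClosed (range S.puncture) := (finite_range _).isClosed

theorem ball_subset_surface : Metric.ball (0 : ℂ) 1 ⊆ S.surface := by
  intro z hz
  refine ⟨Metric.ball_subset_closedBall hz, ?_⟩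
  rintro ⟨j, rfl⟩
  have := S.norm_puncture j
  simp [this] at hz

theorem surface_mem_nhds {z : ℂ} (hz : z ∈ Metric.ball (0 : ℂ) 1) : S.surface ∈ 𝓝 z :=
  mem_of_superset (Metric.isOpen_ball.mem_nhds hz) S.ball_subset_surface

theorem uniqueDiffOn_surface : UniqueDiffOn ℝ S.surface := by
  refine UniqueDiffOn.inter (uniqueDiffOn_convex (convex_closedBall _ _) ?_)
    S.isClosed_range_puncture.isOpen_compl
  rw [interior_closedBall _ one_ne_zero]
  exact ⟨0, by simp⟩

theorem measurableSet_surface : MeasurableSet S.surface :=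
  measurableSet_closedBall.diff S.isClosed_range_puncture.measurableSet

end DiscData

section Curvature

variable {VE : Type*} [NormedAddCommGroup VE] [NormedSpace ℝ VE]
  {BE : Type*} [TopologicalSpace BE] {IE : ModelWithCorners ℝ VE BE}
  {E : Type*} [TopologicalSpace E] [ChartedSpace BE E] [IsManifold IE ∞ E]
  {VM : Type*} [NormedAddCommGroup VM] [NormedSpace ℝ VM]
  {BM : Type*} [TopologicalSpace BM] {IM : ModelWithCorners ℝ VM BM}
  {M : Type*} [TopologicalSpace M] [ChartedSpace BM M] [IsManifold IM ∞ M]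

/-- The Hamiltonian vector field `X_K(ξ)` at `x`. -/
def XK (F : FibrationData IE E IM M) (D : SurfaceData IE E) (z : ℂ) (x : E) (ξ : ℂ) :
    TangentSpace IE x :=
  hamVF IE F.thetaE (fun y => D.K z y ξ) x

/-- The curvature of the connection `d - X_K`, with respect to the standard area form of the disc. -/
def curv {d : ℕ} (F : FibrationData IE E IM M) (S : DiscData d) (D : SurfaceData IE E)
    (z : ℂ) (x : E) : ℝ :=
  fderivWithin ℝ (fun z => D.K z x) S.surface z 1 Complex.I
    - fderivWithin ℝ (fun z => D.K z x) S.surface z Complex.I 1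
    + F.omegaE x (XK F D z x 1) (XK F D z x Complex.I)

/-- The one-form `u^* θ_E - K(u)`. -/
def actionForm {d : ℕ} (F : FibrationData IE E IM M) (S : DiscData d) (D : SurfaceData IE E)
    (u : ℂ → E) (z : ℂ) : ℂ →L[ℝ] ℝ :=
  pullForm F.thetaE u S.surface z - D.K z (u z)

/-- The energy density with respect to the standard area form of the disc. -/
def energyDensity {d : ℕ} (F : FibrationData IE E IM M) (S : DiscData d) (D : SurfaceData IE E)
    (u : ℂ → E) (z : ℂ) : ℝ :=
  F.omegaE (u z) (covDeriv F S D u z 1) (covDeriv F S D u z Complex.I)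

variable {F : FibrationData IE E IM M} {d : ℕ} {S : DiscData d} {e : Fin (d + 1) → EndData IE E}
  {D : SurfaceData IE E}

/-- The functions `K z` are smooth in the sense needed throughout. -/
def SmoothK (S : DiscData d) (D : SurfaceData IE E) : Prop :=
  ContMDiffOn (𝓘(ℝ, ℂ).prod IE) 𝓘(ℝ, ℂ →L[ℝ] ℝ) ∞ (fun q : ℂ × E => D.K q.1 q.2)
    (S.surface ×ˢ univ)

theorem SmoothK.fibre (hK : SmoothK S D) {z : ℂ} (hz : z ∈ S.surface) :
    ContMDiff IE 𝓘(ℝ, ℂ →L[ℝ] ℝ) ∞ (D.K z) := by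
  have h1 : ContMDiff IE (𝓘(ℝ, ℂ).prod IE) ∞ (fun y : E => ((z, y) : ℂ × E)) :=
    contMDiff_const.prodMk contMDiff_id
  exact contMDiffOn_univ.1 (hK.comp h1.contMDiffOn fun y _ => ⟨hz, mem_univ _⟩)

variable (D) in
/-- The differential of `K z` along the target space. -/
def fibreDiff (z : ℂ) (x : E) : VE →L[ℝ] ℂ →L[ℝ] ℝ :=
  mfderiv IE 𝓘(ℝ, ℂ →L[ℝ] ℝ) (D.K z) x

theorem SmoothK.mfderiv_apply (hK : SmoothK S D) {z : ℂ} (hz : z ∈ S.surface) (x : E) (ξ : ℂ)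
    (w : TangentSpace IE x) :
    (mfderiv IE 𝓘(ℝ, ℝ) (fun y => D.K z y ξ) x w : ℝ)
      = fibreDiff D z x w ξ := by
  have h1 := ((hK.fibre hz) x).mdifferentiableAt (by simp)
  have h2 : HasMFDerivAt 𝓘(ℝ, ℂ →L[ℝ] ℝ) 𝓘(ℝ, ℝ) (fun l : ℂ →L[ℝ] ℝ => l ξ) (D.K z x)
      (ContinuousLinearMap.apply ℝ ℝ ξ) :=
    (ContinuousLinearMap.apply ℝ ℝ ξ).hasFDerivAt.hasMFDerivAt
  have h3 := (h2.comp x h1.hasMFDerivAt).mfderiv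
  exact DFunLike.congr_fun h3 w

theorem extD_XK [FiniteDimensional ℝ VE] (hθ : IsSymplecticPrimitive IE F.thetaE)
    (hK : SmoothK S D) {z : ℂ} (hz : z ∈ S.surface) (x : E) (ξ : ℂ) (w : TangentSpace IE x) :
    F.omegaE x (XK F D z x ξ) w = -fibreDiff D z x w ξ := by
  rw [← hK.mfderiv_apply hz]
  exact extD_hamVF hθ _ x w

theorem XK_add [FiniteDimensional ℝ VE] (hθ : IsSymplecticPrimitive IE F.thetaE)
    (hK : SmoothK S D) {z : ℂ} (hz : z ∈ S.surface) (x : E) (ξ η : ℂ) :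
    XK F D z x (ξ + η) = XK F D z x ξ + XK F D z x η := by
  refine extD_left_unique hθ fun w => ?_
  have h := extD_XK hθ hK hz x
  unfold FibrationData.omegaE at h
  rw [extD_add_left, h, h, h, map_add, neg_add]

theorem XK_smul [FiniteDimensional ℝ VE] (hθ : IsSymplecticPrimitive IE F.thetaE)
    (hK : SmoothK S D) {z : ℂ} (hz : z ∈ S.surface) (x : E) (c : ℝ) (ξ : ℂ) :
    XK F D z x (c • ξ) = c • XK F D z x ξ := by
  refine extD_left_unique hθ fun w => ?_
  have h := extD_XK hθ hK hz x
  unfold FibrationData.omegaE at h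
  rw [extD_smul_left, h, h, map_smul, smul_eq_mul, mul_neg]

theorem covDeriv_add [FiniteDimensional ℝ VE] (hθ : IsSymplecticPrimitive IE F.thetaE)
    (hK : SmoothK S D) (u : ℂ → E) {z : ℂ} (hz : z ∈ S.surface) (ξ η : ℂ) :
    covDeriv F S D u z (ξ + η) = covDeriv F S D u z ξ + covDeriv F S D u z η := by
  have h := XK_add hθ hK hz (u z) ξ η
  have h1 : mfderivWithin 𝓘(ℝ, ℂ) IE u S.surface z (ξ + η) = mfderivWithin 𝓘(ℝ, ℂ) IE u S.surface z ξ
      + mfderivWithin 𝓘(ℝ, ℂ) IE u S.surface z η := map_add _ _ _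
  unfold XK at h
  unfold covDeriv
  rw [h, h1]
  abel

theorem covDeriv_smul [FiniteDimensional ℝ VE] (hθ : IsSymplecticPrimitive IE F.thetaE)
    (hK : SmoothK S D) (u : ℂ → E) {z : ℂ} (hz : z ∈ S.surface) (c : ℝ) (ξ : ℂ) :
    covDeriv F S D u z (c • ξ) = c • covDeriv F S D u z ξ := by
  have h := XK_smul hθ hK hz (u z) c ξ
  have h1 : mfderivWithin 𝓘(ℝ, ℂ) IE u S.surface z (c • ξ)
      = c • mfderivWithin 𝓘(ℝ, ℂ) IE u S.surface z ξ := map_smul _ _ _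
  unfold XK at h
  unfold covDeriv
  rw [h, h1, smul_sub]

theorem contDiffOn_actionForm (hθ : IsSymplecticPrimitive IE F.thetaE) (hK : SmoothK S D)
    {u : ℂ → E} (hu : ContMDiffOn 𝓘(ℝ, ℂ) IE ∞ u S.surface) :
    ContDiffOn ℝ ∞ (actionForm F S D u) S.surface := by
  refine (contDiffOn_pullForm hθ.1 S.uniqueDiffOn_surface hu).sub ?_
  have h1 : ContMDiffOn 𝓘(ℝ, ℂ) (𝓘(ℝ, ℂ).prod IE) ∞ (fun z : ℂ => ((z, u z) : ℂ × E)) S.surface :=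
    contMDiffOn_id.prodMk hu
  exact (hK.comp h1 fun z hz => ⟨hz, mem_univ _⟩).contDiffOn

theorem fderiv_actionForm_antisymm [FiniteDimensional ℝ VE]
    (hθ : IsSymplecticPrimitive IE F.thetaE) (hK : SmoothK S D)
    {u : ℂ → E} (hu : ContMDiffOn 𝓘(ℝ, ℂ) IE ∞ u S.surface) {z : ℂ} (hz : z ∈ Metric.ball (0 : ℂ) 1) :
    fderiv ℝ (actionForm F S D u) z 1 Complex.I - fderiv ℝ (actionForm F S D u) z Complex.I 1
      = energyDensity F S D u z - curv F S D z (u z) := by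
  have hzS := S.ball_subset_surface hz
  have hnh := S.surface_mem_nhds hz
  have hint : z ∈ closure (interior S.surface) := subset_closure (mem_interior_iff_mem_nhds.2 hnh)
  have hN := fderivWithin_pullForm hθ.1 S.uniqueDiffOn_surface hzS hint hu 1 Complex.I
  rw [fderivWithin_of_mem_nhds hnh] at hN
  have hp : DifferentiableAt ℝ (pullForm F.thetaE u S.surface) z :=
    ((contDiffOn_pullForm hθ.1 S.uniqueDiffOn_surface hu).contDiffAt hnh).differentiableAt (by simp)
  have hu1 : MDifferentiableAt 𝓘(ℝ, ℂ) IE u z := (hu.contMDiffAt hnh).mdifferentiableAt (by simp)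
  have hK1 : MDifferentiableAt (𝓘(ℝ, ℂ).prod IE) 𝓘(ℝ, ℂ →L[ℝ] ℝ) (fun q : ℂ × E => D.K q.1 q.2)
      (z, u z) :=
    ((hK (z, u z) ⟨hzS, mem_univ _⟩).contMDiffAt (prod_mem_nhds hnh univ_mem)).mdifferentiableAt
      (by simp)
  have hpair : MDifferentiableAt 𝓘(ℝ, ℂ) (𝓘(ℝ, ℂ).prod IE) (fun z : ℂ => ((z, u z) : ℂ × E)) z :=
    mdifferentiableAt_id.prodMk hu1
  have hK2 : ∀ ξ : ℂ, fderiv ℝ (fun z => D.K z (u z)) z ξ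
      = fderivWithin ℝ (fun z' => D.K z' (u z)) S.surface z ξ
        + fibreDiff D z (u z) (mfderiv 𝓘(ℝ, ℂ) IE u z ξ) := by
    intro ξ
    have h1 := mfderiv_comp z hK1 hpair
    have h2 : mfderiv 𝓘(ℝ, ℂ) (𝓘(ℝ, ℂ).prod IE) (fun z : ℂ => ((z, u z) : ℂ × E)) z
        = (mfderiv 𝓘(ℝ, ℂ) 𝓘(ℝ, ℂ) (fun z => z) z).prod (mfderiv 𝓘(ℝ, ℂ) IE u z) :=
      mfderiv_prodMk mdifferentiableAt_id hu1
    have h3 : mfderiv 𝓘(ℝ, ℂ) (𝓘(ℝ, ℂ).prod IE) (fun z : ℂ => ((z, u z) : ℂ × E)) z ξ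
        = ((ξ, mfderiv 𝓘(ℝ, ℂ) IE u z ξ) : ℂ × TangentSpace IE (u z)) := by
      rw [h2]
      have h4 : mfderiv 𝓘(ℝ, ℂ) 𝓘(ℝ, ℂ) (fun z : ℂ => z) z ξ = ξ := by
        have : mfderiv 𝓘(ℝ, ℂ) 𝓘(ℝ, ℂ) (fun z : ℂ => z) z = ContinuousLinearMap.id _ _ := mfderiv_id
        rw [this]; rfl
      exact Prod.ext h4 rfl
    rw [fderivWithin_of_mem_nhds hnh]
    rw [← mfderiv_eq_fderiv, ← mfderiv_eq_fderiv]
    have h5 := DFunLike.congr_fun h1 ξ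
    refine h5.trans ?_
    change mfderiv (𝓘(ℝ, ℂ).prod IE) 𝓘(ℝ, ℂ →L[ℝ] ℝ) (fun q : ℂ × E => D.K q.1 q.2)
      (z, u z) (mfderiv 𝓘(ℝ, ℂ) (𝓘(ℝ, ℂ).prod IE) (fun z : ℂ => ((z, u z) : ℂ × E)) z ξ) = _
    rw [h3]
    exact mfderiv_prod_eq_add_apply hK1
  have hdK : DifferentiableAt ℝ (fun z => D.K z (u z)) z := by
    have := hK1.comp z hpair
    exact this.differentiableAt
  have hact : ∀ ξ : ℂ, fderiv ℝ (actionForm F S D u) z ξ = fderiv ℝ (pullForm F.thetaE u S.surface) z ξ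
      - fderiv ℝ (fun z => D.K z (u z)) z ξ := by
    intro ξ
    have : actionForm F S D u = (pullForm F.thetaE u S.surface) - (fun z => D.K z (u z)) := rfl
    rw [this, fderiv_sub hp hdK]; rfl
  have hmu : ∀ ξ : ℂ, mfderivWithin 𝓘(ℝ, ℂ) IE u S.surface z ξ = mfderiv 𝓘(ℝ, ℂ) IE u z ξ :=
    fun ξ => DFunLike.congr_fun (mfderivWithin_of_mem_nhds hnh) ξ
  have hX := extD_XK hθ hK hzS (u z)
  unfold energyDensity curv covDeriv
  unfold FibrationData.omegaE at hX ⊢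
  rw [hact, hact, hK2, hK2]
  rw [hmu, hmu] at hN ⊢
  generalize mfderiv 𝓘(ℝ, ℂ) IE u z (1 : ℂ) = us at hN ⊢
  generalize mfderiv 𝓘(ℝ, ℂ) IE u z Complex.I = ut at hN ⊢
  have hX1 := hX 1 ut
  have hX2 := hX Complex.I us
  unfold XK at hX1 hX2 ⊢
  rw [extD_sub_left, extD_sub_right, extD_sub_right, hX1, extD_swap _ _ (hamVF IE F.thetaE (fun y => D.K z y Complex.I) (u z)) us, hX2, ← hN]
  simp only [sub_apply, _root_.add_apply]
  ring

end Curvature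

section PartialDerivatives

variable {A B G : Type*} [NormedAddCommGroup A] [NormedSpace ℝ A] [NormedAddCommGroup B]
  [NormedSpace ℝ B] [NormedAddCommGroup G] [NormedSpace ℝ G]

theorem fderivWithin_prod_left {f : A × B → G} {s : Set A} {t : Set B} {a : A} {b : B}
    (hf : DifferentiableWithinAt ℝ f (s ×ˢ t) (a, b)) (hs : UniqueDiffWithinAt ℝ s a) (hb : b ∈ t)
    (ξ : A) : fderivWithin ℝ (fun a => f (a, b)) s a ξ = fderivWithin ℝ f (s ×ˢ t) (a, b) (ξ, 0) := by
  have h1 : HasFDerivWithinAt (fun a : A => (a, b)) (ContinuousLinearMap.inl ℝ A B) s a :=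
    (hasFDerivAt_prodMk_left a b).hasFDerivWithinAt
  have h2 := hf.hasFDerivWithinAt.comp a h1 (t := s ×ˢ t) (fun a' ha' => mk_mem_prod ha' hb)
  exact DFunLike.congr_fun (h2.fderivWithin hs) ξ

theorem fderivWithin_prod_right {f : A × B → G} {s : Set A} {t : Set B} {a : A} {b : B}
    (hf : DifferentiableWithinAt ℝ f (s ×ˢ t) (a, b)) (ht : UniqueDiffWithinAt ℝ t b) (ha : a ∈ s)
    (ξ : B) : fderivWithin ℝ (fun b => f (a, b)) t b ξ = fderivWithin ℝ f (s ×ˢ t) (a, b) (0, ξ) := by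
  have h1 : HasFDerivWithinAt (fun b : B => (a, b)) (ContinuousLinearMap.inr ℝ A B) t b :=
    (hasFDerivAt_prodMk_right a b).hasFDerivWithinAt
  have h2 := hf.hasFDerivWithinAt.comp b h1 (t := s ×ˢ t) (fun a' ha' => mk_mem_prod ha ha')
  exact DFunLike.congr_fun (h2.fderivWithin ht) ξ

end PartialDerivatives

section Symplectic

variable {V : Type*} [NormedAddCommGroup V] [NormedSpace ℝ V] [FiniteDimensional ℝ V]
  {B : Type*} [TopologicalSpace B] {I : ModelWithCorners ℝ V B}
  {X : Type*} [TopologicalSpace X] [ChartedSpace B X] [IsManifold I ∞ X]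

theorem chartOmega_invertible {θ : ∀ x : X, TangentSpace I x →L[ℝ] ℝ}
    (hθ : IsSymplecticPrimitive I θ) {x₀ x : X} (hx : x ∈ (extChartAt I x₀).source) :
    (chartOmega θ x₀ (extChartAt I x₀ x)).IsInvertible := by
  set A := chartOmega θ x₀ (extChartAt I x₀ x)
  have hinj : Function.Injective (A : V →ₗ[ℝ] V →L[ℝ] ℝ) := by
    rw [← LinearMap.ker_eq_bot, LinearMap.ker_eq_bot']
    intro v hv
    have h1 : tvec I x₀ x v = 0 := by
      refine hθ.2 x _ fun w => ?_
      rw [extD_eq_chartOmega hθ.1 hx, tcoord_tvec hx]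
      exact DFunLike.congr_fun hv (tcoord I x₀ x w)
    rw [← tcoord_tvec hx v, h1, map_zero]
  have hfr : Module.finrank ℝ V = Module.finrank ℝ (V →L[ℝ] ℝ) := by
    rw [LinearEquiv.finrank_eq (LinearMap.toContinuousLinearMap (𝕜 := ℝ) (E := V) (F' := ℝ)).symm]
    exact (Subspace.dual_finrank_eq (K := ℝ) (V := V)).symm
  exact ⟨(LinearEquiv.ofInjectiveOfFinrankEq _ hinj hfr).toContinuousLinearEquiv, by ext; rfl⟩

end Symplectic

section CurvatureContinuity

variable {VE : Type*} [NormedAddCommGroup VE] [NormedSpace ℝ VE] [FiniteDimensional ℝ VE]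
  {BE : Type*} [TopologicalSpace BE] {IE : ModelWithCorners ℝ VE BE}
  {E : Type*} [TopologicalSpace E] [ChartedSpace BE E] [IsManifold IE ∞ E]
  {VM : Type*} [NormedAddCommGroup VM] [NormedSpace ℝ VM]
  {BM : Type*} [TopologicalSpace BM] {IM : ModelWithCorners ℝ VM BM}
  {M : Type*} [TopologicalSpace M] [ChartedSpace BM M] [IsManifold IM ∞ M]
  {F : FibrationData IE E IM M} {d : ℕ} {S : DiscData d} {D : SurfaceData IE E}

/-- The coordinate expression of the one-form `K`. -/
def chartK (D : SurfaceData IE E) (x₀ : E) (q : ℂ × VE) : ℂ →L[ℝ] ℝ :=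
  D.K q.1 ((extChartAt IE x₀).symm q.2)

theorem contDiffOn_chartK (hK : SmoothK S D) (x₀ : E) :
    ContDiffOn ℝ ∞ (chartK D x₀) (S.surface ×ˢ (extChartAt IE x₀).target) := by
  have h1 : ContMDiffOn 𝓘(ℝ, ℂ × VE) (𝓘(ℝ, ℂ).prod IE) ∞
      (fun q : ℂ × VE => ((q.1, (extChartAt IE x₀).symm q.2) : ℂ × E))
      (S.surface ×ˢ (extChartAt IE x₀).target) := by
    refine contDiff_fst.contMDiff.contMDiffOn.prodMk ?_
    exact (contMDiffOn_extChartAt_symm (n := ∞) x₀).comp contDiff_snd.contMDiff.contMDiffOn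
      (fun q hq => hq.2)
  exact (hK.comp h1 fun q hq => ⟨hq.1, mem_univ _⟩).contDiffOn

theorem uniqueDiffOn_surface_prod_target (S : DiscData d) (x₀ : E) :
    UniqueDiffOn ℝ (S.surface ×ˢ (extChartAt IE x₀).target) :=
  S.uniqueDiffOn_surface.prod (uniqueDiffOn_extChartAt_target x₀)

/-- The Hamiltonian vector field in coordinates. -/
def chartXK (F : FibrationData IE E IM M) (S : DiscData d) (D : SurfaceData IE E) (x₀ : E) (ξ : ℂ)
    (q : ℂ × VE) : VE :=
  (chartOmega F.thetaE x₀ q.2).inverse (-(((fderivWithin ℝ (chartK D x₀)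
    (S.surface ×ˢ (extChartAt IE x₀).target) q).comp (ContinuousLinearMap.inr ℝ ℂ VE)).flip ξ))

theorem tcoord_XK (hθ : IsSymplecticPrimitive IE F.thetaE) (hK : SmoothK S D) {x₀ x : E}
    (hx : x ∈ (extChartAt IE x₀).source) {z : ℂ} (hz : z ∈ S.surface) (ξ : ℂ) :
    tcoord IE x₀ x (XK F D z x ξ) = chartXK F S D x₀ ξ (z, extChartAt IE x₀ x) := by
  have ht := (extChartAt IE x₀).map_source hx
  have hinv := chartOmega_invertible hθ hx
  have key : chartOmega F.thetaE x₀ (extChartAt IE x₀ x) (tcoord IE x₀ x (XK F D z x ξ))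
      = -(((fderivWithin ℝ (chartK D x₀) (S.surface ×ˢ (extChartAt IE x₀).target)
          (z, extChartAt IE x₀ x)).comp (ContinuousLinearMap.inr ℝ ℂ VE)).flip ξ) := by
    ext v
    have h1 := extD_XK hθ hK hz x ξ (tvec IE x₀ x v)
    have h3 : fibreDiff D z x (tvec IE x₀ x v) = fderivWithin ℝ (chartK D x₀)
        (S.surface ×ˢ (extChartAt IE x₀).target) (z, extChartAt IE x₀ x) (0, v) := by
      have h2 := mfderiv_eq_fderivWithin_tcoord (h := D.K z) hx
        (((hK.fibre hz) x).mdifferentiableAt (by simp)) (tvec IE x₀ x v)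
      rw [tcoord_tvec hx] at h2
      refine h2.trans ?_
      exact fderivWithin_prod_right (f := chartK D x₀)
        ((contDiffOn_chartK hK x₀ _ ⟨hz, ht⟩).differentiableWithinAt (by simp))
        (uniqueDiffOn_extChartAt_target x₀ _ ht) hz v
    rw [h3] at h1
    unfold FibrationData.omegaE at h1
    rw [extD_eq_chartOmega hθ.1 hx, tcoord_tvec hx] at h1
    rw [h1]
    rfl
  unfold chartXK
  rw [← key]
  exact (hinv.inverse_apply_self _).symm

theorem continuousOn_chartXK (hθ : IsSymplecticPrimitive IE F.thetaE) (hK : SmoothK S D) (x₀ : E)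
    (ξ : ℂ) : ContinuousOn (chartXK F S D x₀ ξ) (S.surface ×ˢ (extChartAt IE x₀).target) := by
  have h1 : ContinuousOn (fderivWithin ℝ (chartK D x₀) (S.surface ×ˢ (extChartAt IE x₀).target))
      (S.surface ×ˢ (extChartAt IE x₀).target) :=
    (contDiffOn_chartK hK x₀).continuousOn_fderivWithin (uniqueDiffOn_surface_prod_target S x₀)
      (by simp)
  have h2 : ContinuousOn (fun q : ℂ × VE => (chartOmega F.thetaE x₀ q.2).inverse)
      (S.surface ×ˢ (extChartAt IE x₀).target) := by
    intro q hq
    have hsrc := (extChartAt IE x₀).map_target hq.2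
    have hinv := chartOmega_invertible hθ hsrc
    rw [(extChartAt IE x₀).right_inv hq.2] at hinv
    obtain ⟨A, hA⟩ := hinv
    have h3 : ContinuousAt (ContinuousLinearMap.inverse : (VE →L[ℝ] VE →L[ℝ] ℝ) → _)
        (chartOmega F.thetaE x₀ q.2) := by
      rw [← hA]
      exact (contDiffAt_map_inverse (n := 0) A).continuousAt
    exact ContinuousAt.comp_continuousWithinAt (f := fun q : ℂ × VE => chartOmega F.thetaE x₀ q.2) h3
      (((contDiffOn_chartOmega hθ.1 x₀).continuousOn.comp continuousOn_snd fun q hq => hq.2) q hq)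
  refine h2.clm_apply (ContinuousOn.neg ?_)
  rw [continuousOn_clm_apply]
  intro v
  exact (h1.clm_apply continuousOn_const).clm_apply continuousOn_const

theorem curv_eq_chart (hθ : IsSymplecticPrimitive IE F.thetaE) (hK : SmoothK S D) {x₀ x : E}
    (hx : x ∈ (extChartAt IE x₀).source) {z : ℂ} (hz : z ∈ S.surface) :
    curv F S D z x
      = fderivWithin ℝ (chartK D x₀) (S.surface ×ˢ (extChartAt IE x₀).target)
          (z, extChartAt IE x₀ x) (1, 0) Complex.I
        - fderivWithin ℝ (chartK D x₀) (S.surface ×ˢ (extChartAt IE x₀).target)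
          (z, extChartAt IE x₀ x) (Complex.I, 0) 1
        + chartOmega F.thetaE x₀ (extChartAt IE x₀ x)
          (chartXK F S D x₀ 1 (z, extChartAt IE x₀ x))
          (chartXK F S D x₀ Complex.I (z, extChartAt IE x₀ x)) := by
  have ht := (extChartAt IE x₀).map_source hx
  have h1 : (fun z => D.K z x) = fun z => chartK D x₀ (z, extChartAt IE x₀ x) := by
    funext z
    simp only [chartK, (extChartAt IE x₀).left_inv hx]
  have h2 : DifferentiableWithinAt ℝ (chartK D x₀) (S.surface ×ˢ (extChartAt IE x₀).target)
      (z, extChartAt IE x₀ x) := (contDiffOn_chartK hK x₀ _ ⟨hz, ht⟩).differentiableWithinAt (by simp)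
  unfold curv FibrationData.omegaE
  rw [extD_eq_chartOmega hθ.1 hx, tcoord_XK hθ hK hx hz, tcoord_XK hθ hK hx hz, h1,
    fderivWithin_prod_left h2 (S.uniqueDiffOn_surface z hz) ht,
    fderivWithin_prod_left h2 (S.uniqueDiffOn_surface z hz) ht]

theorem continuousOn_curv (hθ : IsSymplecticPrimitive IE F.thetaE) (hK : SmoothK S D) :
    ContinuousOn (fun q : ℂ × E => curv F S D q.1 q.2) (S.surface ×ˢ univ) := by
  rintro ⟨z, x⟩ ⟨hz, -⟩
  have h1 : ContinuousOn (fderivWithin ℝ (chartK D x) (S.surface ×ˢ (extChartAt IE x).target))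
      (S.surface ×ˢ (extChartAt IE x).target) :=
    (contDiffOn_chartK hK x).continuousOn_fderivWithin (uniqueDiffOn_surface_prod_target S x)
      (by simp)
  have h2 : ContinuousOn (fun q : ℂ × VE => fderivWithin ℝ (chartK D x)
        (S.surface ×ˢ (extChartAt IE x).target) q (1, 0) Complex.I
      - fderivWithin ℝ (chartK D x) (S.surface ×ˢ (extChartAt IE x).target) q (Complex.I, 0) 1
      + chartOmega F.thetaE x q.2 (chartXK F S D x 1 q) (chartXK F S D x Complex.I q))
      (S.surface ×ˢ (extChartAt IE x).target) := by
    refine (((h1.clm_apply continuousOn_const).clm_apply continuousOn_const).sub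
      ((h1.clm_apply continuousOn_const).clm_apply continuousOn_const)).add ?_
    exact (((contDiffOn_chartOmega hθ.1 x).continuousOn.comp continuousOn_snd fun q hq => hq.2).clm_apply
      (continuousOn_chartXK hθ hK x 1)).clm_apply (continuousOn_chartXK hθ hK x Complex.I)
  have h3 : ContinuousOn (fun q : ℂ × E => curv F S D q.1 q.2)
      (S.surface ×ˢ (extChartAt IE x).source) := by
    have h4 : ContinuousOn (fun q : ℂ × E => (q.1, extChartAt IE x q.2))
        (S.surface ×ˢ (extChartAt IE x).source) :=
      continuousOn_fst.prodMk ((continuousOn_extChartAt x).comp continuousOn_snd fun q hq => hq.2)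
    refine (h2.comp h4 fun q hq => mk_mem_prod hq.1 ((extChartAt IE x).map_source hq.2)).congr ?_
    intro q hq
    exact curv_eq_chart hθ hK hq.2 hq.1
  have h5 := h3 (z, x) ⟨hz, mem_extChartAt_source x⟩
  refine h5.mono_of_mem_nhdsWithin ?_
  rw [nhdsWithin_prod_eq, nhdsWithin_univ]
  exact prod_mem_prod self_mem_nhdsWithin (extChartAt_source_mem_nhds (I := IE) x)

end CurvatureContinuity

section PlaneAlgebra

/-- The standard area form on `ℂ`. -/
def det2 (ξ η : ℂ) : ℝ := ξ.re * η.im - ξ.im * η.re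

theorem complex_eq_smul_add (ξ : ℂ) : ξ = ξ.re • (1 : ℂ) + ξ.im • Complex.I := by
  apply Complex.ext <;> simp

theorem alternating_eq_det2 (B : ℂ →L[ℝ] ℂ →L[ℝ] ℝ) (ξ η : ℂ) :
    B ξ η - B η ξ = det2 ξ η * (B 1 Complex.I - B Complex.I 1) := by
  conv_lhs => rw [complex_eq_smul_add ξ, complex_eq_smul_add η]
  simp only [map_add, map_smul, _root_.add_apply, smul_apply, smul_eq_mul, det2]
  ring

theorem det2_cplx_pos (j : ℂ →L[ℝ] ℂ) (hj : ∀ ξ, j (j ξ) = -ξ) (h1 : 0 < (j 1).im) {ξ : ℂ}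
    (hξ : ξ ≠ 0) : 0 < det2 ξ (j ξ) := by
  set a := (j 1).re with ha
  set b := (j 1).im with hb
  have e1 : j 1 = a • (1 : ℂ) + b • Complex.I := complex_eq_smul_add _
  have e2 : (-1 : ℂ) = a • j 1 + b • j Complex.I := by
    rw [← map_smul, ← map_smul, ← map_add, ← e1, hj]
  have r2 := congrArg Complex.re e2
  have i2 := congrArg Complex.im e2
  simp only [Complex.neg_re, Complex.one_re, Complex.add_re, Complex.smul_re, smul_eq_mul,
    Complex.neg_im, Complex.one_im, Complex.add_im, Complex.smul_im, ← ha, ← hb] at r2 i2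
  have e3 : j ξ = ξ.re • j 1 + ξ.im • j Complex.I := by
    rw [← map_smul, ← map_smul, ← map_add, ← complex_eq_smul_add]
  have key : b * det2 ξ (j ξ) = (b * ξ.re - a * ξ.im) ^ 2 + ξ.im ^ 2 := by
    rw [det2, e3]
    simp only [Complex.add_re, Complex.smul_re, smul_eq_mul, Complex.add_im, Complex.smul_im,
      ← ha, ← hb]
    linear_combination (ξ.im ^ 2) * r2 - (ξ.re * ξ.im) * i2
  have hpos : 0 < (b * ξ.re - a * ξ.im) ^ 2 + ξ.im ^ 2 := by
    by_cases h : ξ.im = 0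
    · have hre : ξ.re ≠ 0 := fun h' => hξ (Complex.ext h' h)
      rw [h]
      have : 0 < (b * ξ.re) ^ 2 := by positivity
      nlinarith
    · have : 0 < ξ.im ^ 2 := by positivity
      nlinarith [sq_nonneg (b * ξ.re - a * ξ.im)]
  rw [← key] at hpos
  exact (mul_pos_iff_of_pos_left h1).1 hpos

end PlaneAlgebra

section Curvature

variable {VE : Type*} [NormedAddCommGroup VE] [NormedSpace ℝ VE] [FiniteDimensional ℝ VE]
  {BE : Type*} [TopologicalSpace BE] {IE : ModelWithCorners ℝ VE BE}
  {E : Type*} [TopologicalSpace E] [ChartedSpace BE E] [IsManifold IE ∞ E]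
  {VM : Type*} [NormedAddCommGroup VM] [NormedSpace ℝ VM]
  {BM : Type*} [TopologicalSpace BM] {IM : ModelWithCorners ℝ VM BM}
  {M : Type*} [TopologicalSpace M] [ChartedSpace BM M] [IsManifold IM ∞ M]
  {F : FibrationData IE E IM M} {d : ℕ} {S : DiscData d} {e : Fin (d + 1) → EndData IE E}
  {D : SurfaceData IE E}

theorem omegaE_XK_eq_det2 (hθ : IsSymplecticPrimitive IE F.thetaE) (hK : SmoothK S D) {z : ℂ}
    (hz : z ∈ S.surface) (x : E) (ξ η : ℂ) : F.omegaE x (XK F D z x ξ) (XK F D z x η)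
      = det2 ξ η * F.omegaE x (XK F D z x 1) (XK F D z x Complex.I) := by
  have h : ∀ ξ : ℂ, XK F D z x ξ = ξ.re • XK F D z x 1 + ξ.im • XK F D z x Complex.I := by
    intro ξ
    rw [← XK_smul hθ hK hz, ← XK_smul hθ hK hz, ← XK_add hθ hK hz, ← complex_eq_smul_add]
  unfold FibrationData.omegaE
  rw [h ξ, h η]
  simp only [extD_add_left, extD_add_right, extD_smul_left, extD_smul_right, extD_self,
    extD_swap _ _ (XK F D z x 1) (XK F D z x Complex.I), det2]
  ring

theorem omegaE_covDeriv_eq_det2 (hθ : IsSymplecticPrimitive IE F.thetaE) (hK : SmoothK S D)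
    (u : ℂ → E) {z : ℂ} (hz : z ∈ S.surface) (ξ η : ℂ) :
    F.omegaE (u z) (covDeriv F S D u z ξ) (covDeriv F S D u z η)
      = det2 ξ η * energyDensity F S D u z := by
  have h : ∀ ξ : ℂ, covDeriv F S D u z ξ
      = ξ.re • covDeriv F S D u z 1 + ξ.im • covDeriv F S D u z Complex.I := by
    intro ξ
    rw [← covDeriv_smul hθ hK u hz, ← covDeriv_smul hθ hK u hz, ← covDeriv_add hθ hK u hz,
      ← complex_eq_smul_add]
  unfold energyDensity FibrationData.omegaE
  rw [h ξ, h η]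
  simp only [extD_add_left, extD_add_right, extD_smul_left, extD_smul_right, extD_self,
    extD_swap _ _ (covDeriv F S D u z 1) (covDeriv F S D u z Complex.I), det2]
  ring

/-- The Hamiltonian vector field of a function vanishing identically. -/
theorem hamVF_zero (hθ : IsSymplecticPrimitive IE F.thetaE) (x : E) :
    hamVF IE F.thetaE (fun _ => (0 : ℝ)) x = 0 := by
  refine extD_left_unique hθ fun w => ?_
  rw [extD_hamVF hθ, extD_zero_left]
  have : mfderiv IE 𝓘(ℝ, ℝ) (fun _ : E => (0 : ℝ)) x = 0 := mfderiv_const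
  rw [this]
  exact neg_zero

/-- The differential of `H_γ`. -/
def affHamDeriv (γ : LieAff) (w v : ℂ) : ℝ :=
  γ.1 * v.re / w.im - (γ.1 * w.re + γ.2) * v.im / w.im ^ 2

theorem hasFDerivAt_affHam (γ : LieAff) {w : ℂ} (hw : w.im ≠ 0) :
    ∃ L : ℂ →L[ℝ] ℝ, HasFDerivAt (affHam γ) L w ∧ ∀ v, L v = affHamDeriv γ w v := by
  have h1 : HasFDerivAt (fun w : ℂ => γ.1 * w.re + γ.2) (γ.1 • Complex.reCLM) w :=
    (Complex.reCLM.hasFDerivAt.const_mul γ.1).add_const _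
  have h2 : HasFDerivAt (fun w : ℂ => w.im) Complex.imCLM w := Complex.imCLM.hasFDerivAt
  have h3 : HasFDerivAt (fun w : ℂ => (w.im)⁻¹) ((-(w.im ^ 2)⁻¹) • Complex.imCLM) w :=
    (hasDerivAt_inv hw).comp_hasFDerivAt w h2
  have h4 := h1.mul h3
  refine ⟨_, h4.congr_of_eventuallyEq (Eventually.of_forall fun v => by simp [affHam, div_eq_mul_inv]),
    fun v => ?_⟩
  simp [affHamDeriv]
  field_simp
  ring

theorem omegaW_eq_affHamDeriv (γ : LieAff) {w : ℂ} (hw : w.im ≠ 0) (v : ℂ) :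
    omegaW w (γ.1 • w + γ.2 • (1 : ℂ)) v = -affHamDeriv γ w v := by
  simp [omegaW, affHamDeriv]
  field_simp

theorem omegaW_left_unique {w a b : ℂ} (hw : w.im ≠ 0) (h : ∀ c, omegaW w a c = omegaW w b c) :
    a = b := by
  have h1 := h 1
  have h2 := h Complex.I
  simp only [omegaW, Complex.one_re, Complex.one_im, Complex.I_re, Complex.I_im] at h1 h2
  have hw2 : w.im ^ 2 ≠ 0 := pow_ne_zero _ hw
  rw [div_left_inj' hw2] at h1 h2
  apply Complex.ext <;> linarith

/-- Where the Hamiltonians are pulled back from the base, the curvature vanishes. -/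
theorem curv_eq_zero_of_affHam (hF : F.IsTarget) (hD : D.IsAdmissible F S e) {z : ℂ}
    (hz : z ∈ Metric.ball (0 : ℂ) 1) {x : E} (hx : F.LocallyTrivialAt x)
    (hloc : ∀ᶠ z' in 𝓝 z, ∀ᶠ y in 𝓝 x, ∀ ξ : ℂ, D.K z' y ξ = affHam (D.A z' ξ) (F.proj y)) :
    curv F S D z x = 0 := by
  have hθ := hF.thetaE_symplectic
  have hK : SmoothK S D := hD.K_smooth
  have hzS := S.ball_subset_surface hz
  have hnh := S.surface_mem_nhds hz
  have him : (F.proj x).im ≠ 0 := (hF.proj_mem x).ne'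
  have hfd : ∀ (w : TangentSpace IE x) (ξ : ℂ), fibreDiff D z x w ξ
      = affHamDeriv (D.A z ξ) (F.proj x) (F.dproj x w) := by
    intro w ξ
    rw [← hK.mfderiv_apply hzS]
    obtain ⟨L, hL, hLv⟩ := hasFDerivAt_affHam (D.A z ξ) him
    have h1 : MDifferentiableAt IE 𝓘(ℝ, ℂ) F.proj x := (hF.proj_smooth x).mdifferentiableAt (by simp)
    have h2 := hL.hasMFDerivAt.comp x h1.hasMFDerivAt
    have h3 : mfderiv IE 𝓘(ℝ, ℝ) (fun y => D.K z y ξ) x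
        = mfderiv IE 𝓘(ℝ, ℝ) (affHam (D.A z ξ) ∘ F.proj) x := by
      apply Filter.EventuallyEq.mfderiv_eq
      filter_upwards [hloc.self_of_nhds] with y hy
      exact hy ξ
    rw [h3, h2.mfderiv]
    exact hLv _
  obtain ⟨hsurj, hsplit, hWE⟩ := hx
  have hWx := hWE.self_of_nhds
  have homega := extD_XK hθ hK hzS x
  have hhor : ∀ ξ, XK F D z x ξ ∈ F.hor x := by
    intro ξ w hw
    have hw0 : F.dproj x w = 0 := hw
    rw [homega, hfd, hw0]
    simp [affHamDeriv]
  have hDX : ∀ ξ, F.dproj x (XK F D z x ξ)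
      = (D.A z ξ).1 • F.proj x + (D.A z ξ).2 • (1 : ℂ) := by
    intro ξ
    refine omegaW_left_unique him fun c => ?_
    obtain ⟨v, rfl⟩ := hsurj c
    obtain ⟨⟨p1, p2⟩, ⟨hp1, hp2, hv⟩, -⟩ := hsplit v
    have hp : F.dproj x v = F.dproj x p2 := by
      have h1 : F.dproj x v = F.dproj x p1 + F.dproj x p2 := by
        rw [hv]; exact map_add (mfderiv IE 𝓘(ℝ, ℂ) F.proj x) p1 p2
      have h2 : F.dproj x p1 = 0 := hp1
      rw [h1, h2, zero_add]
    rw [hp, ← hWx _ (hhor ξ) _ hp2, homega, hfd, omegaW_eq_affHamDeriv _ him]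
  have hAd : DifferentiableWithinAt ℝ D.A S.surface z :=
    (hD.A_smooth z hzS).differentiableWithinAt (by simp)
  have hdiff : DifferentiableWithinAt ℝ (fun z => D.K z x) S.surface z := by
    have h1 : ContMDiffOn 𝓘(ℝ, ℂ) (𝓘(ℝ, ℂ).prod IE) ∞ (fun z : ℂ => ((z, x) : ℂ × E)) S.surface :=
      contMDiffOn_id.prodMk contMDiffOn_const
    exact ((hK.comp h1 fun z hz => ⟨hz, mem_univ _⟩).contDiffOn z hzS).differentiableWithinAt (by simp)
  have hdK : ∀ η ξ : ℂ, fderivWithin ℝ (fun z => D.K z x) S.surface z η ξ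
      = affHam (fderivWithin ℝ D.A S.surface z η ξ) (F.proj x) := by
    intro η ξ
    have h1 : HasFDerivWithinAt (fun z => D.K z x ξ)
        ((ContinuousLinearMap.apply ℝ ℝ ξ).comp (fderivWithin ℝ (fun z => D.K z x) S.surface z))
        S.surface z :=
      (ContinuousLinearMap.apply ℝ ℝ ξ).hasFDerivAt.comp_hasFDerivWithinAt z hdiff.hasFDerivWithinAt
    have h2 : HasFDerivWithinAt (fun z => D.A z ξ)
        ((ContinuousLinearMap.apply ℝ LieAff ξ).comp (fderivWithin ℝ D.A S.surface z)) S.surface z :=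
      (ContinuousLinearMap.apply ℝ LieAff ξ).hasFDerivAt.comp_hasFDerivWithinAt z
        hAd.hasFDerivWithinAt
    set l : LieAff →L[ℝ] ℝ := ((F.proj x).re / (F.proj x).im) • ContinuousLinearMap.fst ℝ ℝ ℝ
      + ((F.proj x).im)⁻¹ • ContinuousLinearMap.snd ℝ ℝ ℝ with hl
    have hlγ : ∀ γ, l γ = affHam γ (F.proj x) := by
      intro γ
      simp only [hl, affHam, _root_.add_apply, smul_apply, ContinuousLinearMap.coe_fst',
        ContinuousLinearMap.coe_snd', smul_eq_mul]
      field_simp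
    have h3 := l.hasFDerivAt.comp_hasFDerivWithinAt z h2
    have h4 : HasFDerivWithinAt (fun z => D.K z x ξ)
        (l.comp ((ContinuousLinearMap.apply ℝ LieAff ξ).comp (fderivWithin ℝ D.A S.surface z)))
        S.surface z := by
      refine h3.congr_of_eventuallyEq ?_ ((hloc.self_of_nhds.self_of_nhds ξ).trans (hlγ _).symm)
      filter_upwards [nhdsWithin_le_nhds hloc] with z' hz'
      exact (hz'.self_of_nhds ξ).trans (hlγ _).symm
    have h5 := (S.uniqueDiffOn_surface z hzS).eq h1 h4
    exact (DFunLike.congr_fun h5 η).trans (hlγ _)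
  unfold curv
  rw [hdK, hdK, hWx _ (hhor 1) _ (hhor Complex.I), hDX, hDX]
  have hflat := hD.A_flat z hzS
  have hf1 := congrArg Prod.fst hflat
  have hf2 := congrArg Prod.snd hflat
  simp only [affBracket, Prod.fst_add, Prod.snd_add, Prod.fst_sub, Prod.snd_sub, Prod.fst_zero,
    Prod.snd_zero, add_zero] at hf1 hf2
  simp only [affHam, omegaW, Complex.add_re, Complex.add_im, Complex.smul_re, Complex.smul_im,
    smul_eq_mul, Complex.one_re, Complex.one_im, mul_zero, mul_one, add_zero]
  field_simp
  linear_combination (-(F.proj x).re) * hf1 - hf2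

theorem isCompact_disc (hF : F.IsTarget) : IsCompact F.disc := by
  obtain ⟨h⟩ := hF.disc_homeo
  have : CompactSpace (Metric.closedBall (0 : ℂ) 1) :=
    isCompact_iff_compactSpace.1 (isCompact_closedBall _ _)
  exact isCompact_iff_compactSpace.2 h.symm.compactSpace

/-- The curvature is bounded over compact subsets of the surface. -/
theorem exists_curv_bound [T2Space E] (hF : F.IsTarget) (hD : D.IsAdmissible F S e) {Z : Set ℂ}
    (hZ : IsCompact Z) (hZS : Z ⊆ S.surface) :
    ∃ c : ℝ, 0 ≤ c ∧ ∀ z ∈ Z, z ∈ Metric.ball (0 : ℂ) 1 → ∀ x, |curv F S D z x| ≤ c := by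
  obtain ⟨L, hL, hZL, hLU⟩ := exists_compact_between hZ S.isClosed_range_puncture.isOpen_compl
    (fun z hz => (hZS hz).2)
  obtain ⟨C, hC, -, hCK⟩ := hD.K_admissible (L ∩ Metric.closedBall 0 1)
    (fun z hz => ⟨hz.2, hLU hz.1⟩) (hL.inter_right Metric.isClosed_closedBall)
  have hC2 : IsCompact (C ∪ F.proj ⁻¹' F.disc) :=
    hC.union (hF.proj_proper _ hF.disc_subset (isCompact_disc hF))
  have hcont := (continuousOn_curv (F := F) (S := S) (D := D) hF.thetaE_symplectic hD.K_smooth).mono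
    (prod_mono hZS (subset_univ (C ∪ F.proj ⁻¹' F.disc)))
  obtain ⟨c, hc⟩ := (hZ.prod hC2).exists_bound_of_continuousOn hcont
  refine ⟨max c 0, le_max_right _ _, fun z hz hzb x => ?_⟩
  by_cases hx : x ∈ C ∪ F.proj ⁻¹' F.disc
  · exact (hc (z, x) ⟨hz, hx⟩).trans (le_max_left _ _)
  · rw [curv_eq_zero_of_affHam hF hD hzb (hF.infinity_trivial x fun h => hx (Or.inr h)), abs_zero]
    · exact le_max_right _ _
    have h1 : ∀ᶠ z' in 𝓝 z, z' ∈ interior L := isOpen_interior.mem_nhds (hZL hz)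
    have h2 : ∀ᶠ z' in 𝓝 z, z' ∈ Metric.ball (0 : ℂ) 1 := Metric.isOpen_ball.mem_nhds hzb
    have h3 : ∀ᶠ y in 𝓝 x, y ∉ C := hC.isClosed.isOpen_compl.mem_nhds fun h => hx (Or.inl h)
    filter_upwards [h1, h2] with z' hz1 hz2
    filter_upwards [h3] with y hy
    exact hCK z' ⟨interior_subset hz1, Metric.ball_subset_closedBall hz2⟩ y hy

end Curvature

section Strips

variable {d : ℕ}

theorem isClosed_endRay (j : Fin (d + 1)) : IsClosed (endRay j) := by
  unfold endRay; split_ifs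
  · exact isClosed_Iic
  · exact isClosed_Ici

theorem uniqueDiffOn_endRay (j : Fin (d + 1)) : UniqueDiffOn ℝ (endRay j) := by
  unfold endRay; split_ifs
  · exact uniqueDiffOn_Iic 0
  · exact uniqueDiffOn_Ici 0

theorem uniqueDiffOn_endStrip (j : Fin (d + 1)) : UniqueDiffOn ℝ (endStrip j) :=
  (uniqueDiffOn_endRay j).prod (uniqueDiffOn_Icc zero_lt_one)

theorem isClosed_endStrip (j : Fin (d + 1)) : IsClosed (endStrip j) :=
  (isClosed_endRay j).prod isClosed_Icc

theorem interior_endStrip (j : Fin (d + 1)) :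
    interior (endStrip j) = {s | s ∈ endRay j ∧ s ≠ 0} ×ˢ Ioo 0 1 := by
  unfold endStrip
  rw [interior_prod_eq, interior_Icc]
  congr 1
  unfold endRay
  split_ifs
  · rw [interior_Iic]; ext s; simp [lt_iff_le_and_ne]
  · rw [interior_Ici]; ext s; simp [lt_iff_le_and_ne, eq_comm]

namespace DiscData

variable {S : DiscData d}

theorem IsPuncturedDisc.differentiableWithinAt_strip (hS : S.IsPuncturedDisc) {j : Fin (d + 1)}
    {q : ℝ × ℝ} (hq : q ∈ endStrip j) : DifferentiableWithinAt ℝ (S.strip j) (endStrip j) q :=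
  (hS.strip_smooth j q hq).differentiableWithinAt (by simp)

theorem IsPuncturedDisc.hasFDerivAt_strip (hS : S.IsPuncturedDisc) {j : Fin (d + 1)}
    {q : ℝ × ℝ} (hq : q ∈ interior (endStrip j)) :
    HasFDerivAt (S.strip j) (fderivWithin ℝ (S.strip j) (endStrip j) q) q :=
  (hS.differentiableWithinAt_strip (interior_subset hq)).hasFDerivWithinAt.hasFDerivAt
    (mem_interior_iff_mem_nhds.1 hq)

theorem IsPuncturedDisc.det2_strip_pos (hS : S.IsPuncturedDisc) {j : Fin (d + 1)}
    {q : ℝ × ℝ} (hq : q ∈ endStrip j) : 0 < det2 (S.stripS j q) (S.stripT j q) := by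
  have hz := hS.strip_mapsTo j hq
  rw [← hS.strip_holomorphic j q hq]
  exact det2_cplx_pos _ (hS.cplx_sq _ hz) (hS.cplx_oriented _ hz) (hS.strip_immersion j q hq)

theorem IsPuncturedDisc.strip_mem_ball (hS : S.IsPuncturedDisc) {j : Fin (d + 1)}
    {q : ℝ × ℝ} (hq : q ∈ interior (endStrip j)) : S.strip j q ∈ Metric.ball (0 : ℂ) 1 := by
  have hq' := interior_subset hq
  have h1 := (hS.strip_mapsTo j hq').1
  have h2 := hS.strip_boundary j q hq'
  rw [interior_endStrip] at hq
  have h3 : ‖S.strip j q‖ ≠ 1 := by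
    rw [ne_eq, h2]
    rintro (h | h)
    · exact hq.2.1.ne' h
    · exact hq.2.2.ne h
  rw [mem_closedBall_zero_iff] at h1
  rw [mem_ball_zero_iff]
  exact lt_of_le_of_ne h1 h3

end DiscData
end Strips

section EnergyOnStrips

variable {VE : Type*} [NormedAddCommGroup VE] [NormedSpace ℝ VE] [FiniteDimensional ℝ VE]
  {BE : Type*} [TopologicalSpace BE] {IE : ModelWithCorners ℝ VE BE}
  {E : Type*} [TopologicalSpace E] [ChartedSpace BE E] [IsManifold IE ∞ E]
  {VM : Type*} [NormedAddCommGroup VM] [NormedSpace ℝ VM]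
  {BM : Type*} [TopologicalSpace BM] {IM : ModelWithCorners ℝ VM BM}
  {M : Type*} [TopologicalSpace M] [ChartedSpace BM M] [IsManifold IM ∞ M]
  {F : FibrationData IE E IM M} {d : ℕ} {S : DiscData d} {e : Fin (d + 1) → EndData IE E}
  {D : SurfaceData IE E}

theorem curv_strip_eq_zero (hθ : IsSymplecticPrimitive IE F.thetaE) (hS : S.IsPuncturedDisc)
    (hD : D.IsAdmissible F S e) {j : Fin (d + 1)} {q : ℝ × ℝ} (hq : q ∈ interior (endStrip j))
    (x : E) : curv F S D (S.strip j q) x = 0 := by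
  have hK : SmoothK S D := hD.K_smooth
  have hq' := interior_subset hq
  have hz := hS.strip_mapsTo j hq'
  set z := S.strip j q with hzdef
  have hdet := hS.det2_strip_pos hq'
  have hdiff : DifferentiableWithinAt ℝ (fun z => D.K z x) S.surface z := by
    have h1 : ContMDiffOn 𝓘(ℝ, ℂ) (𝓘(ℝ, ℂ).prod IE) ∞ (fun z : ℂ => ((z, x) : ℂ × E)) S.surface :=
      contMDiffOn_id.prodMk contMDiffOn_const
    exact ((hK.comp h1 fun z hz => ⟨hz, mem_univ _⟩).contDiffOn z hz).differentiableWithinAt (by simp)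
  have hpull := fderivWithin_pullback_antisymm (β := fun z => D.K z x) (g := S.strip j)
    ((hS.strip_smooth j q hq').of_le (by exact WithTop.coe_le_coe.2 (le_top : (2 : ℕ∞) ≤ ⊤)))
    (uniqueDiffOn_endStrip j) hq' (subset_closure hq) hdiff (hS.strip_mapsTo j) (1, 0) (0, 1)
  set β : ℝ × ℝ → ℝ × ℝ →L[ℝ] ℝ := fun p => (D.K (S.strip j p) x).comp
      (fderivWithin ℝ (S.strip j) (endStrip j) p) with hβ
  have hβd : DifferentiableWithinAt ℝ β (endStrip j) q := by
    have h1 : DifferentiableWithinAt ℝ (fun p => D.K (S.strip j p) x) (endStrip j) q :=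
      hdiff.comp q (hS.differentiableWithinAt_strip hq') (hS.strip_mapsTo j)
    have h2 : DifferentiableWithinAt ℝ (fderivWithin ℝ (S.strip j) (endStrip j)) (endStrip j) q :=
      (((hS.strip_smooth j).fderivWithin (m := 1) (uniqueDiffOn_endStrip j) (by
        exact WithTop.coe_le_coe.2 (le_top : (1 + 1 : ℕ∞) ≤ ⊤))) q hq').differentiableWithinAt
        (by norm_num)
    exact h1.clm_comp h2
  have hconst : ∀ (w : ℝ × ℝ) (v : ℝ × ℝ) (f : ℝ × ℝ → ℝ), (∀ p ∈ endStrip j, β p v = f p) →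
      (∀ᶠ r in 𝓝 (0 : ℝ), f (q + r • w) = f q) → fderivWithin ℝ β (endStrip j) q w v = 0 := by
    intro w v f hf hfc
    have hnh := mem_interior_iff_mem_nhds.1 hq
    rw [fderivWithin_of_mem_nhds hnh]
    have h1 : HasFDerivAt β (fderiv ℝ β q) q := (hβd.differentiableAt hnh).hasFDerivAt
    have h2 : HasDerivAt (fun r : ℝ => q + r • w) w 0 := by
      simpa using ((hasDerivAt_id (0 : ℝ)).smul_const w).const_add q
    have h3 : HasDerivAt (fun r : ℝ => β (q + r • w)) (fderiv ℝ β q w) 0 := by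
      have h1' : HasFDerivAt β (fderiv ℝ β q) (q + (0 : ℝ) • w) := by simpa using h1
      exact h1'.comp_hasDerivAt (0 : ℝ) h2
    have h4 : HasDerivAt (fun r : ℝ => β (q + r • w) v) (fderiv ℝ β q w v) 0 := by
      have := (ContinuousLinearMap.apply ℝ ℝ v).hasFDerivAt.comp_hasDerivAt (0 : ℝ) h3
      exact this
    have h5 : HasDerivAt (fun r : ℝ => β (q + r • w) v) 0 0 := by
      have h6 : (fun r : ℝ => β (q + r • w) v) =ᶠ[𝓝 0] fun _ => f q := by
        have h7 : ∀ᶠ r in 𝓝 (0 : ℝ), q + r • w ∈ endStrip j := by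
          have h8 : Tendsto (fun r : ℝ => q + r • w) (𝓝 0) (𝓝 q) := by
            simpa using h2.continuousAt.tendsto
          exact h8 hnh
        filter_upwards [h7, hfc] with r h8 h9
        rw [hf _ h8, h9]
      exact (hasDerivAt_const (0 : ℝ) (f q)).congr_of_eventuallyEq h6
    exact h4.unique h5
  have hz1 : fderivWithin ℝ β (endStrip j) q (1, 0) (0, 1) = 0 := by
    refine hconst (1, 0) (0, 1) (fun p => (e j).H p.2 x) (fun p hp => ?_) (Eventually.of_forall fun r => by simp)
    exact (hD.K_end j p hp x).2
  have hz2 : fderivWithin ℝ β (endStrip j) q (0, 1) (1, 0) = 0 := by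
    refine hconst (0, 1) (1, 0) (fun p => 0) (fun p hp => ?_) (Eventually.of_forall fun r => rfl)
    exact (hD.K_end j p hp x).1
  rw [hz1, hz2] at hpull
  have hXs : XK F D z x (S.stripS j q) = 0 := by
    unfold XK
    have : (fun y => D.K z y (S.stripS j q)) = fun _ => (0 : ℝ) := by
      funext y; exact (hD.K_end j q hq' y).1
    rw [this, hamVF_zero hθ]
  have h1 := alternating_eq_det2 (fderivWithin ℝ (fun z => D.K z x) S.surface z)
    (S.stripS j q) (S.stripT j q)
  have h2 := omegaE_XK_eq_det2 hθ hK hz x (S.stripS j q) (S.stripT j q)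
  rw [hXs] at h2
  unfold FibrationData.omegaE at h2
  rw [extD_zero_left] at h2
  have h3 : det2 (S.stripS j q) (S.stripT j q) * curv F S D z x = 0 := by
    unfold curv FibrationData.omegaE
    rw [mul_add, ← h1, ← h2, add_zero]
    have h4 : fderivWithin ℝ (S.strip j) (endStrip j) q (1, 0) = S.stripS j q := rfl
    have h5 : fderivWithin ℝ (S.strip j) (endStrip j) q (0, 1) = S.stripT j q := rfl
    rw [h4, h5] at hpull
    linarith
  exact (mul_eq_zero.1 h3).resolve_left hdet.ne'

theorem energyDensity_nonneg (hF : F.IsTarget) (hS : S.IsPuncturedDisc) (hD : D.IsAdmissible F S e)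
    {u : ℂ → E} (hu : IsSolution F S D u) {z : ℂ} (hz : z ∈ S.surface) :
    0 ≤ energyDensity F S D u z := by
  have h1 := omegaE_covDeriv_eq_det2 hF.thetaE_symplectic hD.K_smooth u hz 1 (S.cplx z 1)
  rw [hu.equation z hz 1] at h1
  have h2 : 0 ≤ F.omegaE (u z) (covDeriv F S D u z 1) (D.J z (u z) (covDeriv F S D u z 1)) := by
    by_cases h : covDeriv F S D u z 1 = 0
    · unfold FibrationData.omegaE
      rw [h, extD_zero_left]
    · exact (((hD.J_admissible z hz).compatible.2 (u z) (covDeriv F S D u z 1)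
        (covDeriv F S D u z 1)).2.2 h).le
  rw [h1] at h2
  have h3 : det2 1 (S.cplx z 1) = (S.cplx z 1).im := by simp [det2]
  rw [h3] at h2
  exact (mul_nonneg_iff_of_pos_left (hS.cplx_oriented z hz)).1 h2

theorem geomEnergy_eq (hF : F.IsTarget) (hS : S.IsPuncturedDisc) (hD : D.IsAdmissible F S e)
    {u : ℂ → E} (hu : IsSolution F S D u) :
    geomEnergy F S D u = ∫⁻ z in S.surface, ENNReal.ofReal (energyDensity F S D u z) := by
  refine setLIntegral_congr_fun S.measurableSet_surface fun z hz => ?_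
  have hθ := hF.thetaE_symplectic
  have h1 := omegaE_covDeriv_eq_det2 hθ hD.K_smooth u hz 1 (S.cplx z 1)
  have h2 := omegaE_covDeriv_eq_det2 hθ hD.K_smooth u hz (S.cplx z 1) (S.cplx z (S.cplx z 1))
  rw [hu.equation z hz 1] at h1
  rw [hu.equation z hz (S.cplx z 1)] at h2
  rw [← hu.equation z hz 1] at h1
  have h3 : det2 1 (S.cplx z 1) = (S.cplx z 1).im := by simp [det2]
  have h4 : det2 (S.cplx z 1) (S.cplx z (S.cplx z 1)) = (S.cplx z 1).im := by
    rw [hS.cplx_sq z hz]; simp [det2]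
  have h5 : F.omegaE (u z) (covDeriv F S D u z 1) (D.J z (u z) (covDeriv F S D u z 1))
      = (S.cplx z 1).im * energyDensity F S D u z := by
    rw [← h3, ← h1, hu.equation z hz 1]
  have hpos := hS.cplx_oriented z hz
  show ENNReal.ofReal _ = ENNReal.ofReal _
  rw [h5, h2, h4]
  congr 1
  field_simp
  ring

theorem omegaE_covDeriv_stripT (hθ : IsSymplecticPrimitive IE F.thetaE) (hS : S.IsPuncturedDisc)
    (hK : SmoothK S D) {u : ℂ → E} (hu : IsSolution F S D u) {j : Fin (d + 1)} {q : ℝ × ℝ}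
    (hq : q ∈ endStrip j) :
    F.omegaE (u (S.strip j q)) (covDeriv F S D u (S.strip j q) (S.stripT j q))
      (D.J (S.strip j q) (u (S.strip j q)) (covDeriv F S D u (S.strip j q) (S.stripT j q)))
      = det2 (S.stripS j q) (S.stripT j q) * energyDensity F S D u (S.strip j q) := by
  have hz := hS.strip_mapsTo j hq
  rw [← hu.equation _ hz, ← hS.strip_holomorphic j q hq, hS.cplx_sq _ hz,
    omegaE_covDeriv_eq_det2 hθ hK u hz]
  congr 1
  simp [det2]
  ring

end EnergyOnStrips

section BlowUp

/-- A monotone function satisfying a difference version of `A - C ≤ C (1/μ + μ A')` for all `μ`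
does not exceed `C`, since otherwise it would blow up in finite time. -/
theorem le_of_superlinear_growth {A : ℝ → ℝ} {C σ₀ : ℝ} (hC : 0 < C) (hmono : Monotone A)
    (h : ∀ σ ≥ σ₀, ∀ δ > 0, ∀ μ > 0, A σ ≤ C * (1 + 1 / μ) + C * μ * ((A (σ + δ) - A σ) / δ))
    {σ : ℝ} (hσ : σ₀ ≤ σ) : A σ ≤ C := by
  by_contra hcon
  push Not at hcon
  set b := A σ - C with hb
  have hbpos : 0 < b := by linarith
  have step : ∀ n : ℕ, ∃ τ, σ ≤ τ ∧ τ ≤ σ + 8 * C ^ 2 / b * (1 - (1 / 2) ^ n) ∧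
      2 ^ n * b ≤ A τ - C := by
    intro n
    induction n with
    | zero => exact ⟨σ, le_refl _, by simp, by simp [hb]⟩
    | succ n ih =>
      obtain ⟨τ, h1, h2, h3⟩ := ih
      set c := A τ - C with hc
      have h2n : (0 : ℝ) < 2 ^ n := by positivity
      have hcpos : 0 < c := lt_of_lt_of_le (by positivity) h3
      set δ := 4 * C ^ 2 / c with hδ
      have hδpos : 0 < δ := by positivity
      have hh := h τ (hσ.trans h1) δ hδpos (2 * C / c) (by positivity)
      have e1 : C * (1 + 1 / (2 * C / c)) = C + c / 2 := by field_simp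
      have e2 : C * (2 * C / c) * ((A (τ + δ) - A τ) / δ) = (A (τ + δ) - A τ) / 2 := by
        rw [hδ]; field_simp; ring
      rw [e1, e2] at hh
      refine ⟨τ + δ, by linarith, ?_, ?_⟩
      · have : δ ≤ 8 * C ^ 2 / b * ((1 / 2) ^ (n + 1)) := by
          rw [hδ, div_mul_eq_mul_div, div_le_div_iff₀ hcpos hbpos]
          have : 8 * C ^ 2 * (1 / 2 : ℝ) ^ (n + 1) * (2 ^ n * b) = 4 * C ^ 2 * b := by
            rw [pow_succ, one_div, inv_pow]; field_simp; ring
          rw [← this]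
          gcongr
        have e3 : (1 / 2 : ℝ) ^ (n + 1) = (1 / 2) ^ n - (1 / 2) ^ (n + 1) := by
          rw [pow_succ]; ring
        calc τ + δ ≤ σ + 8 * C ^ 2 / b * (1 - (1 / 2) ^ n) + 8 * C ^ 2 / b * ((1 / 2) ^ (n + 1)) := by
              linarith
          _ = σ + 8 * C ^ 2 / b * (1 - ((1 / 2) ^ n - (1 / 2) ^ (n + 1))) := by ring
          _ = _ := by rw [← e3]
      · rw [pow_succ]
        linarith
  obtain ⟨n, hn⟩ := pow_unbounded_of_one_lt ((A (σ + 8 * C ^ 2 / b) - C) / b) (one_lt_two)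
  obtain ⟨τ, -, h2, h3⟩ := step n
  have h4 : A τ ≤ A (σ + 8 * C ^ 2 / b) := by
    apply hmono
    refine h2.trans ?_
    have : 8 * C ^ 2 / b * (1 - (1 / 2) ^ n) ≤ 8 * C ^ 2 / b * 1 := by
      gcongr
      have : (0 : ℝ) ≤ (1 / 2) ^ n := by positivity
      linarith
    linarith
  rw [div_lt_iff₀ hbpos] at hn
  linarith

end BlowUp

section ChangeOfVariables

theorem det_eq_det2 (L : ℝ × ℝ →L[ℝ] ℂ) :
    ((Complex.equivRealProdCLM : ℂ →L[ℝ] ℝ × ℝ).comp L).det = det2 (L (1, 0)) (L (0, 1)) := by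
  rw [ContinuousLinearMap.det, ← LinearMap.det_toMatrix (Module.Basis.finTwoProd ℝ), Matrix.det_fin_two]
  simp [LinearMap.toMatrix_apply, det2]
  ring

variable {f : ℝ × ℝ → ℂ} {f' : ℝ × ℝ → ℝ × ℝ →L[ℝ] ℂ} {s : Set (ℝ × ℝ)}

theorem integrableOn_image_iff_det2 (hs : MeasurableSet s)
    (hf' : ∀ x ∈ s, HasFDerivWithinAt f (f' x) s x) (hf : InjOn f s) (g : ℂ → ℝ) :
    IntegrableOn g (f '' s) ↔
      IntegrableOn (fun x => |det2 (f' x (1, 0)) (f' x (0, 1))| * g (f x)) s := by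
  set φ := Complex.measurableEquivRealProd.symm
  have hφ : MeasurePreserving φ volume volume := Complex.volume_preserving_equiv_real_prod.symm
  have h1 := hφ.integrableOn_comp_preimage φ.measurableEmbedding (f := g) (s := f '' s)
  rw [← h1]
  have h2 : φ ⁻¹' (f '' s) = (fun x => Complex.equivRealProdCLM (f x)) '' s := by
    ext p
    constructor
    · rintro ⟨x, hx, hxp⟩
      refine ⟨x, hx, ?_⟩
      show Complex.equivRealProdCLM (f x) = p
      rw [hxp]; rfl
    · rintro ⟨x, hx, rfl⟩
      exact ⟨x, hx, rfl⟩
  have h3 := integrableOn_image_iff_integrableOn_abs_det_fderiv_smul volume hs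
    (f := fun x => Complex.equivRealProdCLM (f x)) (f' := fun x => (Complex.equivRealProdCLM : ℂ →L[ℝ] ℝ × ℝ).comp (f' x))
    (fun x hx => Complex.equivRealProdCLM.hasFDerivAt.comp_hasFDerivWithinAt x (hf' x hx))
    (fun x hx y hy hxy => hf hx hy (Complex.equivRealProdCLM.injective hxy)) (fun p => g (φ p))
  simp only [det_eq_det2, smul_eq_mul] at h3
  exact (by rw [h2]; exact h3)

theorem integral_image_eq_det2 (hs : MeasurableSet s)
    (hf' : ∀ x ∈ s, HasFDerivWithinAt f (f' x) s x) (hf : InjOn f s) (g : ℂ → ℝ) :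
    ∫ z in f '' s, g z = ∫ x in s, |det2 (f' x (1, 0)) (f' x (0, 1))| * g (f x) := by
  set φ := Complex.measurableEquivRealProd.symm
  have hφ : MeasurePreserving φ volume volume := Complex.volume_preserving_equiv_real_prod.symm
  have h1 := hφ.setIntegral_preimage_emb φ.measurableEmbedding g (f '' s)
  rw [← h1]
  have h2 : φ ⁻¹' (f '' s) = (fun x => Complex.equivRealProdCLM (f x)) '' s := by
    ext p
    constructor
    · rintro ⟨x, hx, hxp⟩
      refine ⟨x, hx, ?_⟩
      show Complex.equivRealProdCLM (f x) = p
      rw [hxp]; rfl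
    · rintro ⟨x, hx, rfl⟩
      exact ⟨x, hx, rfl⟩
  have h3 := integral_image_eq_integral_abs_det_fderiv_smul volume hs
    (f := fun x => Complex.equivRealProdCLM (f x)) (f' := fun x => (Complex.equivRealProdCLM : ℂ →L[ℝ] ℝ × ℝ).comp (f' x))
    (fun x hx => Complex.equivRealProdCLM.hasFDerivAt.comp_hasFDerivWithinAt x (hf' x hx))
    (fun x hx y hy hxy => hf hx hy (Complex.equivRealProdCLM.injective hxy)) (fun p => g (φ p))
  simp only [det_eq_det2, smul_eq_mul] at h3
  exact (by rw [h2]; exact h3)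

end ChangeOfVariables

section Stokes

/-- The point with polar coordinates `(r, τ)`. -/
def polarPt (p : ℝ × ℝ) : ℂ := (p.1 : ℂ) * DiscData.bdryPt p.2

theorem hasDerivAt_bdryPt (τ : ℝ) :
    HasDerivAt DiscData.bdryPt (Complex.I * DiscData.bdryPt τ) τ := by
  have h : HasDerivAt (fun t : ℝ => Complex.exp (t * Complex.I))
      (Complex.exp (τ * Complex.I) * (1 * Complex.I)) τ :=
    ((Complex.ofRealCLM.hasDerivAt).mul_const Complex.I).cexp
  rw [one_mul, mul_comm] at h
  exact h

theorem continuous_bdryPt : Continuous DiscData.bdryPt :=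
  continuous_iff_continuousAt.2 fun τ => (hasDerivAt_bdryPt τ).continuousAt

theorem norm_bdryPt (τ : ℝ) : ‖DiscData.bdryPt τ‖ = 1 := Complex.norm_exp_ofReal_mul_I _

theorem det2_bdryPt (τ : ℝ) : det2 (DiscData.bdryPt τ) (Complex.I * DiscData.bdryPt τ) = 1 := by
  have h := norm_bdryPt τ
  have h1 : Complex.normSq (DiscData.bdryPt τ) = 1 := by
    rw [Complex.normSq_eq_norm_sq, h, one_pow]
  rw [Complex.normSq_apply] at h1
  simp [det2]
  linarith

/-- The derivative of polar coordinates. -/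
def polarDeriv (p : ℝ × ℝ) : ℝ × ℝ →L[ℝ] ℂ :=
  (ContinuousLinearMap.fst ℝ ℝ ℝ).smulRight (DiscData.bdryPt p.2)
    + (ContinuousLinearMap.snd ℝ ℝ ℝ).smulRight ((p.1 : ℂ) * (Complex.I * DiscData.bdryPt p.2))

theorem hasFDerivAt_polarPt (p : ℝ × ℝ) : HasFDerivAt polarPt (polarDeriv p) p := by
  have h1 : HasFDerivAt (fun q : ℝ × ℝ => (q.1 : ℂ)) (Complex.ofRealCLM.comp (ContinuousLinearMap.fst ℝ ℝ ℝ)) p :=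
    Complex.ofRealCLM.hasFDerivAt.comp p hasFDerivAt_fst
  have h2 : HasFDerivAt (fun q : ℝ × ℝ => DiscData.bdryPt q.2) _ p :=
    (hasDerivAt_bdryPt p.2).hasFDerivAt.comp p hasFDerivAt_snd
  have h3 := h1.mul h2
  refine h3.congr_fderiv ?_
  ext <;> simp [polarDeriv]

theorem polarDeriv_fst (p : ℝ × ℝ) : polarDeriv p (1, 0) = DiscData.bdryPt p.2 := by
  simp [polarDeriv]

theorem polarDeriv_snd (p : ℝ × ℝ) :
    polarDeriv p (0, 1) = p.1 • (Complex.I * DiscData.bdryPt p.2) := by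
  simp [polarDeriv]

theorem norm_polarPt (p : ℝ × ℝ) : ‖polarPt p‖ = |p.1| := by
  simp [polarPt, norm_bdryPt]

theorem polarPt_eq (p : ℝ × ℝ) : polarPt p = Complex.polarCoord.symm p := by
  rw [Complex.polarCoord_symm_apply, polarPt, DiscData.bdryPt, Complex.exp_mul_I]
  simp

theorem injOn_polarPt : InjOn polarPt (Ioo 0 1 ×ˢ Ioo (-Real.pi) Real.pi) := by
  intro p hp q hq h
  rw [polarPt_eq, polarPt_eq] at h
  have hsub : Ioo (0 : ℝ) 1 ×ˢ Ioo (-Real.pi) Real.pi ⊆ Complex.polarCoord.target := by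
    rw [Complex.polarCoord_target]
    exact prod_mono (fun r hr => hr.1) subset_rfl
  exact Complex.polarCoord.symm.injOn (hsub hp) (hsub hq) h

theorem image_polarPt_ae : polarPt '' (Ioo 0 1 ×ˢ Ioo (-Real.pi) Real.pi)
    =ᵐ[volume] Metric.ball (0 : ℂ) 1 := by
  have h1 : polarPt '' (Ioo 0 1 ×ˢ Ioo (-Real.pi) Real.pi)
      = Complex.slitPlane ∩ Metric.ball (0 : ℂ) 1 := by
    ext z
    constructor
    · rintro ⟨p, hp, rfl⟩
      have hpt : p ∈ Complex.polarCoord.target := by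
        rw [Complex.polarCoord_target]; exact ⟨hp.1.1, hp.2⟩
      refine ⟨?_, ?_⟩
      · rw [polarPt_eq, ← Complex.polarCoord_source]
        exact Complex.polarCoord.map_target hpt
      · rw [mem_ball_zero_iff, norm_polarPt, abs_of_pos hp.1.1]
        exact hp.1.2
    · rintro ⟨hz, hz1⟩
      rw [← Complex.polarCoord_source] at hz
      have h2 := Complex.polarCoord.map_source hz
      have h3 := Complex.polarCoord.left_inv hz
      rw [← polarPt_eq] at h3
      rw [Complex.polarCoord_target] at h2
      refine ⟨Complex.polarCoord z, ⟨⟨h2.1, ?_⟩, h2.2⟩, h3⟩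
      rw [mem_ball_zero_iff] at hz1
      rwa [← h3, norm_polarPt, abs_of_pos h2.1] at hz1
  rw [h1]
  have h2 : (Complex.slitPlane : Set ℂ) =ᵐ[volume] univ := by
    rw [ae_eq_univ]
    have h4 : Complex.slitPlaneᶜ = Complex.measurableEquivRealProd ⁻¹' polarCoord.sourceᶜ := by
      ext z
      simp [Complex.mem_slitPlane_iff, polarCoord_source]
    rw [h4, Complex.volume_preserving_equiv_real_prod.measure_preimage_equiv]
    exact ae_eq_univ.1 polarCoord_source_ae_eq_univ
  have := h2.inter (ae_eq_refl (Metric.ball (0 : ℂ) 1))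
  simpa using this

/-- Stokes' theorem on the closed disc. -/
theorem integral_ball_eq_integral_circle {β : ℂ → ℂ →L[ℝ] ℝ} {β' : ℂ → ℂ →L[ℝ] ℂ →L[ℝ] ℝ}
    (hc : ContinuousOn β (Metric.closedBall 0 1))
    (hd : ∀ z ∈ Metric.ball (0 : ℂ) 1, HasFDerivAt β (β' z) z)
    (hi : IntegrableOn (fun z => β' z 1 Complex.I - β' z Complex.I 1) (Metric.ball (0 : ℂ) 1))
    (a : ℝ) :
    ∫ z in Metric.ball (0 : ℂ) 1, (β' z 1 Complex.I - β' z Complex.I 1)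
      = ∫ τ in a..(a + 2 * Real.pi),
          β (DiscData.bdryPt τ) (Complex.I * DiscData.bdryPt τ) := by
  set s : Set (ℝ × ℝ) := Ioo 0 1 ×ˢ Ioo (-Real.pi) Real.pi with hs
  have hsm : MeasurableSet s := measurableSet_Ioo.prod measurableSet_Ioo
  have hpi : -Real.pi ≤ Real.pi := by linarith [Real.pi_pos]
  have hder : ∀ x ∈ s, HasFDerivWithinAt polarPt (polarDeriv x) s x :=
    fun x _ => (hasFDerivAt_polarPt x).hasFDerivWithinAt
  have hball : ∀ p ∈ s, polarPt p ∈ Metric.ball (0 : ℂ) 1 := by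
    intro p hp
    rw [mem_ball_zero_iff, norm_polarPt, abs_of_pos hp.1.1]
    exact hp.1.2
  set f : ℝ × ℝ → ℝ := fun p => β (polarPt p) (p.1 • (Complex.I * DiscData.bdryPt p.2)) with hf
  set g : ℝ × ℝ → ℝ := fun p => -β (polarPt p) (DiscData.bdryPt p.2) with hg
  set f' : ℝ × ℝ → ℝ × ℝ →L[ℝ] ℝ := fun p =>
    fderiv ℝ f p with hf'
  set g' : ℝ × ℝ → ℝ × ℝ →L[ℝ] ℝ := fun p => fderiv ℝ g p with hg'
  have hb2 : ∀ p : ℝ × ℝ, HasFDerivAt (fun q : ℝ × ℝ => DiscData.bdryPt q.2)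
      ((ContinuousLinearMap.snd ℝ ℝ ℝ).smulRight (Complex.I * DiscData.bdryPt p.2)) p := by
    intro p
    refine ((hasDerivAt_bdryPt p.2).hasFDerivAt.comp p hasFDerivAt_snd).congr_fderiv ?_
    ext <;> simp
  have hβp : ∀ p ∈ s, HasFDerivAt (fun q => β (polarPt q)) ((β' (polarPt p)).comp (polarDeriv p)) p :=
    fun p hp => (hd _ (hball p hp)).comp p (hasFDerivAt_polarPt p)
  have hfd : ∀ p ∈ s, HasFDerivAt f (f' p) p ∧ f' p (1, 0)
      = β' (polarPt p) (DiscData.bdryPt p.2) (p.1 • (Complex.I * DiscData.bdryPt p.2))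
        + β (polarPt p) (Complex.I * DiscData.bdryPt p.2) := by
    intro p hp
    have h1 : HasFDerivAt (fun q : ℝ × ℝ => q.1 • (Complex.I * DiscData.bdryPt q.2)) _ p :=
      hasFDerivAt_fst.smul ((hb2 p).const_mul Complex.I)
    have h2 := (hβp p hp).clm_apply h1
    refine ⟨h2.differentiableAt.hasFDerivAt, ?_⟩
    have h3 : HasFDerivAt f _ p := h2
    rw [show f' p = fderiv ℝ f p from rfl, h3.fderiv]
    simp [polarDeriv_fst]
    ring
  have hgd : ∀ p ∈ s, HasFDerivAt g (g' p) p ∧ g' p (0, 1)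
      = -(β' (polarPt p) (p.1 • (Complex.I * DiscData.bdryPt p.2)) (DiscData.bdryPt p.2)
        + β (polarPt p) (Complex.I * DiscData.bdryPt p.2)) := by
    intro p hp
    have h2 := ((hβp p hp).clm_apply (hb2 p)).neg
    refine ⟨h2.differentiableAt.hasFDerivAt, ?_⟩
    have h3 : HasFDerivAt g _ p := h2
    rw [show g' p = fderiv ℝ g p from rfl, h3.fderiv]
    simp [polarDeriv_snd]
    ring
  have hsum : ∀ p ∈ s, f' p (1, 0) + g' p (0, 1)
      = |det2 (polarDeriv p (1, 0)) (polarDeriv p (0, 1))|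
        * (β' (polarPt p) 1 Complex.I - β' (polarPt p) Complex.I 1) := by
    intro p hp
    have hdet : det2 (polarDeriv p (1, 0)) (polarDeriv p (0, 1)) = p.1 := by
      rw [polarDeriv_fst, polarDeriv_snd]
      have := det2_bdryPt p.2
      simp only [det2, Complex.smul_re, Complex.smul_im, smul_eq_mul] at this ⊢
      linear_combination p.1 * this
    have h3 := alternating_eq_det2 (β' (polarPt p)) (polarDeriv p (1, 0)) (polarDeriv p (0, 1))
    rw [hdet] at h3 ⊢
    rw [abs_of_pos hp.1.1, ← h3, (hfd p hp).2, (hgd p hp).2, polarDeriv_fst, polarDeriv_snd]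
    ring
  have hrect : (uIcc (0 : ℝ) 1 ×ˢ uIcc (-Real.pi) Real.pi) =ᵐ[volume] s := by
    rw [uIcc_of_le zero_le_one, uIcc_of_le hpi]
    exact Measure.set_prod_ae_eq Ioo_ae_eq_Icc.symm Ioo_ae_eq_Icc.symm
  have hint : IntegrableOn (fun p => f' p (1, 0) + g' p (0, 1)) s := by
    have h1 : IntegrableOn (fun z => β' z 1 Complex.I - β' z Complex.I 1) (polarPt '' s) :=
      hi.congr_set_ae image_polarPt_ae
    rw [integrableOn_image_iff_det2 hsm hder injOn_polarPt] at h1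
    exact h1.congr_fun (fun p hp => (hsum p hp).symm) hsm
  have hcP : ContinuousOn (fun p => β (polarPt p)) (uIcc (0 : ℝ) 1 ×ˢ uIcc (-Real.pi) Real.pi) := by
    refine hc.comp (fun p _ => (hasFDerivAt_polarPt p).continuousAt.continuousWithinAt) ?_
    rintro p ⟨hp, -⟩
    rw [uIcc_of_le zero_le_one] at hp
    rw [mem_closedBall_zero_iff, norm_polarPt, abs_of_nonneg hp.1]
    exact hp.2
  have hcb : Continuous (fun p : ℝ × ℝ => DiscData.bdryPt p.2) := continuous_bdryPt.comp continuous_snd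
  have main := integral2_divergence_prod_of_hasFDerivAt f g f' g' 0 (-Real.pi) 1 Real.pi
    (hcP.clm_apply (continuous_fst.smul (continuous_const.mul hcb)).continuousOn)
    (hcP.clm_apply hcb.continuousOn).neg
    (by
      rw [min_eq_left zero_le_one, max_eq_right zero_le_one, min_eq_left hpi, max_eq_right hpi]
      exact fun p hp => (hfd p hp).1)
    (by
      rw [min_eq_left zero_le_one, max_eq_right zero_le_one, min_eq_left hpi, max_eq_right hpi]
      exact fun p hp => (hgd p hp).1)
    (hint.congr_set_ae hrect)
  have hper : Function.Periodic (fun τ => β (DiscData.bdryPt τ) (Complex.I * DiscData.bdryPt τ))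
      (2 * Real.pi) := by
    intro τ
    have : DiscData.bdryPt (τ + 2 * Real.pi) = DiscData.bdryPt τ := by
      unfold DiscData.bdryPt
      rw [Complex.exp_eq_exp_iff_exists_int]
      exact ⟨1, by push_cast; ring⟩
    simp only [this]
  have hgg : ∀ x, g (x, Real.pi) = g (x, -Real.pi) := by
    intro x
    have : DiscData.bdryPt Real.pi = DiscData.bdryPt (-Real.pi) := by
      unfold DiscData.bdryPt
      rw [Complex.exp_eq_exp_iff_exists_int]
      exact ⟨1, by push_cast; ring⟩
    simp only [hg, polarPt, this]
  have hlhs : (∫ x in (0 : ℝ)..1, ∫ y in (-Real.pi)..Real.pi, f' (x, y) (1, 0) + g' (x, y) (0, 1))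
      = ∫ z in Metric.ball (0 : ℂ) 1, (β' z 1 Complex.I - β' z Complex.I 1) := by
    rw [← setIntegral_congr_set image_polarPt_ae, integral_image_eq_det2 hsm hder injOn_polarPt,
      ← setIntegral_congr_fun hsm hsum, hs, Measure.volume_eq_prod, setIntegral_prod _ hint,
      intervalIntegral.integral_of_le zero_le_one, integral_Ioc_eq_integral_Ioo]
    refine setIntegral_congr_fun measurableSet_Ioo fun x _ => ?_
    rw [intervalIntegral.integral_of_le hpi, integral_Ioc_eq_integral_Ioo]
  rw [← hlhs, main]
  simp only [hgg, sub_self, zero_add]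
  have h0 : ∀ y, f (0, y) = 0 := by intro y; simp [hf]
  have h1 : ∀ y, f (1, y) = β (DiscData.bdryPt y) (Complex.I * DiscData.bdryPt y) := by
    intro y; simp [hf, polarPt]
  simp only [h0, h1, intervalIntegral.integral_zero, sub_zero]
  rw [hper.intervalIntegral_add_eq a (-Real.pi)]
  congr 1
  ring

end Stokes

section StripTopology

variable {d : ℕ} {S : DiscData d}

theorem isOpen_image_of_hasStrictFDerivAt_surj {P Q : Type*} [NormedAddCommGroup P]
    [NormedSpace ℝ P] [CompleteSpace P] [NormedAddCommGroup Q] [NormedSpace ℝ Q] [CompleteSpace Q]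
    {f : P → Q} {s : Set P} (hs : IsOpen s)
    (hf : ∀ x ∈ s, ∃ f' : P →L[ℝ] Q, HasStrictFDerivAt f f' x ∧ f'.range = ⊤) :
    IsOpen (f '' s) := by
  rw [isOpen_iff_mem_nhds]
  rintro _ ⟨x, hx, rfl⟩
  obtain ⟨f', h1, h2⟩ := hf x hx
  rw [← h1.map_nhds_eq_of_surj h2]
  exact image_mem_map (hs.mem_nhds hx)

theorem surjective_of_det2_ne_zero {L : ℝ × ℝ →L[ℝ] ℂ} (h : det2 (L (1, 0)) (L (0, 1)) ≠ 0) :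
    Function.Surjective L := by
  intro z
  set a := L (1, 0)
  set b := L (0, 1)
  refine ⟨(det2 z b / det2 a b, det2 a z / det2 a b), ?_⟩
  have e : L (det2 z b / det2 a b, det2 a z / det2 a b)
      = (det2 z b / det2 a b) • a + (det2 a z / det2 a b) • b := by
    rw [← map_smul, ← map_smul, ← map_add]
    simp
  rw [e]
  apply Complex.ext
  · simp only [Complex.add_re, Complex.smul_re, smul_eq_mul]
    field_simp
    simp only [det2]
    ring
  · simp only [Complex.add_im, Complex.smul_im, smul_eq_mul]
    field_simp
    simp only [det2]
    ring

theorem injective_of_det2_ne_zero {L : ℝ × ℝ →L[ℝ] ℂ} (h : det2 (L (1, 0)) (L (0, 1)) ≠ 0) :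
    Function.Injective L := by
  rw [injective_iff_map_eq_zero]
  intro v hv
  have e : L v = v.1 • L (1, 0) + v.2 • L (0, 1) := by
    rw [← map_smul, ← map_smul, ← map_add]
    simp
  rw [hv] at e
  have h1 := congrArg Complex.re e
  have h2 := congrArg Complex.im e
  simp only [Complex.add_re, Complex.add_im, Complex.smul_re, Complex.smul_im, Complex.zero_re,
    Complex.zero_im, smul_eq_mul] at h1 h2
  simp only [det2] at h
  ext
  · have : v.1 * ((L (1, 0)).re * (L (0, 1)).im - (L (1, 0)).im * (L (0, 1)).re) = 0 := by
      linear_combination (-(L (0, 1)).im) * h1 + (L (0, 1)).re * h2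
    exact (mul_eq_zero.1 this).resolve_right h
  · have : v.2 * ((L (1, 0)).re * (L (0, 1)).im - (L (1, 0)).im * (L (0, 1)).re) = 0 := by
      linear_combination ((L (1, 0)).im) * h1 - (L (1, 0)).re * h2
    exact (mul_eq_zero.1 this).resolve_right h

namespace DiscData.IsPuncturedDisc

theorem det2_fderivWithin_strip_pos (hS : S.IsPuncturedDisc) {j : Fin (d + 1)} {q : ℝ × ℝ}
    (hq : q ∈ endStrip j) :
    0 < det2 (fderivWithin ℝ (S.strip j) (endStrip j) q (1, 0))
      (fderivWithin ℝ (S.strip j) (endStrip j) q (0, 1)) :=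
  hS.det2_strip_pos hq

theorem hasStrictFDerivAt_strip (hS : S.IsPuncturedDisc) {j : Fin (d + 1)} {q : ℝ × ℝ}
    (hq : q ∈ interior (endStrip j)) :
    HasStrictFDerivAt (S.strip j) (fderivWithin ℝ (S.strip j) (endStrip j) q) q := by
  have h1 : ContDiffAt ℝ ∞ (S.strip j) q :=
    (hS.strip_smooth j q (interior_subset hq)).contDiffAt (mem_interior_iff_mem_nhds.1 hq)
  have h2 := h1.hasStrictFDerivAt (by simp)
  rwa [(hS.hasFDerivAt_strip hq).fderiv] at h2

theorem isOpen_image_strip (hS : S.IsPuncturedDisc) (j : Fin (d + 1)) {O : Set (ℝ × ℝ)}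
    (hO : IsOpen O) (hO' : O ⊆ endStrip j) : IsOpen (S.strip j '' O) := by
  refine isOpen_image_of_hasStrictFDerivAt_surj hO fun q hq => ?_
  have hq' : q ∈ interior (endStrip j) := mem_interior.2 ⟨O, hO', hO, hq⟩
  exact ⟨_, hS.hasStrictFDerivAt_strip hq', LinearMap.range_eq_top.2
    (surjective_of_det2_ne_zero (hS.det2_fderivWithin_strip_pos (interior_subset hq')).ne')⟩

theorem exists_compact_nhds_surface (S : DiscData d) {z : ℂ} (hz : z ∈ S.surface) :
    ∃ C ⊆ S.surface, IsCompact C ∧ ∃ U ∈ 𝓝 z, U ∩ S.surface ⊆ C := by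
  have h1 : (range S.puncture)ᶜ ∈ 𝓝 z := S.isClosed_range_puncture.isOpen_compl.mem_nhds hz.2
  obtain ⟨K, hK, hKs, hKc⟩ := local_compact_nhds h1
  refine ⟨K ∩ Metric.closedBall 0 1, fun w hw => ⟨hw.2, hKs hw.1⟩,
    hKc.inter_right Metric.isClosed_closedBall, K, hK, fun w hw => ⟨hw.1, hw.2.1⟩⟩

/-- The images of closed subsets of the strips are relatively closed. -/
theorem mem_image_of_mem_closure (hS : S.IsPuncturedDisc) (j : Fin (d + 1)) {Q : Set (ℝ × ℝ)}
    (hQ : IsClosed Q) (hQ' : Q ⊆ endStrip j) {z : ℂ} (hz : z ∈ S.surface)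
    (hzc : z ∈ closure (S.strip j '' Q)) : z ∈ S.strip j '' Q := by
  obtain ⟨C, hCS, hC, U, hU, hUC⟩ := exists_compact_nhds_surface S hz
  have h1 : IsCompact (Q ∩ (endStrip j ∩ S.strip j ⁻¹' C)) :=
    (hS.strip_proper j C hCS hC).inter_left hQ
  have h2 : IsCompact (S.strip j '' (Q ∩ (endStrip j ∩ S.strip j ⁻¹' C))) :=
    h1.image_of_continuousOn ((hS.strip_smooth j).continuousOn.mono fun q hq => hq.2.1)
  have h3 : z ∈ closure (S.strip j '' (Q ∩ (endStrip j ∩ S.strip j ⁻¹' C))) := by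
    rw [mem_closure_iff_nhds] at hzc ⊢
    intro t ht
    obtain ⟨w, ⟨hwt, hwU⟩, q, hq, rfl⟩ := hzc (t ∩ U) (inter_mem ht hU)
    exact ⟨_, hwt, q, ⟨hq, hQ' hq, hUC ⟨hwU, hS.strip_mapsTo j (hQ' hq)⟩⟩, rfl⟩
  rw [h2.isClosed.closure_eq] at h3
  exact image_mono inter_subset_left h3

theorem snd_mem_Ioo (hS : S.IsPuncturedDisc) {j : Fin (d + 1)} {q : ℝ × ℝ}
    (hq : q ∈ endStrip j) (h : S.strip j q ∈ Metric.ball (0 : ℂ) 1) : q.2 ∈ Ioo (0 : ℝ) 1 := by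
  have h1 : ‖S.strip j q‖ ≠ 1 := by
    rw [mem_ball_zero_iff] at h; exact h.ne
  rw [Ne, hS.strip_boundary j q hq] at h1
  push Not at h1
  exact ⟨lt_of_le_of_ne hq.2.1 (Ne.symm h1.1), lt_of_le_of_ne hq.2.2 h1.2⟩

/-- If `Q ⊆ endStrip j` is closed and contains the end of the strip, the rest of the strip has relatively
open image. -/
theorem exists_ball_subset_image (hS : S.IsPuncturedDisc) (j : Fin (d + 1)) {Q : Set (ℝ × ℝ)}
    (hQ0 : ∀ q ∈ endStrip j, q.1 = 0 → q ∈ Q) {z : ℂ}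
    (hzQ : z ∉ closure (S.strip j '' Q))
    (hzi : z ∈ closure (S.strip j '' interior (endStrip j))) :
    ∃ ρ > 0, S.surface ∩ Metric.ball z ρ ⊆ S.strip j '' (endStrip j \ Q) := by
  obtain ⟨ρ, hρ, hρQ⟩ := Metric.isOpen_iff.1 isClosed_closure.isOpen_compl z hzQ
  refine ⟨ρ, hρ, ?_⟩
  have hsub : Metric.ball (0 : ℂ) 1 ∩ Metric.ball z ρ ⊆ S.strip j '' interior (endStrip j) := by
    refine ((convex_ball _ _).inter (convex_ball _ _)).isPreconnected.subset_of_closure_inter_subset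
      (hS.isOpen_image_strip j isOpen_interior interior_subset) ?_ ?_
    · obtain ⟨w, hw, q, hq, rfl⟩ := mem_closure_iff_nhds.1 hzi _ (Metric.ball_mem_nhds z hρ)
      exact ⟨_, ⟨hS.strip_mem_ball hq, hw⟩, q, hq, rfl⟩
    · rintro w ⟨hw, hw1, hw2⟩
      have h1 : w ∈ S.strip j '' endStrip j :=
        hS.mem_image_of_mem_closure j (isClosed_endStrip j) subset_rfl (S.ball_subset_surface hw1)
          (closure_mono (image_mono interior_subset) hw)
      obtain ⟨q, hq, rfl⟩ := h1
      refine ⟨q, ?_, rfl⟩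
      rw [interior_endStrip]
      refine ⟨⟨hq.1, fun h0 => hρQ hw2 (subset_closure ⟨q, hQ0 q hq h0, rfl⟩)⟩,
        hS.snd_mem_Ioo hq hw1⟩
  rintro w ⟨hw, hwρ⟩
  have h1 : w ∈ closure (Metric.ball (0 : ℂ) 1 ∩ Metric.ball z ρ) := by
    have h2 : w ∈ closure (Metric.ball (0 : ℂ) 1) := by
      rw [closure_ball _ one_ne_zero]; exact hw.1
    rw [mem_closure_iff_nhds] at h2 ⊢
    intro t ht
    obtain ⟨v, ⟨hv1, hv2⟩, hv3⟩ := h2 _ (inter_mem ht (Metric.isOpen_ball.mem_nhds hwρ))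
    exact ⟨v, hv1, hv3, hv2⟩
  obtain ⟨q, hq, rfl⟩ := hS.mem_image_of_mem_closure j (isClosed_endStrip j) subset_rfl hw
    (closure_mono (hsub.trans (image_mono interior_subset)) h1)
  exact ⟨q, ⟨hq, fun hqQ => hρQ hwρ (subset_closure ⟨q, hqQ, rfl⟩)⟩, rfl⟩

theorem puncture_mem_closure (hS : S.IsPuncturedDisc) (j : Fin (d + 1)) :
    S.puncture j ∈ closure (S.strip j '' interior (endStrip j)) := by
  have h1 : Tendsto (fun s : ℝ => (s, (1 / 2 : ℝ))) (endFilter j) (endFilter j ×ˢ 𝓟 (Icc 0 1)) :=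
    tendsto_id.prodMk (tendsto_principal.2 (Eventually.of_forall fun _ => by norm_num))
  have h2 := (hS.strip_limit j).comp h1
  have h3 : ∀ᶠ s in endFilter j, s ∈ {s | s ∈ endRay j ∧ s ≠ 0} := by
    unfold endFilter endRay
    split_ifs
    · filter_upwards [eventually_lt_atBot 0] with s hs using ⟨hs.le, hs.ne⟩
    · filter_upwards [eventually_gt_atTop 0] with s hs using ⟨hs.le, hs.ne'⟩
  have : NeBot (endFilter j) := by
    unfold endFilter; split_ifs <;> infer_instance
  refine mem_closure_of_tendsto h2 ?_
  filter_upwards [h3] with s hs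
  refine ⟨(s, 1 / 2), ?_, rfl⟩
  rw [interior_endStrip]
  exact ⟨hs, by norm_num, by norm_num⟩

theorem isCompact_strip_le (j : Fin (d + 1)) (σ : ℝ) :
    IsCompact {q : ℝ × ℝ | q ∈ endStrip j ∧ |q.1| ≤ σ} := by
  have h : {q : ℝ × ℝ | q ∈ endStrip j ∧ |q.1| ≤ σ}
      = (endRay j ∩ Icc (-σ) σ) ×ˢ Icc 0 1 := by
    ext q
    simp only [mem_ofPred_eq, mem_prod, mem_inter_iff, endStrip, abs_le, mem_Icc]
    tauto
  rw [h]
  exact (isCompact_Icc.inter_left (isClosed_endRay j)).prod isCompact_Icc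

/-- The parts `{|s| > σ}` of the strips are neighbourhoods of the punctures. -/
theorem exists_ball_puncture (hS : S.IsPuncturedDisc) (j : Fin (d + 1)) {σ : ℝ} (hσ : 0 ≤ σ) :
    ∃ ρ > 0, S.surface ∩ Metric.ball (S.puncture j) ρ
      ⊆ S.strip j '' {q | q ∈ endStrip j ∧ σ < |q.1|} := by
  have hc : IsCompact (S.strip j '' {q : ℝ × ℝ | q ∈ endStrip j ∧ |q.1| ≤ σ}) :=
    (isCompact_strip_le j σ).image_of_continuousOn
      ((hS.strip_smooth j).continuousOn.mono fun q hq => hq.1)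
  obtain ⟨ρ, hρ, h⟩ := hS.exists_ball_subset_image j (Q := {q : ℝ × ℝ | q ∈ endStrip j ∧ |q.1| ≤ σ})
    (z := S.puncture j) (fun q hq h0 => ⟨hq, by simpa [h0] using hσ⟩)
    (by
      rw [hc.isClosed.closure_eq]
      rintro ⟨q, hq, h⟩
      exact (hS.strip_mapsTo j hq.1).2 ⟨j, h.symm⟩) (hS.puncture_mem_closure j)
  refine ⟨ρ, hρ, h.trans (image_mono ?_)⟩
  rintro q ⟨hq, hq2⟩
  exact ⟨hq, not_le.1 fun h3 => hq2 ⟨hq, h3⟩⟩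

theorem endStrip_subset_closure_interior (j : Fin (d + 1)) :
    endStrip j ⊆ closure (interior (endStrip j)) := by
  have h1 : Convex ℝ (endStrip j) := by
    refine Convex.prod ?_ (convex_Icc 0 1)
    unfold endRay; split_ifs
    · exact convex_Iic 0
    · exact convex_Ici 0
  have h2 : (interior (endStrip j)).Nonempty := by
    rw [interior_endStrip]
    refine Set.Nonempty.prod ?_ ⟨1 / 2, by norm_num, by norm_num⟩
    unfold endRay; split_ifs
    · exact ⟨-1, by simp, by norm_num⟩
    · exact ⟨1, by simp, by norm_num⟩
  rw [h1.closure_interior_eq_closure_of_nonempty_interior h2]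
  exact subset_closure

/-- The strips are homeomorphisms onto their images, which are relatively open away from `s = 0`. -/
theorem exists_ball_strip (hS : S.IsPuncturedDisc) (j : Fin (d + 1)) {q : ℝ × ℝ}
    (hq : q ∈ endStrip j) (hq0 : q.1 ≠ 0) {O : Set (ℝ × ℝ)} (hO : O ∈ 𝓝 q) :
    ∃ ρ > 0, S.surface ∩ Metric.ball (S.strip j q) ρ
      ⊆ S.strip j '' {p | p ∈ endStrip j ∧ p ∈ O ∧ p.1 ≠ 0} := by
  set Q := {p : ℝ × ℝ | p ∈ endStrip j ∧ (p ∉ interior O ∨ p.1 = 0)} with hQ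
  have hQc : IsClosed Q := (isClosed_endStrip j).inter
    (isOpen_interior.isClosed_compl.union (isClosed_eq continuous_fst continuous_const))
  have hqS := hS.strip_mapsTo j hq
  obtain ⟨ρ, hρ, h⟩ := hS.exists_ball_subset_image j (Q := Q) (z := S.strip j q)
    (fun p hp h0 => ⟨hp, Or.inr h0⟩) (fun hcl => by
      obtain ⟨p, hp, hpq⟩ := hS.mem_image_of_mem_closure j hQc (fun p hp => hp.1) hqS hcl
      rw [hS.strip_inj j hp.1 hq hpq] at hp
      rcases hp.2 with h | h
      · exact h (mem_interior_iff_mem_nhds.2 hO)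
      · exact hq0 h) (by
      have h1 := ((hS.strip_smooth j).continuousOn q hq).mono (interior_subset (s := endStrip j))
      exact h1.mem_closure (endStrip_subset_closure_interior j hq) (mapsTo_image _ _))
  refine ⟨ρ, hρ, h.trans (image_mono ?_)⟩
  rintro p ⟨hp, hpQ⟩
  simp only [hQ, mem_ofPred_eq, not_and, not_or, not_not] at hpQ
  exact ⟨hp, interior_subset (hpQ hp).1, (hpQ hp).2⟩

end DiscData.IsPuncturedDisc

/-- The inverse of a strip-like end. -/
def DiscData.stripInv (S : DiscData d) (j : Fin (d + 1)) (z : ℂ) : ℝ × ℝ :=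
  Function.invFunOn (S.strip j) (endStrip j) z

namespace DiscData.IsPuncturedDisc

theorem stripInv_strip (hS : S.IsPuncturedDisc) {j : Fin (d + 1)} {q : ℝ × ℝ} (hq : q ∈ endStrip j) :
    S.stripInv j (S.strip j q) = q := (hS.strip_inj j).leftInvOn_invFunOn hq

theorem continuousWithinAt_stripInv (hS : S.IsPuncturedDisc) {j : Fin (d + 1)} {q : ℝ × ℝ}
    (hq : q ∈ endStrip j) (hq0 : q.1 ≠ 0) :
    ContinuousWithinAt (S.stripInv j) S.surface (S.strip j q) := by
  intro O hO
  rw [hS.stripInv_strip hq] at hO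
  obtain ⟨ρ, hρ, h⟩ := hS.exists_ball_strip j hq hq0 hO
  rw [mem_map, mem_nhdsWithin]
  refine ⟨_, Metric.isOpen_ball, Metric.mem_ball_self hρ, fun w hw => ?_⟩
  obtain ⟨p, hp, rfl⟩ := h ⟨hw.2, hw.1⟩
  rw [mem_preimage, hS.stripInv_strip hp.1]
  exact hp.2.1

end DiscData.IsPuncturedDisc

end StripTopology

section Ramp

/-- A smooth function which is `1` up to `σ` and `0` from `σ + δ` on. -/
def ramp (σ δ r : ℝ) : ℝ := 1 - Real.smoothTransition ((r - σ) / δ)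

theorem ramp_eq_one {σ δ r : ℝ} (hδ : 0 < δ) (h : r ≤ σ) : ramp σ δ r = 1 := by
  rw [ramp, Real.smoothTransition.zero_of_nonpos (div_nonpos_of_nonpos_of_nonneg (by linarith) hδ.le),
    sub_zero]

theorem ramp_eq_zero {σ δ r : ℝ} (hδ : 0 < δ) (h : σ + δ ≤ r) : ramp σ δ r = 0 := by
  rw [ramp, Real.smoothTransition.one_of_one_le ((one_le_div hδ).2 (by linarith)), sub_self]

theorem ramp_nonneg (σ δ r : ℝ) : 0 ≤ ramp σ δ r :=
  sub_nonneg.2 (Real.smoothTransition.le_one _)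

theorem ramp_le_one (σ δ r : ℝ) : ramp σ δ r ≤ 1 :=
  sub_le_self _ (Real.smoothTransition.nonneg _)

theorem contDiff_ramp (σ δ : ℝ) : ContDiff ℝ 1 (ramp σ δ) :=
  contDiff_const.sub ((Real.smoothTransition.contDiff (n := 1)).comp
    ((contDiff_id.sub contDiff_const).div_const δ))

theorem continuous_ramp (σ δ : ℝ) : Continuous (ramp σ δ) := (contDiff_ramp σ δ).continuous

theorem hasDerivAt_ramp (σ δ r : ℝ) : HasDerivAt (ramp σ δ) (deriv (ramp σ δ) r) r :=
  ((contDiff_ramp σ δ).differentiable (by simp) r).hasDerivAt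

theorem continuous_deriv_ramp (σ δ : ℝ) : Continuous (deriv (ramp σ δ)) :=
  (contDiff_ramp σ δ).continuous_deriv (by simp)

theorem antitone_ramp {σ δ : ℝ} (hδ : 0 < δ) : Antitone (ramp σ δ) := by
  intro a b hab
  refine sub_le_sub_left (Real.smoothTransition.monotone ?_) _
  gcongr

theorem deriv_ramp_eq_zero_of_le {σ δ r : ℝ} (hδ : 0 < δ) (h : r ≤ σ) : deriv (ramp σ δ) r = 0 := by
  have : IsLocalMax (ramp σ δ) r := by
    refine Eventually.of_forall fun x => ?_
    rw [ramp_eq_one hδ h]; exact ramp_le_one _ _ _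
  exact this.deriv_eq_zero

theorem deriv_ramp_eq_zero_of_ge {σ δ r : ℝ} (hδ : 0 < δ) (h : σ + δ ≤ r) :
    deriv (ramp σ δ) r = 0 := by
  have : IsLocalMin (ramp σ δ) r := by
    refine Eventually.of_forall fun x => ?_
    rw [ramp_eq_zero hδ h]; exact ramp_nonneg _ _ _
  exact this.deriv_eq_zero

theorem exists_deriv_ramp_bound :
    ∃ c : ℝ, 0 ≤ c ∧ ∀ σ δ r : ℝ, 0 < δ → |deriv (ramp σ δ) r| ≤ c / δ := by
  obtain ⟨c, hc⟩ := isCompact_Icc.exists_bound_of_continuousOn (s := Icc (0 : ℝ) 1)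
    (continuous_deriv_ramp 0 1).continuousOn
  refine ⟨max c 0, le_max_right _ _, fun σ δ r hδ => ?_⟩
  have h1 : deriv (ramp σ δ) r = deriv (ramp 0 1) ((r - σ) / δ) * (1 / δ) := by
    have h2 : ramp σ δ = fun r => ramp 0 1 ((r - σ) / δ) := by
      funext r; simp [ramp]
    have h3 : HasDerivAt (fun r : ℝ => (r - σ) / δ) (1 / δ) r :=
      ((hasDerivAt_id r).sub_const σ).div_const δ
    conv_lhs => rw [h2]
    exact ((hasDerivAt_ramp 0 1 _).comp r h3).deriv
  have h2 : |deriv (ramp 0 1) ((r - σ) / δ)| ≤ max c 0 := by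
    by_cases h3 : (r - σ) / δ ∈ Icc (0 : ℝ) 1
    · exact (hc _ h3).trans (le_max_left _ _)
    · rw [mem_Icc, not_and_or, not_le, not_le] at h3
      rcases h3 with h3 | h3
      · rw [deriv_ramp_eq_zero_of_le one_pos h3.le]; simp
      · rw [deriv_ramp_eq_zero_of_ge one_pos (by linarith)]; simp
  rw [h1, abs_mul, abs_of_pos (one_div_pos.2 hδ), mul_one_div]
  gcongr

end Ramp

section Cutoff

variable {d : ℕ} {S : DiscData d}

/-- The sign of `s` on the `j`-th end. -/
def endSign (j : Fin (d + 1)) : ℝ := if j = 0 then -1 else 1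

theorem abs_endSign (j : Fin (d + 1)) : |endSign j| = 1 := by
  unfold endSign; split_ifs <;> simp

theorem abs_eq_endSign_mul {j : Fin (d + 1)} {s : ℝ} (hs : s ∈ endRay j) : |s| = endSign j * s := by
  unfold endRay at hs
  unfold endSign
  split_ifs at hs ⊢
  · rw [abs_of_nonpos hs]; ring
  · rw [abs_of_nonneg hs]; ring

namespace DiscData

/-- The function `|s|` on the ends, extended by zero. -/
def endHeight (S : DiscData d) (z : ℂ) : ℝ :=
  ∑ j, (S.strip j '' endStrip j).indicator (fun z => |(S.stripInv j z).1|) z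

/-- A smooth cutoff function supported in `|s| ≤ σ + δ`. -/
def cutoff (S : DiscData d) (σ δ : ℝ) : ℂ → ℝ :=
  S.surface.indicator fun z => ramp σ δ (S.endHeight z)

theorem endHeight_nonneg (S : DiscData d) (z : ℂ) : 0 ≤ S.endHeight z :=
  Finset.sum_nonneg fun _ _ => indicator_nonneg (fun _ _ => abs_nonneg _) _

theorem exists_mem_image_of_endHeight_ne_zero {z : ℂ} (h : S.endHeight z ≠ 0) :
    ∃ j, z ∈ S.strip j '' endStrip j := by
  by_contra hcon
  push Not at hcon
  exact h (Finset.sum_eq_zero fun j _ => indicator_of_notMem (hcon j) _)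

theorem cutoff_nonneg (σ δ : ℝ) (z : ℂ) : 0 ≤ S.cutoff σ δ z :=
  indicator_nonneg (fun _ _ => ramp_nonneg _ _ _) _

theorem cutoff_le_one (σ δ : ℝ) (z : ℂ) : S.cutoff σ δ z ≤ 1 :=
  indicator_apply_le' (fun _ => ramp_le_one _ _ _) fun _ => zero_le_one

theorem cutoff_of_mem {z : ℂ} (hz : z ∈ S.surface) (σ δ : ℝ) :
    S.cutoff σ δ z = ramp σ δ (S.endHeight z) := indicator_of_mem hz _

namespace IsPuncturedDisc

theorem endHeight_strip (hS : S.IsPuncturedDisc) {j : Fin (d + 1)} {q : ℝ × ℝ} (hq : q ∈ endStrip j) :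
    S.endHeight (S.strip j q) = |q.1| := by
  rw [endHeight, Finset.sum_eq_single j]
  · rw [indicator_of_mem (mem_image_of_mem _ hq), hS.stripInv_strip hq]
  · intro i _ hij
    refine indicator_of_notMem (fun h => ?_) _
    exact (disjoint_left.1 (hS.strip_disjoint i j hij)) h (mem_image_of_mem _ hq)
  · simp

theorem exists_strip_eq (hS : S.IsPuncturedDisc) {z : ℂ} {σ : ℝ} (hσ : 0 < σ)
    (h : σ ≤ S.endHeight z) : ∃ j, ∃ q ∈ endStrip j, S.strip j q = z ∧ σ ≤ |q.1| := by
  obtain ⟨j, q, hq, rfl⟩ := exists_mem_image_of_endHeight_ne_zero (by linarith : S.endHeight z ≠ 0)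
  exact ⟨j, q, hq, rfl, by rwa [hS.endHeight_strip hq] at h⟩

theorem eventually_endHeight_lt (hS : S.IsPuncturedDisc) {z : ℂ} (hz : z ∈ S.surface) {σ : ℝ}
    (h : S.endHeight z < σ) : ∀ᶠ w in 𝓝[S.surface] z, S.endHeight w < σ := by
  have hσ : 0 < σ := (S.endHeight_nonneg z).trans_lt h
  have h1 : ∀ j, ∀ᶠ w in 𝓝 z, w ∉ S.strip j '' {q | q ∈ endStrip j ∧ σ ≤ |q.1|} := by
    intro j
    have hcl : IsClosed {q : ℝ × ℝ | q ∈ endStrip j ∧ σ ≤ |q.1|} :=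
      (isClosed_endStrip j).inter (isClosed_le continuous_const continuous_fst.abs)
    have h2 : z ∉ closure (S.strip j '' {q | q ∈ endStrip j ∧ σ ≤ |q.1|}) := by
      intro hcon
      obtain ⟨q, hq, rfl⟩ := hS.mem_image_of_mem_closure j hcl (fun q hq => hq.1) hz hcon
      rw [hS.endHeight_strip hq.1] at h
      exact absurd hq.2 (not_le.2 h)
    filter_upwards [isClosed_closure.isOpen_compl.mem_nhds h2] with w hw hw'
    exact hw (subset_closure hw')
  filter_upwards [nhdsWithin_le_nhds (eventually_all.2 h1)] with w hw
  by_contra hcon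
  obtain ⟨j, q, hq, rfl, hqσ⟩ := hS.exists_strip_eq hσ (not_lt.1 hcon)
  exact hw j ⟨q, ⟨hq, hqσ⟩, rfl⟩

theorem eventually_cutoff_eq_one (hS : S.IsPuncturedDisc) {z : ℂ} (hz : z ∈ S.surface) {σ δ : ℝ}
    (hδ : 0 < δ) (h : S.endHeight z < σ) : ∀ᶠ w in 𝓝[S.surface] z, S.cutoff σ δ w = 1 := by
  filter_upwards [hS.eventually_endHeight_lt hz h, self_mem_nhdsWithin] with w hw hwS
  rw [cutoff_of_mem hwS, ramp_eq_one hδ hw.le]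

theorem eventually_strip_stripInv (hS : S.IsPuncturedDisc) {j : Fin (d + 1)} {q : ℝ × ℝ}
    (hq : q ∈ endStrip j) (hq0 : q.1 ≠ 0) : ∀ᶠ w in 𝓝[S.surface] (S.strip j q),
      S.strip j (S.stripInv j w) = w ∧ S.stripInv j w ∈ endStrip j := by
  obtain ⟨ρ, hρ, h⟩ := hS.exists_ball_strip j hq hq0 univ_mem
  filter_upwards [self_mem_nhdsWithin, nhdsWithin_le_nhds (Metric.ball_mem_nhds _ hρ)] with w hw1 hw2
  obtain ⟨p, hp, rfl⟩ := h ⟨hw1, hw2⟩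
  rw [hS.stripInv_strip hp.1]
  exact ⟨rfl, hp.1⟩

theorem eventually_cutoff_eq_ramp (hS : S.IsPuncturedDisc) {j : Fin (d + 1)} {q : ℝ × ℝ}
    (hq : q ∈ endStrip j) (hq0 : q.1 ≠ 0) (σ δ : ℝ) : ∀ᶠ w in 𝓝[S.surface] (S.strip j q),
      S.cutoff σ δ w = ramp σ δ (endSign j * (S.stripInv j w).1) := by
  filter_upwards [hS.eventually_strip_stripInv hq hq0, self_mem_nhdsWithin] with w hw hwS
  rw [cutoff_of_mem hwS]
  conv_lhs => rw [← hw.1]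
  rw [hS.endHeight_strip hw.2, abs_eq_endSign_mul hw.2.1]

theorem eventually_cutoff_puncture (hS : S.IsPuncturedDisc) (j : Fin (d + 1)) {σ δ : ℝ} (hσ : 0 < σ)
    (hδ : 0 < δ) : ∀ᶠ w in 𝓝 (S.puncture j), S.cutoff σ δ w = 0 := by
  obtain ⟨ρ, hρ, h⟩ := hS.exists_ball_puncture j (add_pos hσ hδ).le
  filter_upwards [Metric.ball_mem_nhds _ hρ] with w hw
  by_cases hwS : w ∈ S.surface
  · obtain ⟨q, hq, rfl⟩ := h ⟨hwS, hw⟩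
    rw [cutoff_of_mem hwS, hS.endHeight_strip hq.1, ramp_eq_zero hδ hq.2.le]
  · exact indicator_of_notMem hwS _

theorem continuousOn_cutoff (hS : S.IsPuncturedDisc) {σ δ : ℝ} (hσ : 0 < σ) (hδ : 0 < δ) :
    ContinuousOn (S.cutoff σ δ) S.surface := by
  intro z hz
  by_cases h : S.endHeight z < σ
  · have h1 := hS.eventually_cutoff_eq_one hz hδ h
    exact (continuousWithinAt_const (b := (1 : ℝ))).congr_of_eventuallyEq h1 (h1.self_of_nhdsWithin hz)
  · obtain ⟨j, q, hq, rfl, hqσ⟩ := hS.exists_strip_eq hσ (not_lt.1 h)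
    have hq0 : q.1 ≠ 0 := by
      intro h0; rw [h0, abs_zero] at hqσ; linarith
    have h1 := hS.eventually_cutoff_eq_ramp hq hq0 σ δ
    refine ContinuousWithinAt.congr_of_eventuallyEq ?_ h1 (h1.self_of_nhdsWithin hz)
    exact (continuous_ramp σ δ).continuousAt.comp_continuousWithinAt
      (continuousWithinAt_const.mul (hS.continuousWithinAt_stripInv hq hq0).fst)

/-- Multiplication by a cutoff function extends continuously over the punctures. -/
theorem continuousOn_cutoff_smul (hS : S.IsPuncturedDisc) {σ δ : ℝ} (hσ : 0 < σ) (hδ : 0 < δ)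
    {G : Type*} [NormedAddCommGroup G] [NormedSpace ℝ G] {g : ℂ → G}
    (hg : ContinuousOn g S.surface) :
    ContinuousOn (fun z => S.cutoff σ δ z • g z) (Metric.closedBall 0 1) := by
  intro z hz
  by_cases hzp : z ∈ range S.puncture
  · obtain ⟨j, rfl⟩ := hzp
    have h1 := hS.eventually_cutoff_puncture j hσ hδ
    have h2 : (fun z => S.cutoff σ δ z • g z) =ᶠ[𝓝 (S.puncture j)] fun _ => 0 := by
      filter_upwards [h1] with w hw
      rw [hw, zero_smul]
    exact (continuousAt_const.congr h2.symm).continuousWithinAt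
  · have h1 := ((hS.continuousOn_cutoff hσ hδ).smul hg) z ⟨hz, hzp⟩
    refine h1.mono_of_mem_nhdsWithin ?_
    exact inter_mem self_mem_nhdsWithin
      (nhdsWithin_le_nhds (S.isClosed_range_puncture.isOpen_compl.mem_nhds hzp))

theorem integrableOn_cutoff_mul (hS : S.IsPuncturedDisc) {σ δ : ℝ} (hσ : 0 < σ) (hδ : 0 < δ)
    {g : ℂ → ℝ} (hg : ContinuousOn g S.surface) :
    IntegrableOn (fun z => S.cutoff σ δ z * g z) (Metric.ball (0 : ℂ) 1) :=
  ((hS.continuousOn_cutoff_smul hσ hδ hg).integrableOn_compact (isCompact_closedBall _ _)).mono_set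
    Metric.ball_subset_closedBall

theorem hasFDerivAt_cutoff_of_lt (hS : S.IsPuncturedDisc) {σ δ : ℝ} (hδ : 0 < δ) {z : ℂ}
    (hz : z ∈ Metric.ball (0 : ℂ) 1) (h : S.endHeight z < σ) :
    HasFDerivAt (S.cutoff σ δ) (0 : ℂ →L[ℝ] ℝ) z := by
  have h1 := hS.eventually_cutoff_eq_one (S.ball_subset_surface hz) hδ h
  rw [nhdsWithin_eq_nhds.2 (S.surface_mem_nhds hz)] at h1
  exact (hasFDerivAt_const (1 : ℝ) z).congr_of_eventuallyEq h1

theorem hasFDerivAt_cutoff_strip (hS : S.IsPuncturedDisc) (σ δ : ℝ) {j : Fin (d + 1)}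
    {q : ℝ × ℝ} (hq : q ∈ interior (endStrip j)) :
    ∃ χ' : ℂ →L[ℝ] ℝ, HasFDerivAt (S.cutoff σ δ) χ' (S.strip j q) ∧
      χ' (S.stripS j q) = deriv (ramp σ δ) |q.1| * endSign j ∧ χ' (S.stripT j q) = 0 := by
  have hq' := interior_subset hq
  have hq0 : q.1 ≠ 0 := by
    rw [interior_endStrip] at hq; exact hq.1.2
  have hz := hS.strip_mem_ball hq
  have hnh : 𝓝[S.surface] (S.strip j q) = 𝓝 (S.strip j q) :=
    nhdsWithin_eq_nhds.2 (S.surface_mem_nhds hz)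
  have hdet := (hS.det2_fderivWithin_strip_pos hq').ne'
  set L := fderivWithin ℝ (S.strip j) (endStrip j) q with hL
  set e : (ℝ × ℝ) ≃L[ℝ] ℂ := ContinuousLinearEquiv.ofBijective L
    (LinearMap.ker_eq_bot.2 (injective_of_det2_ne_zero hdet))
    (LinearMap.range_eq_top.2 (surjective_of_det2_ne_zero hdet)) with he
  have h1 : HasFDerivAt (S.stripInv j) (e.symm : ℂ →L[ℝ] ℝ × ℝ) (S.strip j q) := by
    refine HasFDerivAt.of_local_left_inverse (f := S.strip j) ?_ ?_ ?_
    · rw [ContinuousAt, ← hnh]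
      exact hS.continuousWithinAt_stripInv hq' hq0
    · rw [hS.stripInv_strip hq']
      exact hS.hasFDerivAt_strip hq
    · have := hS.eventually_strip_stripInv hq' hq0
      rw [hnh] at this
      exact this.mono fun w hw => hw.1
  have h2 : HasFDerivAt (fun w => endSign j * (S.stripInv j w).1)
      (endSign j • (ContinuousLinearMap.fst ℝ ℝ ℝ).comp (e.symm : ℂ →L[ℝ] ℝ × ℝ)) (S.strip j q) :=
    (hasFDerivAt_fst.comp _ h1).const_mul (endSign j)
  have h3 : endSign j * (S.stripInv j (S.strip j q)).1 = |q.1| := by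
    rw [hS.stripInv_strip hq', abs_eq_endSign_mul hq'.1]
  have h4 := HasFDerivAt.comp (g := ramp σ δ) (f := fun w => endSign j * (S.stripInv j w).1)
    (S.strip j q) (hasDerivAt_ramp σ δ (endSign j * (S.stripInv j (S.strip j q)).1)).hasFDerivAt h2
  rw [h3] at h4
  have h5 := hS.eventually_cutoff_eq_ramp hq' hq0 σ δ
  rw [hnh] at h5
  refine ⟨_, h4.congr_of_eventuallyEq h5, ?_, ?_⟩
  · have : e.symm (S.stripS j q) = (1, 0) := by
      rw [ContinuousLinearEquiv.symm_apply_eq]; rfl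
    simp [this, mul_comm]
  · have : e.symm (S.stripT j q) = (0, 1) := by
      rw [ContinuousLinearEquiv.symm_apply_eq]; rfl
    simp [this]

theorem mem_interior_of_mem_ball (hS : S.IsPuncturedDisc) {j : Fin (d + 1)} {q : ℝ × ℝ}
    (hq : q ∈ endStrip j) (hq0 : q.1 ≠ 0) (h : S.strip j q ∈ Metric.ball (0 : ℂ) 1) :
    q ∈ interior (endStrip j) := by
  rw [interior_endStrip]
  exact ⟨⟨hq.1, hq0⟩, hS.snd_mem_Ioo hq h⟩

theorem differentiableAt_cutoff (hS : S.IsPuncturedDisc) {σ δ : ℝ} (hσ : 0 < σ) (hδ : 0 < δ) {z : ℂ}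
    (hz : z ∈ Metric.ball (0 : ℂ) 1) : DifferentiableAt ℝ (S.cutoff σ δ) z := by
  by_cases h : S.endHeight z < σ
  · exact (hS.hasFDerivAt_cutoff_of_lt hδ hz h).differentiableAt
  · obtain ⟨j, q, hq, rfl, hqσ⟩ := hS.exists_strip_eq hσ (not_lt.1 h)
    have hq0 : q.1 ≠ 0 := by
      intro h0; rw [h0, abs_zero] at hqσ; linarith
    obtain ⟨χ', h1, -⟩ := hS.hasFDerivAt_cutoff_strip σ δ (hS.mem_interior_of_mem_ball hq hq0 hz)
    exact h1.differentiableAt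

theorem fderiv_cutoff_stripS (hS : S.IsPuncturedDisc) (σ δ : ℝ) {j : Fin (d + 1)}
    {q : ℝ × ℝ} (hq : q ∈ interior (endStrip j)) :
    fderiv ℝ (S.cutoff σ δ) (S.strip j q) (S.stripS j q) = deriv (ramp σ δ) |q.1| * endSign j := by
  obtain ⟨χ', h1, h2, -⟩ := hS.hasFDerivAt_cutoff_strip σ δ hq
  rw [h1.fderiv, h2]

theorem fderiv_cutoff_stripT (hS : S.IsPuncturedDisc) (σ δ : ℝ) {j : Fin (d + 1)}
    {q : ℝ × ℝ} (hq : q ∈ interior (endStrip j)) :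
    fderiv ℝ (S.cutoff σ δ) (S.strip j q) (S.stripT j q) = 0 := by
  obtain ⟨χ', h1, -, h3⟩ := hS.hasFDerivAt_cutoff_strip σ δ hq
  rw [h1.fderiv, h3]

end IsPuncturedDisc

end DiscData

end Cutoff

section Core

variable {d : ℕ} {S : DiscData d}

namespace DiscData

/-- The part of the open disc where `|s| ≤ σ`. -/
def truncated (S : DiscData d) (σ : ℝ) : Set ℂ := {z | z ∈ Metric.ball (0 : ℂ) 1 ∧ S.endHeight z ≤ σ}

/-- The interior of the part of a strip where `σ < |s| < τ`. -/
def window (j : Fin (d + 1)) (σ τ : ℝ) : Set (ℝ × ℝ) :=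
  {q | q ∈ interior (endStrip j) ∧ σ < |q.1| ∧ |q.1| < τ}

theorem isOpen_window (j : Fin (d + 1)) (σ τ : ℝ) : IsOpen (window j σ τ) :=
  isOpen_interior.inter ((isOpen_lt continuous_const continuous_fst.abs).inter
    (isOpen_lt continuous_fst.abs continuous_const))

theorem window_subset (j : Fin (d + 1)) (σ τ : ℝ) :
    window j σ τ ⊆ {q | q ∈ endStrip j ∧ |q.1| ≤ τ} := fun _ hq => ⟨interior_subset hq.1, hq.2.2.le⟩

theorem volume_window_le (j : Fin (d + 1)) (σ τ : ℝ) :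
    volume (window j σ τ) ≤ ENNReal.ofReal (τ - σ) := by
  have hsub : window j σ τ ⊆ ((fun s => endSign j * s) ⁻¹' Ioo σ τ) ×ˢ Ioo 0 1 := by
    rintro q ⟨hq, h1, h2⟩
    rw [abs_eq_endSign_mul (interior_subset hq).1] at h1 h2
    rw [interior_endStrip] at hq
    exact ⟨⟨h1, h2⟩, hq.2⟩
  refine (measure_mono hsub).trans ?_
  rw [Measure.volume_eq_prod, Measure.prod_prod, Real.volume_Ioo, sub_zero, ENNReal.ofReal_one,
    mul_one]
  unfold endSign
  split_ifs
  · rw [show (fun s : ℝ => -1 * s) = Neg.neg by funext s; ring]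
    rw [Measure.measure_preimage_neg, Real.volume_Ioo]
  · simp

namespace IsPuncturedDisc

theorem measurableSet_truncated (hS : S.IsPuncturedDisc) (σ : ℝ) : MeasurableSet (S.truncated σ) := by
  have h : IsOpen {z | z ∈ Metric.ball (0 : ℂ) 1 ∧ σ < S.endHeight z} := by
    by_cases hσ : 0 ≤ σ
    · have h1 : {z | z ∈ Metric.ball (0 : ℂ) 1 ∧ σ < S.endHeight z}
          = ⋃ j, S.strip j '' {q | q ∈ interior (endStrip j) ∧ σ < |q.1|} := by
        ext z
        simp only [mem_iUnion]
        constructor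
        · rintro ⟨hz, h⟩
          obtain ⟨j, q, hq, rfl, hqσ⟩ := hS.exists_strip_eq (hσ.trans_lt h) le_rfl
          rw [hS.endHeight_strip hq] at h
          refine ⟨j, q, ⟨hS.mem_interior_of_mem_ball hq ?_ hz, h⟩, rfl⟩
          intro h0
          rw [h0, abs_zero] at h; linarith
        · rintro ⟨j, q, hq, rfl⟩
          exact ⟨hS.strip_mem_ball hq.1, by
            rw [hS.endHeight_strip (interior_subset hq.1)]; exact hq.2⟩
      rw [h1]
      exact isOpen_iUnion fun j => hS.isOpen_image_strip j (isOpen_interior.inter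
        (isOpen_lt continuous_const continuous_fst.abs)) fun q hq => interior_subset hq.1
    · have h1 : {z | z ∈ Metric.ball (0 : ℂ) 1 ∧ σ < S.endHeight z} = Metric.ball (0 : ℂ) 1 := by
        ext z
        exact ⟨fun h => h.1, fun h => ⟨h, (not_le.1 hσ).trans_le (S.endHeight_nonneg z)⟩⟩
      rw [h1]
      exact Metric.isOpen_ball
  have h2 : S.truncated σ
      = Metric.ball (0 : ℂ) 1 \ {z | z ∈ Metric.ball (0 : ℂ) 1 ∧ σ < S.endHeight z} := by
    ext z
    simp only [truncated, mem_ofPred_eq, Set.mem_sdiff, not_and, not_lt]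
    tauto
  rw [h2]
  exact Metric.isOpen_ball.measurableSet.diff h.measurableSet

end IsPuncturedDisc

end DiscData

variable {VE : Type*} [NormedAddCommGroup VE] [NormedSpace ℝ VE] [FiniteDimensional ℝ VE]
  {BE : Type*} [TopologicalSpace BE] {IE : ModelWithCorners ℝ VE BE}
  {E : Type*} [TopologicalSpace E] [ChartedSpace BE E] [IsManifold IE ∞ E]
  {VM : Type*} [NormedAddCommGroup VM] [NormedSpace ℝ VM]
  {BM : Type*} [TopologicalSpace BM] {IM : ModelWithCorners ℝ VM BM}
  {M : Type*} [TopologicalSpace M] [ChartedSpace BM M] [IsManifold IM ∞ M]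
  {F : FibrationData IE E IM M} {e : Fin (d + 1) → EndData IE E} {D : SurfaceData IE E}

theorem continuousOn_curv_comp (hθ : IsSymplecticPrimitive IE F.thetaE) (hK : SmoothK S D)
    {u : ℂ → E} (hu : ContMDiffOn 𝓘(ℝ, ℂ) IE ∞ u S.surface) :
    ContinuousOn (fun z => curv F S D z (u z)) S.surface := by
  have h1 : ContinuousOn (fun z => ((z, u z) : ℂ × E)) S.surface :=
    continuousOn_id.prodMk hu.continuousOn
  have h2 : ContinuousOn (fun q : ℂ × E => curv F S D q.1 q.2) (S.surface ×ˢ univ) :=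
    continuousOn_curv hθ hK
  have h3 : MapsTo (fun z => ((z, u z) : ℂ × E)) S.surface (S.surface ×ˢ univ) :=
    fun _ hz => ⟨hz, mem_univ _⟩
  generalize curv F S D = R at *
  exact h2.comp h1 h3

/-- The exterior derivative of the action form, up to the boundary. -/
def actionFormDeriv (F : FibrationData IE E IM M) (S : DiscData d) (D : SurfaceData IE E)
    (u : ℂ → E) (z : ℂ) : ℝ :=
  fderivWithin ℝ (actionForm F S D u) S.surface z 1 Complex.I
    - fderivWithin ℝ (actionForm F S D u) S.surface z Complex.I 1

theorem continuousOn_actionFormDeriv (hθ : IsSymplecticPrimitive IE F.thetaE) (hK : SmoothK S D)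
    {u : ℂ → E} (hu : ContMDiffOn 𝓘(ℝ, ℂ) IE ∞ u S.surface) :
    ContinuousOn (actionFormDeriv F S D u) S.surface := by
  have h := (contDiffOn_actionForm hθ hK hu).continuousOn_fderivWithin S.uniqueDiffOn_surface
    (by simp)
  exact ((h.clm_apply continuousOn_const).clm_apply continuousOn_const).sub
    ((h.clm_apply continuousOn_const).clm_apply continuousOn_const)

theorem actionFormDeriv_eq (hθ : IsSymplecticPrimitive IE F.thetaE) (hK : SmoothK S D)
    {u : ℂ → E} (hu : ContMDiffOn 𝓘(ℝ, ℂ) IE ∞ u S.surface) {z : ℂ} (hz : z ∈ Metric.ball (0 : ℂ) 1) :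
    actionFormDeriv F S D u z = energyDensity F S D u z - curv F S D z (u z) := by
  rw [← fderiv_actionForm_antisymm hθ hK hu hz, actionFormDeriv,
    fderivWithin_of_mem_nhds (S.surface_mem_nhds hz)]

theorem integrableOn_cutoff_mul_energyDensity (hS : S.IsPuncturedDisc)
    (hθ : IsSymplecticPrimitive IE F.thetaE) (hK : SmoothK S D)
    {u : ℂ → E} (hu : ContMDiffOn 𝓘(ℝ, ℂ) IE ∞ u S.surface) {σ δ : ℝ} (hσ : 0 < σ) (hδ : 0 < δ) :
    IntegrableOn (fun z => S.cutoff σ δ z * energyDensity F S D u z) (Metric.ball (0 : ℂ) 1) := by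
  have h := hS.integrableOn_cutoff_mul hσ hδ
    ((continuousOn_actionFormDeriv hθ hK hu).add (continuousOn_curv_comp hθ hK hu))
  refine h.congr_fun (fun z hz => ?_) Metric.isOpen_ball.measurableSet
  simp only [Pi.add_apply]
  rw [actionFormDeriv_eq hθ hK hu hz]
  ring

theorem integrableOn_energyDensity_truncated (hS : S.IsPuncturedDisc)
    (hθ : IsSymplecticPrimitive IE F.thetaE) (hK : SmoothK S D)
    {u : ℂ → E} (hu : ContMDiffOn 𝓘(ℝ, ℂ) IE ∞ u S.surface) (σ : ℝ) :
    IntegrableOn (energyDensity F S D u) (S.truncated σ) := by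
  have h := integrableOn_cutoff_mul_energyDensity hS hθ hK hu
    (lt_max_of_lt_right one_pos : 0 < max σ 1) one_pos
  refine (h.mono_set fun z hz => hz.1).congr_fun (fun z hz => ?_) (hS.measurableSet_truncated σ)
  simp only
  rw [DiscData.cutoff_of_mem (S.ball_subset_surface hz.1),
    ramp_eq_one one_pos (hz.2.trans (le_max_left _ _)), one_mul]

/-- The energy of the part of a map where `|s| ≤ σ`. -/
def truncatedEnergy (F : FibrationData IE E IM M) (S : DiscData d) (D : SurfaceData IE E)
    (u : ℂ → E) (σ : ℝ) : ℝ := ∫ z in S.truncated σ, energyDensity F S D u z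

theorem truncatedEnergy_mono (hF : F.IsTarget) (hS : S.IsPuncturedDisc) (hD : D.IsAdmissible F S e)
    {u : ℂ → E} (hu : IsSolution F S D u) : Monotone (truncatedEnergy F S D u) := by
  intro σ τ h
  refine setIntegral_mono_set (integrableOn_energyDensity_truncated hS hF.thetaE_symplectic hD.K_smooth
    hu.smooth τ) ?_ (LE.le.eventuallyLE fun z hz => ⟨hz.1, hz.2.trans h⟩)
  filter_upwards [ae_restrict_mem (hS.measurableSet_truncated τ)] with z hz
  exact energyDensity_nonneg hF hS hD hu (S.ball_subset_surface hz.1)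

theorem geomEnergy_le_of_truncatedEnergy_le (hF : F.IsTarget) (hS : S.IsPuncturedDisc)
    (hD : D.IsAdmissible F S e) {u : ℂ → E} (hu : IsSolution F S D u) {C : ℝ}
    (h : ∀ n : ℕ, truncatedEnergy F S D u n ≤ C) :
    geomEnergy F S D u ≤ ENNReal.ofReal C := by
  rw [geomEnergy_eq hF hS hD hu]
  have h1 : S.surface =ᵐ[volume] (⋃ n : ℕ, S.truncated n) := by
    have h2 : (⋃ n : ℕ, S.truncated n) = Metric.ball (0 : ℂ) 1 := by
      ext z
      simp only [mem_iUnion, DiscData.truncated, mem_ofPred_eq]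
      exact ⟨fun ⟨_, h⟩ => h.1, fun h => (exists_nat_ge (S.endHeight z)).imp fun n hn => ⟨h, hn⟩⟩
    rw [h2]
    refine ae_eq_set.2 ⟨measure_mono_null (fun z hz => ?_) (Measure.addHaar_sphere volume (0 : ℂ) 1),
      by rw [sdiff_eq_empty.2 S.ball_subset_surface, measure_empty]⟩
    have h3 := mem_closedBall_zero_iff.1 hz.1.1
    have h4 := hz.2
    rw [mem_ball_zero_iff, not_lt] at h4
    exact mem_sphere_zero_iff_norm.2 (le_antisymm h3 h4)
  rw [setLIntegral_congr h1, setLIntegral_iUnion_of_directed]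
  · refine iSup_le fun n => ?_
    rw [← ofReal_integral_eq_lintegral_ofReal (integrableOn_energyDensity_truncated hS
      hF.thetaE_symplectic hD.K_smooth hu.smooth n)]
    · exact ENNReal.ofReal_le_ofReal (h n)
    · filter_upwards [ae_restrict_mem (hS.measurableSet_truncated n)] with z hz
      exact energyDensity_nonneg hF hS hD hu (S.ball_subset_surface hz.1)
  · refine Monotone.directed_le fun m n hmn z hz => ⟨hz.1, hz.2.trans ?_⟩
    exact_mod_cast hmn

/-- The curvature term of the energy identity is bounded. -/
theorem exists_curv_bound_ball [T2Space E] (hF : F.IsTarget) (hS : S.IsPuncturedDisc)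
    (hD : D.IsAdmissible F S e) :
    ∃ c : ℝ, 0 ≤ c ∧ ∀ z ∈ Metric.ball (0 : ℂ) 1, ∀ x, |curv F S D z x| ≤ c := by
  choose ρ hρ hsub using fun j => hS.exists_ball_puncture j le_rfl
  have hZ : IsCompact (Metric.closedBall (0 : ℂ) 1 \ ⋃ j, Metric.ball (S.puncture j) (ρ j)) :=
    (isCompact_closedBall _ _).diff (isOpen_iUnion fun _ => Metric.isOpen_ball)
  obtain ⟨c, hc, h⟩ := exists_curv_bound hF hD hZ (fun z hz => ⟨hz.1, by
    rintro ⟨j, rfl⟩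
    exact hz.2 (mem_iUnion.2 ⟨j, Metric.mem_ball_self (hρ j)⟩)⟩)
  refine ⟨c, hc, fun z hz x => ?_⟩
  by_cases hzj : z ∈ ⋃ j, Metric.ball (S.puncture j) (ρ j)
  · obtain ⟨j, hj⟩ := mem_iUnion.1 hzj
    obtain ⟨q, hq, rfl⟩ := hsub j ⟨S.ball_subset_surface hz, hj⟩
    rw [curv_strip_eq_zero hF.thetaE_symplectic hS hD (hS.mem_interior_of_mem_ball hq.1
      (abs_pos.1 hq.2) hz), abs_zero]
    exact hc
  · exact h z ⟨Metric.ball_subset_closedBall hz, hzj⟩ hz x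

/-- The wedge product of the derivative of the cutoff function with the action form. -/
def cutoffWedge (F : FibrationData IE E IM M) (S : DiscData d) (D : SurfaceData IE E)
    (u : ℂ → E) (σ δ : ℝ) (z : ℂ) : ℝ :=
  fderiv ℝ (S.cutoff σ δ) z 1 * actionForm F S D u z Complex.I
    - fderiv ℝ (S.cutoff σ δ) z Complex.I * actionForm F S D u z 1

theorem cutoffWedge_strip (hS : S.IsPuncturedDisc) (u : ℂ → E) (σ δ : ℝ) {j : Fin (d + 1)}
    {q : ℝ × ℝ} (hq : q ∈ interior (endStrip j)) :
    |det2 (fderivWithin ℝ (S.strip j) (endStrip j) q (1, 0))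
        (fderivWithin ℝ (S.strip j) (endStrip j) q (0, 1))| * cutoffWedge F S D u σ δ (S.strip j q)
      = deriv (ramp σ δ) |q.1| * endSign j * actionForm F S D u (S.strip j q) (S.stripT j q) := by
  rw [abs_of_pos (hS.det2_fderivWithin_strip_pos (interior_subset hq))]
  have h := alternating_eq_det2
    ((fderiv ℝ (S.cutoff σ δ) (S.strip j q)).smulRight (actionForm F S D u (S.strip j q)))
    (S.stripS j q) (S.stripT j q)
  simp only [ContinuousLinearMap.smulRight_apply, smul_apply, smul_eq_mul] at h
  rw [hS.fderiv_cutoff_stripS σ δ hq, hS.fderiv_cutoff_stripT σ δ hq, zero_mul, sub_zero] at h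
  exact h.symm

theorem cutoffWedge_eq_zero (hS : S.IsPuncturedDisc) (u : ℂ → E) {σ δ : ℝ} (hσ : 0 < σ) (hδ : 0 < δ)
    {z : ℂ} (hz : z ∈ Metric.ball (0 : ℂ) 1)
    (h : z ∉ ⋃ j, S.strip j '' DiscData.window j σ (σ + δ)) : cutoffWedge F S D u σ δ z = 0 := by
  by_cases hlt : S.endHeight z < σ
  · rw [cutoffWedge, (hS.hasFDerivAt_cutoff_of_lt hδ hz hlt).fderiv]
    simp
  · obtain ⟨j, q, hq, rfl, hqσ⟩ := hS.exists_strip_eq hσ (not_lt.1 hlt)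
    have hq0 : q.1 ≠ 0 := by
      intro h0; rw [h0, abs_zero] at hqσ; linarith
    have hqi := hS.mem_interior_of_mem_ball hq hq0 hz
    have h1 := cutoffWedge_strip (F := F) (D := D) hS u σ δ hqi
    have h2 : deriv (ramp σ δ) |q.1| = 0 := by
      rcases hqσ.eq_or_lt with h3 | h3
      · exact deriv_ramp_eq_zero_of_le hδ h3.ge
      · refine deriv_ramp_eq_zero_of_ge hδ (not_lt.1 fun h4 => h ?_)
        exact mem_iUnion.2 ⟨j, q, ⟨hqi, h3, h4⟩, rfl⟩
    rw [h2, zero_mul, zero_mul] at h1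
    exact (mul_eq_zero.1 h1).resolve_left
      (abs_pos.2 (hS.det2_fderivWithin_strip_pos hq).ne').ne'

theorem disjoint_windows (hS : S.IsPuncturedDisc) (σ τ : ℝ) :
    Pairwise (Function.onFun Disjoint fun j => S.strip j '' DiscData.window j σ τ) := by
  intro i j hij
  exact (hS.strip_disjoint i j hij).mono (image_mono fun q hq => interior_subset hq.1)
    (image_mono fun q hq => interior_subset hq.1)

theorem isOpen_image_window (hS : S.IsPuncturedDisc) (j : Fin (d + 1)) (σ τ : ℝ) :
    IsOpen (S.strip j '' DiscData.window j σ τ) :=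
  hS.isOpen_image_strip j (DiscData.isOpen_window j σ τ) fun _ hq => interior_subset hq.1

theorem hasFDerivWithinAt_window (hS : S.IsPuncturedDisc) (j : Fin (d + 1)) (σ τ : ℝ) :
    ∀ q ∈ DiscData.window j σ τ, HasFDerivWithinAt (S.strip j)
      (fderivWithin ℝ (S.strip j) (endStrip j) q) (DiscData.window j σ τ) q :=
  fun _ hq => (hS.hasFDerivAt_strip hq.1).hasFDerivWithinAt

theorem injOn_window (hS : S.IsPuncturedDisc) (j : Fin (d + 1)) (σ τ : ℝ) :
    InjOn (S.strip j) (DiscData.window j σ τ) :=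
  (hS.strip_inj j).mono fun _ hq => interior_subset hq.1

theorem image_window_subset (hS : S.IsPuncturedDisc) (j : Fin (d + 1)) (σ τ : ℝ) :
    S.strip j '' DiscData.window j σ τ ⊆ S.truncated τ \ S.truncated σ := by
  rintro _ ⟨q, hq, rfl⟩
  have h := hS.endHeight_strip (interior_subset hq.1)
  refine ⟨⟨hS.strip_mem_ball hq.1, h.le.trans hq.2.2.le⟩, fun h2 => ?_⟩
  have h3 := h2.2
  rw [h] at h3
  exact absurd hq.2.1 (not_lt.2 h3)

theorem continuousOn_actionForm_stripT (hS : S.IsPuncturedDisc)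
    (hθ : IsSymplecticPrimitive IE F.thetaE) (hK : SmoothK S D)
    {u : ℂ → E} (hu : ContMDiffOn 𝓘(ℝ, ℂ) IE ∞ u S.surface) (j : Fin (d + 1)) :
    ContinuousOn (fun q => actionForm F S D u (S.strip j q) (S.stripT j q)) (endStrip j) := by
  have h1 : ContinuousOn (actionForm F S D u) S.surface := (contDiffOn_actionForm hθ hK hu).continuousOn
  have h2 : ContinuousOn (fderivWithin ℝ (S.strip j) (endStrip j)) (endStrip j) :=
    (hS.strip_smooth j).continuousOn_fderivWithin (uniqueDiffOn_endStrip j) (by simp)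
  exact (h1.comp (hS.strip_smooth j).continuousOn (hS.strip_mapsTo j)).clm_apply
    (h2.clm_apply continuousOn_const)

theorem integrableOn_cutoffWedge_window (hS : S.IsPuncturedDisc)
    (hθ : IsSymplecticPrimitive IE F.thetaE) (hK : SmoothK S D)
    {u : ℂ → E} (hu : ContMDiffOn 𝓘(ℝ, ℂ) IE ∞ u S.surface) (σ δ : ℝ) (j : Fin (d + 1)) :
    IntegrableOn (fun q => deriv (ramp σ δ) |q.1| * endSign j
      * actionForm F S D u (S.strip j q) (S.stripT j q)) (DiscData.window j σ (σ + δ)) := by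
  have h1 : ContinuousOn (fun q : ℝ × ℝ => deriv (ramp σ δ) |q.1| * endSign j
      * actionForm F S D u (S.strip j q) (S.stripT j q)) {q | q ∈ endStrip j ∧ |q.1| ≤ σ + δ} := by
    refine ContinuousOn.mul ?_ ((continuousOn_actionForm_stripT hS hθ hK hu j).mono fun q hq => hq.1)
    exact (((continuous_deriv_ramp σ δ).comp continuous_fst.abs).mul continuous_const).continuousOn
  exact (h1.integrableOn_compact (DiscData.IsPuncturedDisc.isCompact_strip_le j _)).mono_set
    (DiscData.window_subset j σ _)

theorem integrableOn_cutoffWedge (hS : S.IsPuncturedDisc)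
    (hθ : IsSymplecticPrimitive IE F.thetaE) (hK : SmoothK S D)
    {u : ℂ → E} (hu : ContMDiffOn 𝓘(ℝ, ℂ) IE ∞ u S.surface) (σ δ : ℝ) (j : Fin (d + 1)) :
    IntegrableOn (cutoffWedge F S D u σ δ) (S.strip j '' DiscData.window j σ (σ + δ)) := by
  have hm := (DiscData.isOpen_window j σ (σ + δ)).measurableSet
  rw [integrableOn_image_iff_det2 hm (hasFDerivWithinAt_window hS j σ _) (injOn_window hS j σ _)]
  exact (integrableOn_cutoffWedge_window hS hθ hK hu σ δ j).congr_fun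
    (fun q hq => (cutoffWedge_strip hS u σ δ hq.1).symm) hm

theorem integral_window_energy (hS : S.IsPuncturedDisc)
    (u : ℂ → E) (σ τ : ℝ) (j : Fin (d + 1)) :
    ∫ z in S.strip j '' DiscData.window j σ τ, energyDensity F S D u z
      = ∫ q in DiscData.window j σ τ, det2 (S.stripS j q) (S.stripT j q)
        * energyDensity F S D u (S.strip j q) := by
  have hm := (DiscData.isOpen_window j σ τ).measurableSet
  rw [integral_image_eq_det2 hm (hasFDerivWithinAt_window hS j σ _) (injOn_window hS j σ _)]
  refine setIntegral_congr_fun hm fun q hq => ?_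
  rw [abs_of_pos (hS.det2_fderivWithin_strip_pos (interior_subset hq.1))]
  rfl

theorem integrableOn_window_energy (hS : S.IsPuncturedDisc)
    (hθ : IsSymplecticPrimitive IE F.thetaE) (hK : SmoothK S D)
    {u : ℂ → E} (hu : ContMDiffOn 𝓘(ℝ, ℂ) IE ∞ u S.surface) (σ τ : ℝ) (j : Fin (d + 1)) :
    IntegrableOn (fun q => det2 (S.stripS j q) (S.stripT j q)
        * energyDensity F S D u (S.strip j q)) (DiscData.window j σ τ) := by
  have hm := (DiscData.isOpen_window j σ τ).measurableSet
  have h := (integrableOn_energyDensity_truncated hS hθ hK hu τ).mono_set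
    ((image_window_subset hS j σ τ).trans sdiff_subset)
  rw [integrableOn_image_iff_det2 hm (hasFDerivWithinAt_window hS j σ _) (injOn_window hS j σ _)] at h
  refine h.congr_fun (fun q hq => ?_) hm
  simp only
  rw [abs_of_pos (hS.det2_fderivWithin_strip_pos (interior_subset hq.1))]
  rfl

theorem sqrt_le_inv_add_mul {x μ : ℝ} (hx : 0 ≤ x) (hμ : 0 < μ) : √x ≤ 1 / μ + μ * x := by
  have h1 : √x * √x = x := Real.mul_self_sqrt hx
  have h2 : 0 ≤ (1 - μ * √x) ^ 2 := sq_nonneg _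
  have h3 : μ * √x ≤ 1 + μ ^ 2 * x := by
    nlinarith [Real.sqrt_nonneg x, mul_nonneg hμ.le (Real.sqrt_nonneg x), mul_nonneg hμ.le hx]
  have h4 : 1 / μ + μ * x = (1 + μ ^ 2 * x) / μ := by field_simp
  rw [h4, le_div_iff₀ hμ]
  linarith

/-- The contribution of a window to the energy identity. -/
theorem abs_integral_cutoffWedge_window_le (hF : F.IsTarget) (hS : S.IsPuncturedDisc)
    (hD : D.IsAdmissible F S e) {u : ℂ → E} (hu : IsSolution F S D u) {c c₁ σ δ μ : ℝ}
    (hc : 0 ≤ c) (hc₁ : 0 ≤ c₁) (hδ : 0 < δ) (hμ : 0 < μ)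
    (hr : ∀ r, |deriv (ramp σ δ) r| ≤ c / δ) (j : Fin (d + 1))
    (h : ∀ q ∈ endStrip j, σ ≤ |q.1| → |actionForm F S D u (S.strip j q) (S.stripT j q)|
      ≤ c₁ * (1 + √(det2 (S.stripS j q) (S.stripT j q) * energyDensity F S D u (S.strip j q)))) :
    |∫ z in S.strip j '' DiscData.window j σ (σ + δ), cutoffWedge F S D u σ δ z|
      ≤ c * c₁ * (1 + 1 / μ) + c * c₁ * μ / δ
        * ∫ z in S.strip j '' DiscData.window j σ (σ + δ), energyDensity F S D u z := by
  have hm := (DiscData.isOpen_window j σ (σ + δ)).measurableSet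
  have hθ := hF.thetaE_symplectic
  have hi := integrableOn_window_energy hS hθ hD.K_smooth hu.smooth σ (σ + δ) j
  have hvol := DiscData.volume_window_le j σ (σ + δ)
  rw [add_sub_cancel_left] at hvol
  have hfin : volume (DiscData.window j σ (σ + δ)) ≠ ⊤ := (hvol.trans_lt ENNReal.ofReal_lt_top).ne
  rw [integral_window_energy hS, integral_image_eq_det2 hm (hasFDerivWithinAt_window hS j σ _)
    (injOn_window hS j σ _), setIntegral_congr_fun hm fun q hq => cutoffWedge_strip hS u σ δ hq.1]
  have hconst : IntegrableOn (fun _ : ℝ × ℝ => c * c₁ / δ * (1 + 1 / μ))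
      (DiscData.window j σ (σ + δ)) := integrableOn_const hfin
  calc _ ≤ ∫ q in DiscData.window j σ (σ + δ), |deriv (ramp σ δ) |q.1| * endSign j
        * actionForm F S D u (S.strip j q) (S.stripT j q)| := abs_integral_le_integral_abs
    _ ≤ ∫ q in DiscData.window j σ (σ + δ), (c * c₁ / δ * (1 + 1 / μ) + c * c₁ * μ / δ
        * (det2 (S.stripS j q) (S.stripT j q) * energyDensity F S D u (S.strip j q))) := by
      refine setIntegral_mono_on
        (integrableOn_cutoffWedge_window hS hθ hD.K_smooth hu.smooth σ δ j).abs
        (hconst.add (hi.const_mul _)) hm fun q hq => ?_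
      have hq' := interior_subset hq.1
      have h0 : 0 ≤ det2 (S.stripS j q) (S.stripT j q) * energyDensity F S D u (S.strip j q) :=
        mul_nonneg (hS.det2_strip_pos hq').le
          (energyDensity_nonneg hF hS hD hu (hS.strip_mapsTo j hq'))
      rw [abs_mul, abs_mul, abs_endSign, mul_one]
      calc _ ≤ c / δ * (c₁ * (1 + (1 / μ + μ * (det2 (S.stripS j q) (S.stripT j q)
            * energyDensity F S D u (S.strip j q))))) := by
            refine mul_le_mul (hr _) ((h q hq' hq.2.1.le).trans ?_) (abs_nonneg _) (by positivity)
            gcongr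
            exact sqrt_le_inv_add_mul h0 hμ
        _ = _ := by ring
    _ = volume.real (DiscData.window j σ (σ + δ)) * (c * c₁ / δ * (1 + 1 / μ)) + c * c₁ * μ / δ
        * ∫ q in DiscData.window j σ (σ + δ), (det2 (S.stripS j q) (S.stripT j q)
          * energyDensity F S D u (S.strip j q)) := by
      rw [integral_add hconst (hi.const_mul _), setIntegral_const, integral_const_mul, smul_eq_mul]
    _ ≤ _ := by
      refine add_le_add ?_ le_rfl
      have h1 : volume.real (DiscData.window j σ (σ + δ)) ≤ δ := ENNReal.toReal_le_of_le_ofReal hδ.le hvol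
      calc _ ≤ δ * (c * c₁ / δ * (1 + 1 / μ)) := by gcongr
        _ = _ := by field_simp

theorem integral_cutoff_stokes (hS : S.IsPuncturedDisc) {α : ℂ → ℂ →L[ℝ] ℝ}
    (hα : ContDiffOn ℝ ∞ α S.surface) {G R W : ℂ → ℝ} (hR : ContinuousOn R S.surface)
    {σ δ : ℝ} (hσ : 0 < σ) (hδ : 0 < δ)
    (hdα : ∀ z ∈ Metric.ball (0 : ℂ) 1, fderiv ℝ α z 1 Complex.I - fderiv ℝ α z Complex.I 1
      = G z - R z)
    (hWz : ∀ z, W z = fderiv ℝ (S.cutoff σ δ) z 1 * α z Complex.I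
      - fderiv ℝ (S.cutoff σ δ) z Complex.I * α z 1)
    (hG : IntegrableOn (fun z => S.cutoff σ δ z * G z) (Metric.ball (0 : ℂ) 1))
    (hW : IntegrableOn W (Metric.ball (0 : ℂ) 1)) (a : ℝ) :
    ∫ z in Metric.ball (0 : ℂ) 1, S.cutoff σ δ z * G z
      = (∫ z in Metric.ball (0 : ℂ) 1, S.cutoff σ δ z * R z)
        - (∫ z in Metric.ball (0 : ℂ) 1, W z)
        + ∫ τ in a..(a + 2 * Real.pi), S.cutoff σ δ (DiscData.bdryPt τ)
          * α (DiscData.bdryPt τ) (Complex.I * DiscData.bdryPt τ) := by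
  have hbm : MeasurableSet (Metric.ball (0 : ℂ) 1) := Metric.isOpen_ball.measurableSet
  have hRi := hS.integrableOn_cutoff_mul hσ hδ hR
  set β' : ℂ → ℂ →L[ℝ] ℂ →L[ℝ] ℝ := fun z => S.cutoff σ δ z • fderiv ℝ α z
    + (fderiv ℝ (S.cutoff σ δ) z).smulRight (α z) with hβ'
  have hβ'z : ∀ z ∈ Metric.ball (0 : ℂ) 1, β' z 1 Complex.I - β' z Complex.I 1
      = S.cutoff σ δ z * G z - S.cutoff σ δ z * R z + W z := by
    intro z hz
    have h1 := hdα z hz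
    simp only [hβ', _root_.add_apply, smul_apply, ContinuousLinearMap.smulRight_apply, smul_eq_mul,
      hWz]
    linear_combination S.cutoff σ δ z * h1
  have hd : ∀ z ∈ Metric.ball (0 : ℂ) 1, HasFDerivAt (fun z => S.cutoff σ δ z • α z) (β' z) z := by
    intro z hz
    have h1 : DifferentiableAt ℝ α z :=
      (hα.contDiffAt (S.surface_mem_nhds hz)).differentiableAt (by simp)
    have h2 := (hS.differentiableAt_cutoff hσ hδ hz).hasFDerivAt
    exact h2.smul h1.hasFDerivAt
  have hint : IntegrableOn (fun z => β' z 1 Complex.I - β' z Complex.I 1) (Metric.ball (0 : ℂ) 1) :=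
    ((hG.sub hRi).add hW).congr_fun (fun z hz => (hβ'z z hz).symm) hbm
  have hcont := hS.continuousOn_cutoff_smul hσ hδ hα.continuousOn
  have hstokes := integral_ball_eq_integral_circle hcont hd hint a
  have hsub : IntegrableOn (fun z => S.cutoff σ δ z * G z - S.cutoff σ δ z * R z)
      (Metric.ball (0 : ℂ) 1) := hG.sub hRi
  rw [setIntegral_congr_fun hbm hβ'z, integral_add hsub hW, integral_sub hG hRi] at hstokes
  simp only [smul_apply, smul_eq_mul] at hstokes
  linarith

theorem integrableOn_cutoffWedge_ball (hS : S.IsPuncturedDisc)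
    (hθ : IsSymplecticPrimitive IE F.thetaE) (hK : SmoothK S D)
    {u : ℂ → E} (hu : ContMDiffOn 𝓘(ℝ, ℂ) IE ∞ u S.surface) {σ δ : ℝ} (hσ : 0 < σ) (hδ : 0 < δ) :
    IntegrableOn (cutoffWedge F S D u σ δ) (Metric.ball (0 : ℂ) 1) :=
  IntegrableOn.of_forall_sdiff_eq_zero
    (integrableOn_finite_iUnion.2 fun j => integrableOn_cutoffWedge hS hθ hK hu σ δ j)
    Metric.isOpen_ball.measurableSet fun _ hz => cutoffWedge_eq_zero hS u hσ hδ hz.1 hz.2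

theorem integral_cutoffWedge_ball (hS : S.IsPuncturedDisc)
    (hθ : IsSymplecticPrimitive IE F.thetaE) (hK : SmoothK S D)
    {u : ℂ → E} (hu : ContMDiffOn 𝓘(ℝ, ℂ) IE ∞ u S.surface) {σ δ : ℝ} (hσ : 0 < σ) (hδ : 0 < δ) :
    ∫ z in Metric.ball (0 : ℂ) 1, cutoffWedge F S D u σ δ z
      = ∑ j, ∫ z in S.strip j '' DiscData.window j σ (σ + δ), cutoffWedge F S D u σ δ z := by
  have hUsub : (⋃ j, S.strip j '' DiscData.window j σ (σ + δ)) ⊆ Metric.ball (0 : ℂ) 1 :=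
    iUnion_subset fun j z hz => (image_window_subset hS j σ _ hz).1.1
  rw [setIntegral_eq_of_subset_of_forall_sdiff_eq_zero Metric.isOpen_ball.measurableSet hUsub
    fun z hz => cutoffWedge_eq_zero hS u hσ hδ hz.1 hz.2]
  exact integral_iUnion_fintype (fun j => (isOpen_image_window hS j σ _).measurableSet)
    (disjoint_windows hS σ _) fun j => integrableOn_cutoffWedge hS hθ hK hu σ δ j

/-- The energy identity, with a cutoff function. -/
theorem integral_cutoff_energy_eq (hθ : IsSymplecticPrimitive IE F.thetaE) (hS : S.IsPuncturedDisc)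
    (hK : SmoothK S D) {u : ℂ → E} (hu : ContMDiffOn 𝓘(ℝ, ℂ) IE ∞ u S.surface) {σ δ : ℝ} (hσ : 0 < σ)
    (hδ : 0 < δ) (a : ℝ) :
    ∫ z in Metric.ball (0 : ℂ) 1, S.cutoff σ δ z * energyDensity F S D u z
      = (∫ z in Metric.ball (0 : ℂ) 1, S.cutoff σ δ z * curv F S D z (u z))
        - (∑ j, ∫ z in S.strip j '' DiscData.window j σ (σ + δ), cutoffWedge F S D u σ δ z)
        + ∫ τ in a..(a + 2 * Real.pi), S.cutoff σ δ (DiscData.bdryPt τ)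
          * actionForm F S D u (DiscData.bdryPt τ) (Complex.I * DiscData.bdryPt τ) := by
  have hR := continuousOn_curv_comp hθ hK hu
  have hα := contDiffOn_actionForm hθ hK hu
  have hG := integrableOn_cutoff_mul_energyDensity hS hθ hK hu hσ hδ
  have hW := integrableOn_cutoffWedge_ball hS hθ hK hu hσ hδ
  rw [← integral_cutoffWedge_ball hS hθ hK hu hσ hδ]
  have hdα : ∀ z ∈ Metric.ball (0 : ℂ) 1, fderiv ℝ (actionForm F S D u) z 1 Complex.I
      - fderiv ℝ (actionForm F S D u) z Complex.I 1
        = energyDensity F S D u z - curv F S D z (u z) :=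
    fun z hz => fderiv_actionForm_antisymm hθ hK hu hz
  have hWz : ∀ z, cutoffWedge F S D u σ δ z
      = fderiv ℝ (S.cutoff σ δ) z 1 * actionForm F S D u z Complex.I
      - fderiv ℝ (S.cutoff σ δ) z Complex.I * actionForm F S D u z 1 := fun z => rfl
  generalize actionForm F S D u = α at *
  generalize energyDensity F S D u = G at *
  generalize cutoffWedge F S D u σ δ = W at *
  generalize curv F S D = R at *
  exact integral_cutoff_stokes hS hα hR hσ hδ hdα hWz hG hW a

/-- A uniform estimate for the action form on the ends and on the boundary bounds the energy. -/
theorem exists_geomEnergy_le [T2Space E] (hF : F.IsTarget) (hS : S.IsPuncturedDisc)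
    (hD : D.IsAdmissible F S e) {c₁ : ℝ} (hc₁ : 0 ≤ c₁) (c₂ a : ℝ) :
    ∃ C : ℝ, ∀ u : ℂ → E, IsSolution F S D u → (∃ σ₁ > 0,
      (∀ j, ∀ q ∈ endStrip j, σ₁ ≤ |q.1| → |actionForm F S D u (S.strip j q) (S.stripT j q)|
        ≤ c₁ * (1 + √(det2 (S.stripS j q) (S.stripT j q) * energyDensity F S D u (S.strip j q)))) ∧
      ∀ σ ≥ σ₁, ∀ δ > 0, ∫ τ in a..(a + 2 * Real.pi), S.cutoff σ δ (DiscData.bdryPt τ)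
          * actionForm F S D u (DiscData.bdryPt τ) (Complex.I * DiscData.bdryPt τ) ≤ c₂) →
      geomEnergy F S D u ≤ ENNReal.ofReal C := by
  obtain ⟨c, hc, hr⟩ := exists_deriv_ramp_bound
  obtain ⟨R, hR, hcurv⟩ := exists_curv_bound_ball hF hS hD
  set v := volume.real (Metric.ball (0 : ℂ) 1)
  have hv : 0 ≤ v := measureReal_nonneg
  set C := R * v + |c₂| + (d + 1) * (c * c₁) + 1 with hC
  have hcc : 0 ≤ c * c₁ := mul_nonneg hc hc₁
  have hCpos : 0 < C := by positivity
  refine ⟨C, fun u hu ⟨σ₁, hσ₁, hend, hbdry⟩ => ?_⟩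
  have hθ := hF.thetaE_symplectic
  have hK : SmoothK S D := hD.K_smooth
  have hmono := truncatedEnergy_mono hF hS hD hu
  have key : ∀ σ ≥ σ₁, ∀ δ > 0, ∀ μ > 0, truncatedEnergy F S D u σ ≤ C * (1 + 1 / μ)
      + C * μ * ((truncatedEnergy F S D u (σ + δ) - truncatedEnergy F S D u σ) / δ) := by
    intro σ hσ δ hδ μ hμ
    have hσ0 : 0 < σ := hσ₁.trans_le hσ
    have hbm : MeasurableSet (Metric.ball (0 : ℂ) 1) := Metric.isOpen_ball.measurableSet
    have hEi := integrableOn_cutoff_mul_energyDensity hS hθ hK hu.smooth hσ0 hδ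
    have h1 : truncatedEnergy F S D u σ
        ≤ ∫ z in Metric.ball (0 : ℂ) 1, S.cutoff σ δ z * energyDensity F S D u z := by
      have h2 : truncatedEnergy F S D u σ
          = ∫ z in S.truncated σ, S.cutoff σ δ z * energyDensity F S D u z := by
        refine setIntegral_congr_fun (hS.measurableSet_truncated σ) fun z hz => ?_
        rw [DiscData.cutoff_of_mem (S.ball_subset_surface hz.1), ramp_eq_one hδ hz.2, one_mul]
      rw [h2]
      refine setIntegral_mono_set hEi ?_ (LE.le.eventuallyLE fun z hz => hz.1)
      filter_upwards [ae_restrict_mem hbm] with z hz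
      exact mul_nonneg (DiscData.cutoff_nonneg _ _ _)
        (energyDensity_nonneg hF hS hD hu (S.ball_subset_surface hz))
    have h2 : ∫ z in Metric.ball (0 : ℂ) 1, S.cutoff σ δ z * curv F S D z (u z) ≤ R * v := by
      refine (Real.le_norm_self _).trans ?_
      refine norm_setIntegral_le_of_norm_le_const measure_ball_lt_top fun z hz => ?_
      rw [norm_mul, Real.norm_of_nonneg (DiscData.cutoff_nonneg _ _ _)]
      calc _ ≤ 1 * R := mul_le_mul (DiscData.cutoff_le_one _ _ _) (hcurv z hz _) (abs_nonneg _) zero_le_one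
        _ = R := one_mul _
    have h3 : -(∑ j, ∫ z in S.strip j '' DiscData.window j σ (σ + δ), cutoffWedge F S D u σ δ z)
        ≤ (d + 1) * (c * c₁ * (1 + 1 / μ)) + c * c₁ * μ / δ
          * (truncatedEnergy F S D u (σ + δ) - truncatedEnergy F S D u σ) := by
      have h4 : ∑ j, ∫ z in S.strip j '' DiscData.window j σ (σ + δ), energyDensity F S D u z
          ≤ truncatedEnergy F S D u (σ + δ) - truncatedEnergy F S D u σ := by
        have hi := integrableOn_energyDensity_truncated hS hθ hK hu.smooth (σ + δ)
        have hsub : S.truncated σ ⊆ S.truncated (σ + δ) := fun z hz => ⟨hz.1, by linarith [hz.2]⟩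
        rw [← integral_iUnion_fintype (fun j => (isOpen_image_window hS j σ (σ + δ)).measurableSet)
          (disjoint_windows hS σ _) (fun j => hi.mono_set fun z hz => (image_window_subset hS j σ _ hz).1),
          truncatedEnergy, truncatedEnergy, ← setIntegral_sdiff (hS.measurableSet_truncated σ) hi hsub]
        refine setIntegral_mono_set (hi.mono_set sdiff_subset) ?_
          (LE.le.eventuallyLE (iUnion_subset fun j => image_window_subset hS j σ _))
        filter_upwards [ae_restrict_mem ((hS.measurableSet_truncated _).diff
          (hS.measurableSet_truncated _))] with z hz
        exact energyDensity_nonneg hF hS hD hu (S.ball_subset_surface hz.1.1)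
      calc _ ≤ |∑ j, ∫ z in S.strip j '' DiscData.window j σ (σ + δ), cutoffWedge F S D u σ δ z| :=
            neg_le_abs _
        _ ≤ ∑ j, |∫ z in S.strip j '' DiscData.window j σ (σ + δ), cutoffWedge F S D u σ δ z| :=
            Finset.abs_sum_le_sum_abs _ _
        _ ≤ ∑ j : Fin (d + 1), (c * c₁ * (1 + 1 / μ) + c * c₁ * μ / δ
            * ∫ z in S.strip j '' DiscData.window j σ (σ + δ), energyDensity F S D u z) :=
            Finset.sum_le_sum fun j _ => abs_integral_cutoffWedge_window_le hF hS hD hu hc hc₁ hδ hμ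
              (fun r => hr σ δ r hδ) j fun q hq h => hend j q hq (hσ.le.trans h)
        _ ≤ _ := by
            rw [Finset.sum_add_distrib, Finset.sum_const, Finset.card_univ, Fintype.card_fin,
              nsmul_eq_mul, ← Finset.mul_sum]
            refine add_le_add (le_of_eq ?_) (mul_le_mul_of_nonneg_left h4 (by positivity))
            push_cast
            ring
    have h4 := hbdry σ hσ δ hδ
    have h5 := integral_cutoff_energy_eq hθ hS hK hu.smooth hσ0 hδ a
    have h6 : 0 ≤ truncatedEnergy F S D u (σ + δ) - truncatedEnergy F S D u σ :=
      sub_nonneg.2 (hmono (by linarith))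
    have h7 : c * c₁ * μ / δ * (truncatedEnergy F S D u (σ + δ) - truncatedEnergy F S D u σ)
        ≤ C * μ * ((truncatedEnergy F S D u (σ + δ) - truncatedEnergy F S D u σ) / δ) := by
      rw [div_mul_eq_mul_div, ← mul_div_assoc]
      gcongr
      have : c * c₁ ≤ (d + 1) * (c * c₁) := by nlinarith [(Nat.cast_nonneg d : (0 : ℝ) ≤ d)]
      have := abs_nonneg c₂
      have := mul_nonneg hR hv
      linarith
    have h8 : R * v + |c₂| + (d + 1) * (c * c₁ * (1 + 1 / μ)) ≤ C * (1 + 1 / μ) := by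
      have h9 : 0 < 1 / μ := by positivity
      have := abs_nonneg c₂
      have := mul_nonneg hR hv
      rw [hC]
      nlinarith
    have := le_abs_self c₂
    linarith
  refine geomEnergy_le_of_truncatedEnergy_le hF hS hD hu fun n => ?_
  exact (hmono (le_max_left _ σ₁)).trans
    (le_of_superlinear_growth hCpos hmono key (le_max_right (n : ℝ) σ₁))

end Core

section Slopes

theorem sub_le_of_local_slope_le {h : ℝ → ℝ} {a b C : ℝ} (hab : a ≤ b)
    (hc : ContinuousOn h (Icc a b))
    (H : ∀ τ ∈ Ico a b, ∀ r > C, ∃ᶠ τ' in 𝓝[>] τ, h τ' - h τ ≤ r * (τ' - τ)) :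
    h b - h a ≤ C * (b - a) := by
  refine image_le_of_liminf_slope_right_le_deriv_boundary (f := fun τ => h τ - h a) (a := a) (b := b)
    (B := fun τ => C * (τ - a)) (B' := fun _ => C) (hc.sub continuousOn_const) (by simp)
    (by fun_prop) (fun x _ => ?_) (fun x hx r hr => ?_) (right_mem_Icc.2 hab)
  · have := ((hasDerivAt_id x).sub_const a).const_mul C
    rw [mul_one] at this
    exact this.hasDerivWithinAt
  · obtain ⟨r', h1, h2⟩ := exists_between hr
    refine ((H x hx r' h1).and_eventually self_mem_nhdsWithin).mono ?_
    rintro z ⟨hz, hxz⟩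
    have hxz' : 0 < z - x := sub_pos.2 hxz
    rw [slope_def_field, div_lt_iff₀ hxz']
    have : r' * (z - x) < r * (z - x) := by gcongr
    linarith

/-- A function whose difference quotients are locally bounded by `C` is `C`-Lipschitz. -/
theorem abs_sub_le_of_local_slope_le {h : ℝ → ℝ} {a b C : ℝ} (hab : a ≤ b)
    (H : ∀ τ ∈ Icc a b, ∀ᶠ τ' in 𝓝 τ, |h τ' - h τ| ≤ C * |τ' - τ|) : |h b - h a| ≤ C * (b - a) := by
  have hcont : ContinuousOn h (Icc a b) := by
    intro τ hτ
    refine ContinuousAt.continuousWithinAt ?_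
    rw [ContinuousAt, tendsto_iff_norm_sub_tendsto_zero]
    have h1 : Tendsto (fun τ' => C * |τ' - τ|) (𝓝 τ) (𝓝 0) := by
      have : ContinuousAt (fun τ' => C * |τ' - τ|) τ := by fun_prop
      simpa [ContinuousAt] using this
    exact squeeze_zero' (Eventually.of_forall fun _ => norm_nonneg _) (H τ hτ) h1
  have h2 : ∀ τ ∈ Ico a b, ∀ᶠ τ' in 𝓝[>] τ, |h τ' - h τ| ≤ C * (τ' - τ) := by
    intro τ hτ
    filter_upwards [nhdsWithin_le_nhds (H τ ⟨hτ.1, hτ.2.le⟩), self_mem_nhdsWithin] with τ' h1 h3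
    rwa [abs_of_pos (sub_pos.2 h3 : 0 < τ' - τ)] at h1
  have key : ∀ k : ℝ → ℝ, ContinuousOn k (Icc a b) → (∀ x y, k y - k x ≤ |h y - h x|) →
      k b - k a ≤ C * (b - a) := by
    intro k hk hkh
    refine sub_le_of_local_slope_le hab hk fun τ hτ r hr => ?_
    refine Eventually.frequently ?_
    filter_upwards [h2 τ hτ, self_mem_nhdsWithin] with τ' h3 h4
    have h5 : 0 < τ' - τ := sub_pos.2 h4
    exact (hkh _ _).trans (h3.trans (by gcongr))
  rw [abs_sub_le_iff]
  constructor
  · exact key h hcont fun x y => le_abs_self _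
  · have := key (fun t => -h t) hcont.neg fun x y => by
      rw [neg_sub_neg, abs_sub_comm]; exact le_abs_self _
    linarith

variable {P G : Type*} [NormedAddCommGroup P] [NormedSpace ℝ P] [FiniteDimensional ℝ P]
  [NormedAddCommGroup G] [NormedSpace ℝ G] [FiniteDimensional ℝ G]

/-- If `f ∘ g` is differentiable, where `f` has injective derivative and `g` is continuous, then `g`
is differentiable. -/
theorem exists_hasDerivAt_of_comp_injective {f : P → G} {f' : P →L[ℝ] G} {s : Set P} {g : ℝ → P}
    {t₀ : ℝ} {v : G} (hf : HasFDerivWithinAt f f' s (g t₀)) (hinj : Function.Injective f')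
    (hgs : ∀ᶠ t in 𝓝 t₀, g t ∈ s) (hg : ContinuousAt g t₀)
    (hfg : HasDerivAt (fun t => f (g t)) v t₀) : ∃ w, HasDerivAt g w t₀ ∧ f' w = v := by
  obtain ⟨L₀, hL₀⟩ := LinearMap.exists_leftInverse_of_injective (f' : P →ₗ[ℝ] G)
    (LinearMap.ker_eq_bot.2 hinj)
  set L : G →L[ℝ] P := LinearMap.toContinuousLinearMap L₀
  have hL : ∀ x, L (f' x) = x := fun x => LinearMap.congr_fun hL₀ x
  have hgs' : Tendsto g (𝓝 t₀) (𝓝[s] (g t₀)) := tendsto_nhdsWithin_iff.2 ⟨hg, hgs⟩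
  have h1 : (fun t => L (f (g t) - f (g t₀)) - (g t - g t₀)) =o[𝓝 t₀] fun t => g t - g t₀ := by
    have h2 := (L.isBigO_comp (fun t => f (g t) - f (g t₀) - f' (g t - g t₀)) (𝓝 t₀)).trans_isLittleO
      (hf.isLittleO.comp_tendsto hgs')
    refine h2.congr_left fun t => ?_
    rw [map_sub, hL]
  have h3 : (fun t => g t - g t₀) =O[𝓝 t₀] fun t => L (f (g t) - f (g t₀)) := by
    have := (h1.neg_left).right_isBigO_sub
    refine this.trans (Asymptotics.isBigO_of_le _ fun t => le_of_eq ?_)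
    congr 1; abel
  have h4 : HasDerivAt (fun t => L (f (g t))) (L v) t₀ := L.hasFDerivAt.comp_hasDerivAt t₀ hfg
  have h5 : (fun t => L (f (g t) - f (g t₀))) =O[𝓝 t₀] fun t => t - t₀ := by
    have := h4.hasFDerivAt.isBigO_sub
    refine this.congr_left fun t => ?_
    rw [map_sub]
  have h6 : HasDerivAt g (L v) t₀ := by
    rw [hasDerivAt_iff_isLittleO] at h4 ⊢
    have h7 := h4.sub (h1.trans_isBigO (h3.trans h5))
    refine h7.congr_left fun t => ?_
    rw [map_sub]; abel
  exact ⟨L v, h6, (hf.comp_hasDerivAt t₀ h6 hgs).unique hfg⟩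

end Slopes

section Curves

variable {V : Type*} [NormedAddCommGroup V] [NormedSpace ℝ V]
  {B : Type*} [TopologicalSpace B] {I : ModelWithCorners ℝ V B}
  {X : Type*} [TopologicalSpace X] [ChartedSpace B X] [IsManifold I ∞ X]
  {V' : Type*} [NormedAddCommGroup V'] [NormedSpace ℝ V']
  {B' : Type*} [TopologicalSpace B'] {I' : ModelWithCorners ℝ V' B'}
  {Y : Type*} [TopologicalSpace Y] [ChartedSpace B' Y] [IsManifold I' ∞ Y]

variable (I) in
/-- The velocity of a curve. -/
def velocity (c : ℝ → X) (t : ℝ) : TangentSpace I (c t) := mfderiv 𝓘(ℝ, ℝ) I c t (1 : ℝ)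

theorem hasDerivAt_chart_curve {c : ℝ → X} {t : ℝ} (hc : MDifferentiableAt 𝓘(ℝ, ℝ) I c t) {x₀ : X}
    (hx : c t ∈ (extChartAt I x₀).source) :
    HasDerivAt (fun t => extChartAt I x₀ (c t)) (tcoord I x₀ (c t) (velocity I c t)) t := by
  have hx' : c t ∈ (chartAt B x₀).source := by rwa [← extChartAt_source (I := I)]
  have h1 : HasMFDerivAt I 𝓘(ℝ, V) (extChartAt I x₀) (c t) (tcoord I x₀ (c t)) :=
    (mdifferentiableAt_extChartAt hx').hasMFDerivAt
  have h2 : HasFDerivAt (fun t => extChartAt I x₀ (c t))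
      (((tcoord I x₀ (c t)).comp (mfderiv 𝓘(ℝ, ℝ) I c t) : ℝ →L[ℝ] V)) t :=
    (h1.comp t hc.hasMFDerivAt).hasFDerivAt
  exact h2.hasDerivAt

theorem mdifferentiableAt_curve_of_chart {c : ℝ → X} {t : ℝ} (hc : ContinuousAt c t) {x₀ : X}
    (hx : c t ∈ (extChartAt I x₀).source)
    (hd : DifferentiableAt ℝ (fun t => extChartAt I x₀ (c t)) t) : MDifferentiableAt 𝓘(ℝ, ℝ) I c t := by
  have hx' : c t ∈ (chartAt B x₀).source := by rwa [← extChartAt_source (I := I)]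
  have : IsManifold I 1 X := IsManifold.of_le (n := ∞) (by simp)
  exact (mdifferentiableAt_iff_target_of_mem_source hx').2 ⟨hc, hd.mdifferentiableAt⟩

theorem oneForm_velocity_eq (θ : ∀ x : X, TangentSpace I x →L[ℝ] ℝ) {c : ℝ → X} {t : ℝ} {x₀ : X}
    (hx : c t ∈ (extChartAt I x₀).source) :
    θ (c t) (velocity I c t)
      = oneFormInChart I θ x₀ (extChartAt I x₀ (c t)) (tcoord I x₀ (c t) (velocity I c t)) :=
  (oneFormInChart_tcoord θ hx _).symm

theorem velocity_comp {f : Y → X} {c : ℝ → Y} {t : ℝ} (hf : MDifferentiableAt I' I f (c t))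
    (hc : MDifferentiableAt 𝓘(ℝ, ℝ) I' c t) :
    (velocity I (fun t => f (c t)) t : V) = mfderiv I' I f (c t) (velocity I' c t) := by
  have h := (hf.hasMFDerivAt.comp t hc.hasMFDerivAt).mfderiv
  exact DFunLike.congr_fun h (1 : ℝ)

theorem hasDerivAt_comp_curve {f : X → ℝ} {c : ℝ → X} {t : ℝ}
    (hf : MDifferentiableAt I 𝓘(ℝ, ℝ) f (c t)) (hc : MDifferentiableAt 𝓘(ℝ, ℝ) I c t) :
    HasDerivAt (fun t => f (c t)) (mfderiv I 𝓘(ℝ, ℝ) f (c t) (velocity I c t) : ℝ) t :=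
  have h2 : HasFDerivAt (fun t => f (c t))
      (((mfderiv I 𝓘(ℝ, ℝ) f (c t)).comp (mfderiv 𝓘(ℝ, ℝ) I c t) : ℝ →L[ℝ] ℝ)) t :=
    (hf.hasMFDerivAt.comp t hc.hasMFDerivAt).hasFDerivAt
  have h3 : ∀ L : ℝ →L[ℝ] ℝ, HasFDerivAt (fun t => f (c t)) L t →
      HasDerivAt (fun t => f (c t)) (L 1) t := fun _ h => h.hasDerivAt
  h3 _ h2

/-- A continuous curve is differentiable if its composition with a map with injective derivative is. -/
theorem mdifferentiableAt_of_comp_injective [FiniteDimensional ℝ V] [FiniteDimensional ℝ V']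
    {f : Y → X} {c : ℝ → Y} {t : ℝ} (hf : MDifferentiableAt I' I f (c t))
    (hinj : Function.Injective (mfderiv I' I f (c t))) (hc : ContinuousAt c t)
    (hfc : MDifferentiableAt 𝓘(ℝ, ℝ) I (fun t => f (c t)) t) : MDifferentiableAt 𝓘(ℝ, ℝ) I' c t := by
  have hsrc : ∀ᶠ s in 𝓝 t, c s ∈ (extChartAt I' (c t)).source :=
    hc (extChartAt_source_mem_nhds (I := I') (c t))
  have h1 : HasFDerivWithinAt (writtenInExtChartAt I' I (c t) f) (mfderiv I' I f (c t))
      (range I') (extChartAt I' (c t) (c t)) := hf.hasMFDerivAt.2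
  have h2 := hasDerivAt_chart_curve hfc (x₀ := f (c t)) (mem_extChartAt_source (f (c t)))
  have h3 : (fun s => writtenInExtChartAt I' I (c t) f (extChartAt I' (c t) (c s)))
      =ᶠ[𝓝 t] fun s => extChartAt I (f (c t)) (f (c s)) := by
    filter_upwards [hsrc] with s hs
    simp only [writtenInExtChartAt, Function.comp_apply, (extChartAt I' (c t)).left_inv hs]
  obtain ⟨w, hw, -⟩ := exists_hasDerivAt_of_comp_injective
    (g := fun s => extChartAt I' (c t) (c s)) h1 hinj
    (hsrc.mono fun s hs => extChartAt_target_subset_range (c t) ((extChartAt I' (c t)).map_source hs))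
    ((continuousAt_extChartAt (I := I') (c t)).comp hc) (h2.congr_of_eventuallyEq h3)
  exact mdifferentiableAt_curve_of_chart hc (mem_extChartAt_source (c t)) hw.differentiableAt

end Curves

section ImplicitFunction

variable {V G : Type*} [NormedAddCommGroup V] [NormedSpace ℝ V] [FiniteDimensional ℝ V]
  [NormedAddCommGroup G] [NormedSpace ℝ G] [FiniteDimensional ℝ G]

theorem exists_clm_proj (N : Submodule ℝ V) : ∃ π : V →L[ℝ] N, ∀ x : N, π x = x := by
  obtain ⟨p, hp⟩ := LinearMap.exists_leftInverse_of_injective N.subtype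
    (LinearMap.ker_eq_bot.2 N.injective_subtype)
  exact ⟨LinearMap.toContinuousLinearMap p, fun x => LinearMap.congr_fun hp x⟩

/-- A family of level sets `{g (τ, ·) = 0}`, with `g` submersive in the second variable, has a smooth
parametrization. -/
theorem exists_implicit_family {g : ℝ × V → G} {W : Set (ℝ × V)} (hW : IsOpen W)
    (hg : ContDiffOn ℝ ∞ g W) {τ₀ : ℝ} {v₀ : V} (h0 : (τ₀, v₀) ∈ W)
    (hsurj : Function.Surjective (fun v => fderiv ℝ g (τ₀, v₀) (0, v))) (hg0 : g (τ₀, v₀) = 0) :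
    ∃ (N : Submodule ℝ V) (π : V →L[ℝ] N) (f : ℝ × N → V) (r : ℝ), 0 < r ∧
      ContDiffOn ℝ ∞ f (Metric.ball (τ₀, 0) r) ∧
      (∀ p ∈ Metric.ball ((τ₀, 0) : ℝ × N) r, (p.1, f p) ∈ W ∧ g (p.1, f p) = 0) ∧
      ∀ s > 0, ∀ᶠ q in 𝓝 (τ₀, v₀), g q = 0 →
        (q.1, π (q.2 - v₀)) ∈ Metric.ball ((τ₀, 0) : ℝ × N) s ∧ f (q.1, π (q.2 - v₀)) = q.2 := by
  set A := fderiv ℝ g (τ₀, v₀) with hA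
  set Av : V →L[ℝ] G := A.comp (ContinuousLinearMap.inr ℝ ℝ V) with hAv
  set N : Submodule ℝ V := Av.ker with hN
  obtain ⟨π, hπ⟩ := exists_clm_proj N
  set Φ : ℝ × V → ℝ × G × N := fun q => (q.1, g q, π (q.2 - v₀)) with hΦ
  set Φ' : (ℝ × V →L[ℝ] G) → ℝ × V →L[ℝ] ℝ × G × N := fun A =>
    (ContinuousLinearMap.fst ℝ ℝ V).prod (A.prod (π.comp (ContinuousLinearMap.snd ℝ ℝ V))) with hΦ'
  have hΦd : ∀ q ∈ W, HasFDerivAt Φ (Φ' (fderiv ℝ g q)) q := by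
    intro q hq
    have h1 : HasFDerivAt g (fderiv ℝ g q) q :=
      ((hg.contDiffAt (hW.mem_nhds hq)).differentiableAt (by simp)).hasFDerivAt
    have h2 : HasFDerivAt (fun q : ℝ × V => π (q.2 - v₀)) (π.comp (ContinuousLinearMap.snd ℝ ℝ V)) q :=
      π.hasFDerivAt.comp q (hasFDerivAt_snd.sub_const v₀)
    exact hasFDerivAt_fst.prodMk (h1.prodMk h2)
  have hΦc : ∀ q ∈ W, ContDiffAt ℝ ∞ Φ q := by
    intro q hq
    exact contDiffAt_fst.prodMk ((hg.contDiffAt (hW.mem_nhds hq)).prodMk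
      (π.contDiff.contDiffAt.comp q (contDiffAt_snd.sub contDiffAt_const)))
  have hinj : Function.Injective (Φ' A) := by
    rw [injective_iff_map_eq_zero]
    rintro ⟨s, v⟩ h
    have h1 : s = 0 := congrArg Prod.fst h
    subst h1
    have h2 : A (0, v) = 0 := congrArg (fun x => x.2.1) h
    have h3 : π v = 0 := congrArg (fun x => x.2.2) h
    have h4 : v ∈ N := by
      rw [hN, LinearMap.mem_ker]; exact h2
    have h5 := hπ ⟨v, h4⟩
    rw [h3] at h5
    have h6 : v = 0 := (congrArg Subtype.val h5).symm
    rw [h6]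
    rfl
  have hsur : Function.Surjective (Φ' A) := by
    rintro ⟨s, a, n⟩
    obtain ⟨w, hw⟩ := hsurj (a - A (s, 0))
    have hw' : A (0, w) = a - A (s, 0) := hw
    refine ⟨(s, w - (π w : V) + n), ?_⟩
    have hker : ∀ m : N, A (0, (m : V)) = 0 := fun m => m.2
    have e : ((s, w - (π w : V) + n) : ℝ × V) = (s, 0) + (0, w) - (0, (π w : V)) + (0, (n : V)) := by
      ext <;> simp
    refine Prod.ext rfl (Prod.ext ?_ ?_)
    · show A (s, w - (π w : V) + n) = a
      rw [e, map_add, map_sub, map_add, hker, hker, hw']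
      abel
    · show π (w - (π w : V) + n) = n
      rw [map_add, map_sub, hπ, hπ]
      abel
  set e₀ : (ℝ × V) ≃L[ℝ] ℝ × G × N := ContinuousLinearEquiv.ofBijective (Φ' A)
    (LinearMap.ker_eq_bot.2 hinj) (LinearMap.range_eq_top.2 hsur) with he₀
  have he₀' : (e₀ : (ℝ × V) →L[ℝ] ℝ × G × N) = Φ' A := rfl
  set e := ContDiffAt.toOpenPartialHomeomorph Φ (hΦc _ h0) (f' := e₀) (hΦd _ h0) (by simp) with he
  have heΦ : ⇑e = Φ := ContDiffAt.toOpenPartialHomeomorph_coe _ _ _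
  have hsrc : (τ₀, v₀) ∈ e.source := ContDiffAt.mem_toOpenPartialHomeomorph_source _ _ _
  have heq : e (τ₀, v₀) = (τ₀, 0, 0) := by
    rw [heΦ, hΦ]
    simp [hg0]
  have htgt : ((τ₀, 0, 0) : ℝ × G × N) ∈ e.target := heq ▸ e.map_source hsrc
  have hsymm0 : e.symm (τ₀, 0, 0) = (τ₀, v₀) := by rw [← heq, e.left_inv hsrc]
  have hcs : ContinuousAt e.symm (τ₀, 0, 0) := e.continuousAt_symm htgt
  have hΦ'c : ContinuousAt (fun q => Φ' (fderiv ℝ g q)) (τ₀, v₀) := by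
    have h1 : ContinuousAt (fderiv ℝ g) (τ₀, v₀) :=
      ((hg.contDiffAt (hW.mem_nhds h0)).fderiv_right (m := 0) (by simp)).continuousAt
    have h2 : ∀ C : ℝ × V →L[ℝ] G, Φ' C = Φ' 0 + (ContinuousLinearMap.inr ℝ ℝ (G × N)).comp
        ((ContinuousLinearMap.inl ℝ G N).comp C) := by
      intro C
      ext v <;> simp [hΦ']
    rw [show (fun q => Φ' (fderiv ℝ g q)) = fun q => Φ' 0 + (ContinuousLinearMap.inr ℝ ℝ (G × N)).comp
        ((ContinuousLinearMap.inl ℝ G N).comp (fderiv ℝ g q)) from funext fun q => h2 _]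
    exact continuousAt_const.add (continuousAt_const.clm_comp (continuousAt_const.clm_comp h1))
  have hinv : ∀ᶠ q in 𝓝 (τ₀, v₀), q ∈ W ∧ ∃ e' : (ℝ × V) ≃L[ℝ] ℝ × G × N,
      (e' : (ℝ × V) →L[ℝ] ℝ × G × N) = Φ' (fderiv ℝ g q) := by
    have h1 : ∀ᶠ q in 𝓝 (τ₀, v₀), q ∈ W := hW.mem_nhds h0
    have h2 : range ((↑) : ((ℝ × V) ≃L[ℝ] ℝ × G × N) → (ℝ × V) →L[ℝ] ℝ × G × N)
        ∈ 𝓝 (Φ' (fderiv ℝ g (τ₀, v₀))) := by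
      rw [← hA, ← he₀']
      exact ContinuousLinearEquiv.nhds e₀
    exact h1.and ((hΦ'c.eventually_mem h2).mono fun q hq => hq)
  have hι : Continuous (fun p : ℝ × N => ((p.1, 0, p.2) : ℝ × G × N)) := by fun_prop
  have hgood : ∀ᶠ p in 𝓝 ((τ₀, 0) : ℝ × N), (p.1, (0 : G), p.2) ∈ e.target ∧
      e.symm (p.1, 0, p.2) ∈ W ∧ ∃ e' : (ℝ × V) ≃L[ℝ] ℝ × G × N,
      (e' : (ℝ × V) →L[ℝ] ℝ × G × N) = Φ' (fderiv ℝ g (e.symm (p.1, 0, p.2))) := by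
    have h1 : ∀ᶠ p in 𝓝 ((τ₀, 0) : ℝ × N), (p.1, (0 : G), p.2) ∈ e.target :=
      hι.continuousAt (e.open_target.mem_nhds htgt)
    have h2 : Tendsto (fun p : ℝ × N => e.symm (p.1, 0, p.2)) (𝓝 (τ₀, 0)) (𝓝 (τ₀, v₀)) := by
      have := hcs.tendsto.comp (hι.tendsto ((τ₀, 0) : ℝ × N))
      rwa [hsymm0] at this
    exact h1.and (h2.eventually hinv)
  obtain ⟨r, hr, hball⟩ := Metric.eventually_nhds_iff_ball.1 hgood
  have hfst : ∀ p ∈ Metric.ball ((τ₀, 0) : ℝ × N) r,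
      Φ (e.symm (p.1, 0, p.2)) = (p.1, 0, p.2) := by
    intro p hp
    have := e.right_inv (hball p hp).1
    rwa [heΦ] at this
  refine ⟨N, π, fun p => (e.symm (p.1, 0, p.2)).2, r, hr, ?_, ?_, ?_⟩
  · intro p hp
    obtain ⟨h1, h2, e', h3⟩ := hball p hp
    have h4 : ContDiffAt ℝ ∞ e.symm (p.1, 0, p.2) := by
      refine e.contDiffAt_symm (f₀' := e') h1 ?_ ?_
      · rw [heΦ, h3]; exact hΦd _ h2
      · rw [heΦ]; exact hΦc _ h2
    have h5 : ContDiffAt ℝ ∞ (fun p : ℝ × N => ((p.1, 0, p.2) : ℝ × G × N)) p :=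
      contDiffAt_fst.prodMk (contDiffAt_const.prodMk contDiffAt_snd)
    exact (contDiffAt_snd.comp p (h4.comp p h5)).contDiffWithinAt
  · intro p hp
    have h1 := hfst p hp
    have h2 : (e.symm (p.1, 0, p.2)).1 = p.1 := congrArg Prod.fst h1
    have h3 : g (e.symm (p.1, 0, p.2)) = 0 := congrArg (fun x => x.2.1) h1
    have h4 : ((p.1, (e.symm (p.1, 0, p.2)).2) : ℝ × V) = e.symm (p.1, 0, p.2) :=
      Prod.ext h2.symm rfl
    rw [h4]
    exact ⟨(hball p hp).2.1, h3⟩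
  · intro s hs
    have h1 : ∀ᶠ q in 𝓝 (τ₀, v₀), q ∈ e.source := e.open_source.mem_nhds hsrc
    have h2 : Tendsto (fun q : ℝ × V => ((q.1, π (q.2 - v₀)) : ℝ × N)) (𝓝 (τ₀, v₀)) (𝓝 (τ₀, 0)) := by
      have : Continuous (fun q : ℝ × V => ((q.1, π (q.2 - v₀)) : ℝ × N)) := by fun_prop
      have := this.tendsto (τ₀, v₀)
      simpa using this
    filter_upwards [h1, h2 (Metric.ball_mem_nhds _ hs)] with q hq1 hq2 hgq
    refine ⟨hq2, ?_⟩
    have h3 : ((q.1, 0, π (q.2 - v₀)) : ℝ × G × N) = e q := by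
      rw [heΦ, hΦ]; simp [hgq]
    show (e.symm (q.1, 0, π (q.2 - v₀))).2 = q.2
    rw [h3, e.left_inv hq1]

end ImplicitFunction

section FamilyChart

variable {V : Type*} [NormedAddCommGroup V] [NormedSpace ℝ V] [FiniteDimensional ℝ V]
  {B : Type*} [TopologicalSpace B] {I : ModelWithCorners ℝ V B}
  {X : Type*} [TopologicalSpace X] [ChartedSpace B X] [IsManifold I ∞ X]
  {θ : ∀ x : X, TangentSpace I x →L[ℝ] ℝ}

/-- `P` is a primitive of `θ` on the submanifold `L`. -/
def IsPrimitiveOn (θ : ∀ x : X, TangentSpace I x →L[ℝ] ℝ) (L : Set X) (P : X → ℝ) : Prop :=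
  ContMDiff I 𝓘(ℝ, ℝ) ∞ P ∧ ∀ x ∈ L, ∀ v ∈ tangentTo I L x, (mfderiv I 𝓘(ℝ, ℝ) P x v : ℝ) = θ x v

theorem velocity_mem_tangentTo {L : Set X} {γ : ℝ → X} {s : ℝ} (hγ : ContMDiffAt 𝓘(ℝ, ℝ) I ∞ γ s)
    (hL : ∀ᶠ t in 𝓝 s, γ t ∈ L) : velocity I γ s ∈ tangentTo I L (γ s) := by
  have hadd : Tendsto (fun t : ℝ => s + t) (𝓝 0) (𝓝 s) := by
    have : Continuous (fun t : ℝ => s + t) := by fun_prop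
    simpa using this.tendsto 0
  have h0 : s + 0 = s := add_zero s
  have hγ' : ContMDiffAt 𝓘(ℝ, ℝ) I ∞ γ (s + 0) := by rwa [h0]
  have hlin : ContMDiffAt 𝓘(ℝ, ℝ) 𝓘(ℝ, ℝ) ∞ (fun t : ℝ => s + t) 0 :=
    (contDiff_const.add contDiff_id).contMDiff.contMDiffAt
  refine ⟨fun t => γ (s + t), ContMDiffAt.comp 0 hγ' hlin, hadd.eventually hL, by show γ (s + 0) = γ s; rw [h0], ?_⟩
  have h1 := velocity_comp (I := I) (I' := 𝓘(ℝ, ℝ)) (f := γ) (c := fun t => s + t) (t := 0)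
    (hγ'.mdifferentiableAt (by simp)) (hlin.mdifferentiableAt (by simp))
  have h2 : (velocity 𝓘(ℝ, ℝ) (fun t : ℝ => s + t) 0 : ℝ) = 1 := by
    have h3 : HasDerivAt (fun t : ℝ => s + t) 1 0 := (hasDerivAt_id (0 : ℝ)).const_add s
    unfold velocity
    rw [mfderiv_eq_fderiv]
    have := h3.hasFDerivAt.fderiv
    rw [this]
    exact one_smul ℝ (1 : ℝ)
  have h4 : ∀ s', s' = s → (mfderiv 𝓘(ℝ, ℝ) I γ s' (1 : ℝ) : V) = mfderiv 𝓘(ℝ, ℝ) I γ s (1 : ℝ) := by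
    rintro _ rfl; rfl
  exact (h1.trans (congrArg (fun r : ℝ => (mfderiv 𝓘(ℝ, ℝ) I γ (s + 0) r : V)) h2)).trans (h4 _ h0)

theorem IsPrimitiveOn.hasDerivAt {L : Set X} {P : X → ℝ} (hP : IsPrimitiveOn θ L P) {γ : ℝ → X} {s : ℝ}
    (hγ : ContMDiffAt 𝓘(ℝ, ℝ) I ∞ γ s) (hL : ∀ᶠ t in 𝓝 s, γ t ∈ L) :
    HasDerivAt (fun t => P (γ t)) (θ (γ s) (velocity I γ s)) s := by
  rw [← hP.2 (γ s) hL.self_of_nhds _ (velocity_mem_tangentTo hγ hL)]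
  exact hasDerivAt_comp_curve ((hP.1 (γ s)).mdifferentiableAt (by simp)) (hγ.mdifferentiableAt (by simp))

/-- Along all curves through `x₁` in a family of submanifolds, the variation of the normalized primitive
differs from the integral of `θ` by at most `C`. -/
def SlopeBound (θ : ∀ x : X, TangentSpace I x →L[ℝ] ℝ) (L : ℝ → Set X) (P : ℝ → X → ℝ) (a : ℝ → ℝ)
    (C τ₁ : ℝ) (x₁ : X) : Prop :=
  ∀ c : ℝ → X, MDifferentiableAt 𝓘(ℝ, ℝ) I c τ₁ → c τ₁ = x₁ → (∀ᶠ τ in 𝓝 τ₁, c τ ∈ L τ) →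
    ∀ᶠ τ in 𝓝 τ₁, |P τ (c τ) - a τ - (P τ₁ (c τ₁) - a τ₁)
      - (τ - τ₁) * θ (c τ₁) (velocity I c τ₁)| ≤ C * |τ - τ₁|

/-- A smooth family of submanifolds has local coordinates. -/
theorem exists_family_coordinates {T : Set ℝ} {L : ℝ → Set X} {τ₀ : ℝ} {x₀ : X} (hx₀ : x₀ ∈ L τ₀)
    (hint : I.IsInteriorPoint x₀)
    (hsub : ∃ (k : ℕ) (O : Set (ℝ × X)) (g : ℝ × X → (Fin k → ℝ)),
      IsOpen O ∧ (τ₀, x₀) ∈ O ∧ O ⊆ T ×ˢ univ ∧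
      ContMDiffOn (𝓘(ℝ, ℝ).prod I) 𝓘(ℝ, Fin k → ℝ) ∞ g O ∧
      (∀ q ∈ O, Function.Surjective (mfderiv I 𝓘(ℝ, Fin k → ℝ) (fun y => g (q.1, y)) q.2)) ∧
      {q ∈ O | q.2 ∈ L q.1} = {q ∈ O | g q = 0}) :
    ∃ (N : Submodule ℝ V) (π : V →L[ℝ] N) (f : ℝ × N → V) (r : ℝ), 0 < r ∧
      ContDiffOn ℝ ∞ f (Metric.ball (τ₀, 0) r) ∧
      (∀ p ∈ Metric.ball ((τ₀, 0) : ℝ × N) r, p.1 ∈ T ∧ f p ∈ interior (extChartAt I x₀).target ∧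
        (extChartAt I x₀).symm (f p) ∈ L p.1) ∧
      ∀ s > 0, ∀ᶠ q in 𝓝 (τ₀, x₀), q.2 ∈ (extChartAt I x₀).source ∧ (q.2 ∈ L q.1 →
        (q.1, π (extChartAt I x₀ q.2 - extChartAt I x₀ x₀)) ∈ Metric.ball ((τ₀, 0) : ℝ × N) s ∧
        f (q.1, π (extChartAt I x₀ q.2 - extChartAt I x₀ x₀)) = extChartAt I x₀ q.2) := by
  obtain ⟨k, O, g, hO, h0O, hOT, hg, hgs, hgL⟩ := hsub
  set φ := extChartAt I x₀ with hφ
  set v₀ := φ x₀ with hv₀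
  have hv₀i : v₀ ∈ interior φ.target := ModelWithCorners.isInteriorPoint_iff.1 hint
  have hsymm0 : φ.symm v₀ = x₀ := extChartAt_to_inv x₀
  set W : Set (ℝ × V) := (univ ×ˢ interior φ.target) ∩ (fun q => (q.1, φ.symm q.2)) ⁻¹' O with hW
  have hcont : ContinuousOn (fun q : ℝ × V => (q.1, φ.symm q.2)) (univ ×ˢ interior φ.target) := by
    refine continuousOn_fst.prodMk ((continuousOn_extChartAt_symm x₀).comp continuousOn_snd ?_)
    exact fun q hq => interior_subset hq.2
  have hWo : IsOpen W := hcont.isOpen_inter_preimage (isOpen_univ.prod isOpen_interior) hO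
  have hW0 : (τ₀, v₀) ∈ W := ⟨⟨mem_univ _, hv₀i⟩, by
    show (τ₀, φ.symm v₀) ∈ O
    rwa [hsymm0]⟩
  have hgd : ContDiffOn ℝ ∞ (fun q : ℝ × V => g (q.1, φ.symm q.2)) W := by
    have h1 : ContMDiffOn 𝓘(ℝ, ℝ × V) (𝓘(ℝ, ℝ).prod I) ∞
        (fun q : ℝ × V => ((q.1, φ.symm q.2) : ℝ × X)) W := by
      refine contDiff_fst.contMDiff.contMDiffOn.prodMk ?_
      exact (contMDiffOn_extChartAt_symm x₀).comp contDiff_snd.contMDiff.contMDiffOn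
        fun q hq => (interior_subset hq.1.2 : q.2 ∈ φ.target)
    exact (hg.comp h1 fun q hq => hq.2).contDiffOn
  have hsurj : Function.Surjective
      (fun v => fderiv ℝ (fun q : ℝ × V => g (q.1, φ.symm q.2)) (τ₀, v₀) (0, v)) := by
    intro y
    obtain ⟨w, hw⟩ := hgs _ h0O y
    have hι : ContMDiffAt I (𝓘(ℝ, ℝ).prod I) ∞ (fun y : X => ((τ₀, y) : ℝ × X)) x₀ :=
      contMDiffAt_const.prodMk contMDiffAt_id
    have hmd : MDifferentiableAt I 𝓘(ℝ, Fin k → ℝ) (fun y => g (τ₀, y)) x₀ :=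
      ((hg.contMDiffAt (hO.mem_nhds h0O)).comp x₀ hι).mdifferentiableAt (by simp)
    have h1 := mfderiv_eq_fderivWithin_tcoord (mem_extChartAt_source (I := I) x₀) hmd w
    refine ⟨tcoord I x₀ x₀ w, ?_⟩
    have h2 : fderivWithin ℝ (fun e => g (τ₀, φ.symm e)) φ.target v₀
        = fderiv ℝ (fun e => g (τ₀, φ.symm e)) v₀ :=
      fderivWithin_of_mem_nhds (mem_interior_iff_mem_nhds.1 hv₀i)
    have h3 : HasFDerivAt (fun q : ℝ × V => g (q.1, φ.symm q.2))
        (fderiv ℝ (fun q : ℝ × V => g (q.1, φ.symm q.2)) (τ₀, v₀)) (τ₀, v₀) :=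
      ((hgd.contDiffAt (hWo.mem_nhds hW0)).differentiableAt (by simp)).hasFDerivAt
    have h4 := (HasFDerivAt.comp (f := fun e : V => ((τ₀, e) : ℝ × V)) v₀ h3
      (hasFDerivAt_prodMk_right τ₀ v₀)).fderiv
    have h5 : fderiv ℝ (fun e => g (τ₀, φ.symm e)) v₀ (tcoord I x₀ x₀ w)
        = fderiv ℝ (fun q : ℝ × V => g (q.1, φ.symm q.2)) (τ₀, v₀) (0, tcoord I x₀ x₀ w) :=
      DFunLike.congr_fun h4 _
    exact h5.symm.trans ((DFunLike.congr_fun h2 _).symm.trans (h1.symm.trans hw))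
  have hmem : ∀ q ∈ O, q.2 ∈ L q.1 ↔ g q = 0 := by
    intro q hq
    have := Set.ext_iff.1 hgL q
    exact ⟨fun h => (this.1 ⟨hq, h⟩).2, fun h => (this.2 ⟨hq, h⟩).2⟩
  have hg0 : (fun q : ℝ × V => g (q.1, φ.symm q.2)) (τ₀, v₀) = 0 := by
    show g (τ₀, φ.symm v₀) = 0
    rw [hsymm0]
    exact (hmem _ h0O).1 hx₀
  obtain ⟨N, π, f, r, hr, hf, hfW, hret⟩ := exists_implicit_family hWo hgd hW0 hsurj hg0
  refine ⟨N, π, f, r, hr, hf, fun p hp => ?_, fun s hs => ?_⟩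
  · obtain ⟨h1, h2⟩ := hfW p hp
    exact ⟨(hOT h1.2).1, h1.1.2, (hmem _ h1.2).2 h2⟩
  · have hc : Tendsto (fun q : ℝ × X => (q.1, φ q.2)) (𝓝 (τ₀, x₀)) (𝓝 (τ₀, v₀)) :=
      continuousAt_fst.prodMk
        (ContinuousAt.comp (g := φ) (continuousAt_extChartAt x₀) continuousAt_snd)
    have hsrc : ∀ᶠ q in 𝓝 (τ₀, x₀), q.2 ∈ φ.source :=
      continuousAt_snd (extChartAt_source_mem_nhds (I := I) x₀)
    have hOn : ∀ᶠ q in 𝓝 (τ₀, x₀), q ∈ O := hO.mem_nhds h0O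
    filter_upwards [hc.eventually (hret s hs), hsrc, hOn] with q h1 h2 h3
    refine ⟨h2, fun hq => h1 ?_⟩
    show g (q.1, φ.symm (φ q.2)) = 0
    rw [φ.left_inv h2]
    exact (hmem q h3).1 hq

end FamilyChart

section FamilySlope

variable {V : Type*} [NormedAddCommGroup V] [NormedSpace ℝ V] [FiniteDimensional ℝ V]
  {B : Type*} [TopologicalSpace B] {I : ModelWithCorners ℝ V B}
  {X : Type*} [TopologicalSpace X] [ChartedSpace B X] [IsManifold I ∞ X]
  {θ : ∀ x : X, TangentSpace I x →L[ℝ] ℝ}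

theorem contMDiffAt_extChartAt_symm_comp {Y : Type*} [NormedAddCommGroup Y] [NormedSpace ℝ Y]
    {γ : Y → V} {s : Y} {x₀ : X} (hγ : ContDiffAt ℝ ∞ γ s)
    (hs : γ s ∈ interior (extChartAt I x₀).target) :
    ContMDiffAt 𝓘(ℝ, Y) I ∞ (fun t => (extChartAt I x₀).symm (γ t)) s :=
  ContMDiffAt.comp s ((contMDiffOn_extChartAt_symm x₀).contMDiffAt (mem_interior_iff_mem_nhds.1 hs))
    hγ.contMDiffAt

theorem IsPrimitiveOn.hasDerivAt_chart {L : Set X} {P : X → ℝ} (hP : IsPrimitiveOn θ L P) {γ : ℝ → V}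
    {s : ℝ} {x₀ : X} {v : V} (hγ : ContDiffAt ℝ ∞ γ s) (hv : HasDerivAt γ v s)
    (hs : γ s ∈ interior (extChartAt I x₀).target)
    (hL : ∀ᶠ t in 𝓝 s, (extChartAt I x₀).symm (γ t) ∈ L) :
    HasDerivAt (fun t => P ((extChartAt I x₀).symm (γ t))) (oneFormInChart I θ x₀ (γ s) v) s := by
  have h1 := contMDiffAt_extChartAt_symm_comp hγ hs
  have h2 := hP.hasDerivAt h1 hL
  have hsrc : (extChartAt I x₀).symm (γ s) ∈ (extChartAt I x₀).source :=
    (extChartAt I x₀).map_target (interior_subset hs)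
  have hinv : ∀ᶠ t in 𝓝 s, extChartAt I x₀ ((extChartAt I x₀).symm (γ t)) = γ t := by
    filter_upwards [hγ.continuousAt (isOpen_interior.mem_nhds hs)] with t ht
    exact (extChartAt I x₀).right_inv (interior_subset ht)
  have h3 := hasDerivAt_chart_curve (h1.mdifferentiableAt (by simp)) hsrc
  have h4 := (h3.congr_of_eventuallyEq (hinv.mono fun t ht => ht.symm)).unique hv
  have h5 := oneForm_velocity_eq θ (c := fun t => (extChartAt I x₀).symm (γ t)) hsrc
  have h6 := h5.trans (congrArg₂ (fun a b => oneFormInChart I θ x₀ a b) hinv.self_of_nhds h4)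
  exact h6 ▸ h2

theorem exists_family_chart (hθ : SmoothOneForm I θ) {T : Set ℝ} {L : ℝ → Set X} {P : ℝ → X → ℝ}
    {τ₀ : ℝ} {x₀ : X} (hx₀ : x₀ ∈ L τ₀) (hint : I.IsInteriorPoint x₀)
    (hP : ∀ τ ∈ T, IsPrimitiveOn θ (L τ) (P τ))
    (hsub : ∃ (k : ℕ) (O : Set (ℝ × X)) (g : ℝ × X → (Fin k → ℝ)),
      IsOpen O ∧ (τ₀, x₀) ∈ O ∧ O ⊆ T ×ˢ univ ∧
      ContMDiffOn (𝓘(ℝ, ℝ).prod I) 𝓘(ℝ, Fin k → ℝ) ∞ g O ∧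
      (∀ q ∈ O, Function.Surjective (mfderiv I 𝓘(ℝ, Fin k → ℝ) (fun y => g (q.1, y)) q.2)) ∧
      {q ∈ O | q.2 ∈ L q.1} = {q ∈ O | g q = 0}) :
    ∃ (b : ℝ → ℝ) (C : ℝ), ∀ᶠ q in 𝓝 (τ₀, x₀), (q.2 ∈ L q.1 → SlopeBound θ L P b C q.1 q.2) ∧
      (q.1 = τ₀ → q.2 ∈ L τ₀ → ∃ c : ℝ → X, c τ₀ = q.2 ∧ MDifferentiableAt 𝓘(ℝ, ℝ) I c τ₀ ∧
        ∀ᶠ τ in 𝓝 τ₀, MDifferentiableAt 𝓘(ℝ, ℝ) I c τ ∧ c τ ∈ L τ) := by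
  obtain ⟨N, π, f, r, hr, hf, hfL, hret⟩ := exists_family_coordinates hx₀ hint hsub
  set φ := extChartAt I x₀ with hφ
  set v₀ := φ x₀ with hv₀
  set Θ := oneFormInChart I θ x₀ with hΘ
  set p₀ : ℝ × N := (τ₀, 0) with hp₀
  set h : ℝ → N → ℝ := fun τ y => P τ (φ.symm (f (τ, y))) with hh
  have hfd : ∀ p ∈ Metric.ball p₀ r, ContDiffAt ℝ ∞ f p := fun p hp =>
    hf.contDiffAt (Metric.isOpen_ball.mem_nhds hp)
  have hΘd : ∀ p ∈ Metric.ball p₀ r, ContDiffAt ℝ ∞ (fun p => Θ (f p)) p := fun p hp => by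
    have h1 : ContDiffAt ℝ ∞ Θ (f p) := (contDiffOn_oneFormInChart hθ x₀).contDiffAt
      (mem_interior_iff_mem_nhds.1 (hfL p hp).2.1)
    exact h1.comp p (hfd p hp)
  have hffd : ∀ p ∈ Metric.ball p₀ r, ContDiffAt ℝ ∞ (fderiv ℝ f) p := fun p hp =>
    (hfd p hp).fderiv_right (m := ∞) (by simp)
  set b1 : ℝ × N → N →L[ℝ] ℝ := fun p =>
    (Θ (f p)).comp ((fderiv ℝ f p).comp (ContinuousLinearMap.inr ℝ ℝ N)) with hb1
  set b0 : ℝ × N → ℝ := fun p => Θ (f p) (fderiv ℝ f p (1, 0)) with hb0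
  have hp0r : p₀ ∈ Metric.ball p₀ r := Metric.mem_ball_self hr
  have hb1d : ContDiffAt ℝ ∞ b1 p₀ :=
    (hΘd p₀ hp0r).clm_comp ((hffd p₀ hp0r).clm_comp contDiffAt_const)
  have hb0d : ContDiffAt ℝ ∞ b0 p₀ :=
    (hΘd p₀ hp0r).clm_apply ((hffd p₀ hp0r).clm_apply contDiffAt_const)
  obtain ⟨K, t, ht, hK⟩ := (hb1d.of_le (m := 1) (by simp)).exists_lipschitzOnWith
  have hb0c : ∀ᶠ p in 𝓝 p₀, |b0 p| < |b0 p₀| + 1 :=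
    (hb0d.continuousAt.abs).eventually (gt_mem_nhds (lt_add_one _))
  obtain ⟨s₁, hs₁, hball⟩ := Metric.mem_nhds_iff.1 (inter_mem ht hb0c)
  set s := min s₁ (min r 1) with hs
  have hs0 : 0 < s := lt_min hs₁ (lt_min hr one_pos)
  have hsr : Metric.ball p₀ s ⊆ Metric.ball p₀ r :=
    Metric.ball_subset_ball ((min_le_right _ _).trans (min_le_left _ _))
  have hsb : Metric.ball p₀ s ⊆ t ∩ {p | |b0 p| < |b0 p₀| + 1} :=
    (Metric.ball_subset_ball (min_le_left _ _)).trans hball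
  have hs1 : s ≤ 1 := (min_le_right _ _).trans (min_le_right _ _)
  have hmemball : ∀ (τ : ℝ) (y : N) (a : ℝ), (τ, y) ∈ Metric.ball p₀ a ↔ |τ - τ₀| < a ∧ ‖y‖ < a := by
    intro τ y a
    rw [hp₀, ← ball_prod_same, mem_prod, Metric.mem_ball, Metric.mem_ball, Real.dist_eq,
      dist_zero_right]
  -- the derivative along the submanifold
  have claim1 : ∀ (τ : ℝ) (y y' : N) (σ : ℝ), (τ, y + σ • y') ∈ Metric.ball p₀ r →
      HasDerivAt (fun σ => h τ (y + σ • y')) (b1 (τ, y + σ • y') y') σ := by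
    intro τ y y' σ hσ
    have hlin : HasDerivAt (fun σ : ℝ => ((τ, y + σ • y') : ℝ × N)) (0, y') σ := by
      have := ((hasDerivAt_id σ).smul_const y').const_add y
      simp only [one_smul] at this
      exact (hasDerivAt_const σ τ).prodMk this
    have hlind : ContDiffAt ℝ ∞ (fun σ : ℝ => ((τ, y + σ • y') : ℝ × N)) σ :=
      contDiffAt_const.prodMk (contDiffAt_const.add (contDiffAt_id.smul contDiffAt_const))
    have hγ : ContDiffAt ℝ ∞ (fun σ : ℝ => f (τ, y + σ • y')) σ :=
      ContDiffAt.comp (g := f) σ (hfd _ hσ) hlind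
    have hγ' : HasDerivAt (fun σ : ℝ => f (τ, y + σ • y')) (fderiv ℝ f (τ, y + σ • y') (0, y')) σ :=
      ((hfd _ hσ).differentiableAt (by simp)).hasFDerivAt.comp_hasDerivAt σ hlin
    refine (hP τ (hfL _ hσ).1).hasDerivAt_chart hγ hγ' (hfL _ hσ).2.1 ?_
    filter_upwards [hlind.continuousAt (Metric.isOpen_ball.mem_nhds hσ)] with σ' hσ'
    exact (hfL _ hσ').2.2
  have claim2 : ∀ (τ₁ τ₂ : ℝ) (y : N), (τ₁, y) ∈ Metric.ball p₀ s → (τ₂, y) ∈ Metric.ball p₀ s →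
      |(h τ₂ y - h τ₂ 0) - (h τ₁ y - h τ₁ 0)| ≤ K * |τ₂ - τ₁| := by
    intro τ₁ τ₂ y h1 h2
    have hσ : ∀ τ, (τ, y) ∈ Metric.ball p₀ s → ∀ σ ∈ Icc (0 : ℝ) 1,
        (τ, 0 + σ • y) ∈ Metric.ball p₀ s := by
      intro τ hτ σ hσ
      rw [hmemball] at hτ ⊢
      refine ⟨hτ.1, lt_of_le_of_lt ?_ hτ.2⟩
      rw [zero_add, norm_smul, Real.norm_eq_abs, abs_of_nonneg hσ.1]
      exact mul_le_of_le_one_left (norm_nonneg _) hσ.2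
    have hd : ∀ σ ∈ Icc (0 : ℝ) 1, HasDerivWithinAt (fun σ => h τ₂ (0 + σ • y) - h τ₁ (0 + σ • y))
        (b1 (τ₂, 0 + σ • y) y - b1 (τ₁, 0 + σ • y) y) (Icc 0 1) σ := fun σ hσ' =>
      ((claim1 τ₂ 0 y σ (hsr (hσ τ₂ h2 σ hσ'))).sub
        (claim1 τ₁ 0 y σ (hsr (hσ τ₁ h1 σ hσ')))).hasDerivWithinAt
    have hb : ∀ σ ∈ Ico (0 : ℝ) 1, ‖b1 (τ₂, 0 + σ • y) y - b1 (τ₁, 0 + σ • y) y‖ ≤ K * |τ₂ - τ₁| := by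
      intro σ hσ'
      have h3 := hK.norm_sub_le (hsb (hσ τ₂ h2 σ (Ico_subset_Icc_self hσ'))).1
        (hsb (hσ τ₁ h1 σ (Ico_subset_Icc_self hσ'))).1
      have h4 : ‖((τ₂, 0 + σ • y) : ℝ × N) - (τ₁, 0 + σ • y)‖ = |τ₂ - τ₁| := by
        simp [Prod.norm_def]
      rw [h4] at h3
      have h5 : ‖y‖ ≤ 1 := (((hmemball _ _ _).1 h1).2.le).trans hs1
      rw [← _root_.sub_apply]
      calc _ ≤ ‖b1 (τ₂, 0 + σ • y) - b1 (τ₁, 0 + σ • y)‖ * ‖y‖ := ContinuousLinearMap.le_opNorm _ _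
        _ ≤ (K * |τ₂ - τ₁|) * 1 := by gcongr
        _ = _ := mul_one _
    have h6 := norm_image_sub_le_of_norm_deriv_le_segment_01' hd hb
    simp only [one_smul, zero_smul, zero_add, Real.norm_eq_abs] at h6
    calc _ = |h τ₂ y - h τ₁ y - (h τ₂ 0 - h τ₁ 0)| := by congr 1; ring
      _ ≤ _ := h6
  refine ⟨fun τ => h τ 0, K + (|b0 p₀| + 1) + 1, ?_⟩
  filter_upwards [eventually_eventually_nhds.2 (hret s hs0)] with q hq
  obtain ⟨τ₁, x₁⟩ := q
  refine ⟨fun hx₁ c hc hcx hcL => ?_, fun hτ hx₁ => ?_⟩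
  · dsimp only at hx₁ hc hcx hcL ⊢
    set y : ℝ → N := fun τ => π (φ (c τ) - v₀) with hy
    have hq' : ∀ᶠ τ in 𝓝 τ₁, c τ ∈ φ.source ∧ (τ, y τ) ∈ Metric.ball p₀ s ∧ f (τ, y τ) = φ (c τ) := by
      have hcc : Tendsto (fun τ => (τ, c τ)) (𝓝 τ₁) (𝓝 (τ₁, x₁)) := by
        have := (continuousAt_id (x := τ₁)).prodMk hc.continuousAt
        rw [← hcx]
        exact this
      filter_upwards [hcc.eventually hq, hcL] with τ h1 h2
      exact ⟨h1.1, h1.2 h2⟩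
    obtain ⟨hsrc, hyb, hfy⟩ := hq'.self_of_nhds
    set w := tcoord I x₀ (c τ₁) (velocity I c τ₁) with hw
    have hφc : HasDerivAt (fun τ => φ (c τ)) w τ₁ := hasDerivAt_chart_curve hc hsrc
    have hyd : HasDerivAt y (π w) τ₁ := π.hasFDerivAt.comp_hasDerivAt τ₁ (hφc.sub_const v₀)
    have hyd2 : HasDerivAt (fun τ => (τ, y τ)) ((1 : ℝ), π w) τ₁ := (hasDerivAt_id τ₁).prodMk hyd
    have hfd1 : HasFDerivAt f (fderiv ℝ f (τ₁, y τ₁)) (τ₁, y τ₁) :=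
      ((hfd _ (hsr hyb)).differentiableAt (by simp)).hasFDerivAt
    have hfw : fderiv ℝ f (τ₁, y τ₁) (1, π w) = w :=
      ((hfd1.comp_hasDerivAt τ₁ hyd2).congr_of_eventuallyEq
        (hq'.mono fun τ h => h.2.2.symm)).unique hφc
    have hθ' : θ (c τ₁) (velocity I c τ₁) = b0 (τ₁, y τ₁) + b1 (τ₁, y τ₁) (π w) := by
      rw [oneForm_velocity_eq θ hsrc]
      show Θ (φ (c τ₁)) w = _
      have h1 : ((1 : ℝ), π w) = (1, 0) + (0, π w) := by simp
      rw [← hfy]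
      conv_lhs => rw [← hfw, h1, map_add, map_add]
      rfl
    have hτ1 : τ₁ ∈ T := (hfL _ (hsr hyb)).1
    have hhd : HasDerivAt (fun τ => h τ₁ (y τ)) (b1 (τ₁, y τ₁) (π w)) τ₁ := by
      have h1 : ContDiffAt ℝ ∞ (fun y' : N => f (τ₁, y')) (y τ₁) :=
        ContDiffAt.comp (g := f) _ (hfd _ (hsr hyb)) (contDiffAt_const.prodMk contDiffAt_id)
      have h2 : ContMDiffAt 𝓘(ℝ, N) 𝓘(ℝ, ℝ) ∞ (h τ₁) (y τ₁) :=
        ContMDiffAt.comp (y τ₁) ((hP τ₁ hτ1).1 _) (contMDiffAt_extChartAt_symm_comp h1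
          (hfL _ (hsr hyb)).2.1)
      have h3 : HasFDerivAt (h τ₁) (fderiv ℝ (h τ₁) (y τ₁)) (y τ₁) :=
        (h2.contDiffAt.differentiableAt (by simp)).hasFDerivAt
      have h4 : HasDerivAt (fun σ : ℝ => y τ₁ + σ • π w) (π w) 0 := by
        have := ((hasDerivAt_id (0 : ℝ)).smul_const (π w)).const_add (y τ₁)
        simp only [one_smul] at this
        exact this
      have h0 : y τ₁ + (0 : ℝ) • π w = y τ₁ := by simp
      have h3' : HasFDerivAt (h τ₁) (fderiv ℝ (h τ₁) (y τ₁)) (y τ₁ + (0 : ℝ) • π w) := by rwa [h0]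
      have h5 := h3'.comp_hasDerivAt (0 : ℝ) h4
      have h6 := claim1 τ₁ (y τ₁) (π w) 0 (by rw [h0]; exact hsr hyb)
      rw [h0] at h6
      rw [← h5.unique h6]
      exact h3.comp_hasDerivAt τ₁ hyd
    have ho := hhd.isLittleO.def one_pos
    have hcont : Tendsto (fun τ => (τ₁, y τ)) (𝓝 τ₁) (𝓝 (τ₁, y τ₁)) :=
      continuousAt_const.prodMk hyd.continuousAt
    filter_upwards [ho, hq', hcont (Metric.isOpen_ball.mem_nhds hyb)] with τ h1 h2 h3
    have h4 := claim2 τ₁ τ (y τ) h3 h2.2.1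
    have hPc : ∀ τ', c τ' ∈ φ.source → f (τ', y τ') = φ (c τ') → P τ' (c τ') = h τ' (y τ') := by
      intro τ' h5 h6
      show _ = P τ' (φ.symm (f (τ', y τ')))
      rw [h6, φ.left_inv h5]
    rw [hPc τ h2.1 h2.2.2, hPc τ₁ hsrc hfy, hθ']
    simp only [Real.norm_eq_abs, smul_eq_mul, one_mul] at h1
    have h5 : |(τ - τ₁) * b0 (τ₁, y τ₁)| ≤ (|b0 p₀| + 1) * |τ - τ₁| := by
      rw [abs_mul, mul_comm]
      have : |b0 (τ₁, y τ₁)| ≤ |b0 p₀| + 1 := (hsb hyb).2.le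
      gcongr
    calc _ = |((h τ (y τ) - h τ 0) - (h τ₁ (y τ) - h τ₁ 0))
          + (h τ₁ (y τ) - h τ₁ (y τ₁) - (τ - τ₁) * b1 (τ₁, y τ₁) (π w))
          - (τ - τ₁) * b0 (τ₁, y τ₁)| := by congr 1; ring
      _ ≤ |(h τ (y τ) - h τ 0) - (h τ₁ (y τ) - h τ₁ 0)|
          + |h τ₁ (y τ) - h τ₁ (y τ₁) - (τ - τ₁) * b1 (τ₁, y τ₁) (π w)|
          + |(τ - τ₁) * b0 (τ₁, y τ₁)| := (abs_sub _ _).trans (by gcongr; exact abs_add_le _ _)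
      _ ≤ K * |τ - τ₁| + |τ - τ₁| + (|b0 p₀| + 1) * |τ - τ₁| := by gcongr
      _ = _ := by ring
  · dsimp only at hτ hx₁ ⊢
    subst hτ
    obtain ⟨h1, h2⟩ := hq.self_of_nhds
    obtain ⟨h3, h4⟩ := h2 hx₁
    dsimp only at h1 h3 h4
    set y := π (φ x₁ - v₀) with hy
    have hd : ∀ τ, (τ, y) ∈ Metric.ball p₀ s →
        MDifferentiableAt 𝓘(ℝ, ℝ) I (fun τ => φ.symm (f (τ, y))) τ := by
      intro τ hτ
      have h5 : ContDiffAt ℝ ∞ (fun τ' : ℝ => f (τ', y)) τ :=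
        ContDiffAt.comp (g := f) _ (hfd _ (hsr hτ)) (contDiffAt_id.prodMk contDiffAt_const)
      exact (contMDiffAt_extChartAt_symm_comp h5 (hfL _ (hsr hτ)).2.1).mdifferentiableAt (by simp)
    refine ⟨fun τ => φ.symm (f (τ, y)), ?_, hd _ h3, ?_⟩
    · show φ.symm (f (τ₁, y)) = x₁
      rw [h4, φ.left_inv h1]
    · have hcont : Tendsto (fun τ => (τ, y)) (𝓝 τ₁) (𝓝 (τ₁, y)) :=
        continuousAt_id.prodMk continuousAt_const
      filter_upwards [hcont (Metric.isOpen_ball.mem_nhds h3)] with τ hτ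
      exact ⟨hd τ hτ, (hfL _ (hsr hτ)).2.2⟩

theorem SlopeBound.change {L : ℝ → Set X} {P : ℝ → X → ℝ} {a b : ℝ → ℝ} {C C' τ : ℝ} {x : X}
    (h : SlopeBound θ L P b C τ x)
    (hab : ∀ᶠ τ' in 𝓝 τ, |(a τ' - b τ') - (a τ - b τ)| ≤ C' * |τ' - τ|) :
    SlopeBound θ L P a (C + C') τ x := by
  intro c hc hcx hcL
  filter_upwards [h c hc hcx hcL, hab] with τ' h1 h2
  rw [add_mul]
  refine le_trans ?_ (add_le_add h1 h2)
  rw [show P τ' (c τ') - a τ' - (P τ (c τ) - a τ) - (τ' - τ) * θ (c τ) (velocity I c τ)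
    = (P τ' (c τ') - b τ' - (P τ (c τ) - b τ) - (τ' - τ) * θ (c τ) (velocity I c τ))
      - ((a τ' - b τ') - (a τ - b τ)) by ring]
  exact abs_sub _ _

theorem SlopeBound.compare {L : ℝ → Set X} {P : ℝ → X → ℝ} {a b : ℝ → ℝ} {C C' τ : ℝ} {c : ℝ → X}
    (h : SlopeBound θ L P b C τ (c τ)) (h' : SlopeBound θ L P a C' τ (c τ))
    (hc : MDifferentiableAt 𝓘(ℝ, ℝ) I c τ) (hcL : ∀ᶠ τ in 𝓝 τ, c τ ∈ L τ) :
    ∀ᶠ τ' in 𝓝 τ, |(a τ' - b τ') - (a τ - b τ)| ≤ (C + C') * |τ' - τ| := by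
  filter_upwards [h c hc rfl hcL, h' c hc rfl hcL] with τ' h1 h2
  rw [add_mul]
  refine le_trans ?_ (add_le_add h1 h2)
  rw [show a τ' - b τ' - (a τ - b τ)
    = (P τ' (c τ') - b τ' - (P τ (c τ) - b τ) - (τ' - τ) * θ (c τ) (velocity I c τ))
      - (P τ' (c τ') - a τ' - (P τ (c τ) - a τ) - (τ' - τ) * θ (c τ) (velocity I c τ)) by ring]
  exact abs_sub _ _

/-- A single normalization of the primitives works near every point of a connected fibre. -/
theorem exists_uniform_slopeBound (hθ : SmoothOneForm I θ) {T : Set ℝ} {L : ℝ → Set X} {P : ℝ → X → ℝ}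
    {τ₀ : ℝ} (hconn : IsPreconnected (L τ₀)) (hint : ∀ x ∈ L τ₀, I.IsInteriorPoint x)
    (hP : ∀ τ ∈ T, IsPrimitiveOn θ (L τ) (P τ))
    (hsub : ∀ x ∈ L τ₀, ∃ (k : ℕ) (O : Set (ℝ × X)) (g : ℝ × X → (Fin k → ℝ)),
      IsOpen O ∧ (τ₀, x) ∈ O ∧ O ⊆ T ×ˢ univ ∧
      ContMDiffOn (𝓘(ℝ, ℝ).prod I) 𝓘(ℝ, Fin k → ℝ) ∞ g O ∧
      (∀ q ∈ O, Function.Surjective (mfderiv I 𝓘(ℝ, Fin k → ℝ) (fun y => g (q.1, y)) q.2)) ∧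
      {q ∈ O | q.2 ∈ L q.1} = {q ∈ O | g q = 0}) :
    ∃ a : ℝ → ℝ, ∀ x ∈ L τ₀, ∃ C, ∀ᶠ q in 𝓝 (τ₀, x), q.2 ∈ L q.1 →
      SlopeBound θ L P a C q.1 q.2 := by
  rcases (L τ₀).eq_empty_or_nonempty with h0 | ⟨x₁, hx₁⟩
  · exact ⟨0, fun x hx => by simp [h0] at hx⟩
  have hchart := fun x (hx : x ∈ L τ₀) => exists_family_chart hθ hx (hint x hx) hP (hsub x hx)
  obtain ⟨a, C₁, hC₁⟩ := hchart x₁ hx₁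
  refine ⟨a, fun x hx => ?_⟩
  set G : X → Prop := fun x => ∃ C, ∀ᶠ q in 𝓝 (τ₀, x), q.2 ∈ L q.1 → SlopeBound θ L P a C q.1 q.2
    with hG
  have hG₁ : G x₁ := ⟨C₁, hC₁.mono fun q h => h.1⟩
  have hloc : ∀ x ∈ L τ₀, ∀ᶠ y in 𝓝[L τ₀] x, (G x ↔ G y) ∧ (G y ↔ G x) := by
    intro x hx
    obtain ⟨b, C, hC⟩ := hchart x hx
    have hslice : Tendsto (fun y : X => (τ₀, y)) (𝓝 x) (𝓝 (τ₀, x)) :=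
      (continuous_const.prodMk continuous_id).tendsto x
    have key : ∀ y ∈ L τ₀, ∀ z ∈ L τ₀,
        (∀ᶠ q in 𝓝 (τ₀, y), (q.2 ∈ L q.1 → SlopeBound θ L P b C q.1 q.2) ∧
          (q.1 = τ₀ → q.2 ∈ L τ₀ → ∃ c : ℝ → X, c τ₀ = q.2 ∧ MDifferentiableAt 𝓘(ℝ, ℝ) I c τ₀ ∧
          ∀ᶠ τ in 𝓝 τ₀, MDifferentiableAt 𝓘(ℝ, ℝ) I c τ ∧ c τ ∈ L τ)) →
        (∀ᶠ q in 𝓝 (τ₀, z), (q.2 ∈ L q.1 → SlopeBound θ L P b C q.1 q.2)) → G y → G z := by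
      rintro y hy z hz h1 h2 ⟨C', h3⟩
      obtain ⟨c, hcy, hcd, hcL⟩ := h1.self_of_nhds.2 rfl hy
      dsimp only at hcy
      have hcc : Tendsto (fun τ => (τ, c τ)) (𝓝 τ₀) (𝓝 (τ₀, y)) := by
        have := (continuousAt_id (x := τ₀)).prodMk hcd.continuousAt
        rw [← hcy]
        exact this
      have h4 : ∀ᶠ τ in 𝓝 τ₀, ∀ᶠ τ' in 𝓝 τ,
          |(a τ' - b τ') - (a τ - b τ)| ≤ (C + C') * |τ' - τ| := by
        filter_upwards [hcc.eventually h1, hcc.eventually h3, hcL, eventually_eventually_nhds.2 hcL]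
          with τ h5 h6 h7 h8
        exact (h5.1 h7.2).compare (h6 h7.2) h7.1 (h8.mono fun _ h => h.2)
      refine ⟨C + (C + C'), ?_⟩
      filter_upwards [h2, (continuousAt_fst (p := (τ₀, z))).eventually h4] with q h5 h6 h7
      exact (h5 h7).change h6
    have hev := hslice.eventually (eventually_eventually_nhds.2 hC)
    filter_upwards [hev.filter_mono nhdsWithin_le_nhds, self_mem_nhdsWithin] with y h1 h2
    have h3 := key x hx y h2 hC (h1.mono fun _ h => h.1)
    have h4 := key y h2 x hx h1 (hC.mono fun _ h => h.1)
    exact ⟨⟨h3, h4⟩, ⟨h4, h3⟩⟩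
  exact (hconn.induction₂ (fun x y => G x ↔ G y) (fun x hx => (hloc x hx).mono fun y h => h.1)
    (fun _ _ _ _ _ _ h1 h2 => h1.trans h2)
    (fun _ _ _ _ h => h.symm) hx₁ hx).1 hG₁

end FamilySlope

section Analysis

theorem eventually_eq_zero_of_norm_deriv_le {V : Type*} [NormedAddCommGroup V] [NormedSpace ℝ V]
    {k k' : ℝ → V} {σ₀ : ℝ} {C : NNReal}
    (hk : ∀ᶠ σ in 𝓝 σ₀, HasDerivAt k (k' σ) σ ∧ ‖k' σ‖ ≤ C * ‖k σ‖) (h0 : k σ₀ = 0) :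
    ∀ᶠ σ in 𝓝 σ₀, k σ = 0 := by
  classical
  have := ODE_solution_unique_of_eventually (v := fun σ y => if y = 0 then 0 else k' σ)
    (s := fun σ => {0, k σ}) (K := C) (f := k) (g := fun _ => 0) (t₀ := σ₀) ?_ ?_ ?_ h0
  · exact this
  · filter_upwards [hk] with σ hσ
    refine LipschitzOnWith.of_dist_le_mul ?_
    rintro x (rfl | rfl) y (rfl | rfl)
    · simp
    · by_cases h : k σ = 0
      · simp [h]
      · simpa [h, dist_zero_left] using hσ.2
    · by_cases h : k σ = 0
      · simp [h]
      · simpa [h] using hσ.2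
    · simp
  · filter_upwards [hk] with σ hσ
    refine ⟨?_, by simp⟩
    by_cases h : k σ = 0
    · have h1 : k' σ = 0 := by
        have := hσ.2
        rw [h, norm_zero, mul_zero] at this
        exact norm_le_zero_iff.1 this
      simpa [h, h1] using hσ.1
    · simpa [h] using hσ.1
  · exact Eventually.of_forall fun σ => ⟨by simpa using hasDerivAt_const σ (0 : V), by simp⟩

/-- A `C¹` function is uniformly differentiable along a compact set. -/
theorem eventually_uniform_differentiable {P : Type*} [NormedAddCommGroup P] [NormedSpace ℝ P]
    {G : P → ℝ} {G' : P → P →L[ℝ] ℝ} {s U K : Set P} (hs : Convex ℝ s) (hU : IsOpen U)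
    (hG : ∀ q ∈ s ∩ U, HasFDerivWithinAt G (G' q) (s ∩ U) q) (hG' : ContinuousOn G' (s ∩ U))
    (hK : IsCompact K) (hKs : K ⊆ s ∩ U) {ε : ℝ} (hε : 0 < ε) :
    ∀ᶠ v in 𝓝 (0 : P), ∀ q ∈ K, q + v ∈ s → |G (q + v) - G q - G' q v| ≤ ε * ‖v‖ := by
  have h1 : ∀ᶠ v in 𝓝 (0 : P), ∀ q ∈ K, q ∈ s → q + v ∈ s → |G (q + v) - G q - G' q v| ≤ ε * ‖v‖ := by
    refine hK.eventually_forall_of_forall_eventually fun q₀ hq₀ => ?_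
    obtain ⟨δ, hδ, hball⟩ := Metric.mem_nhdsWithin_iff.1
      (inter_mem (hG' q₀ (hKs hq₀) (Metric.ball_mem_nhds _ (half_pos hε)))
        (nhdsWithin_le_nhds (hU.mem_nhds (hKs hq₀).2)))
    obtain ⟨δ', hδ', hU'⟩ := Metric.mem_nhds_iff.1 (hU.mem_nhds (hKs hq₀).2)
    set ρ := min δ δ' with hρ
    have hρ0 : 0 < ρ := lt_min hδ hδ'
    have hc1 : ∀ᶠ z : P × P in 𝓝 (0, q₀), z.2 ∈ Metric.ball q₀ ρ :=
      continuousAt_snd (Metric.isOpen_ball.mem_nhds (Metric.mem_ball_self hρ0))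
    have hc2 : ∀ᶠ z : P × P in 𝓝 (0, q₀), z.2 + z.1 ∈ Metric.ball q₀ ρ := by
      have : ContinuousAt (fun z : P × P => z.2 + z.1) (0, q₀) := by fun_prop
      exact this (Metric.isOpen_ball.mem_nhds (by simpa using hρ0))
    filter_upwards [hc1, hc2] with z h1 h2 h3 h4
    have hsub : s ∩ Metric.ball q₀ ρ ⊆ s ∩ U := fun p hp =>
      ⟨hp.1, hU' (Metric.ball_subset_ball (min_le_right _ _) hp.2)⟩
    have hn : ∀ p ∈ s ∩ Metric.ball q₀ ρ, dist (G' p) (G' q₀) < ε / 2 := fun p hp =>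
      (hball ⟨Metric.ball_subset_ball (min_le_left _ _) hp.2, hsub hp⟩).1
    have := (hs.inter (convex_ball q₀ ρ)).norm_image_sub_le_of_norm_hasFDerivWithin_le'
      (f := G) (f' := G') (φ := G' z.2) (C := ε) (fun p hp => (hG p (hsub hp)).mono hsub)
      (fun p hp => ?_) ⟨h3, h1⟩ ⟨h4, h2⟩
    · simpa using this
    · rw [← dist_eq_norm]
      have := dist_triangle_right (G' p) (G' z.2) (G' q₀)
      linarith [hn p hp, hn z.2 ⟨h3, h1⟩]
  exact h1.mono fun v hv q hq => hv q hq (hKs hq).1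

theorem hasDerivAt_variable_endpoint {h k : ℝ → ℝ → ℝ} {b b' y : ℝ → ℝ} {lo hi y₀ y' τ₁ : ℝ}
    (hy : HasDerivAt y y' τ₁) (hy₁ : y τ₁ ∈ Ioo lo hi) (hy₀ : y₀ ∈ Icc lo hi)
    (hh : ∀ᶠ τ in 𝓝 τ₁, ∀ σ ∈ Icc lo hi, HasDerivAt (h τ) (k τ σ) σ)
    (hb : ∀ σ ∈ Icc lo hi, HasDerivAt b (b' σ) σ)
    (hk : ∀ ε > 0, ∀ᶠ τ in 𝓝 τ₁, ∀ σ ∈ Icc lo hi,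
      |k τ σ - k τ₁ σ - (τ - τ₁) * b' σ| ≤ ε * |τ - τ₁|) :
    HasDerivAt (fun τ => h τ (y τ) - h τ y₀) (k τ₁ (y τ₁) * y' + (b (y τ₁) - b y₀)) τ₁ := by
  have hy1' := Ioo_subset_Icc_self hy₁
  have hd1 : HasDerivAt (fun τ => h τ₁ (y τ)) (k τ₁ (y τ₁) * y') τ₁ :=
    (hh.self_of_nhds _ hy1').comp τ₁ hy
  have hbc : Tendsto (fun τ => b (y τ)) (𝓝 τ₁) (𝓝 (b (y τ₁))) :=
    ((hb _ hy1').continuousAt.comp hy.continuousAt : ContinuousAt (fun τ => b (y τ)) τ₁)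
  refine hasDerivAt_iff_isLittleO.2 (Asymptotics.isLittleO_iff.2 fun ε hε => ?_)
  set l := |hi - lo| + 1 with hl
  have hl0 : 0 < l := by positivity
  have hε3 : 0 < ε / 3 := by positivity
  have hbe : ∀ᶠ τ in 𝓝 τ₁, |b (y τ) - b (y τ₁)| < ε / 3 := by
    have := hbc (Metric.ball_mem_nhds _ hε3)
    exact this
  filter_upwards [hd1.isLittleO.def hε3, hbe, hh, hk (ε / (3 * l)) (by positivity),
    hy.continuousAt (Icc_mem_nhds hy₁.1 hy₁.2)] with τ h1 h2 h3 h4 h5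
  have h6 := (convex_Icc lo hi).norm_image_sub_le_of_norm_hasDerivWithin_le
    (f := fun σ => h τ σ - h τ₁ σ - (τ - τ₁) * b σ)
    (f' := fun σ => k τ σ - k τ₁ σ - (τ - τ₁) * b' σ) (C := ε / (3 * l) * |τ - τ₁|)
    (fun σ hσ => (((h3 σ hσ).sub (hh.self_of_nhds σ hσ)).sub
      ((hb σ hσ).const_mul (τ - τ₁))).hasDerivWithinAt) h4 hy₀ h5
  have h7 : ‖y τ - y₀‖ ≤ l := by
    rw [Real.norm_eq_abs, hl, abs_le]
    have := le_abs_self (hi - lo)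
    constructor <;> linarith [h5.1, h5.2, hy₀.1, hy₀.2]
  have h8 : ε / (3 * l) * |τ - τ₁| * ‖y τ - y₀‖ ≤ ε / 3 * |τ - τ₁| := by
    calc _ ≤ ε / (3 * l) * |τ - τ₁| * l := by gcongr
      _ = _ := by field_simp
  have h9 : |(τ - τ₁) * (b (y τ) - b (y τ₁))| ≤ ε / 3 * |τ - τ₁| := by
    rw [abs_mul, mul_comm]
    gcongr
  simp only [Real.norm_eq_abs, smul_eq_mul] at h1 h6 h8 ⊢
  rw [abs_le] at h1 h6 h9 ⊢
  constructor <;> linarith [h1.1, h1.2, h6.1, h6.2, h9.1, h9.2]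

end Analysis

section FlatTrivialization

variable {VE : Type*} [NormedAddCommGroup VE] [NormedSpace ℝ VE] [FiniteDimensional ℝ VE]
  {BE : Type*} [TopologicalSpace BE] {IE : ModelWithCorners ℝ VE BE}
  {E : Type*} [TopologicalSpace E] [ChartedSpace BE E] [IsManifold IE ∞ E]
  {VM : Type*} [NormedAddCommGroup VM] [NormedSpace ℝ VM] [FiniteDimensional ℝ VM]
  {BM : Type*} [TopologicalSpace BM] {IM : ModelWithCorners ℝ VM BM}
  {M : Type*} [TopologicalSpace M] [ChartedSpace BM M] [IsManifold IM ∞ M]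
  {F : FibrationData IE E IM M}

theorem isOpen_upperW : IsOpen upperW := isOpen_lt continuous_const Complex.continuous_im

theorem FibrationData.IsFlatTrivialization.mfderiv_injective (hF : F.IsTarget) {κ : ℂ → ℂ} {D : Set ℂ}
    {N : Set M} {Ψ : ℂ × M → E} (hΨ : F.IsFlatTrivialization κ D N Ψ) (hD : D ⊆ upperW) {p : ℂ × M}
    (hp : p ∈ D ×ˢ N) : Function.Injective (mfderiv (𝓘(ℝ, ℂ).prod IM) IE Ψ p) := by
  refine (injective_iff_map_eq_zero _).2 fun v hv => ?_
  have hs := hΨ.symplectic p hp v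
  have him : p.1.im ≠ 0 := (hD hp.1).ne'
  have h0 : ∀ w : TangentSpace (𝓘(ℝ, ℂ).prod IM) p,
      omegaW p.1 (v.1 : ℂ) (w.1 : ℂ)
        + F.omegaM p.2 (v.2 : TangentSpace IM p.2) (w.2 : TangentSpace IM p.2) = 0 := by
    intro w
    rw [← hs w, hv]
    exact extD_zero_left _ _ _
  have h1 : (v.1 : ℂ) = 0 := by
    refine omegaW_left_unique him fun c => ?_
    have h2 := h0 ((c, 0) : ℂ × VM)
    have h3 : F.omegaM p.2 (v.2 : TangentSpace IM p.2) (0 : TangentSpace IM p.2) = 0 :=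
      extD_zero_right _ _ _
    have h4 : omegaW p.1 (v.1 : ℂ) c + F.omegaM p.2 (v.2 : TangentSpace IM p.2) (0 : TangentSpace IM p.2)
      = 0 := h2
    rw [h3, add_zero] at h4
    rw [h4]
    simp [omegaW]
  have h5 : (v.2 : TangentSpace IM p.2) = 0 := by
    refine hF.thetaM_symplectic.2 p.2 _ fun w => ?_
    have h2 : omegaW p.1 (v.1 : ℂ) 0 + F.omegaM p.2 (v.2 : TangentSpace IM p.2) w = 0 :=
      h0 ((0, w) : ℂ × VM)
    have h3 : omegaW p.1 (v.1 : ℂ) 0 = 0 := by simp [omegaW]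
    rw [h3, zero_add] at h2
    exact h2
  exact Prod.ext h1 h5

/-- A flat trivialization near a real point, together with the fibre component of its inverse. -/
structure FibrationData.IsEndChart (F : FibrationData IE E IM M) (p r : ℝ) (Ψ : ℂ × M → E)
    (m : E → M) : Prop where
  flat : F.IsFlatTrivialization (fun w => (p : ℂ) + w) (Metric.ball 0 r ∩ upperW) univ Ψ
  right_inv : ∀ x, F.proj x - p ∈ Metric.ball (0 : ℂ) r → Ψ (F.proj x - p, m x) = x
  continuousAt : ∀ x, F.proj x - p ∈ Metric.ball (0 : ℂ) r → ContinuousAt m x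

theorem FibrationData.IsTarget.sub_mem_upperW (hF : F.IsTarget) (p : ℝ) (x : E) :
    F.proj x - p ∈ upperW := by
  have := hF.proj_mem x
  simpa [upperW] using this

theorem exists_endChart [CompactSpace M] [T2Space E] (hF : F.IsTarget) {p r : ℝ} {Ψ : ℂ × M → E}
    (hΨ : F.IsFlatTrivialization (fun w => (p : ℂ) + w) (Metric.ball 0 r ∩ upperW) univ Ψ)
    (himg : Ψ '' ((Metric.ball 0 r ∩ upperW) ×ˢ univ)
      = F.proj ⁻¹' ((fun w => (p : ℂ) + w) '' (Metric.ball 0 r ∩ upperW)))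
    {x₁ : E} (hx₁ : F.proj x₁ - p ∈ Metric.ball (0 : ℂ) r) :
    ∃ m : E → M, F.IsEndChart p r Ψ m := by
  have hex : ∀ x, F.proj x - p ∈ Metric.ball (0 : ℂ) r → ∃ m : M, Ψ (F.proj x - p, m) = x := by
    intro x h
    have h1 : x ∈ F.proj ⁻¹' ((fun w => (p : ℂ) + w) '' (Metric.ball 0 r ∩ upperW)) :=
      ⟨F.proj x - p, ⟨h, hF.sub_mem_upperW p x⟩, by ring⟩
    rw [← himg] at h1
    obtain ⟨q, hq, hqx⟩ := h1
    have h2 := hΨ.proj_eq q hq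
    rw [hqx] at h2
    refine ⟨q.2, ?_⟩
    have h3 : (F.proj x - p, q.2) = q := by rw [h2]; ext <;> simp
    rw [h3, hqx]
  have hex' : ∀ x, ∃ m : M, F.proj x - p ∈ Metric.ball (0 : ℂ) r → Ψ (F.proj x - p, m) = x := by
    intro x
    by_cases h : F.proj x - p ∈ Metric.ball (0 : ℂ) r
    · obtain ⟨m, hm⟩ := hex x h
      exact ⟨m, fun _ => hm⟩
    · exact ⟨(hex x₁ hx₁).choose, fun h' => (h h').elim⟩
  choose m hm using hex'
  refine ⟨m, hΨ, hm, fun x hx => ?_⟩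
  have hπ : ContinuousAt (fun y => F.proj y - p) x :=
    (hF.proj_smooth.continuous.sub continuous_const).continuousAt
  have hev : ∀ᶠ y in 𝓝 x, F.proj y - p ∈ Metric.ball (0 : ℂ) r :=
    hπ (Metric.isOpen_ball.mem_nhds hx)
  refine (tendsto_iff_ultrafilter _ _ _).2 fun g hg => ?_
  obtain ⟨y, -, hy⟩ := isCompact_univ.ultrafilter_le_nhds (g.map m) (by simp)
  have hmem : ∀ x, F.proj x - p ∈ Metric.ball (0 : ℂ) r → ∀ m : M,
      (F.proj x - p, m) ∈ (Metric.ball (0 : ℂ) r ∩ upperW) ×ˢ (univ : Set M) :=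
    fun x h m => ⟨⟨h, hF.sub_mem_upperW p x⟩, mem_univ _⟩
  have hopen : IsOpen ((Metric.ball (0 : ℂ) r ∩ upperW) ×ˢ (univ : Set M)) :=
    (Metric.isOpen_ball.inter isOpen_upperW).prod isOpen_univ
  have hc : ContinuousAt Ψ (F.proj x - p, y) :=
    hΨ.smooth.continuousOn.continuousAt (hopen.mem_nhds (hmem x hx y))
  have h1 : Tendsto (fun z => (F.proj z - p, m z)) g (𝓝 (F.proj x - p, y)) :=
    (Filter.Tendsto.mono_left hπ hg).prodMk_nhds hy
  have h2 : Tendsto (fun z => Ψ (F.proj z - p, m z)) g (𝓝 (Ψ (F.proj x - p, y))) := hc.tendsto.comp h1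
  have h3 : Tendsto (fun z => Ψ (F.proj z - p, m z)) g (𝓝 x) :=
    (tendsto_id.mono_left hg).congr' ((hev.filter_mono hg).mono fun z hz => (hm z hz).symm)
  have h4 : Ψ (F.proj x - p, y) = Ψ (F.proj x - p, m x) := by
    rw [hm x hx]; exact tendsto_nhds_unique h2 h3
  have h5 := hΨ.inj (hmem x hx y) (hmem x hx (m x)) h4
  have h6 : y = m x := (Prod.ext_iff.1 h5).2
  rw [← h6]
  exact hy

namespace FibrationData.IsEndChart

variable {p r : ℝ} {Ψ : ℂ × M → E} {m : E → M}

theorem isOpen_domain : IsOpen ((Metric.ball (0 : ℂ) r ∩ upperW) ×ˢ (univ : Set M)) :=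
  (Metric.isOpen_ball.inter isOpen_upperW).prod isOpen_univ

theorem contMDiffAt (h : F.IsEndChart p r Ψ m) {w : ℂ} (hw : w ∈ Metric.ball (0 : ℂ) r)
    (hw' : w ∈ upperW) (n : M) : ContMDiffAt (𝓘(ℝ, ℂ).prod IM) IE ∞ Ψ (w, n) :=
  h.flat.smooth.contMDiffAt (isOpen_domain.mem_nhds ⟨⟨hw, hw'⟩, mem_univ _⟩)

theorem proj_apply (h : F.IsEndChart p r Ψ m) {w : ℂ} (hw : w ∈ Metric.ball (0 : ℂ) r)
    (hw' : w ∈ upperW) (n : M) : F.proj (Ψ (w, n)) = p + w :=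
  h.flat.proj_eq (w, n) ⟨⟨hw, hw'⟩, mem_univ _⟩

theorem mdifferentiableAt_curve (hF : F.IsTarget) (h : F.IsEndChart p r Ψ m) {c : ℝ → E} {t : ℝ}
    (hc : MDifferentiableAt 𝓘(ℝ, ℝ) IE c t) (ht : F.proj (c t) - p ∈ Metric.ball (0 : ℂ) r) :
    MDifferentiableAt 𝓘(ℝ, ℝ) (𝓘(ℝ, ℂ).prod IM) (fun t => (F.proj (c t) - p, m (c t))) t := by
  have hup := hF.sub_mem_upperW p (c t)
  have hcont : ContinuousAt (fun t => F.proj (c t) - p) t :=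
    (hF.proj_smooth.continuous.continuousAt.comp hc.continuousAt).sub continuousAt_const
  refine mdifferentiableAt_of_comp_injective (f := Ψ) ((h.contMDiffAt ht hup _).mdifferentiableAt (by simp))
    (h.flat.mfderiv_injective hF inter_subset_right ⟨⟨ht, hup⟩, mem_univ _⟩)
    (hcont.prodMk ((h.continuousAt _ ht).comp hc.continuousAt)) ?_
  refine hc.congr_of_eventuallyEq ?_
  filter_upwards [hcont (Metric.isOpen_ball.mem_nhds ht)] with s hs
  exact h.right_inv _ hs

theorem exists_mfderiv_eq (hF : F.IsTarget) (h : F.IsEndChart p r Ψ m) {x : E}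
    (hx : F.proj x - p ∈ Metric.ball (0 : ℂ) r) (hint : IE.IsInteriorPoint x) (v : VE) :
    ∃ w : ℂ × VM, (mfderiv (𝓘(ℝ, ℂ).prod IM) IE Ψ (F.proj x - p, m x) w : VE) = v := by
  set φ := extChartAt IE x with hφ
  set γ : ℝ → VE := fun t => φ x + t • tcoord IE x x v with hγ
  have hγ0 : γ 0 = φ x := by simp [hγ]
  have hγd : ContDiffAt ℝ ∞ γ 0 := contDiffAt_const.add (contDiffAt_id.smul contDiffAt_const)
  have hγi : γ 0 ∈ interior φ.target := by
    rw [hγ0]; exact ModelWithCorners.isInteriorPoint_iff.1 hint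
  have hc := (contMDiffAt_extChartAt_symm_comp hγd hγi).mdifferentiableAt (by simp)
  set c : ℝ → E := fun t => φ.symm (γ t) with hcdef
  have hc0 : c 0 = x := by
    show φ.symm (γ 0) = x
    rw [hγ0]; exact extChartAt_to_inv x
  have ht : F.proj (c 0) - p ∈ Metric.ball (0 : ℂ) r := by rwa [hc0]
  have hd := h.mdifferentiableAt_curve hF hc ht
  have hup := hF.sub_mem_upperW p (c 0)
  have h1 := velocity_comp (I := IE) (f := Ψ) ((h.contMDiffAt ht hup _).mdifferentiableAt (by simp)) hd
  have hev : (fun t => Ψ (F.proj (c t) - p, m (c t))) =ᶠ[𝓝 0] c := by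
    have hcont : ContinuousAt (fun t => F.proj (c t) - p) 0 :=
      (hF.proj_smooth.continuous.continuousAt.comp hc.continuousAt).sub continuousAt_const
    filter_upwards [hcont (Metric.isOpen_ball.mem_nhds ht)] with s hs
    exact h.right_inv _ hs
  have h2 : (velocity IE (fun t => Ψ (F.proj (c t) - p, m (c t))) 0 : VE) = velocity IE c 0 := by
    unfold velocity
    exact DFunLike.congr_fun hev.mfderiv_eq (1 : ℝ)
  have hsrc : c 0 ∈ φ.source := by rw [hc0]; exact mem_extChartAt_source x
  have h3 : tcoord IE x (c 0) (velocity IE c 0) = tcoord IE x x v := by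
    have h4 := hasDerivAt_chart_curve hc hsrc
    have h5 : HasDerivAt γ (tcoord IE x x v) 0 := by
      have := ((hasDerivAt_id (0 : ℝ)).smul_const (tcoord IE x x v)).const_add (φ x)
      simp only [one_smul] at this
      exact this
    refine (h4.congr_of_eventuallyEq ?_).unique h5
    filter_upwards [hγd.continuousAt (isOpen_interior.mem_nhds hγi)] with s hs
    exact (φ.right_inv (interior_subset hs)).symm
  have h4 : (velocity IE c 0 : VE) = v := by
    have h5 : ∀ y, y = x → ∀ a : VE, tcoord IE x y a = tcoord IE x x a := by rintro _ rfl a; rfl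
    have h6 := congrArg (tvec IE x x) ((h5 _ hc0 _).symm.trans h3)
    exact (tvec_tcoord (mem_extChartAt_source x) (velocity IE c 0 : VE)).symm.trans
      (h6.trans (tvec_tcoord (mem_extChartAt_source x) v))
  have h5 : ∀ y, y = x → ∀ a : ℂ × VM, (mfderiv (𝓘(ℝ, ℂ).prod IM) IE Ψ (F.proj y - p, m y) a : VE)
      = mfderiv (𝓘(ℝ, ℂ).prod IM) IE Ψ (F.proj x - p, m x) a := by rintro _ rfl a; rfl
  exact ⟨_, (h5 _ hc0 _).symm.trans (h1.symm.trans (h2.trans h4))⟩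

/-- The vertical direction of the base lifts to a multiple of the Hamiltonian vector field of the real
part. -/
theorem mfderiv_vertical (hF : F.IsTarget) (h : F.IsEndChart p r Ψ m) {x : E}
    (hx : F.proj x - p ∈ Metric.ball (0 : ℂ) r) (hint : IE.IsInteriorPoint x) :
    (mfderiv (𝓘(ℝ, ℂ).prod IM) IE Ψ (F.proj x - p, m x) ((Complex.I, 0) : ℂ × VM) : VE)
      = ((F.proj x).im ^ 2)⁻¹ • hamVF IE F.thetaE (fun y => (F.proj y).re) x := by
  have hup := hF.sub_mem_upperW p x
  have hxy : Ψ (F.proj x - p, m x) = x := h.right_inv x hx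
  have hmem : (F.proj x - p, m x) ∈ (Metric.ball (0 : ℂ) r ∩ upperW) ×ˢ (univ : Set M) :=
    ⟨⟨hx, hup⟩, mem_univ _⟩
  have hs := h.flat.symplectic _ hmem ((Complex.I, 0) : ℂ × VM)
  have hΨd : MDifferentiableAt (𝓘(ℝ, ℂ).prod IM) IE Ψ (F.proj x - p, m x) :=
    (h.contMDiffAt hx hup _).mdifferentiableAt (by simp)
  have hre : ∀ y, MDifferentiableAt IE 𝓘(ℝ, ℝ) (fun y => (F.proj y).re) y := fun y =>
    ((Complex.reCLM.contDiff.contMDiff.comp hF.proj_smooth) y).mdifferentiableAt (n := ∞) (by simp)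
  have hdre : ∀ w : ℂ × VM, (mfderiv IE 𝓘(ℝ, ℝ) (fun y => (F.proj y).re) (Ψ (F.proj x - p, m x))
      (mfderiv (𝓘(ℝ, ℂ).prod IM) IE Ψ (F.proj x - p, m x) w) : ℝ) = w.1.re := by
    intro w
    have h1 := ((hre (Ψ (F.proj x - p, m x))).hasMFDerivAt.comp _ hΨd.hasMFDerivAt)
    have h2 : (fun q : ℂ × M => (F.proj (Ψ q)).re) =ᶠ[𝓝 (F.proj x - p, m x)]
        fun q => p + q.1.re := by
      filter_upwards [isOpen_domain.mem_nhds hmem] with q hq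
      rw [h.proj_apply hq.1.1 hq.1.2 q.2]
      simp
    have h3 : HasMFDerivAt (𝓘(ℝ, ℂ).prod IM) 𝓘(ℝ, ℝ) (fun q : ℂ × M => p + q.1.re)
        (F.proj x - p, m x) (Complex.reCLM.comp (ContinuousLinearMap.fst ℝ ℂ VM)) := by
      have h4 : HasMFDerivAt 𝓘(ℝ, ℂ) 𝓘(ℝ, ℝ) (fun z : ℂ => p + z.re) (F.proj x - p) Complex.reCLM :=
        (Complex.reCLM.hasFDerivAt.const_add p).hasMFDerivAt
      exact HasMFDerivAt.comp (g := fun z : ℂ => p + z.re) (F.proj x - p, m x) h4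
        (hasMFDerivAt_fst (x := (F.proj x - p, m x)))
    exact DFunLike.congr_fun ((h1.congr_of_eventuallyEq h2.symm).mfderiv.symm.trans h3.mfderiv) w
  have hω : ∀ y, Ψ (F.proj x - p, m x) = y → ∀ v : VE,
      extD IE F.thetaE y (mfderiv (𝓘(ℝ, ℂ).prod IM) IE Ψ (F.proj x - p, m x) ((Complex.I, 0) : ℂ × VM) : VE) v
        = extD IE F.thetaE y (((F.proj x).im ^ 2)⁻¹ • hamVF IE F.thetaE (fun y => (F.proj y).re) y : VE) v := by
    rintro _ rfl v
    have hint' : IE.IsInteriorPoint (Ψ (F.proj x - p, m x)) := by rwa [hxy]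
    obtain ⟨w, hw⟩ := h.exists_mfderiv_eq hF hx hint v
    subst hw
    refine (hs w).trans ?_
    refine Eq.trans ?_ (extD_smul_left F.thetaE _ _ _ _).symm
    refine Eq.trans ?_ (congrArg (fun a : ℝ => ((F.proj x).im ^ 2)⁻¹ * a)
      (extD_hamVF hF.thetaE_symplectic _ _ _)).symm
    rw [hdre w]
    have h3 : F.omegaM (m x) (0 : TangentSpace IM (m x)) (w.2 : TangentSpace IM (m x)) = 0 :=
      extD_zero_left _ _ _
    refine (congrArg (fun a => omegaW (F.proj x - p) Complex.I w.1 + a) h3).trans ?_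
    have key : ∀ c : ℂ, omegaW (F.proj x - p) Complex.I c + 0 = ((F.proj x).im ^ 2)⁻¹ * -c.re := by
      intro c
      simp [omegaW]
      ring
    exact key w.1
  have hω' := extD_left_unique (x := x) hF.thetaE_symplectic (hω x hxy)
  exact hω'

end FibrationData.IsEndChart

end FlatTrivialization

section Invariance

variable {V : Type*} [NormedAddCommGroup V] [NormedSpace ℝ V] [FiniteDimensional ℝ V]
  {B : Type*} [TopologicalSpace B] {I : ModelWithCorners ℝ V B}
  {X : Type*} [TopologicalSpace X] [ChartedSpace B X] [IsManifold I ∞ X]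
  {θ : ∀ x : X, TangentSpace I x →L[ℝ] ℝ}

/-- A Hamiltonian vector field in the preferred chart at `x₀`. -/
def chartHamVF (θ : ∀ x : X, TangentSpace I x →L[ℝ] ℝ) (H : X → ℝ) (x₀ : X) (e : V) : V :=
  (chartOmega θ x₀ e).inverse
    (-fderivWithin ℝ (fun e => H ((extChartAt I x₀).symm e)) (extChartAt I x₀).target e)

theorem contDiffOn_chartHamVF (hθ : IsSymplecticPrimitive I θ) {H : X → ℝ} (hH : ContMDiff I 𝓘(ℝ, ℝ) ∞ H)
    (x₀ : X) : ContDiffOn ℝ ∞ (chartHamVF θ H x₀) (extChartAt I x₀).target := by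
  have h1 : ContDiffOn ℝ ∞ (fun e => H ((extChartAt I x₀).symm e)) (extChartAt I x₀).target :=
    (hH.comp_contMDiffOn (contMDiffOn_extChartAt_symm x₀)).contDiffOn
  have h2 := h1.fderivWithin (m := ∞) (uniqueDiffOn_extChartAt_target x₀) (by simp)
  refine ContDiffOn.clm_apply (fun e he => ?_) h2.neg
  have hinv := chartOmega_invertible hθ ((extChartAt I x₀).map_target he)
  rw [(extChartAt I x₀).right_inv he] at hinv
  obtain ⟨A, hA⟩ := hinv
  have h3 : ContDiffAt ℝ ∞ (ContinuousLinearMap.inverse : (V →L[ℝ] V →L[ℝ] ℝ) → _)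
      (chartOmega θ x₀ e) := by
    rw [← hA]
    exact contDiffAt_map_inverse A
  exact h3.comp_contDiffWithinAt e (contDiffOn_chartOmega hθ.1 x₀ e he)

theorem tcoord_hamVF (hθ : IsSymplecticPrimitive I θ) {H : X → ℝ} (hH : ContMDiff I 𝓘(ℝ, ℝ) ∞ H)
    {x₀ x : X} (hx : x ∈ (extChartAt I x₀).source) :
    tcoord I x₀ x (hamVF I θ H x) = chartHamVF θ H x₀ (extChartAt I x₀ x) := by
  have hinv := chartOmega_invertible hθ hx
  have key : chartOmega θ x₀ (extChartAt I x₀ x) (tcoord I x₀ x (hamVF I θ H x))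
      = -fderivWithin ℝ (fun e => H ((extChartAt I x₀).symm e)) (extChartAt I x₀).target
        (extChartAt I x₀ x) := by
    ext v
    have h1 := extD_hamVF hθ H x (tvec I x₀ x v)
    have h2 := mfderiv_eq_fderivWithin_tcoord hx ((hH x).mdifferentiableAt (by simp)) (tvec I x₀ x v)
    rw [tcoord_tvec hx] at h2
    rw [extD_eq_chartOmega hθ.1 hx, tcoord_tvec hx] at h1
    exact h1.trans (congrArg (fun a : ℝ => -a) h2)
  unfold chartHamVF
  rw [← key]
  exact (hinv.inverse_apply_self _).symm

/-- A submanifold is locally invariant under Hamiltonian vector fields which are tangent to it. -/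
theorem eventually_mem_of_velocity_eq (hθ : IsSymplecticPrimitive I θ) {H : X → ℝ}
    (hH : ContMDiff I 𝓘(ℝ, ℝ) ∞ H) {L : Set X} {x₀ : X} (hx₀ : x₀ ∈ L) (hint : I.IsInteriorPoint x₀)
    (hsub : IsSubmanifold I L) (htan : ∀ᶠ x in 𝓝 x₀, x ∈ L → hamVF I θ H x ∈ tangentTo I L x)
    {γ : ℝ → X} {g : ℝ → ℝ} {σ₀ G : ℝ} (hγ₀ : γ σ₀ = x₀)
    (hγ : ∀ᶠ σ in 𝓝 σ₀, MDifferentiableAt 𝓘(ℝ, ℝ) I γ σ ∧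
      (velocity I γ σ : V) = g σ • (hamVF I θ H (γ σ) : V) ∧ |g σ| ≤ G) :
    ∀ᶠ σ in 𝓝 σ₀, γ σ ∈ L := by
  have hsub' : ∃ (k : ℕ) (O : Set (ℝ × X)) (g : ℝ × X → (Fin k → ℝ)),
      IsOpen O ∧ ((0 : ℝ), x₀) ∈ O ∧ O ⊆ univ ×ˢ univ ∧
      ContMDiffOn (𝓘(ℝ, ℝ).prod I) 𝓘(ℝ, Fin k → ℝ) ∞ g O ∧
      (∀ q ∈ O, Function.Surjective (mfderiv I 𝓘(ℝ, Fin k → ℝ) (fun y => g (q.1, y)) q.2)) ∧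
      {q ∈ O | q.2 ∈ (fun _ : ℝ => L) q.1} = {q ∈ O | g q = 0} := by
    obtain ⟨k, O, g, hO, hxO, hg, hgs, hgL⟩ := hsub x₀ hx₀
    refine ⟨k, univ ×ˢ O, fun q => g q.2, isOpen_univ.prod hO, ⟨mem_univ _, hxO⟩,
      prod_mono le_rfl (subset_univ _), hg.comp contMDiffOn_snd fun q hq => hq.2,
      fun q hq => hgs q.2 hq.2, ?_⟩
    ext q
    have := Set.ext_iff.1 hgL q.2
    constructor
    · rintro ⟨h1, h2⟩
      exact ⟨h1, (this.1 ⟨h2, h1.2⟩).2⟩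
    · rintro ⟨h1, h2⟩
      exact ⟨h1, (this.2 ⟨h1.2, h2⟩).1⟩
  obtain ⟨N, π, f, r, hr, hf, hfL, hret⟩ := exists_family_coordinates (L := fun _ => L) hx₀ hint hsub'
  set φ := extChartAt I x₀ with hφ
  set v₀ := φ x₀ with hv₀
  have hv₀i : v₀ ∈ interior φ.target := ModelWithCorners.isInteriorPoint_iff.1 hint
  set ι : V → ℝ × N := fun v => (0, π (v - v₀)) with hι
  have hιd : ContDiff ℝ ∞ ι :=
    contDiff_const.prodMk (π.contDiff.comp (contDiff_id.sub contDiff_const))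
  have hι0 : ι v₀ = ((0 : ℝ), (0 : N)) := by simp [hι]
  set ρ : V → V := fun v => f (ι v) with hρ
  have hιb : ∀ᶠ v in 𝓝 v₀, ι v ∈ Metric.ball ((0 : ℝ), (0 : N)) r := by
    refine hιd.continuous.continuousAt (Metric.isOpen_ball.mem_nhds ?_)
    rw [hι0]; exact Metric.mem_ball_self hr
  have hρd : ∀ᶠ v in 𝓝 v₀, ContDiffAt ℝ ∞ ρ v := hιb.mono fun v hv =>
    ContDiffAt.comp (g := f) v (hf.contDiffAt (Metric.isOpen_ball.mem_nhds hv)) hιd.contDiffAt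
  have hslice : Tendsto (fun y : X => ((0 : ℝ), y)) (𝓝 x₀) (𝓝 (0, x₀)) :=
    (continuous_const.prodMk continuous_id).tendsto x₀
  have hret' : ∀ᶠ x in 𝓝 x₀, x ∈ φ.source ∧ (x ∈ L → ρ (φ x) = φ x) :=
    (hslice.eventually (hret r hr)).mono fun x hx => ⟨hx.1, fun h => (hx.2 h).2⟩
  have hρ0 : ρ v₀ = v₀ := hret'.self_of_nhds.2 hx₀
  set Xh := chartHamVF θ H x₀ with hXh
  set ψ : V → V := fun v => Xh v - fderiv ℝ ρ v (Xh v) with hψ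
  have hXd : ContDiffAt ℝ ∞ Xh v₀ :=
    (contDiffOn_chartHamVF hθ hH x₀).contDiffAt (mem_interior_iff_mem_nhds.1 hv₀i)
  have hψd : ContDiffAt ℝ 1 ψ v₀ :=
    (hXd.sub ((hρd.self_of_nhds.fderiv_right (m := ∞) (by simp)).clm_apply hXd)).of_le (by simp)
  obtain ⟨K, t, ht, hK⟩ := hψd.exists_lipschitzOnWith
  have hsymm : ContinuousAt φ.symm v₀ := continuousAt_extChartAt_symm x₀
  have hsymm0 : φ.symm v₀ = x₀ := extChartAt_to_inv x₀
  have hψ0 : ∀ᶠ x in 𝓝 x₀, x ∈ L → ψ (φ x) = 0 := by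
    have hρdx : ∀ᶠ x in 𝓝 x₀, ContDiffAt ℝ ∞ ρ (φ x) :=
      (continuousAt_extChartAt (I := I) x₀).eventually hρd
    filter_upwards [eventually_eventually_nhds.2 hret', hρdx, htan] with x h1 h2 h3 hxL
    obtain ⟨c, hc, hcL, hc0, hcv⟩ := h3 hxL
    have hsrc : c 0 ∈ φ.source := by rw [hc0]; exact h1.self_of_nhds.1
    have h4 := hasDerivAt_chart_curve (hc.mdifferentiableAt (by simp)) hsrc
    have h5 : (tcoord I x₀ (c 0) (velocity I c 0) : V) = Xh (φ x) := by
      have h6 : ∀ y, y = x → ∀ a : V, tcoord I x₀ y a = tcoord I x₀ x a := by rintro _ rfl a; rfl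
      exact ((h6 _ hc0 _).trans (congrArg (fun a : V => tcoord I x₀ x a) hcv)).trans
        (tcoord_hamVF hθ hH h1.self_of_nhds.1)
    rw [h5] at h4
    have h7 : HasDerivAt (fun t => ρ (φ (c t))) (fderiv ℝ ρ (φ x) (Xh (φ x))) 0 := by
      have h8 : HasFDerivAt ρ (fderiv ℝ ρ (φ x)) (φ (c 0)) := by
        rw [hc0]; exact (h2.differentiableAt (by simp)).hasFDerivAt
      exact h8.comp_hasDerivAt (0 : ℝ) h4
    have h9 : ∀ᶠ t in 𝓝 (0 : ℝ), ρ (φ (c t)) = φ (c t) := by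
      have h10 : Tendsto c (𝓝 0) (𝓝 x) := by rw [← hc0]; exact hc.continuousAt
      filter_upwards [h10.eventually h1, hcL] with t h11 h12 using h11.2 h12
    show Xh (φ x) - fderiv ℝ ρ (φ x) (Xh (φ x)) = 0
    rw [sub_eq_zero]
    exact h4.unique (h7.congr_of_eventuallyEq (h9.mono fun t h => h.symm))
  have hρc : Tendsto ρ (𝓝 v₀) (𝓝 v₀) := by
    have := hρd.self_of_nhds.continuousAt
    rw [ContinuousAt, hρ0] at this
    exact this
  have hψK : ∀ᶠ v in 𝓝 v₀, ‖ψ v‖ ≤ K * ‖v - ρ v‖ := by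
    have h1 : Tendsto φ.symm (𝓝 v₀) (𝓝 x₀) := by rw [← hsymm0]; exact hsymm
    have ht' : ∀ᶠ v in 𝓝 v₀, v ∈ t := ht
    filter_upwards [ht', hρc.eventually ht', (h1.comp hρc).eventually hψ0, hιb] with v h2 h3 h4 h5
    obtain ⟨-, h6, h7⟩ := hfL _ h5
    have h8 : ψ (ρ v) = 0 := by
      have h9 : ψ (φ (φ.symm (ρ v))) = 0 := h4 h7
      rwa [φ.right_inv (interior_subset h6 : ρ v ∈ φ.target)] at h9
    have := hK.norm_sub_le h2 h3
    rwa [h8, sub_zero] at this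
  have hγc : Tendsto γ (𝓝 σ₀) (𝓝 x₀) := by
    rw [← hγ₀]; exact hγ.self_of_nhds.1.continuousAt
  have hφγ : Tendsto (fun σ => φ (γ σ)) (𝓝 σ₀) (𝓝 v₀) :=
    (continuousAt_extChartAt (I := I) x₀).tendsto.comp hγc
  have hG : 0 ≤ G := (abs_nonneg _).trans hγ.self_of_nhds.2.2
  have hzero := eventually_eq_zero_of_norm_deriv_le (σ₀ := σ₀)
    (k := fun σ => φ (γ σ) - ρ (φ (γ σ))) (k' := fun σ => g σ • ψ (φ (γ σ)))
    (C := ⟨G, hG⟩ * K) ?_ (by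
      show φ (γ σ₀) - ρ (φ (γ σ₀)) = 0
      rw [hγ₀]; exact sub_eq_zero.2 hρ0.symm)
  · filter_upwards [hzero, hγc.eventually hret', hφγ.eventually hιb] with σ h1 h2 h3
    have h4 := (hfL _ h3).2.2
    have h5 : f (ι (φ (γ σ))) = φ (γ σ) := (sub_eq_zero.1 h1).symm
    rw [h5, φ.left_inv h2.1] at h4
    exact h4
  · filter_upwards [hγ, hγc.eventually hret', hφγ.eventually hρd, hφγ.eventually hψK]
      with σ h1 h2 h3 h4
    constructor
    · have h5 := hasDerivAt_chart_curve h1.1 h2.1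
      have h6 : (tcoord I x₀ (γ σ) (velocity I γ σ) : V) = g σ • Xh (φ (γ σ)) := by
        exact ((congrArg (fun a : V => tcoord I x₀ (γ σ) a) h1.2.1).trans
          ((tcoord I x₀ (γ σ)).map_smul (g σ) _)).trans
          (congrArg (fun a : V => g σ • a) (tcoord_hamVF hθ hH h2.1))
      rw [h6] at h5
      have h7 := (h3.differentiableAt (by simp)).hasFDerivAt.comp_hasDerivAt σ h5
      have h8 := h5.sub h7
      rw [map_smul, ← smul_sub] at h8
      exact h8
    · show ‖g σ • ψ (φ (γ σ))‖ ≤ (G * K : ℝ) * ‖φ (γ σ) - ρ (φ (γ σ))‖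
      rw [norm_smul, mul_assoc]
      exact mul_le_mul h1.2.2 h4 (norm_nonneg _) hG

end Invariance

section VerticalInvariance

variable {VE : Type*} [NormedAddCommGroup VE] [NormedSpace ℝ VE] [FiniteDimensional ℝ VE]
  {BE : Type*} [TopologicalSpace BE] {IE : ModelWithCorners ℝ VE BE}
  {E : Type*} [TopologicalSpace E] [ChartedSpace BE E] [IsManifold IE ∞ E]
  {VM : Type*} [NormedAddCommGroup VM] [NormedSpace ℝ VM] [FiniteDimensional ℝ VM]
  {BM : Type*} [TopologicalSpace BM] {IM : ModelWithCorners ℝ VM BM}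
  {M : Type*} [TopologicalSpace M] [ChartedSpace BM M] [IsManifold IM ∞ M]
  {F : FibrationData IE E IM M}

theorem contMDiff_re_proj (hF : F.IsTarget) : ContMDiff IE 𝓘(ℝ, ℝ) ∞ (fun y => (F.proj y).re) :=
  Complex.reCLM.contDiff.contMDiff.comp hF.proj_smooth

theorem FibrationData.IsAdmissibleL.isClosed [T2Space E] (hF : F.IsTarget) {lam : ℝ} {L : Set E}
    (hL : F.IsAdmissibleL lam L) : IsClosed L := by
  refine isClosed_of_closure_subset fun x hx => ?_
  obtain ⟨ε, hε, hball⟩ := Metric.nhds_basis_closedBall.mem_iff.1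
    (isOpen_upperW.mem_nhds (hF.proj_mem x))
  have hc := hL.proper _ hball (isCompact_closedBall _ _)
  have h1 : x ∈ closure (L ∩ F.proj ⁻¹' Metric.closedBall (F.proj x) ε) := by
    rw [mem_closure_iff_frequently] at hx ⊢
    have h2 : ∀ᶠ y in 𝓝 x, F.proj y ∈ Metric.closedBall (F.proj x) ε :=
      hF.proj_smooth.continuous.continuousAt (Metric.closedBall_mem_nhds _ hε)
    exact (hx.and_eventually h2).mono fun y hy => hy
  rw [hc.isClosed.closure_eq] at h1
  exact h1.1

theorem FibrationData.IsAdmissibleL.isInteriorPoint {lam : ℝ} {L : Set E}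
    (hL : F.IsAdmissibleL lam L) {x : E} (hx : x ∈ L) : IE.IsInteriorPoint x := by
  rw [ModelWithCorners.isInteriorPoint_iff_not_isBoundaryPoint]
  exact fun h => hL.disjoint_boundary.le_bot ⟨hx, h⟩

/-- Where the projection of a Lagrangian submanifold lies on a vertical line, the Hamiltonian vector
field of the real part is tangent to it. -/
theorem hamVF_re_mem_tangentTo (hF : F.IsTarget) {lam : ℝ} {L : Set E} (hL : F.IsAdmissibleL lam L)
    {x : E} (hx : x ∈ L) (hre : ∀ᶠ y in 𝓝 x, y ∈ L → (F.proj y).re = lam) :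
    hamVF IE F.thetaE (fun y => (F.proj y).re) x ∈ tangentTo IE L x := by
  rw [hL.lagrangian x hx]
  rintro w ⟨c, hc, hcL, hc0, hcw⟩
  refine (extD_hamVF hF.thetaE_symplectic _ x w).trans ?_
  have h1 := hasDerivAt_comp_curve ((contMDiff_re_proj hF (c 0)).mdifferentiableAt (by simp))
    (hc.mdifferentiableAt (by simp))
  have hct : Tendsto c (𝓝 0) (𝓝 x) := by rw [← hc0]; exact hc.continuousAt
  have h2 : HasDerivAt (fun t => (F.proj (c t)).re) 0 (0 : ℝ) := by
    refine (hasDerivAt_const (0 : ℝ) lam).congr_of_eventuallyEq ?_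
    filter_upwards [hct.eventually hre, hcL] with t h3 h4 using h3 h4
  have h3 := h1.unique h2
  have h4 : ∀ y, y = x → ∀ a : VE, (mfderiv IE 𝓘(ℝ, ℝ) (fun y => (F.proj y).re) y a : ℝ)
      = mfderiv IE 𝓘(ℝ, ℝ) (fun y => (F.proj y).re) x a := by rintro _ rfl a; rfl
  have h5 : (mfderiv IE 𝓘(ℝ, ℝ) (fun y => (F.proj y).re) x w : ℝ) = 0 :=
    (congrArg (fun a : VE => (mfderiv IE 𝓘(ℝ, ℝ) (fun y => (F.proj y).re) x a : ℝ)) hcw.symm).trans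
      ((h4 _ hc0 _).symm.trans h3)
  exact (congrArg (fun a : ℝ => -a) h5).trans neg_zero

theorem hasDerivAt_complex_mk (a σ : ℝ) : HasDerivAt (fun σ : ℝ => (⟨a, σ⟩ : ℂ)) Complex.I σ := by
  have h : (fun σ : ℝ => (⟨a, σ⟩ : ℂ)) = fun σ : ℝ => (a : ℂ) + σ * Complex.I := by
    funext σ; apply Complex.ext <;> simp
  rw [h]
  simpa using ((Complex.ofRealCLM.hasDerivAt (x := σ)).mul_const Complex.I).const_add (a : ℂ)

theorem contDiff_complex_mk (a : ℝ) : ContDiff ℝ ∞ (fun σ : ℝ => (⟨a, σ⟩ : ℂ)) := by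
  have h : (fun σ : ℝ => (⟨a, σ⟩ : ℂ)) = fun σ : ℝ => (a : ℂ) + σ • Complex.I := by
    funext σ; apply Complex.ext <;> simp
  rw [h]
  exact contDiff_const.add (contDiff_id.smul contDiff_const)

theorem contMDiff_vertical (a : ℝ) (n : M) :
    ContMDiff 𝓘(ℝ, ℝ) (𝓘(ℝ, ℂ).prod IM) ∞ (fun σ : ℝ => ((⟨a, σ⟩ : ℂ), n)) :=
  (contDiff_complex_mk a).contMDiff.prodMk contMDiff_const

theorem velocity_vertical (a : ℝ) (n : M) (σ : ℝ) :
    (velocity (𝓘(ℝ, ℂ).prod IM) (fun σ : ℝ => ((⟨a, σ⟩ : ℂ), n)) σ : ℂ × VM) = (Complex.I, 0) := by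
  have h1 : HasMFDerivAt 𝓘(ℝ, ℝ) 𝓘(ℝ, ℂ) (fun σ : ℝ => (⟨a, σ⟩ : ℂ)) σ
      (ContinuousLinearMap.toSpanSingleton ℝ Complex.I) :=
    (hasDerivAt_complex_mk a σ).hasFDerivAt.hasMFDerivAt
  have h2 := h1.prodMk (hasMFDerivAt_const (I := 𝓘(ℝ, ℝ)) (I' := IM) n σ)
  unfold velocity
  rw [h2.mfderiv]
  exact Prod.ext (one_smul ℝ Complex.I) rfl

namespace FibrationData.IsEndChart

variable {p r : ℝ} {Ψ : ℂ × M → E} {m : E → M}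

theorem fibre_apply (h : F.IsEndChart p r Ψ m) {w : ℂ}
    (hw : w ∈ Metric.ball (0 : ℂ) r) (hw' : w ∈ upperW) (n : M) : m (Ψ (w, n)) = n := by
  have h1 := h.proj_apply hw hw' n
  have h2 : F.proj (Ψ (w, n)) - p = w := by rw [h1]; ring
  have h3 := h.right_inv (Ψ (w, n)) (by rwa [h2])
  rw [h2] at h3
  exact (Prod.ext_iff.1 (h.flat.inj ⟨⟨hw, hw'⟩, mem_univ _⟩ ⟨⟨hw, hw'⟩, mem_univ _⟩ h3)).2

theorem velocity_vertical_apply (hF : F.IsTarget) (h : F.IsEndChart p r Ψ m) {a σ : ℝ} {n : M}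
    (hσ : (⟨a, σ⟩ : ℂ) ∈ Metric.ball (0 : ℂ) r) (hσ' : 0 < σ)
    (hint : IE.IsInteriorPoint (Ψ ((⟨a, σ⟩ : ℂ), n))) :
    (velocity IE (fun σ : ℝ => Ψ ((⟨a, σ⟩ : ℂ), n)) σ : VE)
      = (σ ^ 2)⁻¹ • (hamVF IE F.thetaE (fun y => (F.proj y).re) (Ψ ((⟨a, σ⟩ : ℂ), n)) : VE) := by
  have h1 := velocity_comp (I := IE) (f := Ψ) (c := fun σ : ℝ => ((⟨a, σ⟩ : ℂ), n)) (t := σ)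
    ((h.contMDiffAt hσ hσ' n).mdifferentiableAt (by simp))
    ((contMDiff_vertical a n σ).mdifferentiableAt (by simp))
  have hp := h.proj_apply hσ hσ' n
  have h2 : F.proj (Ψ ((⟨a, σ⟩ : ℂ), n)) - p = ⟨a, σ⟩ := by rw [hp]; ring
  have h3 := h.mfderiv_vertical hF (x := Ψ ((⟨a, σ⟩ : ℂ), n)) (by rwa [h2]) hint
  have h4 : (F.proj (Ψ ((⟨a, σ⟩ : ℂ), n))).im = σ := by rw [hp]; simp
  have h5 : ∀ q q' : ℂ × M, q = q' → ∀ a : ℂ × VM, (mfderiv (𝓘(ℝ, ℂ).prod IM) IE Ψ q a : VE)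
      = mfderiv (𝓘(ℝ, ℂ).prod IM) IE Ψ q' a := by rintro _ _ rfl a; rfl
  have h6 : (F.proj (Ψ ((⟨a, σ⟩ : ℂ), n)) - p, m (Ψ ((⟨a, σ⟩ : ℂ), n))) = ((⟨a, σ⟩ : ℂ), n) :=
    Prod.ext h2 (h.fibre_apply hσ hσ' n)
  rw [h4] at h3
  refine h1.trans (Eq.trans ?_ h3)
  refine (congrArg (fun b : ℂ × VM => (mfderiv (𝓘(ℝ, ℂ).prod IM) IE Ψ ((⟨a, σ⟩ : ℂ), n) b : VE))
    (velocity_vertical a n σ)).trans (h5 _ _ h6.symm _)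

/-- Lagrangian submanifolds are invariant under vertical translation near infinity. -/
theorem vertical_invariance [T2Space E] (hF : F.IsTarget) (h : F.IsEndChart p r Ψ m) {lam : ℝ}
    {L : Set E} (hL : F.IsAdmissibleL lam L) {y₁ : ℝ}
    (hball : ∀ y ∈ Ioo 0 y₁, (⟨lam - p, y⟩ : ℂ) ∈ Metric.ball (0 : ℂ) r)
    (hre : ∀ x ∈ L, (F.proj x).im < y₁ → (F.proj x).re = lam) {n : M} {σ₀ : ℝ} (hσ₀ : σ₀ ∈ Ioo 0 y₁)
    (hmem : Ψ ((⟨lam - p, σ₀⟩ : ℂ), n) ∈ L) :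
    ∀ σ ∈ Ioo 0 y₁, Ψ ((⟨lam - p, σ⟩ : ℂ), n) ∈ L := by
  set γ : ℝ → E := fun σ => Ψ ((⟨lam - p, σ⟩ : ℂ), n) with hγ
  have hγd : ∀ σ ∈ Ioo 0 y₁, ContMDiffAt 𝓘(ℝ, ℝ) IE ∞ γ σ := fun σ hσ =>
    ContMDiffAt.comp (g := Ψ) σ (h.contMDiffAt (hball σ hσ) hσ.1 n) (contMDiff_vertical _ n σ)
  have hloc : ∀ σ ∈ Ioo 0 y₁, ∀ᶠ σ' in 𝓝 σ, (γ σ ∈ L ↔ γ σ' ∈ L) := by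
    intro σ hσ
    by_cases hx : γ σ ∈ L
    · have hres : ∀ᶠ y in 𝓝 (γ σ), ∀ᶠ z in 𝓝 y, z ∈ L → (F.proj z).re = lam := by
        refine eventually_eventually_nhds.2 ?_
        have h1 : ∀ᶠ y in 𝓝 (γ σ), (F.proj y).im < y₁ := by
          refine (Complex.continuous_im.comp hF.proj_smooth.continuous).continuousAt.eventually
            (gt_mem_nhds ?_)
          show (F.proj (γ σ)).im < y₁
          rw [hγ, h.proj_apply (hball σ hσ) hσ.1 n]
          simpa using hσ.2
        filter_upwards [h1] with y hy hyL using hre y hyL hy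
      have hev : ∀ᶠ σ' in 𝓝 σ, γ σ' ∈ L := by
        have hint : ∀ᶠ σ' in 𝓝 σ, IE.IsInteriorPoint (γ σ') := by
          have := (ModelWithCorners.isOpen_interior (I := IE) (M := E) (n := ∞) (by simp)).mem_nhds
            (hL.isInteriorPoint hx : γ σ ∈ IE.interior E)
          exact (hγd σ hσ).continuousAt this
        refine eventually_mem_of_velocity_eq hF.thetaE_symplectic (contMDiff_re_proj hF) hx
          (hL.isInteriorPoint hx) hL.submanifold
          (hres.mono fun y hy hyL => hamVF_re_mem_tangentTo hF hL hyL hy) (γ := γ)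
          (g := fun σ => (σ ^ 2)⁻¹) (G := |(σ ^ 2)⁻¹| + 1) rfl ?_
        have hg : ∀ᶠ σ' in 𝓝 σ, |(σ' ^ 2)⁻¹| < |(σ ^ 2)⁻¹| + 1 := by
          have : ContinuousAt (fun σ : ℝ => |(σ ^ 2)⁻¹|) σ :=
            ((continuousAt_id.pow 2).inv₀ (pow_ne_zero 2 hσ.1.ne')).abs
          exact this.eventually (gt_mem_nhds (lt_add_one _))
        filter_upwards [isOpen_Ioo.mem_nhds hσ, hint, hg] with σ' h1 h2 h3
        exact ⟨(hγd σ' h1).mdifferentiableAt (by simp),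
          h.velocity_vertical_apply hF (hball σ' h1) h1.1 h2, h3.le⟩
      exact hev.mono fun σ' h' => ⟨fun _ => h', fun _ => hx⟩
    · have h1 : ∀ᶠ σ' in 𝓝 σ, γ σ' ∈ Lᶜ :=
        (hγd σ hσ).continuousAt ((hL.isClosed hF).isOpen_compl.mem_nhds hx)
      exact h1.mono fun σ' h' => ⟨fun h'' => (hx h'').elim, fun h'' => (h' h'').elim⟩
  intro σ hσ
  exact ((isPreconnected_Ioo (a := (0 : ℝ)) (b := y₁)).induction₂ (fun σ σ' => γ σ ∈ L ↔ γ σ' ∈ L)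
    (fun σ hσ => (hloc σ hσ).filter_mono nhdsWithin_le_nhds)
    (fun _ _ _ _ _ _ h1 h2 => h1.trans h2) (fun _ _ _ _ h => h.symm) hσ₀ hσ).1 hmem

end FibrationData.IsEndChart

end VerticalInvariance

section Analysis

theorem eventually_uniform_slope {P Q : Type*} [NormedAddCommGroup P] [NormedSpace ℝ P] [TopologicalSpace Q]
    {G : P → ℝ} {G' : P → P →L[ℝ] ℝ} {s U : Set P} (hs : Convex ℝ s) (hU : IsOpen U)
    (hG : ∀ q ∈ s ∩ U, HasFDerivWithinAt G (G' q) (s ∩ U) q) (hG' : ContinuousOn G' (s ∩ U))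
    {K : Set Q} (hK : IsCompact K) {q : Q → P} (hq : ContinuousOn q K) (hqs : MapsTo q K (s ∩ U))
    {η : ℝ → P} {η' : P} {τ₁ : ℝ} (hη : HasDerivAt η η' τ₁) (hη0 : η τ₁ = 0)
    (hηs : ∀ᶠ τ in 𝓝 τ₁, ∀ σ ∈ K, q σ + η τ ∈ s) {ε : ℝ} (hε : 0 < ε) :
    ∀ᶠ τ in 𝓝 τ₁, ∀ σ ∈ K,
      |G (q σ + η τ) - G (q σ) - (τ - τ₁) * G' (q σ) η'| ≤ ε * |τ - τ₁| := by
  have hKc := hK.image_of_continuousOn hq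
  have hKs : q '' K ⊆ s ∩ U := hqs.image_subset
  obtain ⟨C, hC⟩ := hKc.exists_bound_of_continuousOn (hG'.mono hKs)
  set A := ‖η'‖ + 1 with hA
  set B := max C 0 + 1 with hB
  have hA0 : 0 < A := by positivity
  have hB0 : 0 < B := by positivity
  have h1 := hη.continuousAt.tendsto
  rw [hη0] at h1
  have ho := hη.isLittleO
  simp only [hη0, sub_zero] at ho
  filter_upwards [h1.eventually (eventually_uniform_differentiable hs hU hG hG' hKc hKs
    (show 0 < ε / (2 * A) by positivity)), hηs, ho.def one_pos,
    ho.def (show 0 < ε / (2 * B) by positivity)] with τ h2 h3 h4 h5 σ hσ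
  have h6 := h2 (q σ) (mem_image_of_mem q hσ) (h3 σ hσ)
  have h7 : ‖η τ‖ ≤ A * |τ - τ₁| := by
    calc ‖η τ‖ = ‖(η τ - (τ - τ₁) • η') + (τ - τ₁) • η'‖ := by congr 1; abel
      _ ≤ ‖η τ - (τ - τ₁) • η'‖ + ‖(τ - τ₁) • η'‖ := norm_add_le _ _
      _ ≤ 1 * ‖τ - τ₁‖ + ‖τ - τ₁‖ * ‖η'‖ := by rw [norm_smul]; gcongr
      _ = A * |τ - τ₁| := by rw [hA, Real.norm_eq_abs]; ring
  have h8 : ‖G' (q σ)‖ ≤ B := by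
    have := hC _ (mem_image_of_mem q hσ)
    have := le_max_left C 0
    linarith
  have h9 : |G' (q σ) (η τ) - (τ - τ₁) * G' (q σ) η'| ≤ ε / 2 * |τ - τ₁| := by
    have h10 : G' (q σ) (η τ) - (τ - τ₁) * G' (q σ) η' = G' (q σ) (η τ - (τ - τ₁) • η') := by
      rw [map_sub, map_smul, smul_eq_mul]
    rw [h10, ← Real.norm_eq_abs]
    calc _ ≤ ‖G' (q σ)‖ * ‖η τ - (τ - τ₁) • η'‖ := (G' (q σ)).le_opNorm _
      _ ≤ B * (ε / (2 * B) * ‖τ - τ₁‖) := by gcongr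
      _ = ε / 2 * |τ - τ₁| := by rw [Real.norm_eq_abs]; field_simp
  have h11 : ε / (2 * A) * ‖η τ‖ ≤ ε / 2 * |τ - τ₁| := by
    calc _ ≤ ε / (2 * A) * (A * |τ - τ₁|) := by gcongr
      _ = _ := by field_simp
  calc _ = |(G (q σ + η τ) - G (q σ) - G' (q σ) (η τ))
        + (G' (q σ) (η τ) - (τ - τ₁) * G' (q σ) η')| := by congr 1; ring
    _ ≤ _ := abs_add_le _ _
    _ ≤ ε / 2 * |τ - τ₁| + ε / 2 * |τ - τ₁| := add_le_add (h6.trans h11) h9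
    _ = _ := by ring

end Analysis

section FlatCoordinates

variable {VE : Type*} [NormedAddCommGroup VE] [NormedSpace ℝ VE] [FiniteDimensional ℝ VE]
  {BE : Type*} [TopologicalSpace BE] {IE : ModelWithCorners ℝ VE BE}
  {E : Type*} [TopologicalSpace E] [ChartedSpace BE E] [IsManifold IE ∞ E]
  {VM : Type*} [NormedAddCommGroup VM] [NormedSpace ℝ VM] [FiniteDimensional ℝ VM]
  {BM : Type*} [TopologicalSpace BM] {IM : ModelWithCorners ℝ VM BM}
  {M : Type*} [TopologicalSpace M] [ChartedSpace BM M] [IsManifold IM ∞ M]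
  {F : FibrationData IE E IM M}

theorem IsHalfSpaceModel.convex_range (h : IsHalfSpaceModel IM) : Convex ℝ (range IM) := by
  obtain ⟨φ, hφ⟩ := h
  rw [hφ]
  exact convex_halfSpace_ge (f := φ) φ.isLinear 0

variable (IM) in
/-- A map from `ℂ × M` in the preferred chart at `m₁`. -/
def flatMap (Ψ : ℂ × M → E) (m₁ : M) (q : ℂ × VM) : E := Ψ (q.1, (extChartAt IM m₁).symm q.2)

variable (IM) in
def flatDom (r : ℝ) (m₁ : M) : Set (ℂ × VM) :=
  (Metric.ball 0 r ∩ upperW) ×ˢ (extChartAt IM m₁).target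

theorem uniqueDiffOn_flatDom (r : ℝ) (m₁ : M) : UniqueDiffOn ℝ (flatDom IM r m₁) :=
  (Metric.isOpen_ball.inter isOpen_upperW).uniqueDiffOn.prod (uniqueDiffOn_extChartAt_target m₁)

theorem flatDom_subset_closure_interior (r : ℝ) (m₁ : M) :
    flatDom IM r m₁ ⊆ closure (interior (flatDom IM r m₁)) := by
  rintro q ⟨h1, h2⟩
  rw [flatDom, interior_prod_eq, (Metric.isOpen_ball.inter isOpen_upperW).interior_eq, closure_prod_eq]
  exact ⟨subset_closure h1, extChartAt_target_subset_closure_interior h2⟩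

theorem flatDom_eq (r : ℝ) (m₁ : M) : ∃ U, IsOpen U ∧
    flatDom IM r m₁ = ((univ : Set ℂ) ×ˢ range IM) ∩ U := by
  refine ⟨(Metric.ball 0 r ∩ upperW) ×ˢ (IM.symm ⁻¹' (chartAt BM m₁).target),
    (Metric.isOpen_ball.inter isOpen_upperW).prod
      ((chartAt BM m₁).open_target.preimage IM.continuous_symm), ?_⟩
  rw [flatDom, extChartAt_target, prod_inter_prod, univ_inter, inter_comm (range IM)]

theorem contMDiffOn_prod_symm (r : ℝ) (m₁ : M) :
    ContMDiffOn 𝓘(ℝ, ℂ × VM) (𝓘(ℝ, ℂ).prod IM) ∞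
      (fun q : ℂ × VM => (q.1, (extChartAt IM m₁).symm q.2)) (flatDom IM r m₁) :=
  contDiff_fst.contMDiff.contMDiffOn.prodMk
    ((contMDiffOn_extChartAt_symm m₁).comp contDiff_snd.contMDiff.contMDiffOn fun _ hq => hq.2)

namespace FibrationData.IsEndChart

variable {p r : ℝ} {Ψ : ℂ × M → E} {m : E → M}

theorem contMDiffOn_flatMap (h : F.IsEndChart p r Ψ m) (m₁ : M) :
    ContMDiffOn 𝓘(ℝ, ℂ × VM) IE ∞ (flatMap IM Ψ m₁) (flatDom IM r m₁) :=
  h.flat.smooth.comp (contMDiffOn_prod_symm r m₁) fun _ hq => ⟨hq.1, mem_univ _⟩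

theorem mfderivWithin_flatMap (h : F.IsEndChart p r Ψ m) {m₁ : M} {q : ℂ × VM}
    (hq : q ∈ flatDom IM r m₁) : ∃ T : VM →L[ℝ] VM, ∀ ξ : ℂ × VM,
    (mfderivWithin 𝓘(ℝ, ℂ × VM) IE (flatMap IM Ψ m₁) (flatDom IM r m₁) q ξ : VE)
      = mfderiv (𝓘(ℝ, ℂ).prod IM) IE Ψ (q.1, (extChartAt IM m₁).symm q.2) ((ξ.1, T ξ.2) : ℂ × VM) := by
  have hu : UniqueMDiffWithinAt 𝓘(ℝ, ℂ × VM) (flatDom IM r m₁) q :=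
    (uniqueDiffOn_flatDom r m₁ q hq).uniqueMDiffWithinAt
  have h1 : HasMFDerivAt (𝓘(ℝ, ℂ).prod IM) IE Ψ (q.1, (extChartAt IM m₁).symm q.2) _ :=
    ((h.contMDiffAt hq.1.1 hq.1.2 _).mdifferentiableAt (by simp)).hasMFDerivAt
  have h2 : HasMFDerivWithinAt 𝓘(ℝ, ℂ × VM) 𝓘(ℝ, ℂ) (fun q : ℂ × VM => q.1) (flatDom IM r m₁) q
      (ContinuousLinearMap.fst ℝ ℂ VM) := hasFDerivAt_fst.hasMFDerivAt.hasMFDerivWithinAt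
  have h3 : HasMFDerivWithinAt 𝓘(ℝ, ℂ × VM) 𝓘(ℝ, VM) (fun q : ℂ × VM => q.2) (flatDom IM r m₁) q
      (ContinuousLinearMap.snd ℝ ℂ VM) := hasFDerivAt_snd.hasMFDerivAt.hasMFDerivWithinAt
  have h4 : HasMFDerivWithinAt 𝓘(ℝ, VM) IM (extChartAt IM m₁).symm (extChartAt IM m₁).target q.2
      (mfderivWithin 𝓘(ℝ, VM) IM (extChartAt IM m₁).symm (extChartAt IM m₁).target q.2) :=
    ((contMDiffOn_extChartAt_symm (n := ∞) m₁ _ hq.2).mdifferentiableWithinAt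
      (by simp)).hasMFDerivWithinAt
  have h5 := h2.prodMk (HasMFDerivWithinAt.comp q h4 h3 fun _ hq => hq.2)
  have h6 := HasMFDerivAt.comp_hasMFDerivWithinAt (f := fun q : ℂ × VM => (q.1, (extChartAt IM m₁).symm q.2))
    q h1 h5
  exact ⟨mfderivWithin 𝓘(ℝ, VM) IM (extChartAt IM m₁).symm (extChartAt IM m₁).target q.2,
    fun ξ => DFunLike.congr_fun (h6.mfderivWithin hu) ξ⟩

theorem fderivWithin_pullForm_flatMap (hF : F.IsTarget) (h : F.IsEndChart p r Ψ m) {m₁ : M} {q : ℂ × VM}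
    (hq : q ∈ flatDom IM r m₁) (ξ : ℂ × VM) :
    fderivWithin ℝ (pullForm F.thetaE (flatMap IM Ψ m₁) (flatDom IM r m₁)) (flatDom IM r m₁) q ξ
        (Complex.I, 0)
      - fderivWithin ℝ (pullForm F.thetaE (flatMap IM Ψ m₁) (flatDom IM r m₁)) (flatDom IM r m₁) q
        (Complex.I, 0) ξ = ξ.1.re / q.1.im ^ 2 := by
  rw [fderivWithin_pullForm hF.thetaE_symplectic.1 (uniqueDiffOn_flatDom r m₁) hq
    (flatDom_subset_closure_interior r m₁ hq) (h.contMDiffOn_flatMap m₁)]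
  obtain ⟨T, hT⟩ := h.mfderivWithin_flatMap hq
  have h1 := h.flat.symplectic (q.1, (extChartAt IM m₁).symm q.2) ⟨hq.1, mem_univ _⟩
    ((ξ.1, T ξ.2) : ℂ × VM) ((Complex.I, T 0) : ℂ × VM)
  have h2 : F.omegaM ((extChartAt IM m₁).symm q.2) (T ξ.2 : VM) (T 0 : VM) = 0 := by
    rw [map_zero]
    exact extD_zero_right _ _ _
  refine (congrArg₂ (fun a b : VE => extD IE F.thetaE (flatMap IM Ψ m₁ q) a b) (hT ξ)
    (hT (Complex.I, 0))).trans (h1.trans ?_)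
  refine (congrArg (fun a => omegaW q.1 ξ.1 Complex.I + a) h2).trans ?_
  simp [omegaW]

theorem pullForm_velocity (h : F.IsEndChart p r Ψ m) {m₁ : M} {c : ℝ → ℂ × VM} {c' : ℂ × VM} {t : ℝ}
    (hc : HasDerivAt c c' t) (hcd : ∀ᶠ s in 𝓝 t, c s ∈ flatDom IM r m₁) :
    pullForm F.thetaE (flatMap IM Ψ m₁) (flatDom IM r m₁) (c t) c'
      = F.thetaE (flatMap IM Ψ m₁ (c t)) (velocity IE (fun s => flatMap IM Ψ m₁ (c s)) t) := by
  have h1 : HasMFDerivWithinAt 𝓘(ℝ, ℂ × VM) IE (flatMap IM Ψ m₁) (flatDom IM r m₁) (c t) _ :=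
    ((h.contMDiffOn_flatMap m₁ _ hcd.self_of_nhds).mdifferentiableWithinAt (by simp)).hasMFDerivWithinAt
  have h2 : HasMFDerivWithinAt 𝓘(ℝ, ℝ) 𝓘(ℝ, ℂ × VM) c (c ⁻¹' flatDom IM r m₁) t
      (ContinuousLinearMap.toSpanSingleton ℝ c') := hc.hasFDerivAt.hasMFDerivAt.hasMFDerivWithinAt
  have h3 := (HasMFDerivWithinAt.comp t h1 h2 fun _ hs => hs).hasMFDerivAt hcd
  unfold pullForm velocity
  rw [show (mfderiv 𝓘(ℝ, ℝ) IE (fun s => flatMap IM Ψ m₁ (c s)) t) = _ from h3.mfderiv]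
  have h4 : ContinuousLinearMap.toSpanSingleton ℝ c' (1 : ℝ) = c' := one_smul ℝ c'
  exact congrArg (fun a : ℂ × VM => F.thetaE (flatMap IM Ψ m₁ (c t))
    (mfderivWithin 𝓘(ℝ, ℂ × VM) IE (flatMap IM Ψ m₁) (flatDom IM r m₁) (c t) a)) h4.symm

end FibrationData.IsEndChart

end FlatCoordinates

section EndSlope

variable {VE : Type*} [NormedAddCommGroup VE] [NormedSpace ℝ VE] [FiniteDimensional ℝ VE]
  {BE : Type*} [TopologicalSpace BE] {IE : ModelWithCorners ℝ VE BE}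
  {E : Type*} [TopologicalSpace E] [ChartedSpace BE E] [IsManifold IE ∞ E]
  {VM : Type*} [NormedAddCommGroup VM] [NormedSpace ℝ VM] [FiniteDimensional ℝ VM]
  {BM : Type*} [TopologicalSpace BM] {IM : ModelWithCorners ℝ VM BM}
  {M : Type*} [TopologicalSpace M] [ChartedSpace BM M] [IsManifold IM ∞ M]
  {F : FibrationData IE E IM M}

theorem oneForm_velocity_congr (θ : ∀ x : E, TangentSpace IE x →L[ℝ] ℝ) {c c' : ℝ → E} {t : ℝ}
    (h : c =ᶠ[𝓝 t] c') : θ (c t) (velocity IE c t) = θ (c' t) (velocity IE c' t) := by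
  have h1 : (velocity IE c t : VE) = velocity IE c' t := DFunLike.congr_fun h.mfderiv_eq (1 : ℝ)
  have h2 : ∀ y y', y = y' → ∀ a : VE, θ y a = θ y' a := by rintro _ _ rfl a; rfl
  exact (congrArg (fun a : VE => θ (c t) a) h1).trans (h2 _ _ h.self_of_nhds _)

theorem hasDerivAt_complex_mk₂ {a y : ℝ → ℝ} {a' y' t : ℝ} (ha : HasDerivAt a a' t)
    (hy : HasDerivAt y y' t) : HasDerivAt (fun t => (⟨a t, y t⟩ : ℂ)) ⟨a', y'⟩ t := by
  have h : (fun t : ℝ => (⟨a t, y t⟩ : ℂ)) = fun t : ℝ => (a t : ℂ) + y t • Complex.I := by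
    funext σ; apply Complex.ext <;> simp
  have h' : (⟨a', y'⟩ : ℂ) = (a' : ℂ) + y' • Complex.I := by apply Complex.ext <;> simp
  rw [h, h']
  exact ha.ofReal_comp.add (hy.smul_const Complex.I)

namespace FibrationData.IsEndChart

variable {p r : ℝ} {Ψ : ℂ × M → E} {m : E → M}

theorem hasDerivAt_primitive_sub [T2Space E] (hF : F.IsTarget) (h : F.IsEndChart p r Ψ m)
    {L : ℝ → Set E} {lam : ℝ → ℝ} {P : ℝ → E → ℝ} {lam' τ₁ y₀ y₁ : ℝ}
    (hL : ∀ᶠ τ in 𝓝 τ₁, F.IsAdmissibleL (lam τ) (L τ) ∧ IsPrimitiveOn F.thetaE (L τ) (P τ) ∧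
      (∀ y ∈ Ioo 0 y₁, (⟨lam τ - p, y⟩ : ℂ) ∈ Metric.ball (0 : ℂ) r) ∧
      ∀ x ∈ L τ, (F.proj x).im < y₁ → (F.proj x).re = lam τ)
    (hlam : HasDerivAt lam lam' τ₁) (hy₀ : y₀ ∈ Ioo 0 y₁) {c : ℝ → E}
    (hc : MDifferentiableAt 𝓘(ℝ, ℝ) IE c τ₁) (hcL : ∀ᶠ τ in 𝓝 τ₁, c τ ∈ L τ)
    (him : (F.proj (c τ₁)).im < y₁) :
    ∃ ct : ℝ → E, MDifferentiableAt 𝓘(ℝ, ℝ) IE ct τ₁ ∧ (∀ᶠ τ in 𝓝 τ₁, ct τ ∈ L τ) ∧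
      (F.proj (ct τ₁)).im = y₀ ∧
      HasDerivAt (fun τ => P τ (c τ) - P τ (ct τ))
        (F.thetaE (c τ₁) (velocity IE c τ₁) - F.thetaE (ct τ₁) (velocity IE ct τ₁)
          - lam' / (F.proj (c τ₁)).im + lam' / y₀) τ₁ := by
  set m₁ := m (c τ₁) with hm₁
  set χ := extChartAt IM m₁ with hχ
  set y : ℝ → ℝ := fun τ => (F.proj (c τ)).im with hy
  set a : ℝ → ℝ := fun τ => lam τ - p with ha
  set n : ℝ → VM := fun τ => χ (m (c τ)) with hn
  have hπc : ContinuousAt (fun τ => F.proj (c τ)) τ₁ :=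
    hF.proj_smooth.continuous.continuousAt.comp hc.continuousAt
  have himev : ∀ᶠ τ in 𝓝 τ₁, y τ < y₁ :=
    (Complex.continuous_im.continuousAt.comp hπc).eventually (gt_mem_nhds him)
  have hypos : ∀ τ, 0 < y τ := fun τ => hF.proj_mem (c τ)
  have hgood : ∀ τ, (F.IsAdmissibleL (lam τ) (L τ) ∧ IsPrimitiveOn F.thetaE (L τ) (P τ) ∧
      (∀ y ∈ Ioo 0 y₁, (⟨lam τ - p, y⟩ : ℂ) ∈ Metric.ball (0 : ℂ) r) ∧
      ∀ x ∈ L τ, (F.proj x).im < y₁ → (F.proj x).re = lam τ) → c τ ∈ L τ → y τ < y₁ →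
      F.proj (c τ) - p = ⟨a τ, y τ⟩ ∧ F.proj (c τ) - p ∈ Metric.ball (0 : ℂ) r ∧
        Ψ (⟨a τ, y τ⟩, m (c τ)) = c τ := by
    intro τ h1 h2 h3
    have h4 : F.proj (c τ) - p = ⟨a τ, y τ⟩ := by
      apply Complex.ext
      · simp [ha, h1.2.2.2 _ h2 h3]
      · simp [hy]
    have h5 : F.proj (c τ) - p ∈ Metric.ball (0 : ℂ) r := by
      rw [h4]; exact h1.2.2.1 _ ⟨hypos τ, h3⟩
    exact ⟨h4, h5, by rw [← h4]; exact h.right_inv _ h5⟩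
  obtain ⟨hw₁, hb₁, hΨ₁⟩ := hgood τ₁ hL.self_of_nhds hcL.self_of_nhds him
  have hmd := h.mdifferentiableAt_curve hF hc hb₁
  have hmd2 : MDifferentiableAt 𝓘(ℝ, ℝ) IM (fun τ => m (c τ)) τ₁ :=
    MDifferentiableAt.comp (g := (Prod.snd : ℂ × M → M)) (I' := 𝓘(ℝ, ℂ).prod IM) τ₁
      (mdifferentiableAt_snd) hmd
  have hmsrc : ∀ᶠ τ in 𝓝 τ₁, m (c τ) ∈ χ.source :=
    hmd2.continuousAt (extChartAt_source_mem_nhds (I := IM) m₁)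
  obtain ⟨n', hn'⟩ : ∃ n' : VM, HasDerivAt n n' τ₁ :=
    ⟨_, hasDerivAt_chart_curve hmd2 hmsrc.self_of_nhds⟩
  obtain ⟨y', hy'⟩ : ∃ y', HasDerivAt y y' τ₁ :=
    ⟨_, hasDerivAt_comp_curve (f := fun x => (F.proj x).im)
      (((Complex.imCLM.contDiff.contMDiff.comp hF.proj_smooth) (c τ₁)).mdifferentiableAt
        (n := ∞) (by simp)) hc⟩
  have ha' : HasDerivAt a lam' τ₁ := hlam.sub_const p
  set f := flatMap IM Ψ m₁ with hf
  set s := flatDom IM r m₁ with hs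
  set β := pullForm F.thetaE f s with hβ
  have hβd : ContDiffOn ℝ ∞ β s :=
    contDiffOn_pullForm hF.thetaE_symplectic.1 (uniqueDiffOn_flatDom r m₁) (h.contMDiffOn_flatMap m₁)
  have hfd : ∀ (w : ℂ) τ, m (c τ) ∈ χ.source → f (w, n τ) = Ψ (w, m (c τ)) := by
    intro w τ hτ
    show Ψ (w, χ.symm (χ (m (c τ)))) = _
    rw [χ.left_inv hτ]
  have hmem : ∀ (w : ℂ) τ, w ∈ Metric.ball (0 : ℂ) r → w ∈ upperW → m (c τ) ∈ χ.source →
      (w, n τ) ∈ s := fun w τ h1 h2 h3 => ⟨⟨h1, h2⟩, χ.map_source h3⟩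
  set ct : ℝ → E := fun τ => Ψ (⟨a τ, y₀⟩, m (c τ)) with hct
  have hvert : ∀ᶠ τ in 𝓝 τ₁, ∀ σ ∈ Ioo 0 y₁, Ψ (⟨a τ, σ⟩, m (c τ)) ∈ L τ := by
    filter_upwards [hL, hcL, himev] with τ h1 h2 h3
    refine h.vertical_invariance hF h1.1 h1.2.2.1 h1.2.2.2 (σ₀ := y τ) ⟨hypos τ, h3⟩ ?_
    have h4 := (hgood τ h1 h2 h3).2.2
    rw [← h4] at h2
    exact h2
  have hballev : ∀ᶠ τ in 𝓝 τ₁, ∀ σ ∈ Ioo 0 y₁, (⟨a τ, σ⟩ : ℂ) ∈ Metric.ball (0 : ℂ) r :=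
    hL.mono fun τ h1 => h1.2.2.1
  have hC1 : HasDerivAt (fun τ => (((⟨a τ, y τ⟩ : ℂ), n τ) : ℂ × VM)) (⟨lam', y'⟩, n') τ₁ :=
    (hasDerivAt_complex_mk₂ ha' hy').prodMk hn'
  have hC0 : HasDerivAt (fun τ => (((⟨a τ, y₀⟩ : ℂ), n τ) : ℂ × VM)) (⟨lam', 0⟩, n') τ₁ :=
    (hasDerivAt_complex_mk₂ ha' (hasDerivAt_const τ₁ y₀)).prodMk hn'
  have hC1s : ∀ᶠ τ in 𝓝 τ₁, (((⟨a τ, y τ⟩ : ℂ), n τ) : ℂ × VM) ∈ s := by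
    filter_upwards [hballev, himev, hmsrc] with τ h1 h2 h3
    exact hmem _ _ (h1 _ ⟨hypos τ, h2⟩) (hypos τ) h3
  have hC0s : ∀ᶠ τ in 𝓝 τ₁, (((⟨a τ, y₀⟩ : ℂ), n τ) : ℂ × VM) ∈ s := by
    filter_upwards [hballev, hmsrc] with τ h1 h3
    exact hmem _ _ (h1 _ hy₀) hy₀.1 h3
  have hθ1 : F.thetaE (c τ₁) (velocity IE c τ₁) = β (⟨a τ₁, y τ₁⟩, n τ₁) (⟨lam', y'⟩, n') := by
    refine (oneForm_velocity_congr (c' := fun τ => flatMap IM Ψ m₁ (⟨a τ, y τ⟩, n τ)) F.thetaE ?_).trans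
      (h.pullForm_velocity hC1 hC1s).symm
    filter_upwards [hL, hcL, himev, hmsrc] with τ h1 h2 h3 h4
    rw [← hf, hfd _ _ h4]
    exact (hgood τ h1 h2 h3).2.2.symm
  have hθ0 : F.thetaE (ct τ₁) (velocity IE ct τ₁) = β (⟨a τ₁, y₀⟩, n τ₁) (⟨lam', 0⟩, n') := by
    refine (oneForm_velocity_congr (c' := fun τ => flatMap IM Ψ m₁ (⟨a τ, y₀⟩, n τ)) F.thetaE ?_).trans
      (h.pullForm_velocity hC0 hC0s).symm
    filter_upwards [hmsrc] with τ h4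
    rw [← hf, hfd _ _ h4]
  have hctd : MDifferentiableAt 𝓘(ℝ, ℝ) IE ct τ₁ := by
    have h1 : MDifferentiableAt 𝓘(ℝ, ℝ) 𝓘(ℝ, ℂ) (fun τ => (⟨a τ, y₀⟩ : ℂ)) τ₁ :=
      (hasDerivAt_complex_mk₂ ha' (hasDerivAt_const τ₁ y₀)).differentiableAt.mdifferentiableAt
    exact MDifferentiableAt.comp (g := Ψ) (I' := 𝓘(ℝ, ℂ).prod IM) τ₁
      ((h.contMDiffAt (hballev.self_of_nhds _ hy₀) hy₀.1 _).mdifferentiableAt (by simp))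
      (h1.prodMk hmd2)
  refine ⟨ct, hctd, hvert.mono fun τ h1 => h1 _ hy₀, ?_, ?_⟩
  · rw [hct, h.proj_apply (hballev.self_of_nhds _ hy₀) hy₀.1]
    simp
  set ξ : ℂ × VM := (⟨lam', 0⟩, n') with hξ
  set iv : ℂ × VM := (Complex.I, 0) with hiv
  set lo := min (y τ₁) y₀ / 2 with hlo
  set hi := (max (y τ₁) y₀ + y₁) / 2 with hhi
  have hlo0 : 0 < lo := half_pos (lt_min (hypos τ₁) hy₀.1)
  have hlo1 : lo < y τ₁ := by
    have := min_le_left (y τ₁) y₀; have := hypos τ₁; simp only [hlo] at hlo0 ⊢; linarith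
  have hlo2 : lo < y₀ := by
    have := min_le_right (y τ₁) y₀; simp only [hlo] at hlo0 ⊢; linarith
  have hm1 : max (y τ₁) y₀ < y₁ := max_lt him hy₀.2
  have hhi1 : hi < y₁ := by simp only [hhi]; linarith
  have hhi2 : y τ₁ < hi := by have := le_max_left (y τ₁) y₀; simp only [hhi]; linarith
  have hhi3 : y₀ < hi := by have := le_max_right (y τ₁) y₀; simp only [hhi]; linarith
  have hIcc : ∀ σ ∈ Icc lo hi, σ ∈ Ioo 0 y₁ := fun σ hσ =>
    ⟨hlo0.trans_le hσ.1, hσ.2.trans_lt hhi1⟩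
  have hqs : ∀ σ ∈ Icc lo hi, ((⟨a τ₁, σ⟩ : ℂ), n τ₁) ∈ s := fun σ hσ =>
    hmem _ _ (hballev.self_of_nhds _ (hIcc σ hσ)) (hIcc σ hσ).1 hmsrc.self_of_nhds
  set G' : ℂ × VM → ℂ × VM →L[ℝ] ℝ := fun q =>
    (ContinuousLinearMap.apply ℝ ℝ iv).comp (fderivWithin ℝ β s q) with hG'
  have hβf : ∀ q ∈ s, HasFDerivWithinAt β (fderivWithin ℝ β s q) s q := fun q hq =>
    ((hβd q hq).differentiableWithinAt (by simp)).hasFDerivWithinAt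
  have hGd : ∀ q ∈ s, HasFDerivWithinAt (fun q => β q iv) (G' q) s q := fun q hq =>
    (ContinuousLinearMap.apply ℝ ℝ iv).hasFDerivAt.comp_hasFDerivWithinAt q (hβf q hq)
  have hGc : ContinuousOn G' s := continuousOn_const.clm_comp
    (hβd.continuousOn_fderivWithin (uniqueDiffOn_flatDom r m₁) (by simp))
  have hline : ∀ (b : ℝ) (v : VM) (σ : ℝ),
      HasDerivAt (fun σ : ℝ => (((⟨b, σ⟩ : ℂ), v) : ℂ × VM)) iv σ := fun b v σ =>
    (hasDerivAt_complex_mk b σ).prodMk (hasDerivAt_const σ v)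
  have key := hasDerivAt_variable_endpoint
    (h := fun τ σ => P τ (Ψ (⟨a τ, σ⟩, m (c τ)))) (k := fun τ σ => β (⟨a τ, σ⟩, n τ) iv)
    (b := fun σ => β (⟨a τ₁, σ⟩, n τ₁) ξ - lam' / σ) (b' := fun σ => G' (⟨a τ₁, σ⟩, n τ₁) ξ)
    (y := y) (lo := lo) (hi := hi) (y₀ := y₀) hy' ⟨hlo1, hhi2⟩ ⟨hlo2.le, hhi3.le⟩ ?_ ?_ ?_
  · have hfin : β (⟨a τ₁, y τ₁⟩, n τ₁) iv * y' + (β (⟨a τ₁, y τ₁⟩, n τ₁) ξ - lam' / y τ₁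
        - (β (⟨a τ₁, y₀⟩, n τ₁) ξ - lam' / y₀))
        = F.thetaE (c τ₁) (velocity IE c τ₁) - F.thetaE (ct τ₁) (velocity IE ct τ₁)
          - lam' / y τ₁ + lam' / y₀ := by
      rw [hθ1, hθ0]
      have h1 : ((⟨lam', y'⟩, n') : ℂ × VM) = ξ + y' • iv := by
        refine Prod.ext ?_ ?_
        · apply Complex.ext <;> simp [hξ, hiv]
        · simp [hξ, hiv]
      rw [h1, map_add, map_smul, smul_eq_mul]
      ring
    rw [hfin] at key
    refine key.congr_of_eventuallyEq ?_
    filter_upwards [hL, hcL, himev] with τ h1 h2 h3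
    have h4 := (hgood τ h1 h2 h3).2.2
    show P τ (c τ) - P τ (ct τ) = P τ (Ψ (⟨a τ, y τ⟩, m (c τ))) - P τ (Ψ (⟨a τ, y₀⟩, m (c τ)))
    rw [h4]
  · filter_upwards [hL, hvert, hballev, hmsrc] with τ h1 h2 h3 h4 σ hσ
    have hσ' := hIcc σ hσ
    have h5 : ContMDiffAt 𝓘(ℝ, ℝ) IE ∞ (fun σ : ℝ => Ψ (⟨a τ, σ⟩, m (c τ))) σ :=
      ContMDiffAt.comp (g := Ψ) σ (h.contMDiffAt (h3 σ hσ') hσ'.1 _) (contMDiff_vertical _ _ σ)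
    have h6 := h1.2.1.hasDerivAt h5 (by
      filter_upwards [isOpen_Ioo.mem_nhds hσ'] with σ' h7 using h2 σ' h7)
    have h8 := h.pullForm_velocity (hline (a τ) (n τ) σ) (m₁ := m₁) (by
      filter_upwards [isOpen_Ioo.mem_nhds hσ'] with σ' h7
      exact hmem _ _ (h3 σ' h7) h7.1 h4)
    have h9 : (fun σ : ℝ => flatMap IM Ψ m₁ (⟨a τ, σ⟩, n τ)) = fun σ : ℝ => Ψ (⟨a τ, σ⟩, m (c τ)) :=
      funext fun σ => hfd _ _ h4
    have h10 := h8.trans (oneForm_velocity_congr F.thetaE (Eventually.of_forall (congrFun h9)))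
    exact h10 ▸ h6
  · intro σ hσ
    have hσ' := hIcc σ hσ
    have h1 : HasDerivAt (fun σ : ℝ => β (⟨a τ₁, σ⟩, n τ₁))
        (fderivWithin ℝ β s (⟨a τ₁, σ⟩, n τ₁) iv) σ := by
      refine (HasFDerivWithinAt.comp_hasDerivWithinAt
        (f := fun σ : ℝ => (((⟨a τ₁, σ⟩ : ℂ), n τ₁) : ℂ × VM)) σ (hβf _ (hqs σ hσ))
        (hline (a τ₁) (n τ₁) σ).hasDerivWithinAt (mapsTo_preimage _ _)).hasDerivAt ?_
      filter_upwards [isOpen_Ioo.mem_nhds hσ'] with σ' h7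
      exact hmem _ _ (hballev.self_of_nhds σ' h7) h7.1 hmsrc.self_of_nhds
    have h2 : HasDerivAt (fun σ : ℝ => β (⟨a τ₁, σ⟩, n τ₁) ξ)
        (fderivWithin ℝ β s (⟨a τ₁, σ⟩, n τ₁) iv ξ) σ :=
      (ContinuousLinearMap.apply ℝ ℝ ξ).hasFDerivAt.comp_hasDerivAt σ h1
    have h3 : HasDerivAt (fun σ : ℝ => lam' / σ) (-(lam' / σ ^ 2)) σ := by
      have := (hasDerivAt_inv hσ'.1.ne').const_mul lam'
      refine (this.congr_of_eventuallyEq (Eventually.of_forall fun σ => ?_)).congr_deriv ?_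
      · exact div_eq_mul_inv _ _
      · rw [div_eq_mul_inv]; ring
    have h4 := h2.sub h3
    have h5 := h.fderivWithin_pullForm_flatMap hF (hqs σ hσ) ξ
    have h6 : G' (⟨a τ₁, σ⟩, n τ₁) ξ = fderivWithin ℝ β s (⟨a τ₁, σ⟩, n τ₁) ξ iv := rfl
    have h7 : fderivWithin ℝ β s (⟨a τ₁, σ⟩, n τ₁) ξ iv - fderivWithin ℝ β s (⟨a τ₁, σ⟩, n τ₁) iv ξ
      = lam' / σ ^ 2 := h5
    rw [h6]
    refine h4.congr_deriv ?_
    linarith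
  · intro ε hε
    obtain ⟨U, hU, hsU⟩ := flatDom_eq (IM := IM) r m₁
    have hsU' : s = ((univ : Set ℂ) ×ˢ range IM) ∩ U := hsU
    have hη : HasDerivAt (fun τ => (((a τ - a τ₁ : ℝ) : ℂ), n τ - n τ₁)) ξ τ₁ := by
      have h1 : HasDerivAt (fun τ => ((a τ - a τ₁ : ℝ) : ℂ)) (lam' : ℂ) τ₁ :=
        (ha'.sub_const (a τ₁)).ofReal_comp
      exact h1.prodMk (hn'.sub_const (n τ₁))
    have hq : ContinuousOn (fun σ : ℝ => (((⟨a τ₁, σ⟩ : ℂ), n τ₁) : ℂ × VM)) (Icc lo hi) :=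
      fun σ _ => (hline _ _ σ).continuousAt.continuousWithinAt
    have hsum : ∀ τ σ, (((⟨a τ₁, σ⟩ : ℂ), n τ₁) : ℂ × VM) + (((a τ - a τ₁ : ℝ) : ℂ), n τ - n τ₁)
        = (⟨a τ, σ⟩, n τ) := by
      intro τ σ
      refine Prod.ext ?_ ?_
      · apply Complex.ext <;> simp
      · simp
    have h1 := eventually_uniform_slope (G := fun q => β q iv) (G' := G')
      (convex_univ.prod hF.modelM.convex_range) hU
      (by rw [← hsU']; exact hGd) (by rw [← hsU']; exact hGc) isCompact_Icc hq
      (by rw [← hsU']; exact hqs) hη (by simp) (by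
        filter_upwards [hmsrc] with τ h2 σ hσ
        rw [hsum]
        exact ⟨mem_univ _, extChartAt_target_subset_range m₁ (χ.map_source h2)⟩) hε
    filter_upwards [h1] with τ h2 σ hσ
    have h3 := h2 σ hσ
    rw [hsum] at h3
    exact h3

end FibrationData.IsEndChart

end EndSlope

section LocalSlope

variable {VE : Type*} [NormedAddCommGroup VE] [NormedSpace ℝ VE] [FiniteDimensional ℝ VE]
  {BE : Type*} [TopologicalSpace BE] {IE : ModelWithCorners ℝ VE BE}
  {E : Type*} [TopologicalSpace E] [ChartedSpace BE E] [IsManifold IE ∞ E]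
  {VM : Type*} [NormedAddCommGroup VM] [NormedSpace ℝ VM] [FiniteDimensional ℝ VM]
  {BM : Type*} [TopologicalSpace BM] {IM : ModelWithCorners ℝ VM BM}
  {M : Type*} [TopologicalSpace M] [ChartedSpace BM M] [IsManifold IM ∞ M]
  {F : FibrationData IE E IM M}

theorem SlopeBound.mono {θ : ∀ x : E, TangentSpace IE x →L[ℝ] ℝ} {L : ℝ → Set E} {P : ℝ → E → ℝ}
    {a : ℝ → ℝ} {C C' τ : ℝ} {x : E} (h : SlopeBound θ L P a C τ x) (hC : C ≤ C') :
    SlopeBound θ L P a C' τ x := fun c hc hcx hcL =>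
  (h c hc hcx hcL).mono fun _ h1 => h1.trans (by gcongr)

theorem exists_slopeBound_of_isCompact {θ : ∀ x : E, TangentSpace IE x →L[ℝ] ℝ} {L : ℝ → Set E}
    {P : ℝ → E → ℝ} {a : ℝ → ℝ} {τ₀ : ℝ}
    (ha : ∀ x ∈ L τ₀, ∃ C, ∀ᶠ q in 𝓝 (τ₀, x), q.2 ∈ L q.1 → SlopeBound θ L P a C q.1 q.2)
    {Q : Set (ℝ × E)} (hQ : IsCompact Q) (hQL : ∀ q ∈ Q, q.2 ∈ L q.1) :
    ∃ C, ∀ᶠ τ in 𝓝 τ₀, ∀ x, (τ, x) ∈ Q → SlopeBound θ L P a C τ x := by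
  suffices h : ∃ C, ∀ᶠ τ in 𝓝 τ₀, ∀ x, (τ, x) ∈ Q → (τ, x) ∈ Q → SlopeBound θ L P a C τ x by
    obtain ⟨C, hC⟩ := h
    exact ⟨C, hC.mono fun τ h x hx => h x hx hx⟩
  refine hQ.induction_on
    (p := fun A => ∃ C, ∀ᶠ τ in 𝓝 τ₀, ∀ x, (τ, x) ∈ A → (τ, x) ∈ Q → SlopeBound θ L P a C τ x)
    ⟨0, by simp⟩ ?_ ?_ ?_
  · rintro A A' hAA ⟨C, hC⟩
    exact ⟨C, hC.mono fun τ h x hx => h x (hAA hx)⟩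
  · rintro A A' ⟨C, hC⟩ ⟨C', hC'⟩
    refine ⟨max C C', ?_⟩
    filter_upwards [hC, hC'] with τ h1 h2 x hx hxQ
    rcases hx with hx | hx
    · exact (h1 x hx hxQ).mono (le_max_left _ _)
    · exact (h2 x hx hxQ).mono (le_max_right _ _)
  · rintro ⟨τ₁, x₁⟩ hq
    by_cases hτ : τ₁ = τ₀
    · subst hτ
      obtain ⟨C, hC⟩ := ha x₁ (hQL _ hq)
      exact ⟨_, mem_nhdsWithin_of_mem_nhds hC, C, Eventually.of_forall fun τ x hx hxQ =>
        hx (hQL _ hxQ)⟩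
    · obtain ⟨U, V, hU, hV, hUV⟩ := t2_separation_nhds hτ
      refine ⟨Prod.fst ⁻¹' U, mem_nhdsWithin_of_mem_nhds (continuousAt_fst hU), 0, ?_⟩
      filter_upwards [hV] with τ h1 x hx
      exact (Set.disjoint_left.1 hUV (show τ ∈ U from hx) h1).elim

theorem exists_local_slope [CompactSpace M] [T2Space E] (hF : F.IsTarget)
    {J : ∀ x : E, TangentSpace IE x →L[ℝ] TangentSpace IE x} (hJ : F.ExtendsToInfinity J)
    {T : Set ℝ} (hT : IsOpen T) {lam lam' : ℝ → ℝ} {L : ℝ → Set E} {P K : ℝ → E → ℝ}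
    (hLf : F.IsLagrangianFamily T lam L) (hP : ∀ τ ∈ T, IsPrimitiveOn F.thetaE (L τ) (P τ))
    (hlam : ∀ τ ∈ T, HasDerivAt lam (lam' τ) τ) (hlamc : ContinuousOn lam' T)
    (hKc : ContinuousOn (fun q : ℝ × E => K q.1 q.2) (T ×ˢ univ))
    (hKi : ∀ τ₀ ∈ T, ∃ y > 0, ∀ᶠ τ in 𝓝 τ₀, ∀ x ∈ L τ, (F.proj x).im < y →
      K τ x = lam' τ / (F.proj x).im) {τ₀ : ℝ} (hτ₀ : τ₀ ∈ T) :
    ∃ (a : ℝ → ℝ) (C : ℝ), ∀ᶠ τ in 𝓝 τ₀, ∀ c : ℝ → E, MDifferentiableAt 𝓘(ℝ, ℝ) IE c τ →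
      (∀ᶠ τ' in 𝓝 τ, c τ' ∈ L τ') → ∀ᶠ τ' in 𝓝 τ,
        |P τ' (c τ') - a τ' - (P τ (c τ) - a τ)
          - (τ' - τ) * (F.thetaE (c τ) (velocity IE c τ) - K τ (c τ))| ≤ C * |τ' - τ| := by
  obtain ⟨a, ha⟩ := exists_uniform_slopeBound hF.thetaE_symplectic.1
    (hLf.admissible τ₀ hτ₀).connected.isPreconnected
    (fun x hx => (hLf.admissible τ₀ hτ₀).isInteriorPoint hx) hP (hLf.subbundle τ₀ hτ₀)
  set p := lam τ₀ with hp
  obtain ⟨r, hr, Ψ, -, hΨ, himg, -⟩ := hJ (fun w => (p : ℂ) + w) (Or.inl ⟨p, rfl⟩)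
  obtain ⟨δ, hδ, hZT⟩ := Metric.nhds_basis_closedBall.mem_iff.1 (hT.mem_nhds hτ₀)
  set Z := Metric.closedBall τ₀ δ with hZ
  have hZc : IsCompact Z := isCompact_closedBall _ _
  have hZn : ∀ᶠ τ in 𝓝 τ₀, τ ∈ Z := Metric.closedBall_mem_nhds _ hδ
  obtain ⟨C₀, hC₀, hC₀c, r', hinf⟩ := hLf.at_infinity Z hZT hZc
  obtain ⟨y₂, hy₂, hC₀y⟩ : ∃ y₂ > 0, ∀ w ∈ C₀, y₂ ≤ w.im :=
    hC₀c.exists_forall_le' Complex.continuous_im.continuousOn fun w hw => hC₀ hw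
  obtain ⟨y₃, hy₃, hKy⟩ := hKi τ₀ hτ₀
  set y₁ := min y₂ (min (r / 2) y₃) with hy₁
  have hy₁0 : 0 < y₁ := lt_min hy₂ (lt_min (half_pos hr) hy₃)
  set y₀ := y₁ / 2 with hy₀
  have hy₀0 : 0 < y₀ := half_pos hy₁0
  have hy₀1 : y₀ < y₁ := half_lt_self hy₁0
  have hlamc' : ContinuousOn lam Z := fun τ hτ =>
    (hlam τ (hZT hτ)).continuousAt.continuousWithinAt
  obtain ⟨Λ, hΛ⟩ := hZc.exists_bound_of_continuousOn hlamc'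
  have hre : ∀ τ ∈ Z, ∀ x ∈ L τ, (F.proj x).im < y₁ → (F.proj x).re = lam τ := by
    intro τ hτ x hx hxy
    rcases hinf τ hτ (mem_image_of_mem _ hx) with h1 | h1
    · exact absurd (hC₀y _ h1) (not_le.2 (hxy.trans_le (min_le_left _ _)))
    · exact h1.1
  -- the compact part
  set C' : Set ℂ := C₀ ∪ (Icc (-Λ) Λ ×ℂ Icc y₀ r') with hC'
  have hC'W : C' ⊆ upperW := by
    rintro w (h1 | h1)
    · exact hC₀ h1
    · exact hy₀0.trans_le h1.2.1
  have hC'c : IsCompact C' := hC₀c.union (isCompact_Icc.reProdIm isCompact_Icc)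
  set Q : Set (ℝ × E) := {q | q.1 ∈ Z ∧ q.2 ∈ L q.1 ∧ F.proj q.2 ∈ C'} with hQ
  have hQc : IsCompact Q := hLf.proper Z hZT hZc C' hC'W hC'c
  have hQmem : ∀ τ ∈ Z, ∀ x ∈ L τ, y₀ ≤ (F.proj x).im → (τ, x) ∈ Q := by
    intro τ hτ x hx hxy
    refine ⟨hτ, hx, ?_⟩
    rcases hinf τ hτ (mem_image_of_mem _ hx) with h1 | h1
    · exact Or.inl h1
    · refine Or.inr ⟨?_, hxy, h1.2.2.le⟩
      have := hΛ τ hτ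
      rw [Real.norm_eq_abs, abs_le] at this
      show (F.proj x).re ∈ Icc (-Λ) Λ
      rw [h1.1]
      exact this
  obtain ⟨C₁, hC₁⟩ := exists_slopeBound_of_isCompact ha hQc fun q hq => hq.2.1
  obtain ⟨B, hB⟩ := hQc.exists_bound_of_continuousOn
    (hKc.mono fun q hq => ⟨hZT hq.1, mem_univ _⟩)
  have hlb : ∀ᶠ τ in 𝓝 τ₀, |lam' τ| < |lam' τ₀| + 1 :=
    ((hlamc.continuousAt (hT.mem_nhds hτ₀)).abs).eventually (gt_mem_nhds (lt_add_one _))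
  have hball : ∀ᶠ τ in 𝓝 τ₀, ∀ y ∈ Ioo 0 y₁, (⟨lam τ - p, y⟩ : ℂ) ∈ Metric.ball (0 : ℂ) r := by
    have h1 : ∀ᶠ τ in 𝓝 τ₀, |lam τ - p| < r / 2 := by
      have := (hlam τ₀ hτ₀).continuousAt (Metric.ball_mem_nhds _ (half_pos hr))
      exact this
    filter_upwards [h1] with τ h2 y hy
    rw [mem_ball_zero_iff]
    refine (Complex.norm_le_abs_re_add_abs_im _).trans_lt ?_
    have h3 : |y| < r / 2 := by
      rw [abs_of_pos hy.1]
      exact hy.2.trans_le ((min_le_right _ _).trans (min_le_left _ _))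
    simpa using add_lt_add h2 h3
  have hB0 : 0 ≤ |B| := abs_nonneg B
  set Λ' := (|lam' τ₀| + 1) / y₀ with hΛ'
  have hΛ'0 : 0 ≤ Λ' := by positivity
  refine ⟨a, C₁ + |B| + 1 + Λ', ?_⟩
  filter_upwards [eventually_eventually_nhds.2 hZn, eventually_eventually_nhds.2 hball, hC₁, hlb, hKy]
    with τ h1 h2 h3 h4 h5 c hc hcL
  have hcτ := hcL.self_of_nhds
  have hZτ := h1.self_of_nhds
  rcases lt_or_ge (F.proj (c τ)).im y₀ with him | him
  · have him1 := him.trans hy₀1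
    have hpc : F.proj (c τ) - p ∈ Metric.ball (0 : ℂ) r := by
      have h6 := h2.self_of_nhds _ ⟨hF.proj_mem (c τ), him1⟩
      convert h6 using 1
      apply Complex.ext
      · simp [hre τ hZτ _ hcτ him1]
      · simp
    obtain ⟨m, hm⟩ := exists_endChart hF hΨ himg hpc
    obtain ⟨ct, hct, hctL, hcty, hder⟩ := hm.hasDerivAt_primitive_sub hF (L := L) (lam := lam) (P := P)
      (τ₁ := τ) (y₀ := y₀) (y₁ := y₁) (by
        filter_upwards [h1, h2] with τ' h6 h7
        exact ⟨hLf.admissible τ' (hZT h6), hP τ' (hZT h6), h7, hre τ' h6⟩)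
      (hlam τ (hZT hZτ)) ⟨hy₀0, hy₀1⟩ hc hcL him1
    have h8 := h3 (ct τ) (hQmem τ hZτ _ hctL.self_of_nhds hcty.ge) ct hct rfl hctL
    have h9 := h5 (c τ) hcτ (him1.trans_le ((min_le_right _ _).trans (min_le_right _ _)))
    filter_upwards [h8, hder.isLittleO.def one_pos] with τ' h10 h11
    rw [h9]
    simp only [Real.norm_eq_abs, smul_eq_mul, one_mul] at h11
    have h12 : |(τ' - τ) * (lam' τ / y₀)| ≤ Λ' * |τ' - τ| := by
      rw [abs_mul, mul_comm, abs_div, abs_of_pos hy₀0]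
      refine mul_le_mul_of_nonneg_right ?_ (abs_nonneg _)
      exact div_le_div_of_nonneg_right h4.le hy₀0.le
    have h13 : 0 ≤ |B| * |τ' - τ| := by positivity
    rw [abs_le] at h10 h11 h12 ⊢
    constructor <;> nlinarith [h10.1, h10.2, h11.1, h11.2, h12.1, h12.2, h13]
  · have h6 := hQmem τ hZτ _ hcτ him
    have h7 := hB _ h6
    filter_upwards [h3 (c τ) h6 c hc rfl hcL] with τ' h8
    have h9 : |(τ' - τ) * K τ (c τ)| ≤ |B| * |τ' - τ| := by
      rw [abs_mul, mul_comm]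
      have : |K τ (c τ)| ≤ |B| := h7.trans (le_abs_self B)
      gcongr
    have h10 : 0 ≤ Λ' * |τ' - τ| := by positivity
    have h11 := abs_nonneg (τ' - τ)
    rw [abs_le] at h8 h9 ⊢
    constructor <;> nlinarith [h8.1, h8.2, h9.1, h9.2, h10]

end LocalSlope

section PathAction

variable {VE : Type*} [NormedAddCommGroup VE] [NormedSpace ℝ VE] [FiniteDimensional ℝ VE]
  {BE : Type*} [TopologicalSpace BE] {IE : ModelWithCorners ℝ VE BE}
  {E : Type*} [TopologicalSpace E] [ChartedSpace BE E] [IsManifold IE ∞ E]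
  {VM : Type*} [NormedAddCommGroup VM] [NormedSpace ℝ VM] [FiniteDimensional ℝ VM]
  {BM : Type*} [TopologicalSpace BM] {IM : ModelWithCorners ℝ VM BM}
  {M : Type*} [TopologicalSpace M] [ChartedSpace BM M] [IsManifold IM ∞ M]
  {F : FibrationData IE E IM M}

/-- A path with `c τ ∈ L τ`, such that `θ (c') - K (c)` is continuous. -/
structure IsLagrangianPath (θ : ∀ x : E, TangentSpace IE x →L[ℝ] ℝ) (T : Set ℝ) (L : ℝ → Set E)
    (K : ℝ → E → ℝ) (c : ℝ → E) : Prop where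
  mdifferentiableAt : ∀ τ ∈ T, MDifferentiableAt 𝓘(ℝ, ℝ) IE c τ
  mem : ∀ τ ∈ T, c τ ∈ L τ
  continuousOn : ContinuousOn (fun τ => θ (c τ) (velocity IE c τ) - K τ (c τ)) T

theorem IsLagrangianPath.intervalIntegrable {θ : ∀ x : E, TangentSpace IE x →L[ℝ] ℝ} {T : Set ℝ}
    {L : ℝ → Set E} {K : ℝ → E → ℝ} {c : ℝ → E} (h : IsLagrangianPath θ T L K c) {a b : ℝ}
    (hab : uIcc a b ⊆ T) :
    IntervalIntegrable (fun τ => θ (c τ) (velocity IE c τ) - K τ (c τ)) volume a b :=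
  (h.continuousOn.mono hab).intervalIntegrable

theorem IsLagrangianPath.abs_integral_sub_le {θ : ∀ x : E, TangentSpace IE x →L[ℝ] ℝ} {T : Set ℝ}
    (hT : IsOpen T) {L : ℝ → Set E} {K P : ℝ → E → ℝ} {c : ℝ → E} (h : IsLagrangianPath θ T L K c)
    {A : ℝ → ℝ} {C a b : ℝ} (hab : a ≤ b) (habT : Icc a b ⊆ T)
    (hC : ∀ τ ∈ Icc a b, ∀ c : ℝ → E, MDifferentiableAt 𝓘(ℝ, ℝ) IE c τ →
      (∀ᶠ τ' in 𝓝 τ, c τ' ∈ L τ') → ∀ᶠ τ' in 𝓝 τ,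
        |P τ' (c τ') - A τ' - (P τ (c τ) - A τ)
          - (τ' - τ) * (θ (c τ) (velocity IE c τ) - K τ (c τ))| ≤ C * |τ' - τ|) :
    |(∫ τ in a..b, (θ (c τ) (velocity IE c τ) - K τ (c τ))) - (P b (c b) - P a (c a))|
      ≤ (C + 1) * (b - a) + |A b - A a| := by
  set g : ℝ → ℝ := fun τ => θ (c τ) (velocity IE c τ) - K τ (c τ) with hg
  have hgc : ContinuousOn g T := h.continuousOn
  set G : ℝ → ℝ := fun τ => P τ (c τ) - A τ - ∫ s in a..τ, g s with hG
  have hloc : ∀ τ ∈ Icc a b, ∀ᶠ τ' in 𝓝 τ, |G τ' - G τ| ≤ (C + 1) * |τ' - τ| := by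
    intro τ hτ
    have hτT := habT hτ
    have h1 := hC τ hτ c (h.mdifferentiableAt τ hτT)
      ((hT.eventually_mem hτT).mono fun τ' hτ' => h.mem τ' hτ')
    have hsub : uIcc a τ ⊆ T := by
      rw [uIcc_of_le hτ.1]
      exact (Icc_subset_Icc_right hτ.2).trans habT
    have h2 : HasDerivAt (fun τ => ∫ s in a..τ, g s) (g τ) τ :=
      intervalIntegral.integral_hasDerivAt_right (h.intervalIntegrable hsub)
        (hgc.stronglyMeasurableAtFilter hT τ hτT) (hgc.continuousAt (hT.mem_nhds hτT))
    filter_upwards [h1, h2.isLittleO.def one_pos] with τ' h3 h4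
    simp only [Real.norm_eq_abs, smul_eq_mul, one_mul] at h4
    have h5 : G τ' - G τ = (P τ' (c τ') - A τ' - (P τ (c τ) - A τ) - (τ' - τ) * g τ)
      - ((∫ s in a..τ', g s) - (∫ s in a..τ, g s) - (τ' - τ) * g τ) := by simp only [hG]; ring
    rw [h5, add_mul, one_mul]
    exact (abs_sub _ _).trans (add_le_add h3 h4)
  have h6 := abs_sub_le_of_local_slope_le hab hloc
  have h7 : (∫ τ in a..b, g τ) - (P b (c b) - P a (c a)) = -(G b - G a) - (A b - A a) := by
    simp only [hG, intervalIntegral.integral_same]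
    ring
  rw [h7]
  refine (abs_sub _ _).trans (add_le_add ?_ le_rfl)
  rwa [abs_neg]

/-- The action of a path in a family of Lagrangian submanifolds is determined by the primitives at the
endpoints, up to a bounded error. -/
theorem exists_path_action_bound [CompactSpace M] [T2Space E] (hF : F.IsTarget)
    {J : ∀ x : E, TangentSpace IE x →L[ℝ] TangentSpace IE x} (hJ : F.ExtendsToInfinity J)
    {T : Set ℝ} (hT : IsOpen T) {lam lam' : ℝ → ℝ} {L : ℝ → Set E} {P K : ℝ → E → ℝ}
    (hLf : F.IsLagrangianFamily T lam L) (hP : ∀ τ ∈ T, IsPrimitiveOn F.thetaE (L τ) (P τ))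
    (hlam : ∀ τ ∈ T, HasDerivAt lam (lam' τ) τ) (hlamc : ContinuousOn lam' T)
    (hKc : ContinuousOn (fun q : ℝ × E => K q.1 q.2) (T ×ˢ univ))
    (hKi : ∀ τ₀ ∈ T, ∃ y > 0, ∀ᶠ τ in 𝓝 τ₀, ∀ x ∈ L τ, (F.proj x).im < y →
      K τ x = lam' τ / (F.proj x).im) {a b : ℝ} (hab : a ≤ b) (habT : Icc a b ⊆ T) :
    ∃ C, ∀ c : ℝ → E, IsLagrangianPath F.thetaE T L K c →
      |(∫ τ in a..b, (F.thetaE (c τ) (velocity IE c τ) - K τ (c τ))) - (P b (c b) - P a (c a))| ≤ C := by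
  have hsub : ∀ x ∈ Icc a b, ∀ y ∈ Icc a b, uIcc x y ⊆ T := fun x hx y hy =>
    ((ordConnected_Icc).uIcc_subset hx hy).trans habT
  refine (isPreconnected_Icc (a := a) (b := b)).induction₂ (fun x y => ∃ C, ∀ c : ℝ → E,
    IsLagrangianPath F.thetaE T L K c →
      |(∫ τ in x..y, (F.thetaE (c τ) (velocity IE c τ) - K τ (c τ))) - (P y (c y) - P x (c x))| ≤ C)
    ?_ ?_ ?_ (left_mem_Icc.2 hab) (right_mem_Icc.2 hab)
  · intro x hx
    obtain ⟨A, C, hC⟩ := exists_local_slope hF hJ hT hLf hP hlam hlamc hKc hKi (habT hx)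
    obtain ⟨ε, hε, hball⟩ := Metric.mem_nhds_iff.1 hC
    refine mem_nhdsWithin.2 ⟨Metric.ball x ε, Metric.isOpen_ball, Metric.mem_ball_self hε, ?_⟩
    rintro y ⟨hy, hyab⟩
    have hIcc : uIcc x y ⊆ Metric.ball x ε :=
      (convex_ball x ε).ordConnected.uIcc_subset (Metric.mem_ball_self hε) hy
    rcases le_total x y with hxy | hxy
    · rw [uIcc_of_le hxy] at hIcc
      refine ⟨(C + 1) * (y - x) + |A y - A x|, fun c hc => ?_⟩
      exact hc.abs_integral_sub_le hT hxy (by rw [← uIcc_of_le hxy]; exact hsub x hx y hyab)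
        fun τ hτ => hball (hIcc hτ)
    · rw [uIcc_of_ge hxy] at hIcc
      refine ⟨(C + 1) * (x - y) + |A x - A y|, fun c hc => ?_⟩
      have := hc.abs_integral_sub_le (P := P) hT hxy
        (by rw [← uIcc_of_le hxy]; exact hsub y hyab x hx) fun τ hτ => hball (hIcc hτ)
      rw [intervalIntegral.integral_symm, ← abs_neg]
      convert this using 2
      ring
  · rintro x y z hx hy hz ⟨C, hC⟩ ⟨C', hC'⟩
    refine ⟨C + C', fun c hc => ?_⟩
    rw [← intervalIntegral.integral_add_adjacent_intervals (hc.intervalIntegrable (hsub x hx y hy))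
      (hc.intervalIntegrable (hsub y hy z hz))]
    refine le_trans (le_of_eq ?_) ((abs_add_le _ _).trans (add_le_add (hC c hc) (hC' c hc)))
    congr 1
    ring
  · rintro x y - - ⟨C, hC⟩
    refine ⟨C, fun c hc => ?_⟩
    have := hC c hc
    rw [intervalIntegral.integral_symm, ← abs_neg]
    convert this using 2
    ring

end PathAction

section BoundaryAction

variable {VE : Type*} [NormedAddCommGroup VE] [NormedSpace ℝ VE] [FiniteDimensional ℝ VE]
  {BE : Type*} [TopologicalSpace BE] {IE : ModelWithCorners ℝ VE BE}
  {E : Type*} [TopologicalSpace E] [ChartedSpace BE E] [IsManifold IE ∞ E]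
  {VM : Type*} [NormedAddCommGroup VM] [NormedSpace ℝ VM] [FiniteDimensional ℝ VM]
  {BM : Type*} [TopologicalSpace BM] {IM : ModelWithCorners ℝ VM BM}
  {M : Type*} [TopologicalSpace M] [ChartedSpace BM M] [IsManifold IM ∞ M]
  {F : FibrationData IE E IM M} {d : ℕ} {S : DiscData d} {e : Fin (d + 1) → EndData IE E}
  {D : SurfaceData IE E}

open Classical in
variable (F) in
/-- A primitive of `θ_E` on `L`, chosen depending only on `L`. -/
def primitiveOf (L : Set E) : E → ℝ :=
  if h : ∃ P, IsPrimitiveOn F.thetaE L P then h.choose else 0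

theorem FibrationData.IsAdmissibleL.isPrimitiveOn {lam : ℝ} {L : Set E} (hL : F.IsAdmissibleL lam L) :
    IsPrimitiveOn F.thetaE L (primitiveOf F L) := by
  have h : ∃ P, IsPrimitiveOn F.thetaE L P := hL.exact
  unfold primitiveOf
  rw [dif_pos h]
  exact h.choose_spec

theorem isOpen_bdryAngles : IsOpen S.bdryAngles :=
  (S.isClosed_range_puncture.preimage continuous_bdryPt).isOpen_compl

theorem bdryPt_mem_surface {τ : ℝ} (hτ : τ ∈ S.bdryAngles) : DiscData.bdryPt τ ∈ S.surface :=
  ⟨by rw [mem_closedBall_zero_iff, norm_bdryPt], hτ⟩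

theorem IsSolution.isLagrangianPath (hF : F.IsTarget) (hD : D.IsAdmissible F S e) {u : ℂ → E}
    (hu : IsSolution F S D u) :
    IsLagrangianPath F.thetaE S.bdryAngles (fun τ => D.L (DiscData.bdryPt τ))
      (fun τ x => D.K (DiscData.bdryPt τ) x (Complex.I * DiscData.bdryPt τ))
      (fun τ => u (DiscData.bdryPt τ)) ∧
    ∀ τ ∈ S.bdryAngles, F.thetaE (u (DiscData.bdryPt τ)) (velocity IE (fun τ => u (DiscData.bdryPt τ)) τ)
      - D.K (DiscData.bdryPt τ) (u (DiscData.bdryPt τ)) (Complex.I * DiscData.bdryPt τ)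
      = actionForm F S D u (DiscData.bdryPt τ) (Complex.I * DiscData.bdryPt τ) := by
  have hcomp : ∀ τ ∈ S.bdryAngles, HasMFDerivAt 𝓘(ℝ, ℝ) IE (fun τ => u (DiscData.bdryPt τ)) τ
      ((mfderivWithin 𝓘(ℝ, ℂ) IE u S.surface (DiscData.bdryPt τ)).comp
        (ContinuousLinearMap.toSpanSingleton ℝ (Complex.I * DiscData.bdryPt τ))) := by
    intro τ hτ
    have h1 := ((hu.smooth _ (bdryPt_mem_surface hτ)).mdifferentiableWithinAt
      (by simp)).hasMFDerivWithinAt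
    have h2 : HasMFDerivWithinAt 𝓘(ℝ, ℝ) 𝓘(ℝ, ℂ) DiscData.bdryPt S.bdryAngles τ
        (ContinuousLinearMap.toSpanSingleton ℝ (Complex.I * DiscData.bdryPt τ)) :=
      (hasDerivAt_bdryPt τ).hasFDerivAt.hasMFDerivAt.hasMFDerivWithinAt
    exact (HasMFDerivWithinAt.comp τ h1 h2 fun τ hτ => bdryPt_mem_surface hτ).hasMFDerivAt
      (isOpen_bdryAngles.mem_nhds hτ)
  have heq : ∀ τ ∈ S.bdryAngles,
      F.thetaE (u (DiscData.bdryPt τ)) (velocity IE (fun τ => u (DiscData.bdryPt τ)) τ)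
      - D.K (DiscData.bdryPt τ) (u (DiscData.bdryPt τ)) (Complex.I * DiscData.bdryPt τ)
      = actionForm F S D u (DiscData.bdryPt τ) (Complex.I * DiscData.bdryPt τ) := by
    intro τ hτ
    have h1 : (velocity IE (fun τ => u (DiscData.bdryPt τ)) τ : VE)
        = mfderivWithin 𝓘(ℝ, ℂ) IE u S.surface (DiscData.bdryPt τ) (Complex.I * DiscData.bdryPt τ) := by
      unfold velocity
      rw [(hcomp τ hτ).mfderiv]
      exact congrArg (fun a : ℂ => (mfderivWithin 𝓘(ℝ, ℂ) IE u S.surface (DiscData.bdryPt τ) a : VE))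
        (one_smul ℝ (Complex.I * DiscData.bdryPt τ))
    exact congrArg (fun a : VE => F.thetaE (u (DiscData.bdryPt τ)) a
      - D.K (DiscData.bdryPt τ) (u (DiscData.bdryPt τ)) (Complex.I * DiscData.bdryPt τ)) h1
  refine ⟨⟨fun τ hτ => (hcomp τ hτ).mdifferentiableAt, hu.boundary, ?_⟩, heq⟩
  refine ContinuousOn.congr ?_ heq
  have h1 : ContinuousOn (fun τ => actionForm F S D u (DiscData.bdryPt τ)) S.bdryAngles :=
    (contDiffOn_actionForm hF.thetaE_symplectic hD.K_smooth hu.smooth).continuousOn.comp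
      continuous_bdryPt.continuousOn fun τ hτ => bdryPt_mem_surface hτ
  exact h1.clm_apply (continuous_const.mul continuous_bdryPt).continuousOn

theorem exists_boundary_action_bound [CompactSpace M] [T2Space E] (hF : F.IsTarget)
    (hD : D.IsAdmissible F S e) {a b : ℝ} (hab : a ≤ b) (habT : Icc a b ⊆ S.bdryAngles) :
    ∃ C, ∀ u, IsSolution F S D u →
      |(∫ τ in a..b, actionForm F S D u (DiscData.bdryPt τ) (Complex.I * DiscData.bdryPt τ))
        - (primitiveOf F (D.L (DiscData.bdryPt b)) (u (DiscData.bdryPt b))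
          - primitiveOf F (D.L (DiscData.bdryPt a)) (u (DiscData.bdryPt a)))| ≤ C := by
  have hJ := (hD.J_admissible _ (bdryPt_mem_surface (habT (left_mem_Icc.2 hab)))).extends_to_infinity
  have hAc : ContinuousOn (fun τ => D.A (DiscData.bdryPt τ) (Complex.I * DiscData.bdryPt τ))
      S.bdryAngles :=
    (hD.A_smooth.continuousOn.comp continuous_bdryPt.continuousOn fun τ hτ =>
      bdryPt_mem_surface hτ).clm_apply (continuous_const.mul continuous_bdryPt).continuousOn
  have hlc : ContinuousOn (fun τ => D.lam (DiscData.bdryPt τ)) S.bdryAngles := fun τ hτ =>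
    (hD.lam_constant τ hτ).continuousAt.continuousWithinAt
  have hQ := exists_path_action_bound (T := S.bdryAngles)
    (lam := fun τ => D.lam (DiscData.bdryPt τ))
    (lam' := fun τ => (D.A (DiscData.bdryPt τ) (Complex.I * DiscData.bdryPt τ)).1
      * D.lam (DiscData.bdryPt τ) + (D.A (DiscData.bdryPt τ) (Complex.I * DiscData.bdryPt τ)).2)
    (L := fun τ => D.L (DiscData.bdryPt τ))
    (P := fun τ => primitiveOf F (D.L (DiscData.bdryPt τ)))
    (K := fun τ x => D.K (DiscData.bdryPt τ) x (Complex.I * DiscData.bdryPt τ))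
    hF hJ isOpen_bdryAngles hD.L_family
    (fun τ hτ => (hD.L_family.admissible τ hτ).isPrimitiveOn) hD.lam_constant
    ((hAc.fst.mul hlc).add hAc.snd) ?_ ?_ hab habT
  · obtain ⟨C, hC⟩ := hQ
    refine ⟨C, fun u hu => ?_⟩
    obtain ⟨h1, h2⟩ := hu.isLagrangianPath hF hD
    have h3 := hC _ h1
    rwa [intervalIntegral.integral_congr (g := fun τ =>
      actionForm F S D u (DiscData.bdryPt τ) (Complex.I * DiscData.bdryPt τ))
      (fun τ hτ => h2 τ (habT (by rwa [uIcc_of_le hab] at hτ)))] at h3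
  · have h1 : ContinuousOn (fun q : ℝ × E => D.K (DiscData.bdryPt q.1) q.2) (S.bdryAngles ×ˢ univ) :=
      hD.K_smooth.continuousOn.comp (f := fun q : ℝ × E => ((DiscData.bdryPt q.1, q.2) : ℂ × E))
        ((continuous_bdryPt.comp continuous_fst).prodMk continuous_snd).continuousOn
        fun q hq => ⟨bdryPt_mem_surface hq.1, mem_univ _⟩
    exact h1.clm_apply
      ((continuous_const.mul (continuous_bdryPt.comp continuous_fst)).continuousOn)
  · intro τ₀ hτ₀
    obtain ⟨δ, hδ, hZT⟩ := Metric.nhds_basis_closedBall.mem_iff.1 (isOpen_bdryAngles.mem_nhds hτ₀)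
    obtain ⟨C, hC, -, hCK⟩ := hD.K_admissible (DiscData.bdryPt '' Metric.closedBall τ₀ δ)
      (by rintro _ ⟨τ, hτ, rfl⟩; exact bdryPt_mem_surface (hZT hτ))
      ((isCompact_closedBall τ₀ δ).image continuous_bdryPt)
    obtain ⟨y₁, hy₁, hCy₁⟩ : ∃ y₁ > 0, ∀ x ∈ C, y₁ ≤ (F.proj x).im :=
      hC.exists_forall_le' (Complex.continuous_im.comp hF.proj_smooth.continuous).continuousOn
        fun x _ => hF.proj_mem x
    obtain ⟨C₂, hC₂, hC₂c, r, hinf⟩ := hD.L_family.at_infinity _ hZT (isCompact_closedBall τ₀ δ)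
    obtain ⟨y₂, hy₂, hCy₂⟩ : ∃ y₂ > 0, ∀ w ∈ C₂, y₂ ≤ w.im :=
      hC₂c.exists_forall_le' Complex.continuous_im.continuousOn fun w hw => hC₂ hw
    refine ⟨min y₁ y₂, lt_min hy₁ hy₂, ?_⟩
    filter_upwards [Metric.closedBall_mem_nhds τ₀ hδ] with τ hτ x hx hxy
    have h1 : x ∉ C := fun h => absurd (hCy₁ x h) (not_le.2 (hxy.trans_le (min_le_left _ _)))
    have h2 : (F.proj x).re = D.lam (DiscData.bdryPt τ) := by
      rcases hinf τ hτ (mem_image_of_mem _ hx) with h3 | h3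
      · exact absurd (hCy₂ _ h3) (not_le.2 (hxy.trans_le (min_le_right _ _)))
      · exact h3.1
    rw [hCK _ (mem_image_of_mem _ hτ) x h1, affHam, h2]

end BoundaryAction

/-- Integration by parts against a ramp function along a curve ending at `α`. -/
theorem abs_integral_sub_le_of_ramp {c τ τ' φ φ' : ℝ → ℝ} {R α B σ δ : ℝ} (hc : Continuous c)
    (hτ : ∀ r, R ≤ r → HasDerivAt τ (τ' r) r) (hτ' : ContinuousOn τ' (Ici R))
    (hlim : Tendsto τ atTop (𝓝 α)) (hφ : ∀ r, R ≤ r → HasDerivAt φ (φ' r) r)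
    (hφ' : ContinuousOn φ' (Ici R))
    (heq : ∀ r, R ≤ r → c (τ r) * τ' r = ramp σ δ r * φ' r) (hR : R ≤ σ) (hδ : 0 < δ)
    (hB : ∀ r, σ ≤ r → |φ r| ≤ B) : |(∫ t in α..τ R, c t) - φ R| ≤ B := by
  have key : ∀ r, σ + δ ≤ r → |(∫ t in τ r..τ R, c t) - φ R| ≤ B := by
    intro r hr
    have hRr : R ≤ r := by linarith
    have hsub : uIcc R r ⊆ Ici R := by rw [uIcc_of_le hRr]; exact Icc_subset_Ici_self
    have h1 : ∫ s in R..r, c (τ s) * τ' s = ∫ t in τ R..τ r, c t :=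
      intervalIntegral.integral_comp_mul_deriv (fun s hs => hτ s (hsub hs)) (hτ'.mono hsub) hc
    have h2 : ∫ s in R..r, c (τ s) * τ' s = ∫ s in R..r, ramp σ δ s * φ' s :=
      intervalIntegral.integral_congr fun s hs => heq s (hsub hs)
    have h3 := intervalIntegral.integral_mul_deriv_eq_deriv_mul (a := R) (b := r)
      (fun s _ => hasDerivAt_ramp σ δ s) (fun s hs => hφ s (hsub hs))
      (continuous_deriv_ramp σ δ).continuousOn.intervalIntegrable
      (hφ'.mono hsub).intervalIntegrable
    rw [ramp_eq_one hδ hR, ramp_eq_zero hδ hr, zero_mul, one_mul] at h3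
    have h4 : ‖∫ s in R..r, deriv (ramp σ δ) s * φ s‖ ≤ ∫ s in R..r, -deriv (ramp σ δ) s * B := by
      refine intervalIntegral.norm_integral_le_of_norm_le hRr (Eventually.of_forall fun s hs => ?_)
        ((continuous_deriv_ramp σ δ).neg.mul continuous_const).continuousOn.intervalIntegrable
      have h5 : deriv (ramp σ δ) s ≤ 0 := (antitone_ramp hδ).deriv_nonpos
      rw [norm_mul, Real.norm_eq_abs, abs_of_nonpos h5]
      rcases le_or_gt s σ with h6 | h6
      · rw [deriv_ramp_eq_zero_of_le hδ h6]; simp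
      · exact mul_le_mul_of_nonneg_left (hB s h6.le) (neg_nonneg.2 h5)
    have h5 : ∫ s in R..r, -deriv (ramp σ δ) s * B = B := by
      rw [intervalIntegral.integral_mul_const, intervalIntegral.integral_neg,
        intervalIntegral.integral_eq_sub_of_hasDerivAt (fun s _ => hasDerivAt_ramp σ δ s)
          (continuous_deriv_ramp σ δ).continuousOn.intervalIntegrable,
        ramp_eq_one hδ hR, ramp_eq_zero hδ hr]
      ring
    rw [h5, Real.norm_eq_abs] at h4
    rw [intervalIntegral.integral_symm, ← h1, h2, h3]
    convert h4 using 2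
    ring
  have h1 : Tendsto (fun r => |(∫ t in τ r..τ R, c t) - φ R|) atTop
      (𝓝 |(∫ t in α..τ R, c t) - φ R|) := by
    have h2 : Continuous fun a => ∫ t in a..τ R, c t := by
      have h3 : Continuous fun a => ∫ t in τ R..a, c t :=
        intervalIntegral.continuous_primitive (fun _ _ => hc.intervalIntegrable _ _) _
      exact h3.neg.congr fun a => (intervalIntegral.integral_symm _ _).symm
    exact (((h2.tendsto α).comp hlim).sub_const _).abs
  exact le_of_tendsto h1 (eventually_atTop.2 ⟨σ + δ, key⟩)

namespace DiscData.IsPuncturedDisc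

variable {d : ℕ} {S : DiscData d}

theorem endSign_mul_mem (j : Fin (d + 1)) {r : ℝ} (hr : 0 ≤ r) : endSign j * r ∈ endRay j := by
  unfold endSign endRay
  split_ifs
  · exact mem_Iic.2 (by linarith)
  · exact mem_Ici.2 (by linarith)

theorem tendsto_endSign_mul (j : Fin (d + 1)) :
    Tendsto (fun r : ℝ => endSign j * r) atTop (endFilter j) := by
  unfold endSign endFilter
  split_ifs
  · simpa using tendsto_neg_atTop_atBot
  · simp only [one_mul]
    exact tendsto_id

theorem hasDerivAt_strip_edge (hS : S.IsPuncturedDisc) (j : Fin (d + 1)) {k r : ℝ}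
    (hk : k ∈ Icc (0 : ℝ) 1) (hr : 0 < r) :
    HasDerivAt (fun r => S.strip j (endSign j * r, k))
      (endSign j • S.stripS j (endSign j * r, k)) r := by
  have h1 : HasDerivWithinAt (fun r : ℝ => ((endSign j * r, k) : ℝ × ℝ)) (endSign j, 0) (Ioi 0) r := by
    have := ((hasDerivAt_id r).const_mul (endSign j)).prodMk (hasDerivAt_const r k)
    simpa using this.hasDerivWithinAt
  have hm : MapsTo (fun r : ℝ => ((endSign j * r, k) : ℝ × ℝ)) (Ioi 0) (endStrip j) := fun r hr =>
    ⟨endSign_mul_mem j (le_of_lt hr), hk⟩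
  have h2 := (hS.differentiableWithinAt_strip (hm hr)).hasFDerivWithinAt
  have h3 := (h2.comp_hasDerivWithinAt r h1 hm).hasDerivAt (Ioi_mem_nhds hr)
  have h5 : endSign j • S.stripS j (endSign j * r, k)
      = fderivWithin ℝ (S.strip j) (endStrip j) (endSign j * r, k) (endSign j, 0) := by
    refine ((fderivWithin ℝ (S.strip j) (endStrip j)
      (endSign j * r, k)).map_smul (endSign j) (1, 0)).symm.trans ?_
    simp
  rw [h5]
  exact h3

theorem continuousOn_stripS_edge (hS : S.IsPuncturedDisc) (j : Fin (d + 1)) {k : ℝ}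
    (hk : k ∈ Icc (0 : ℝ) 1) :
    ContinuousOn (fun r => S.stripS j (endSign j * r, k)) (Ici 0) := by
  have h1 := (hS.strip_smooth j).continuousOn_fderivWithin (uniqueDiffOn_endStrip j) (by simp)
  have h2 : ContinuousOn (fun r : ℝ => ((endSign j * r, k) : ℝ × ℝ)) (Ici 0) := by fun_prop
  exact (h1.comp h2 fun r hr => ⟨endSign_mul_mem j hr, hk⟩).clm_apply continuousOn_const

/-- The angle of the boundary points of an end, measured relative to the puncture. -/
def edgeAngle (S : DiscData d) (j : Fin (d + 1)) (k r : ℝ) : ℝ :=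
  (Complex.log (S.strip j (endSign j * r, k) / S.puncture j)).im

theorem puncture_ne_zero (S : DiscData d) (j : Fin (d + 1)) : S.puncture j ≠ 0 := Complex.exp_ne_zero _

theorem tendsto_strip_edge (hS : S.IsPuncturedDisc) (j : Fin (d + 1)) {k : ℝ}
    (hk : k ∈ Icc (0 : ℝ) 1) :
    Tendsto (fun r => S.strip j (endSign j * r, k) / S.puncture j) atTop (𝓝 1) := by
  have h1 : Tendsto (fun r : ℝ => ((endSign j * r, k) : ℝ × ℝ)) atTop
      (endFilter j ×ˢ 𝓟 (Icc 0 1)) :=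
    (tendsto_endSign_mul j).prodMk (tendsto_principal.2 (Eventually.of_forall fun _ => hk))
  have h2 := ((hS.strip_limit j).comp h1).div_const (S.puncture j)
  rwa [div_self (puncture_ne_zero S j)] at h2

theorem bdryPt_edgeAngle (hS : S.IsPuncturedDisc) {j : Fin (d + 1)} {k r α : ℝ}
    (hk : k = 0 ∨ k = 1) (hr : 0 ≤ r) (hα : bdryPt α = S.puncture j) :
    bdryPt (α + edgeAngle S j k r) = S.strip j (endSign j * r, k) := by
  have hk' : k ∈ Icc (0 : ℝ) 1 := by rcases hk with rfl | rfl <;> simp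
  have hn := (hS.strip_boundary j (endSign j * r, k) ⟨endSign_mul_mem j hr, hk'⟩).2 hk
  set z := S.strip j (endSign j * r, k)
  have hz : ‖z / S.puncture j‖ = 1 := by rw [norm_div, hn, ← hα, norm_bdryPt, div_one]
  have h0 : z / S.puncture j ≠ 0 := norm_ne_zero_iff.1 (by rw [hz]; exact one_ne_zero)
  have h1 : ((edgeAngle S j k r : ℝ) : ℂ) * Complex.I = Complex.log (z / S.puncture j) := by
    apply Complex.ext
    · rw [Complex.log_re, hz]; simp
    · simp [edgeAngle, z]
  have h2 : bdryPt (α + edgeAngle S j k r) = bdryPt α * Complex.exp (edgeAngle S j k r * Complex.I) := by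
    rw [bdryPt, bdryPt, ← Complex.exp_add]; push_cast; ring_nf
  rw [h2, h1, Complex.exp_log h0, hα, mul_div_cancel₀ _ (puncture_ne_zero S j)]

/-- The derivative of `edgeAngle`. -/
def edgeSpeed (S : DiscData d) (j : Fin (d + 1)) (k r : ℝ) : ℝ :=
  ((endSign j • S.stripS j (endSign j * r, k) / S.puncture j)
    / (S.strip j (endSign j * r, k) / S.puncture j)).im

theorem hasDerivAt_edgeAngle (hS : S.IsPuncturedDisc) {j : Fin (d + 1)} {k r : ℝ}
    (hk : k ∈ Icc (0 : ℝ) 1) (hr : 0 < r)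
    (hs : S.strip j (endSign j * r, k) / S.puncture j ∈ Complex.slitPlane) :
    HasDerivAt (edgeAngle S j k) (edgeSpeed S j k r) r :=
  Complex.imCLM.hasFDerivAt.comp_hasDerivAt r
    (((hS.hasDerivAt_strip_edge j hk hr).div_const (S.puncture j)).clog_real hs)

theorem continuousOn_edgeSpeed (hS : S.IsPuncturedDisc) {j : Fin (d + 1)} {k R : ℝ}
    (hk : k ∈ Icc (0 : ℝ) 1) (hR : 0 < R)
    (hs : ∀ r, R ≤ r → S.strip j (endSign j * r, k) / S.puncture j ∈ Complex.slitPlane) :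
    ContinuousOn (edgeSpeed S j k) (Ici R) := by
  have h1 : ContinuousOn (fun r => endSign j • S.stripS j (endSign j * r, k) / S.puncture j)
      (Ici R) :=
    (((hS.continuousOn_stripS_edge j hk).const_smul (endSign j)).div_const _).mono
      (Ici_subset_Ici.2 hR.le)
  have h2 : ContinuousOn (fun r => S.strip j (endSign j * r, k) / S.puncture j) (Ici R) := fun r hr =>
    ((hS.hasDerivAt_strip_edge j hk
      (hR.trans_le hr)).continuousAt.div_const (S.puncture j)).continuousWithinAt
  exact Complex.continuous_im.comp_continuousOn
    (h1.div h2 fun r hr => Complex.slitPlane_ne_zero (hs r hr))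

theorem edgeSpeed_smul (hS : S.IsPuncturedDisc) {j : Fin (d + 1)} {k r α : ℝ}
    (hk : k = 0 ∨ k = 1) (hr : 0 < r) (hα : bdryPt α = S.puncture j)
    (hs : S.strip j (endSign j * r, k) / S.puncture j ∈ Complex.slitPlane) :
    edgeSpeed S j k r • (Complex.I * bdryPt (α + edgeAngle S j k r))
      = endSign j • S.stripS j (endSign j * r, k) := by
  have hk' : k ∈ Icc (0 : ℝ) 1 := by rcases hk with rfl | rfl <;> simp
  have h3 := (hasDerivAt_bdryPt (α + edgeAngle S j k r)).scomp r
    ((hS.hasDerivAt_edgeAngle hk' hr hs).const_add α)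
  have h4 := hS.hasDerivAt_strip_edge j hk' hr
  have h5 : (fun r => S.strip j (endSign j * r, k)) =ᶠ[𝓝 r]
      bdryPt ∘ fun r => α + edgeAngle S j k r := by
    filter_upwards [Ioi_mem_nhds hr] with r' hr'
    exact (hS.bdryPt_edgeAngle hk (le_of_lt hr') hα).symm
  exact (h3.congr_of_eventuallyEq h5).unique h4

/-- A boundary arc adjacent to a puncture is parametrized by one edge of the strip-like end. -/
theorem exists_edge_param (hS : S.IsPuncturedDisc) (j : Fin (d + 1)) {α κ h : ℝ}
    (hα : bdryPt α = S.puncture j) (hκ : κ = 1 ∨ κ = -1) (hh : 0 < h)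
    (hside : ∀ ε ∈ Ioo 0 h, α + κ * ε ∈ S.bdryAngles) :
    ∃ k, (k = 0 ∨ k = 1) ∧ ∃ R > 0, ∃ τ τ' : ℝ → ℝ,
      (∀ r, R ≤ r → HasDerivAt τ (τ' r) r) ∧ ContinuousOn τ' (Ici R) ∧ Tendsto τ atTop (𝓝 α) ∧
      ∀ r, R ≤ r → 0 < κ * (τ r - α) ∧ κ * (τ r - α) < h ∧
        bdryPt (τ r) = S.strip j (endSign j * r, k) ∧
        τ' r • (Complex.I * bdryPt (τ r)) = endSign j • S.stripS j (endSign j * r, k) := by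
  have hkI : ∀ k : ℝ, (k = 0 ∨ k = 1) → k ∈ Icc (0 : ℝ) 1 := by rintro k (rfl | rfl) <;> simp
  have hev : ∀ k : ℝ, (k = 0 ∨ k = 1) → ∀ᶠ r in atTop,
      S.strip j (endSign j * r, k) / S.puncture j ∈ Complex.slitPlane := fun k hk =>
    (hS.tendsto_strip_edge j (hkI k hk)).eventually
      (Complex.isOpen_slitPlane.mem_nhds Complex.one_mem_slitPlane)
  obtain ⟨R₀, hR₀⟩ := eventually_atTop.1 ((hev 0 (Or.inl rfl)).and (hev 1 (Or.inr rfl)))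
  set R₁ := max R₀ 1
  have hslit : ∀ k : ℝ, (k = 0 ∨ k = 1) → ∀ r, R₁ ≤ r →
      S.strip j (endSign j * r, k) / S.puncture j ∈ Complex.slitPlane := by
    rintro k (rfl | rfl) r hr
    · exact (hR₀ r ((le_max_left _ _).trans hr)).1
    · exact (hR₀ r ((le_max_left _ _).trans hr)).2
  have hpos : ∀ r, R₁ ≤ r → 0 < r := fun r hr => by
    have := (le_max_right R₀ 1).trans hr; linarith
  have hder : ∀ k : ℝ, (k = 0 ∨ k = 1) → ∀ r, R₁ ≤ r → HasDerivAt (edgeAngle S j k)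
      (edgeSpeed S j k r) r := fun k hk r hr =>
    hS.hasDerivAt_edgeAngle (hkI k hk) (hpos r hr) (hslit k hk r hr)
  obtain ⟨ρ, hρ, hball⟩ := hS.exists_ball_puncture j (σ := R₁) (by
    exact (hpos R₁ le_rfl).le)
  obtain ⟨ε, ⟨hε0, hεh⟩, hεπ, hεb⟩ : ∃ ε ∈ Ioo 0 h, ε < Real.pi ∧
      bdryPt (α + κ * ε) ∈ Metric.ball (S.puncture j) ρ := by
    have h1 : Tendsto (fun ε : ℝ => bdryPt (α + κ * ε)) (𝓝[>] 0) (𝓝 (S.puncture j)) := by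
      have h2 : Continuous fun ε : ℝ => bdryPt (α + κ * ε) :=
        continuous_bdryPt.comp (by fun_prop)
      have h3 := (h2.tendsto 0).mono_left (nhdsWithin_le_nhds (s := Ioi 0))
      simpa [hα] using h3
    have h5 : ∀ᶠ ε in 𝓝[>] (0 : ℝ), ε ∈ Ioo 0 h := Ioo_mem_nhdsGT hh
    have h6 : ∀ᶠ ε in 𝓝[>] (0 : ℝ), ε ∈ Ioo 0 Real.pi := Ioo_mem_nhdsGT Real.pi_pos
    obtain ⟨ε, h2, h3, h4⟩ := ((h1.eventually (Metric.ball_mem_nhds _ hρ)).and (h5.and h6)).exists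
    exact ⟨ε, h3, h4.2, h2⟩
  obtain ⟨q, ⟨hq, hqR⟩, hqz⟩ := hball ⟨bdryPt_mem_surface (hside ε ⟨hε0, hεh⟩), hεb⟩
  have hqk : q.2 = 0 ∨ q.2 = 1 := (hS.strip_boundary j q hq).1 (by rw [hqz, norm_bdryPt])
  have hq1 : q = (endSign j * |q.1|, q.2) := by
    refine Prod.ext ?_ rfl
    have h1 : endSign j * endSign j = 1 := by
      rw [← abs_mul_abs_self, abs_endSign, one_mul]
    show q.1 = endSign j * |q.1|
    rw [abs_eq_endSign_mul hq.1, ← mul_assoc, h1, one_mul]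
  set k := q.2 with hk
  have hθ₀ : edgeAngle S j k |q.1| = κ * ε := by
    have h1 : S.strip j (endSign j * |q.1|, k) / S.puncture j
        = Complex.exp ((κ * ε : ℝ) * Complex.I) := by
      rw [← hq1, hqz, ← hα, bdryPt, bdryPt, ← Complex.exp_sub]
      push_cast; ring_nf
    have h2 : κ * ε ≤ Real.pi ∧ -Real.pi < κ * ε := by
      rcases hκ with rfl | rfl <;> constructor <;> linarith
    rw [edgeAngle, h1, Complex.log_exp (by simpa using h2.2) (by simpa using h2.1)]
    simp
  have hne : ∀ r, R₁ ≤ r → κ * edgeAngle S j k r ≠ 0 := by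
    intro r hr h0
    have h1 : edgeAngle S j k r = 0 := by rcases hκ with rfl | rfl <;> simpa using h0
    have h2 := hS.bdryPt_edgeAngle hqk (hpos r hr).le hα
    rw [h1, add_zero, hα] at h2
    have h3 := hS.strip_mapsTo j (⟨endSign_mul_mem j (hpos r hr).le, hkI k hqk⟩ :
      (endSign j * r, k) ∈ endStrip j)
    exact h3.2 ⟨j, h2⟩
  have hκ2 : κ * κ = 1 := by rcases hκ with rfl | rfl <;> norm_num
  have hsign : ∀ r, R₁ ≤ r → 0 < κ * edgeAngle S j k r := by
    intro r hr
    by_contra hcon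
    have h1 : ContinuousOn (fun r => κ * edgeAngle S j k r) (Ici R₁) := fun r hr =>
      ((hder k hqk r hr).continuousAt.const_mul κ).continuousWithinAt
    have h2 := isPreconnected_Ici.intermediate_value (mem_Ici.2 hr) (mem_Ici.2 hqR.le) h1
    obtain ⟨r', hr', h3⟩ := h2 ⟨not_lt.1 hcon, show (0 : ℝ) ≤ κ * edgeAngle S j k |q.1| by
      rw [hθ₀, ← mul_assoc, hκ2]; linarith⟩
    exact hne r' hr' h3
  have hlim : Tendsto (edgeAngle S j k) atTop (𝓝 0) := by
    have h1 := (Complex.continuous_im.tendsto _).comp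
      ((continuousAt_clog Complex.one_mem_slitPlane).tendsto.comp
        (hS.tendsto_strip_edge j (hkI k hqk)))
    rw [Complex.log_one, Complex.zero_im] at h1
    exact h1
  obtain ⟨R₂, hR₂⟩ := eventually_atTop.1 ((by simpa using hlim.const_mul κ :
    Tendsto (fun r => κ * edgeAngle S j k r) atTop (𝓝 0)).eventually (gt_mem_nhds hh))
  set R := max R₁ R₂ + 1
  have hRR : R₁ < R := by have := le_max_left R₁ R₂; simp only [R]; linarith
  have hRR₂ : R₂ ≤ R := by have := le_max_right R₁ R₂; simp only [R]; linarith
  refine ⟨k, hqk, R, hpos R hRR.le, fun r => α + edgeAngle S j k r, edgeSpeed S j k,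
    fun r hr => (hder k hqk r (hRR.le.trans hr)).const_add α,
    hS.continuousOn_edgeSpeed (hkI k hqk) (hpos R hRR.le)
      (fun r hr => hslit k hqk r (hRR.le.trans hr)),
    by simpa using hlim.const_add α, fun r hr => ?_⟩
  have h1 := hsign r (hRR.le.trans hr)
  have h2 := hR₂ r (hRR₂.trans hr)
  exact ⟨by simpa using h1, by simpa using h2,
    hS.bdryPt_edgeAngle hqk (hpos r (hRR.le.trans hr)).le hα,
    hS.edgeSpeed_smul hqk (hpos r (hRR.le.trans hr)) hα (hslit k hqk r (hRR.le.trans hr))⟩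

end DiscData.IsPuncturedDisc

section CircleBound

variable {VE : Type*} [NormedAddCommGroup VE] [NormedSpace ℝ VE] [FiniteDimensional ℝ VE]
  {BE : Type*} [TopologicalSpace BE] {IE : ModelWithCorners ℝ VE BE}
  {E : Type*} [TopologicalSpace E] [ChartedSpace BE E] [IsManifold IE ∞ E]
  {VM : Type*} [NormedAddCommGroup VM] [NormedSpace ℝ VM] [FiniteDimensional ℝ VM]
  {BM : Type*} [TopologicalSpace BM] {IM : ModelWithCorners ℝ VM BM}
  {M : Type*} [TopologicalSpace M] [ChartedSpace BM M] [IsManifold IM ∞ M]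
  {F : FibrationData IE E IM M} {d : ℕ} {S : DiscData d} {e : Fin (d + 1) → EndData IE E}
  {D : SurfaceData IE E}

theorem velocity_comp_of_contMDiffOn {s : Set ℂ} {u : ℂ → E} (hu : ContMDiffOn 𝓘(ℝ, ℂ) IE ∞ u s)
    {c : ℝ → ℂ} {c' : ℂ} {r : ℝ} (hc : ContDiffAt ℝ ∞ c r) (hc' : HasDerivAt c c' r)
    (hcs : ∀ᶠ t in 𝓝 r, c t ∈ s) :
    ContMDiffAt 𝓘(ℝ, ℝ) IE ∞ (fun t => u (c t)) r ∧
      (velocity IE (fun t => u (c t)) r : VE) = mfderivWithin 𝓘(ℝ, ℂ) IE u s (c r) c' := by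
  have hr := hcs.self_of_nhds
  constructor
  · have h1 : ContMDiffWithinAt 𝓘(ℝ, ℝ) IE ∞ (fun t => u (c t)) (c ⁻¹' s) r :=
      ContMDiffWithinAt.comp r (hu _ hr) hc.contMDiffAt.contMDiffWithinAt fun _ h => h
    exact h1.contMDiffAt hcs
  · have h1 := ((hu _ hr).mdifferentiableWithinAt (by simp)).hasMFDerivWithinAt
    have h2 : HasMFDerivWithinAt 𝓘(ℝ, ℝ) 𝓘(ℝ, ℂ) c (c ⁻¹' s) r
        (ContinuousLinearMap.toSpanSingleton ℝ c') := hc'.hasFDerivAt.hasMFDerivAt.hasMFDerivWithinAt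
    have h3 := (HasMFDerivWithinAt.comp r h1 h2 fun _ h => h).hasMFDerivAt hcs
    unfold velocity
    have h4 := congrArg (fun l : ℝ →L[ℝ] VE => l 1) h3.mfderiv
    refine h4.trans ?_
    exact congrArg (fun a : ℂ => (mfderivWithin 𝓘(ℝ, ℂ) IE u s (c r) a : VE)) (one_smul ℝ c')

theorem hasDerivAt_primitive_edge (hS : S.IsPuncturedDisc) (hD : D.IsAdmissible F S e) {u : ℂ → E}
    (hu : ContMDiffOn 𝓘(ℝ, ℂ) IE ∞ u S.surface) {j : Fin (d + 1)} {k r : ℝ}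
    (hk : k ∈ Icc (0 : ℝ) 1) (hr : 0 < r) {L : Set E} {P : E → ℝ} (hP : IsPrimitiveOn F.thetaE L P)
    (hL : ∀ᶠ t in 𝓝 r, u (S.strip j (endSign j * t, k)) ∈ L) :
    HasDerivAt (fun t => P (u (S.strip j (endSign j * t, k))))
      (actionForm F S D u (S.strip j (endSign j * r, k))
        (endSign j • S.stripS j (endSign j * r, k))) r := by
  have hm : MapsTo (fun r : ℝ => ((endSign j * r, k) : ℝ × ℝ)) (Ioi 0) (endStrip j) := fun r hr =>
    ⟨DiscData.IsPuncturedDisc.endSign_mul_mem j (le_of_lt hr), hk⟩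
  have hc : ContDiffAt ℝ ∞ (fun t : ℝ => S.strip j (endSign j * t, k)) r :=
    ((hS.strip_smooth j).comp (f := fun r : ℝ => ((endSign j * r, k) : ℝ × ℝ))
      ((contDiff_const.mul contDiff_id).prodMk contDiff_const).contDiffOn hm).contDiffAt
      (Ioi_mem_nhds hr)
  obtain ⟨h1, h2⟩ := velocity_comp_of_contMDiffOn hu hc (hS.hasDerivAt_strip_edge j hk hr)
    (by filter_upwards [Ioi_mem_nhds hr] with t ht using hS.strip_mapsTo j (hm ht))
  have h3 := hP.hasDerivAt h1 hL
  have h4 : F.thetaE (u (S.strip j (endSign j * r, k)))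
      (velocity IE (fun t => u (S.strip j (endSign j * t, k))) r)
      = actionForm F S D u (S.strip j (endSign j * r, k))
        (endSign j • S.stripS j (endSign j * r, k)) := by
    have h5 : D.K (S.strip j (endSign j * r, k)) (u (S.strip j (endSign j * r, k)))
        (endSign j • S.stripS j (endSign j * r, k)) = 0 := by
      rw [map_smul, (hD.K_end j _ (hm hr) _).1, smul_zero]
    refine (congrArg (fun a : VE => F.thetaE (u (S.strip j (endSign j * r, k))) a) h2).trans ?_
    unfold actionForm
    rw [_root_.sub_apply, h5, sub_zero]
    rfl
  exact h4 ▸ h3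

theorem continuous_cutoff_action (hF : F.IsTarget) (hS : S.IsPuncturedDisc)
    (hD : D.IsAdmissible F S e) {u : ℂ → E} (hu : IsSolution F S D u) {σ δ : ℝ} (hσ : 0 < σ)
    (hδ : 0 < δ) : Continuous fun τ => S.cutoff σ δ (DiscData.bdryPt τ) *
      actionForm F S D u (DiscData.bdryPt τ) (Complex.I * DiscData.bdryPt τ) := by
  have h1 := hS.continuousOn_cutoff_smul hσ hδ
    (contDiffOn_actionForm hF.thetaE_symplectic hD.K_smooth hu.smooth).continuousOn
  have h2 : Continuous fun τ => S.cutoff σ δ (DiscData.bdryPt τ) •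
      actionForm F S D u (DiscData.bdryPt τ) :=
    h1.comp_continuous continuous_bdryPt fun τ => by rw [mem_closedBall_zero_iff, norm_bdryPt]
  exact h2.clm_apply (continuous_const.mul continuous_bdryPt)

theorem exists_side_bound (hF : F.IsTarget) (hS : S.IsPuncturedDisc) (hD : D.IsAdmissible F S e)
    (x : Fin (d + 1) → ℝ → E) (j : Fin (d + 1)) {α κ h : ℝ}
    (hα : DiscData.bdryPt α = S.puncture j) (hκ : κ = 1 ∨ κ = -1) (hh : 0 < h)
    (hside : ∀ ε ∈ Ioo 0 h, α + κ * ε ∈ S.bdryAngles) :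
    ∃ α', 0 < κ * (α' - α) ∧ κ * (α' - α) < h ∧ ∃ B, ∀ u, IsSolution F S D u → HasLimits S u x →
      ∃ σ₁ > 0, ∀ σ ≥ σ₁, ∀ δ > 0, |(∫ τ in α..α', S.cutoff σ δ (DiscData.bdryPt τ) *
          actionForm F S D u (DiscData.bdryPt τ) (Complex.I * DiscData.bdryPt τ))
        - primitiveOf F (D.L (DiscData.bdryPt α')) (u (DiscData.bdryPt α'))| ≤ B := by
  obtain ⟨k, hk, R, hR, τ, τ', hτ, hτ', hlim, hprop⟩ := hS.exists_edge_param j hα hκ hh hside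
  have hk' : k ∈ Icc (0 : ℝ) 1 := by rcases hk with rfl | rfl <;> simp
  have hτT : ∀ r, R ≤ r → τ r ∈ S.bdryAngles := by
    intro r hr
    have h1 := hside (κ * (τ r - α)) ⟨(hprop r hr).1, (hprop r hr).2.1⟩
    have h2 : κ * κ = 1 := by rcases hκ with rfl | rfl <;> norm_num
    rwa [← mul_assoc, h2, one_mul, add_sub_cancel] at h1
  set L := D.L (DiscData.bdryPt (τ R)) with hLdef
  have hL : ∀ r, R ≤ r → D.L (DiscData.bdryPt (τ r)) = L := by
    intro r hr
    rw [hLdef, (hprop r hr).2.2.1, (hprop R le_rfl).2.2.1]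
    have h0 : ∀ r, R ≤ r → endSign j * r ∈ endRay j := fun r hr =>
      DiscData.IsPuncturedDisc.endSign_mul_mem j (hR.le.trans hr)
    rcases hk with rfl | rfl
    · rw [(hD.L_end j _ (h0 r hr)).1, (hD.L_end j _ (h0 R le_rfl)).1]
    · rw [(hD.L_end j _ (h0 r hr)).2, (hD.L_end j _ (h0 R le_rfl)).2]
  have hP : IsPrimitiveOn F.thetaE L (primitiveOf F L) :=
    (hD.L_family.admissible _ (hτT R le_rfl)).isPrimitiveOn
  set R' := R + 1
  have hRR : R < R' := lt_add_one R
  refine ⟨τ R', (hprop R' hRR.le).1, (hprop R' hRR.le).2.1, |primitiveOf F L (x j k)| + 1,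
    fun u hu hux => ?_⟩
  have hev : ∀ᶠ r in atTop, |primitiveOf F L (u (S.strip j (endSign j * r, k)))|
      < |primitiveOf F L (x j k)| + 1 := by
    have h1 : Tendsto (fun r : ℝ => ((endSign j * r, k) : ℝ × ℝ)) atTop
        (endFilter j ×ˢ 𝓝[Icc 0 1] k) :=
      (DiscData.IsPuncturedDisc.tendsto_endSign_mul j).prodMk
        (tendsto_nhdsWithin_iff.2 ⟨tendsto_const_nhds, Eventually.of_forall fun _ => hk'⟩)
    have h2 := ((hP.1.continuous.tendsto _).comp ((hux j k hk').comp h1)).abs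
    exact h2.eventually (gt_mem_nhds (lt_add_one _))
  obtain ⟨R₁, hR₁⟩ := eventually_atTop.1 hev
  refine ⟨max R' R₁, lt_max_of_lt_left (hR.trans hRR), fun σ hσ δ hδ => ?_⟩
  have hR'σ : R' ≤ σ := (le_max_left _ _).trans hσ
  have hσ0 : 0 < σ := (hR.trans hRR).trans_le hR'σ
  have hact : ContinuousOn (fun t => actionForm F S D u (DiscData.bdryPt t)
      (Complex.I * DiscData.bdryPt t)) S.bdryAngles :=
    ((contDiffOn_actionForm hF.thetaE_symplectic hD.K_smooth hu.smooth).continuousOn.comp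
      continuous_bdryPt.continuousOn fun τ hτ => bdryPt_mem_surface hτ).clm_apply
      (continuous_const.mul continuous_bdryPt).continuousOn
  have hval : ∀ r, R ≤ r → τ' r * actionForm F S D u (DiscData.bdryPt (τ r))
      (Complex.I * DiscData.bdryPt (τ r)) = actionForm F S D u (S.strip j (endSign j * r, k))
        (endSign j • S.stripS j (endSign j * r, k)) := by
    intro r hr
    rw [← (hprop r hr).2.2.2, map_smul, smul_eq_mul, (hprop r hr).2.2.1]
  have hsub : Ici R' ⊆ Ici R := Ici_subset_Ici.2 hRR.le
  have key := abs_integral_sub_le_of_ramp (φ := fun r =>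
      primitiveOf F L (u (S.strip j (endSign j * r, k))))
    (φ' := fun r => τ' r * actionForm F S D u (DiscData.bdryPt (τ r))
      (Complex.I * DiscData.bdryPt (τ r)))
    (continuous_cutoff_action hF hS hD hu hσ0 hδ) (fun r hr => hτ r (hRR.le.trans hr))
    (hτ'.mono hsub) hlim ?_ ?_ ?_ hR'σ hδ
    (fun r hr => (hR₁ r (((le_max_right _ _).trans hσ).trans hr)).le)
  · rw [hL R' hRR.le]
    rw [(hprop R' hRR.le).2.2.1]
    exact key
  · intro r hr
    have hRr : R < r := hRR.trans_le hr
    rw [hval r hRr.le]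
    refine hasDerivAt_primitive_edge hS hD hu.smooth hk' (hR.trans hRr) hP ?_
    filter_upwards [Ioi_mem_nhds hRr] with t ht
    have h1 := hu.boundary _ (hτT t (le_of_lt ht))
    rwa [hL t (le_of_lt ht), (hprop t (le_of_lt ht)).2.2.1] at h1
  · exact (hτ'.mono hsub).mul (hact.comp (fun r hr =>
      (hτ r (hsub hr)).continuousAt.continuousWithinAt) fun r hr => hτT r (hsub hr))
  · intro r hr
    have hRr : R ≤ r := hRR.le.trans hr
    have h1 : S.cutoff σ δ (DiscData.bdryPt (τ r)) = ramp σ δ r := by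
      rw [DiscData.cutoff_of_mem (bdryPt_mem_surface (hτT r hRr)), (hprop r hRr).2.2.1,
        hS.endHeight_strip ⟨DiscData.IsPuncturedDisc.endSign_mul_mem j (hR.le.trans hRr), hk'⟩,
        abs_mul, abs_endSign, one_mul, abs_of_nonneg (hR.le.trans hRr)]
    rw [h1]
    ring

theorem exists_endHeight_lt (hS : S.IsPuncturedDisc) {a b : ℝ} (habT : Icc a b ⊆ S.bdryAngles) :
    ∃ σ₀ > 0, ∀ τ ∈ Icc a b, S.endHeight (DiscData.bdryPt τ) < σ₀ := by
  refine isCompact_Icc.induction_on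
    (p := fun s => ∃ σ₀ > 0, ∀ τ ∈ s, S.endHeight (DiscData.bdryPt τ) < σ₀) ?_ ?_ ?_ ?_
  · exact ⟨1, one_pos, fun _ h => h.elim⟩
  · rintro s t hst ⟨σ₀, h0, h⟩
    exact ⟨σ₀, h0, fun τ hτ => h τ (hst hτ)⟩
  · rintro s t ⟨σ₀, h0, h⟩ ⟨σ₁, h1, h'⟩
    refine ⟨max σ₀ σ₁, lt_max_of_lt_left h0, ?_⟩
    rintro τ (hτ | hτ)
    · exact (h τ hτ).trans_le (le_max_left _ _)
    · exact (h' τ hτ).trans_le (le_max_right _ _)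
  · intro τ hτ
    have h1 := hS.eventually_endHeight_lt (bdryPt_mem_surface (habT hτ))
      (lt_add_one (S.endHeight (DiscData.bdryPt τ)))
    have h2 : Tendsto DiscData.bdryPt (𝓝[Icc a b] τ) (𝓝[S.surface] (DiscData.bdryPt τ)) :=
      tendsto_nhdsWithin_iff.2 ⟨continuous_bdryPt.continuousAt.continuousWithinAt,
        eventually_mem_nhdsWithin.mono fun t ht => bdryPt_mem_surface (habT ht)⟩
    exact ⟨_, h2.eventually h1, S.endHeight (DiscData.bdryPt τ) + 1,
      by have := S.endHeight_nonneg (DiscData.bdryPt τ); linarith, fun _ h => h⟩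

theorem exists_arc_bound [CompactSpace M] [T2Space E] (hF : F.IsTarget) (hS : S.IsPuncturedDisc)
    (hD : D.IsAdmissible F S e) (x : Fin (d + 1) → ℝ → E) {i j : Fin (d + 1)} {α β : ℝ} (hαβ : α < β)
    (hα : DiscData.bdryPt α = S.puncture i) (hβ : DiscData.bdryPt β = S.puncture j)
    (hT : Ioo α β ⊆ S.bdryAngles) :
    ∃ C, ∀ u, IsSolution F S D u → HasLimits S u x → ∃ σ₁ > 0, ∀ σ ≥ σ₁, ∀ δ > 0,
      |∫ τ in α..β, S.cutoff σ δ (DiscData.bdryPt τ) *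
        actionForm F S D u (DiscData.bdryPt τ) (Complex.I * DiscData.bdryPt τ)| ≤ C := by
  have hh : 0 < (β - α) / 2 := by linarith
  obtain ⟨a, ha0, hah, B₁, hB₁⟩ := exists_side_bound hF hS hD x i hα (Or.inl rfl) hh
    (fun ε hε => hT ⟨by linarith [hε.1], by linarith [hε.2]⟩)
  obtain ⟨b, hb0, hbh, B₂, hB₂⟩ := exists_side_bound hF hS hD x j hβ (Or.inr rfl) hh
    (fun ε hε => hT ⟨by linarith [hε.2], by linarith [hε.1]⟩)
  have hab : a ≤ b := by linarith
  have habT : Icc a b ⊆ S.bdryAngles := fun t ht =>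
    hT ⟨by linarith [ht.1], by linarith [ht.2]⟩
  obtain ⟨B₃, hB₃⟩ := exists_boundary_action_bound hF hD hab habT
  obtain ⟨σ₀, hσ₀, hheight⟩ := exists_endHeight_lt hS habT
  refine ⟨B₁ + B₂ + B₃, fun u hu hux => ?_⟩
  obtain ⟨σ₁, hσ₁, h1⟩ := hB₁ u hu hux
  obtain ⟨σ₂, hσ₂, h2⟩ := hB₂ u hu hux
  refine ⟨max σ₀ (max σ₁ σ₂), lt_max_of_lt_left hσ₀, fun σ hσ δ hδ => ?_⟩
  have g0 : σ₀ ≤ σ := (le_max_left _ _).trans hσ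
  have g1 := h1 σ (((le_max_left _ _).trans (le_max_right _ _)).trans hσ) δ hδ
  have g2 := h2 σ (((le_max_right _ _).trans (le_max_right _ _)).trans hσ) δ hδ
  have g3 := hB₃ u hu
  have hc := continuous_cutoff_action hF hS hD hu (hσ₀.trans_le g0) hδ
  rw [intervalIntegral.integral_congr (g := fun τ => S.cutoff σ δ (DiscData.bdryPt τ) *
    actionForm F S D u (DiscData.bdryPt τ) (Complex.I * DiscData.bdryPt τ)) (fun τ hτ => by
      rw [uIcc_of_le hab] at hτ
      beta_reduce
      rw [DiscData.cutoff_of_mem (bdryPt_mem_surface (habT hτ)),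
        ramp_eq_one hδ ((hheight τ hτ).le.trans g0), one_mul])] at g3
  rw [intervalIntegral.integral_symm] at g2
  rw [← intervalIntegral.integral_add_adjacent_intervals (b := a) (hc.intervalIntegrable _ _)
    (hc.intervalIntegrable _ _), ← intervalIntegral.integral_add_adjacent_intervals (a := a) (b := b)
    (hc.intervalIntegrable _ _) (hc.intervalIntegrable _ _)]
  rw [abs_le] at g1 g2 g3 ⊢
  constructor <;> linarith [g1.1, g1.2, g2.1, g2.2, g3.1, g3.2]

/-- The endpoints of the boundary arcs, in increasing order. -/
def arcEnd (S : DiscData d) (k : ℕ) : ℝ :=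
  if h : k < d + 1 then S.angle ⟨k, h⟩ else S.angle 0 + 2 * Real.pi

theorem bdryPt_arcEnd (S : DiscData d) (k : ℕ) : ∃ j, DiscData.bdryPt (arcEnd S k) = S.puncture j := by
  unfold arcEnd
  split_ifs with h
  · exact ⟨_, rfl⟩
  · refine ⟨0, ?_⟩
    rw [DiscData.bdryPt, DiscData.puncture]
    push_cast
    rw [add_mul, Complex.exp_add, Complex.exp_two_pi_mul_I, mul_one]

theorem arcEnd_lt (hS : S.IsPuncturedDisc) {k : ℕ} (hk : k < d + 1) :
    arcEnd S k < arcEnd S (k + 1) := by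
  unfold arcEnd
  rw [dif_pos hk]
  split_ifs with h
  · exact hS.angle_mono (Fin.mk_lt_mk.2 (Nat.lt_succ_self k))
  · have : (⟨k, hk⟩ : Fin (d + 1)) = Fin.last d := Fin.ext (by simp; omega)
    rw [this]; exact hS.angle_lt

theorem Ioo_arcEnd_subset (hS : S.IsPuncturedDisc) {k : ℕ} (hk : k < d + 1) :
    Ioo (arcEnd S k) (arcEnd S (k + 1)) ⊆ S.bdryAngles := by
  rintro τ ⟨h1, h2⟩ ⟨i, hi⟩
  have hlow : S.angle 0 < τ := by
    refine lt_of_le_of_lt ?_ h1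
    unfold arcEnd; rw [dif_pos hk]
    exact hS.angle_mono.monotone (Fin.zero_le _)
  have hupp : τ < S.angle 0 + 2 * Real.pi := by
    refine h2.trans_le ?_
    unfold arcEnd; split_ifs with h
    · exact (hS.angle_mono.monotone (Fin.le_last _)).trans hS.angle_lt.le
    · exact le_rfl
  have hi0 := hS.angle_mono.monotone (Fin.zero_le i)
  have hi1 := (hS.angle_mono.monotone (Fin.le_last i)).trans_lt hS.angle_lt
  have hτ : S.angle i = τ := by
    rw [DiscData.puncture, DiscData.bdryPt, Complex.exp_eq_exp_iff_exists_int] at hi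
    obtain ⟨n, hn⟩ := hi
    have h3 : S.angle i = τ + n * (2 * Real.pi) := by
      have := congrArg Complex.im hn
      simpa using this
    have h4 : n = 0 := by
      have hp := Real.pi_pos
      have h5 : (-1 : ℝ) < n := by
        by_contra hc
        nlinarith [mul_le_mul_of_nonneg_right (not_lt.1 hc) (by linarith : (0 : ℝ) ≤ 2 * Real.pi)]
      have h6 : (n : ℝ) < 1 := by
        by_contra hc
        nlinarith [mul_le_mul_of_nonneg_right (not_lt.1 hc) (by linarith : (0 : ℝ) ≤ 2 * Real.pi)]
      have h7 : -1 < n := by exact_mod_cast h5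
      have h8 : n < 1 := by exact_mod_cast h6
      omega
    rw [h3, h4]; simp
  subst hτ
  unfold arcEnd at h1 h2
  rw [dif_pos hk] at h1
  have h3 : k < i := Fin.lt_def.1 (hS.angle_mono.lt_iff_lt.1 h1)
  have h4 : k + 1 < d + 1 := by have := i.isLt; omega
  rw [dif_pos h4] at h2
  have h5 : (i : ℕ) < k + 1 := Fin.lt_def.1 (hS.angle_mono.lt_iff_lt.1 h2)
  omega

theorem exists_circle_bound [CompactSpace M] [T2Space E] (hF : F.IsTarget) (hS : S.IsPuncturedDisc)
    (hD : D.IsAdmissible F S e) (x : Fin (d + 1) → ℝ → E) :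
    ∃ C, ∀ u, IsSolution F S D u → HasLimits S u x → ∃ σ₁ > 0, ∀ σ ≥ σ₁, ∀ δ > 0,
      ∫ τ in S.angle 0..S.angle 0 + 2 * Real.pi, S.cutoff σ δ (DiscData.bdryPt τ) *
        actionForm F S D u (DiscData.bdryPt τ) (Complex.I * DiscData.bdryPt τ) ≤ C := by
  have h1 : ∀ n ≤ d + 1, ∃ C, ∀ u, IsSolution F S D u → HasLimits S u x → ∃ σ₁ > 0, ∀ σ ≥ σ₁,
      ∀ δ > 0, ∫ τ in arcEnd S 0..arcEnd S n, S.cutoff σ δ (DiscData.bdryPt τ) *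
        actionForm F S D u (DiscData.bdryPt τ) (Complex.I * DiscData.bdryPt τ) ≤ C := by
    intro n
    induction n with
    | zero => exact fun _ => ⟨0, fun u _ _ => ⟨1, one_pos, fun σ _ δ _ => by simp⟩⟩
    | succ n ih =>
      intro hn
      obtain ⟨C₁, hC₁⟩ := ih (by omega)
      obtain ⟨i, hi⟩ := bdryPt_arcEnd S n
      obtain ⟨j, hj⟩ := bdryPt_arcEnd S (n + 1)
      obtain ⟨C₂, hC₂⟩ := exists_arc_bound hF hS hD x (arcEnd_lt hS (by omega)) hi hj
        (Ioo_arcEnd_subset hS (by omega))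
      refine ⟨C₁ + C₂, fun u hu hux => ?_⟩
      obtain ⟨σ₁, hσ₁, h1⟩ := hC₁ u hu hux
      obtain ⟨σ₂, hσ₂, h2⟩ := hC₂ u hu hux
      refine ⟨max σ₁ σ₂, lt_max_of_lt_left hσ₁, fun σ hσ δ hδ => ?_⟩
      have hc := continuous_cutoff_action hF hS hD hu
        (hσ₁.trans_le ((le_max_left _ _).trans hσ)) hδ
      rw [← intervalIntegral.integral_add_adjacent_intervals (b := arcEnd S n)
        (hc.intervalIntegrable _ _) (hc.intervalIntegrable _ _)]
      exact add_le_add (h1 σ ((le_max_left _ _).trans hσ) δ hδ)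
        ((le_abs_self _).trans (h2 σ ((le_max_right _ _).trans hσ) δ hδ))
  have h2 := h1 (d + 1) le_rfl
  have h3 : arcEnd S 0 = S.angle 0 := by
    unfold arcEnd; rw [dif_pos (Nat.succ_pos d)]; rfl
  have h4 : arcEnd S (d + 1) = S.angle 0 + 2 * Real.pi := by
    unfold arcEnd; rw [dif_neg (lt_irrefl _)]
  rwa [h3, h4] at h2

end CircleBound

section ChartMetric

variable {V : Type*} [NormedAddCommGroup V] [NormedSpace ℝ V] [FiniteDimensional ℝ V]
  {B : Type*} [TopologicalSpace B] {I : ModelWithCorners ℝ V B}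
  {X : Type*} [TopologicalSpace X] [ChartedSpace B X] [IsManifold I ∞ X]
  {θ : ∀ x : X, TangentSpace I x →L[ℝ] ℝ}

theorem continuousOn_tcoord (x₀ : X) : ContinuousOn
    (fun v : TangentBundle I X => (tcoord I x₀ v.1 v.2 : V)) {v | v.1 ∈ (extChartAt I x₀).source} := by
  have : IsManifold I 1 X := IsManifold.of_le (n := ∞) (by simp)
  have h1 := (trivializationAt V (TangentSpace I) x₀).continuousOn.snd
  have hsrc : {v : TangentBundle I X | v.1 ∈ (extChartAt I x₀).source}
      = (trivializationAt V (TangentSpace I) x₀).source := by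
    ext v
    rw [Bundle.Trivialization.mem_source, mem_ofPred_eq, extChartAt_source,
      TangentBundle.trivializationAt_baseSet]
  rw [hsrc]
  refine h1.congr fun v hv => ?_
  have hv' : v.1 ∈ (chartAt B x₀).source := by
    rw [← hsrc, mem_ofPred_eq, extChartAt_source] at hv; exact hv
  have h2 := TangentBundle.continuousLinearMapAt_trivializationAt (I := I) hv'
  have h3 := congrArg (fun l : V →L[ℝ] V => l (v.2 : V)) h2
  refine h3.symm.trans ?_
  exact congrFun (Bundle.Trivialization.coe_linearMapAt_of_mem (R := ℝ)
    (trivializationAt V (TangentSpace I) x₀)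
    (by rw [TangentBundle.trivializationAt_baseSet]; exact hv')) v.2

theorem continuousOn_tvec (x₀ : X) (v : V) : ContinuousOn (fun e : V => (⟨(extChartAt I x₀).symm e,
    mfderivWithin 𝓘(ℝ, V) I (extChartAt I x₀).symm (range I) e v⟩ : TangentBundle I X))
    (extChartAt I x₀).target := by
  have h2 : ContMDiffOn 𝓘(ℝ, V).tangent I.tangent ∞
      (tangentMapWithin 𝓘(ℝ, V) I (extChartAt I x₀).symm (extChartAt I x₀).target)
      (Bundle.TotalSpace.proj ⁻¹' (extChartAt I x₀).target) :=
    (contMDiffOn_extChartAt_symm (n := ∞) x₀).contMDiffOn_tangentMapWithin (by simp)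
      (uniqueDiffOn_extChartAt_target x₀).uniqueMDiffOn
  have h3 : ContMDiff 𝓘(ℝ, V) 𝓘(ℝ, V).tangent ∞
      (fun q : V => (⟨q, v⟩ : TangentBundle 𝓘(ℝ, V) V)) :=
    contMDiff_vectorSpace_iff_contDiff.2 contDiff_const
  refine (h2.comp h3.contMDiffOn fun q hq => hq).continuousOn.congr fun e he => ?_
  show _ = (⟨(extChartAt I x₀).symm e, mfderivWithin 𝓘(ℝ, V) I (extChartAt I x₀).symm
    (extChartAt I x₀).target e v⟩ : TangentBundle I X)
  rw [mfderivWithin_congr_set (extChartAt_target_eventuallyEq_of_mem he)]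

theorem endInChart_apply (J : ∀ x : X, TangentSpace I x →L[ℝ] TangentSpace I x) (x₀ : X) (e v : V) :
    endInChart I J x₀ e v = tcoord I x₀ ((extChartAt I x₀).symm e) (J ((extChartAt I x₀).symm e)
      (mfderivWithin 𝓘(ℝ, V) I (extChartAt I x₀).symm (range I) e v)) := rfl

theorem continuousOn_endInChart {P : Type*} [NormedAddCommGroup P] [NormedSpace ℝ P] {T : Set P}
    {J : P → ∀ x : X, TangentSpace I x →L[ℝ] TangentSpace I x} (hJ : SmoothEndFamilyOn I T J) (x₀ : X) :
    ContinuousOn (fun q : P × V => endInChart I (J q.1) x₀ q.2) (T ×ˢ (extChartAt I x₀).target) := by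
  rw [continuousOn_clm_apply]
  intro v
  have h0 := (continuousOn_tcoord (I := I) x₀)
  have h1 := continuousOn_tvec (I := I) x₀ v
  have h2 : ContinuousOn (fun q : P × TangentBundle I X =>
      (⟨q.2.1, J q.1 q.2.1 q.2.2⟩ : TangentBundle I X)) (T ×ˢ univ) := ContMDiffOn.continuousOn hJ
  have h3 : ContinuousOn (fun q : P × V => ((q.1, ⟨(extChartAt I x₀).symm q.2,
      mfderivWithin 𝓘(ℝ, V) I (extChartAt I x₀).symm (range I) q.2 v⟩) : P × TangentBundle I X))
      (T ×ˢ (extChartAt I x₀).target) :=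
    continuousOn_fst.prodMk (h1.comp continuousOn_snd fun q hq => hq.2)
  have h4 := h2.comp h3 fun q hq => ⟨hq.1, mem_univ _⟩
  refine (ContinuousOn.comp h0 h4 fun q hq => ?_).congr fun q _ => endInChart_apply (J q.1) x₀ q.2 v
  exact (extChartAt I x₀).map_target hq.2

theorem endInChart_tcoord (J : ∀ x : X, TangentSpace I x →L[ℝ] TangentSpace I x) {x₀ x : X}
    (hx : x ∈ (extChartAt I x₀).source) (v : TangentSpace I x) :
    endInChart I J x₀ (extChartAt I x₀ x) (tcoord I x₀ x v) = tcoord I x₀ x (J x v) := by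
  have h4 : (extChartAt I x₀).symm (extChartAt I x₀ x) = x := (extChartAt I x₀).left_inv hx
  have h5 := tvec_tcoord hx v
  have h6 : ∀ y, y = x → ∀ a : V, (tcoord I x₀ y (J y a) : V) = tcoord I x₀ x (J x a) := by
    rintro _ rfl a; rfl
  exact (h6 _ h4 _).trans (congrArg (fun a : V => (tcoord I x₀ x (J x a) : V)) h5)

theorem exists_compact_chart (x₀ : X) : ∃ Q ⊆ (extChartAt I x₀).target, IsCompact Q ∧
    ∃ O : Set X, IsOpen O ∧ x₀ ∈ O ∧ O ⊆ (extChartAt I x₀).source ∧ MapsTo (extChartAt I x₀) O Q := by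
  obtain ⟨ρ, hρ, h⟩ := Metric.mem_nhdsWithin_iff.1 (extChartAt_target_mem_nhdsWithin (I := I) x₀)
  refine ⟨Metric.closedBall (extChartAt I x₀ x₀) (ρ / 2) ∩ range I, fun e he =>
    h ⟨Metric.closedBall_subset_ball (by linarith) he.1, he.2⟩,
    (isCompact_closedBall _ _).inter_right I.isClosed_range,
    (extChartAt I x₀).source ∩ extChartAt I x₀ ⁻¹' Metric.ball (extChartAt I x₀ x₀) (ρ / 2),
    (continuousOn_extChartAt x₀).isOpen_inter_preimage (isOpen_extChartAt_source x₀)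
      Metric.isOpen_ball, ⟨mem_extChartAt_source x₀, Metric.mem_ball_self (by linarith)⟩,
    inter_subset_left, fun x hx => ⟨Metric.ball_subset_closedBall hx.2, ?_⟩⟩
  exact extChartAt_target_subset_range x₀ ((extChartAt I x₀).map_source hx.1)

/-- A family of compatible almost complex structures defines uniformly positive metrics on compact
subsets of a chart, and so do sufficiently small perturbations of it. -/
theorem exists_metric_lower_bound (hθ : IsSymplecticPrimitive I θ) {T : Set ℝ} (hT : IsCompact T)
    {J : ℝ → ∀ x : X, TangentSpace I x →L[ℝ] TangentSpace I x} (hJ : SmoothEndFamilyOn I T J)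
    (hJc : ∀ t ∈ T, IsCompatibleACS I θ (J t)) (x₀ : X) {Q : Set V} (hQ : Q ⊆ (extChartAt I x₀).target)
    (hQc : IsCompact Q) : ∃ m > 0, ∃ η > 0, ∀ t ∈ T,
      ∀ J' : ∀ x : X, TangentSpace I x →L[ℝ] TangentSpace I x, ∀ x ∈ (extChartAt I x₀).source,
      extChartAt I x₀ x ∈ Q → ‖endInChart I J' x₀ (extChartAt I x₀ x)
        - endInChart I (J t) x₀ (extChartAt I x₀ x)‖ ≤ η →
      ∀ v : TangentSpace I x, m * ‖(tcoord I x₀ x v : V)‖ ^ 2 ≤ extD I θ x v (J' x v) := by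
  have hΩ : ContinuousOn (chartOmega θ x₀) Q := (contDiffOn_chartOmega hθ.1 x₀).continuousOn.mono hQ
  have hc : ContinuousOn (fun p : (ℝ × V) × V =>
      chartOmega θ x₀ p.1.2 p.2 (endInChart I (J p.1.1) x₀ p.1.2 p.2))
      ((T ×ˢ Q) ×ˢ Metric.sphere 0 1) := by
    have h1 : ContinuousOn (fun p : (ℝ × V) × V => chartOmega θ x₀ p.1.2)
        ((T ×ˢ Q) ×ˢ Metric.sphere 0 1) :=
      hΩ.comp (continuous_snd.comp continuous_fst).continuousOn fun p hp => hp.1.2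
    have h2 : ContinuousOn (fun p : (ℝ × V) × V => endInChart I (J p.1.1) x₀ p.1.2)
        ((T ×ˢ Q) ×ˢ Metric.sphere 0 1) :=
      (continuousOn_endInChart hJ x₀).comp continuousOn_fst fun p hp => ⟨hp.1.1, hQ hp.1.2⟩
    exact (h1.clm_apply continuousOn_snd).clm_apply (h2.clm_apply continuousOn_snd)
  have hpos : ∀ p ∈ (T ×ˢ Q) ×ˢ Metric.sphere (0 : V) 1,
      0 < chartOmega θ x₀ p.1.2 p.2 (endInChart I (J p.1.1) x₀ p.1.2 p.2) := by
    rintro ⟨⟨t, e⟩, v⟩ ⟨⟨ht, he⟩, hv⟩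
    have hsrc := (extChartAt I x₀).map_target (hQ he)
    have hr := (extChartAt I x₀).right_inv (hQ he)
    have h1 := ((hJc t ht).2 _ (tvec I x₀ ((extChartAt I x₀).symm e) v) 0).2.2 (fun h0 => by
      have h2 := tcoord_tvec hsrc v
      rw [h0, map_zero] at h2
      rw [← h2] at hv
      simp at hv)
    rw [extD_eq_chartOmega hθ.1 hsrc, ← endInChart_tcoord (J t) hsrc, tcoord_tvec hsrc, hr] at h1
    exact h1
  obtain ⟨m, hm, hmin⟩ := ((hT.prod hQc).prod (isCompact_sphere (0 : V) 1)).exists_forall_le' hc hpos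
  obtain ⟨C, hC⟩ := hQc.exists_bound_of_continuousOn (f := chartOmega θ x₀) hΩ
  have hC1 : 0 < |C| + 1 := by positivity
  refine ⟨m / 2, half_pos hm, m / 2 / (|C| + 1), by positivity, fun t ht J' x hx hxQ hclose v => ?_⟩
  rw [extD_eq_chartOmega hθ.1 hx, ← endInChart_tcoord J' hx]
  generalize hw : (tcoord I x₀ x v : V) = w
  set y := extChartAt I x₀ x
  have h1 : m * ‖w‖ ^ 2 ≤ chartOmega θ x₀ y w (endInChart I (J t) x₀ y w) := by
    rcases eq_or_ne w 0 with rfl | hw0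
    · simp
    · have hn : 0 < ‖w‖ := norm_pos_iff.2 hw0
      have h2 := hmin ((t, y), ‖w‖⁻¹ • w) ⟨⟨ht, hxQ⟩, by simp [norm_smul, hn.ne']⟩
      simp only [map_smul, smul_apply, smul_eq_mul] at h2
      have h3 := mul_le_mul_of_nonneg_right h2 (sq_nonneg ‖w‖)
      refine h3.trans_eq ?_
      field_simp
  have h2 : |chartOmega θ x₀ y w ((endInChart I J' x₀ y - endInChart I (J t) x₀ y) w)|
      ≤ m / 2 * ‖w‖ ^ 2 := by
    rw [← Real.norm_eq_abs]
    calc _ ≤ ‖chartOmega θ x₀ y‖ * ‖w‖ * ‖(endInChart I J' x₀ y - endInChart I (J t) x₀ y) w‖ :=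
          ContinuousLinearMap.le_opNorm₂ _ _ _
      _ ≤ (|C| + 1) * ‖w‖ * (m / 2 / (|C| + 1) * ‖w‖) := by
          gcongr
          · linarith [hC y hxQ, le_abs_self C]
          · exact (ContinuousLinearMap.le_opNorm _ _).trans
              (mul_le_mul_of_nonneg_right hclose (norm_nonneg _))
      _ = m / 2 * ‖w‖ ^ 2 := by field_simp
  rw [_root_.sub_apply, map_sub] at h2
  have h3 := (abs_le.1 h2).1
  linarith

end ChartMetric

section ChartBounds

variable {V : Type*} [NormedAddCommGroup V] [NormedSpace ℝ V] [FiniteDimensional ℝ V]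
  {B : Type*} [TopologicalSpace B] {I : ModelWithCorners ℝ V B}
  {X : Type*} [TopologicalSpace X] [ChartedSpace B X] [IsManifold I ∞ X]
  {θ : ∀ x : X, TangentSpace I x →L[ℝ] ℝ}

theorem exists_oneForm_bound (hθ : SmoothOneForm I θ) (x₀ : X) {Q : Set V}
    (hQ : Q ⊆ (extChartAt I x₀).target) (hQc : IsCompact Q) :
    ∃ C, ∀ x ∈ (extChartAt I x₀).source, extChartAt I x₀ x ∈ Q → ∀ v : TangentSpace I x,
      |θ x v| ≤ C * ‖(tcoord I x₀ x v : V)‖ := by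
  obtain ⟨C, hC⟩ := hQc.exists_bound_of_continuousOn (f := oneFormInChart I θ x₀)
    ((contDiffOn_oneFormInChart hθ x₀).continuousOn.mono hQ)
  refine ⟨C, fun x hx hxQ v => ?_⟩
  rw [← oneFormInChart_tcoord θ hx, ← Real.norm_eq_abs]
  exact (ContinuousLinearMap.le_opNorm _ _).trans
    (mul_le_mul_of_nonneg_right (hC _ hxQ) (norm_nonneg _))

variable (I) in
/-- The differential of a function, as a one-form. -/
def mdifferential (h : X → ℝ) (x : X) : TangentSpace I x →L[ℝ] ℝ := mfderiv I 𝓘(ℝ, ℝ) h x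

theorem exists_hamiltonian_bound {H : ℝ → X → ℝ}
    (hH : ContMDiffOn (𝓘(ℝ, ℝ).prod I) 𝓘(ℝ, ℝ) ∞ (fun q : ℝ × X => H q.1 q.2) (Icc 0 1 ×ˢ univ))
    (x₀ : X) {Q : Set V} (hQ : Q ⊆ (extChartAt I x₀).target) (hQc : IsCompact Q) :
    ∃ C, ∀ t ∈ Icc (0 : ℝ) 1, ∀ x ∈ (extChartAt I x₀).source, extChartAt I x₀ x ∈ Q →
      |H t x| ≤ C ∧ ∀ v : TangentSpace I x,
        |mdifferential I (H t) x v| ≤ C * ‖(tcoord I x₀ x v : V)‖ := by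
  set h : ℝ × V → ℝ := fun q => H q.1 ((extChartAt I x₀).symm q.2) with hh
  have h1 : ContDiffOn ℝ ∞ h (Icc 0 1 ×ˢ (extChartAt I x₀).target) := by
    have h2 : ContMDiffOn 𝓘(ℝ, ℝ × V) (𝓘(ℝ, ℝ).prod I) ∞
        (fun q : ℝ × V => ((q.1, (extChartAt I x₀).symm q.2) : ℝ × X))
        (Icc 0 1 ×ˢ (extChartAt I x₀).target) := by
      refine contDiff_fst.contMDiff.contMDiffOn.prodMk ?_
      exact (contMDiffOn_extChartAt_symm (n := ∞) x₀).comp contDiff_snd.contMDiff.contMDiffOn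
        fun q hq => hq.2
    exact (hH.comp h2 fun q hq => ⟨hq.1, mem_univ _⟩).contDiffOn
  have hu : UniqueDiffOn ℝ (Icc (0 : ℝ) 1 ×ˢ (extChartAt I x₀).target) :=
    (uniqueDiffOn_Icc zero_lt_one).prod (uniqueDiffOn_extChartAt_target x₀)
  have hsub : Icc (0 : ℝ) 1 ×ˢ Q ⊆ Icc (0 : ℝ) 1 ×ˢ (extChartAt I x₀).target :=
    prod_mono subset_rfl hQ
  obtain ⟨C₁, hC₁⟩ := (isCompact_Icc.prod hQc).exists_bound_of_continuousOn
    (h1.continuousOn.mono hsub)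
  obtain ⟨C₂, hC₂⟩ := (isCompact_Icc.prod hQc).exists_bound_of_continuousOn
    ((h1.continuousOn_fderivWithin hu (by simp)).mono hsub)
  refine ⟨max C₁ C₂, fun t ht x hx hxQ => ⟨?_, fun v => ?_⟩⟩
  · have h2 := hC₁ (t, extChartAt I x₀ x) ⟨ht, hxQ⟩
    rw [hh] at h2
    simp only [(extChartAt I x₀).left_inv hx, Real.norm_eq_abs] at h2
    exact h2.trans (le_max_left _ _)
  · have hHt : ContMDiff I 𝓘(ℝ, ℝ) ∞ (H t) := by
      have h2 : ContMDiff I (𝓘(ℝ, ℝ).prod I) ∞ (fun x : X => (t, x)) :=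
        contMDiff_const.prodMk contMDiff_id
      exact contMDiffOn_univ.1 (hH.comp h2.contMDiffOn fun x _ => ⟨ht, mem_univ _⟩)
    have h3 := mfderiv_eq_fderivWithin_tcoord (h := H t) hx ((hHt x).mdifferentiableAt (by simp)) v
    have h4 := fderivWithin_prod_right (f := h)
      ((h1 (t, extChartAt I x₀ x) ⟨ht, (extChartAt I x₀).map_source hx⟩).differentiableWithinAt
        (by simp)) (uniqueDiffOn_extChartAt_target x₀ _ ((extChartAt I x₀).map_source hx)) ht
      (tcoord I x₀ x v)
    have h5 : mdifferential I (H t) x v = fderivWithin ℝ h (Icc 0 1 ×ˢ (extChartAt I x₀).target)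
        (t, extChartAt I x₀ x) (0, tcoord I x₀ x v) := h3.trans h4
    rw [h5, ← Real.norm_eq_abs]
    have h6 : ∀ w : V, ‖((0 : ℝ), w)‖ = ‖w‖ := fun w => by simp [Prod.norm_def]
    refine (ContinuousLinearMap.le_opNorm _ _).trans ?_
    rw [h6]
    exact mul_le_mul_of_nonneg_right ((hC₂ (t, extChartAt I x₀ x) ⟨ht, hxQ⟩).trans (le_max_right _ _))
      (norm_nonneg _)

/-- The Hamiltonian vector field is bounded in terms of the derivative of the function. -/
theorem norm_tcoord_hamVF_le (hθ : IsSymplecticPrimitive I θ)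
    {J : ∀ x : X, TangentSpace I x →L[ℝ] TangentSpace I x} (hJ : IsCompatibleACS I θ J) {x₀ x : X}
    {H : X → ℝ} {m C : ℝ} (hm : 0 < m) (hC0 : 0 ≤ C)
    (hmet : ∀ v : TangentSpace I x, m * ‖(tcoord I x₀ x v : V)‖ ^ 2 ≤ extD I θ x v (J x v))
    (hC : ∀ v : TangentSpace I x,
      |mdifferential I H x v| ≤ C * ‖(tcoord I x₀ x v : V)‖) :
    ‖(tcoord I x₀ x (hamVF I θ H x) : V)‖ ≤ C / m := by
  set Y := hamVF I θ H x
  have h1 := hmet Y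
  have h2 := hmet (J x Y)
  have h3 : extD I θ x Y (J x Y) ≤ C * ‖(tcoord I x₀ x (J x Y) : V)‖ := by
    rw [extD_hamVF hθ]
    exact (neg_le_abs (mdifferential I H x (J x Y))).trans (hC _)
  have h4 : extD I θ x (J x Y) (J x (J x Y)) = extD I θ x Y (J x Y) := by
    rw [(hJ.2 x Y 0).1, extD_neg_right, ← extD_swap]
  rw [h4] at h2
  have hb : 0 ≤ ‖(tcoord I x₀ x (J x Y) : V)‖ := norm_nonneg _
  have ha : 0 ≤ ‖(tcoord I x₀ x Y : V)‖ := norm_nonneg _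
  revert h1 h2 h3 ha hb
  generalize ‖(tcoord I x₀ x Y : V)‖ = a
  generalize ‖(tcoord I x₀ x (J x Y) : V)‖ = b
  generalize extD I θ x Y (J x Y) = g
  intro h1 h2 h3 hb ha
  rw [le_div_iff₀ hm]
  have hbC : m * b ≤ C := by
    rcases hb.eq_or_lt with h0 | h0
    · rw [← h0, mul_zero]; exact hC0
    · exact le_of_mul_le_mul_right (by nlinarith : m * b * b ≤ C * b) h0
  refine le_of_sq_le_sq ?_ hC0
  nlinarith [mul_le_mul_of_nonneg_left hbC hC0, mul_le_mul_of_nonneg_left (h1.trans h3) hm.le]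

end ChartBounds

section EndEstimate

variable {VE : Type*} [NormedAddCommGroup VE] [NormedSpace ℝ VE] [FiniteDimensional ℝ VE]
  {BE : Type*} [TopologicalSpace BE] {IE : ModelWithCorners ℝ VE BE}
  {E : Type*} [TopologicalSpace E] [ChartedSpace BE E] [IsManifold IE ∞ E]
  {VM : Type*} [NormedAddCommGroup VM] [NormedSpace ℝ VM] [FiniteDimensional ℝ VM]
  {BM : Type*} [TopologicalSpace BM] {IM : ModelWithCorners ℝ VM BM}
  {M : Type*} [TopologicalSpace M] [ChartedSpace BM M] [IsManifold IM ∞ M]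
  {F : FibrationData IE E IM M} {d : ℕ} {S : DiscData d} {e : Fin (d + 1) → EndData IE E}
  {D : SurfaceData IE E}

theorem abs_add_sub_le_of_metric {m g n₁ n₂ A₁ A₂ A₃ C₁ C₂ C₃ : ℝ} (hm : 0 < m) (hg : m * n₁ ^ 2 ≤ g)
    (hn : 0 ≤ n₁) (h1 : |A₁| ≤ C₁ * n₁) (h2 : |A₂| ≤ C₁ * n₂) (hn₂ : 0 ≤ n₂) (h3 : n₂ ≤ C₃)
    (h4 : |A₃| ≤ C₂) :
    |A₁ + A₂ - A₃| ≤ max (|C₁| / √m) (|C₁| * C₃ + |C₂|) * (1 + √g) := by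
  have hn₁ : n₁ ≤ √g / √m := by
    rw [← Real.sqrt_div' _ hm.le]
    exact Real.le_sqrt_of_sq_le (by rw [le_div_iff₀ hm]; linarith)
  have h5 : |A₁| ≤ |C₁| / √m * √g := by
    refine h1.trans ((mul_le_mul_of_nonneg_right (le_abs_self C₁) hn).trans ?_)
    rw [div_mul_eq_mul_div, ← mul_div_assoc']
    exact mul_le_mul_of_nonneg_left hn₁ (abs_nonneg _)
  have h6 : |A₂| ≤ |C₁| * C₃ :=
    h2.trans (mul_le_mul (le_abs_self _) h3 hn₂ (abs_nonneg _))
  have h7 : |A₁ + A₂ - A₃| ≤ |A₁| + |A₂| + |A₃| :=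
    (abs_sub _ _).trans (add_le_add_left (abs_add_le _ _) _)
  have h8 := mul_le_mul_of_nonneg_right
    (le_max_left (|C₁| / √m) (|C₁| * C₃ + |C₂|)) (Real.sqrt_nonneg g)
  have h9 := le_max_right (|C₁| / √m) (|C₁| * C₃ + |C₂|)
  linarith [le_abs_self C₂]

theorem actionForm_eq_covDeriv (F : FibrationData IE E IM M) (S : DiscData d) (D : SurfaceData IE E)
    (u : ℂ → E) (z ξ : ℂ) : actionForm F S D u z ξ = F.thetaE (u z) (covDeriv F S D u z ξ)
      + F.thetaE (u z) (hamVF IE F.thetaE (fun y => D.K z y ξ) (u z)) - D.K z (u z) ξ := by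
  unfold covDeriv
  rw [map_sub, sub_add_cancel]
  rfl

theorem exists_local_end_bound (hF : F.IsTarget) (hS : S.IsPuncturedDisc)
    (he : ∀ j, (e j).IsAdmissible F) (hD : D.IsAdmissible F S e) (j : Fin (d + 1)) (x₀ : E) :
    ∃ O : Set E, IsOpen O ∧ x₀ ∈ O ∧ ∃ c : ℝ, 0 ≤ c ∧ ∃ s₀ : ℝ, ∀ u, IsSolution F S D u →
      ∀ q ∈ endStrip j, s₀ ≤ |q.1| → u (S.strip j q) ∈ O →
      |actionForm F S D u (S.strip j q) (S.stripT j q)| ≤ c * (1 + √(det2 (S.stripS j q)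
        (S.stripT j q) * energyDensity F S D u (S.strip j q))) := by
  have hθ := hF.thetaE_symplectic
  obtain ⟨Q, hQ, hQc, O, hO, hxO, hOsrc, hOQ⟩ := exists_compact_chart (I := IE) x₀
  obtain ⟨m, hm, η, hη, hmet⟩ := exists_metric_lower_bound hθ isCompact_Icc (he j).J_smooth
    (fun t ht => ((he j).J_admissible t ht).compatible) x₀ hQ hQc
  obtain ⟨C₁, hC₁⟩ := exists_oneForm_bound hθ.1 x₀ hQ hQc
  obtain ⟨C₂, hC₂⟩ := exists_hamiltonian_bound (he j).H_smooth x₀ hQ hQc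
  obtain ⟨c, hc, C₃, hC₃⟩ := hD.J_end j x₀ Q hQ hQc 0
  have hsmall : ∀ᶠ s in atTop, C₃ * Real.exp (-c * s) < η := by
    have h1 : Tendsto (fun s : ℝ => C₃ * Real.exp (-c * s)) atTop (𝓝 (C₃ * 0)) :=
      (Real.tendsto_exp_atBot.comp
        (tendsto_id.const_mul_atTop_of_neg (neg_lt_zero.2 hc))).const_mul C₃
    rw [mul_zero] at h1
    exact h1.eventually (gt_mem_nhds hη)
  obtain ⟨s₀, hs₀⟩ := eventually_atTop.1 hsmall
  refine ⟨O, hO, hxO, max (|C₁| / √m) (|C₁| * (|C₂| / m) + |C₂|), ?_, s₀,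
    fun u hu q hq hqs huO => ?_⟩
  · exact le_max_of_le_left (by positivity)
  have hz := hS.strip_mapsTo j hq
  have hclose : ‖endInChart IE (D.J (S.strip j q)) x₀ (extChartAt IE x₀ (u (S.strip j q)))
      - endInChart IE ((e j).J q.2) x₀ (extChartAt IE x₀ (u (S.strip j q)))‖ ≤ η := by
    have h1 := hC₃ q.1 hq.1 q.2 hq.2 _ (hOQ huO)
    rw [norm_iteratedFDerivWithin_zero] at h1
    exact h1.trans (hs₀ _ hqs).le
  have hmet' := hmet q.2 hq.2 (D.J (S.strip j q)) _ (hOsrc huO) (hOQ huO) hclose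
  obtain ⟨hH1, hH2⟩ := hC₂ q.2 hq.2 _ (hOsrc huO) (hOQ huO)
  have hθb := hC₁ _ (hOsrc huO) (hOQ huO)
  have hK : (fun y => D.K (S.strip j q) y (S.stripT j q)) = (e j).H q.2 :=
    funext fun y => (hD.K_end j q hq y).2
  have hX := norm_tcoord_hamVF_le hθ (hD.J_admissible _ hz).compatible hm (abs_nonneg C₂) hmet'
    (fun v => (hH2 v).trans (mul_le_mul_of_nonneg_right (le_abs_self _) (norm_nonneg _)))
  have hcov := hmet' (covDeriv F S D u (S.strip j q) (S.stripT j q))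
  have hE := omegaE_covDeriv_stripT hθ hS hD.K_smooth hu hq
  unfold FibrationData.omegaE at hE
  rw [hE] at hcov
  have hθ1 := hθb (covDeriv F S D u (S.strip j q) (S.stripT j q))
  have hθ2 := hθb (hamVF IE F.thetaE ((e j).H q.2) (u (S.strip j q)))
  rw [actionForm_eq_covDeriv, hK, congrFun hK (u (S.strip j q))]
  exact abs_add_sub_le_of_metric hm hcov (norm_nonneg _) hθ1 hθ2 (norm_nonneg _) hX hH1

theorem exists_end_estimate (hF : F.IsTarget) (hS : S.IsPuncturedDisc)
    (he : ∀ j, (e j).IsAdmissible F) (hD : D.IsAdmissible F S e) {x : Fin (d + 1) → ℝ → E}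
    (hx : ∀ j, IsChord F (e j) (x j)) : ∃ c : ℝ, 0 ≤ c ∧ ∀ u, IsSolution F S D u → HasLimits S u x →
      ∃ σ₁ : ℝ, ∀ j, ∀ q ∈ endStrip j, σ₁ ≤ |q.1| →
      |actionForm F S D u (S.strip j q) (S.stripT j q)| ≤ c * (1 + √(det2 (S.stripS j q)
        (S.stripT j q) * energyDensity F S D u (S.strip j q))) := by
  have hend : ∀ j, ∃ O : Set E, IsOpen O ∧ x j '' Icc 0 1 ⊆ O ∧ ∃ c : ℝ, 0 ≤ c ∧ ∃ s₀ : ℝ, ∀ u,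
      IsSolution F S D u → ∀ q ∈ endStrip j, s₀ ≤ |q.1| → u (S.strip j q) ∈ O →
      |actionForm F S D u (S.strip j q) (S.stripT j q)| ≤ c * (1 + √(det2 (S.stripS j q)
        (S.stripT j q) * energyDensity F S D u (S.strip j q))) := by
    intro j
    have hxc : ContinuousOn (x j) (Icc 0 1) := fun t ht =>
      ((hx j).1 t ht).continuousWithinAt
    refine (isCompact_Icc.image_of_continuousOn hxc).induction_on
      (p := fun A => ∃ O : Set E, IsOpen O ∧ A ⊆ O ∧ ∃ c : ℝ, 0 ≤ c ∧ ∃ s₀ : ℝ, ∀ u,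
        IsSolution F S D u → ∀ q ∈ endStrip j, s₀ ≤ |q.1| → u (S.strip j q) ∈ O →
        |actionForm F S D u (S.strip j q) (S.stripT j q)| ≤ c * (1 + √(det2 (S.stripS j q)
          (S.stripT j q) * energyDensity F S D u (S.strip j q)))) ?_ ?_ ?_ ?_
    · exact ⟨∅, isOpen_empty, subset_rfl, 0, le_rfl, 0, fun _ _ _ _ _ h => h.elim⟩
    · rintro A A' hA ⟨O, hO, hAO, h⟩
      exact ⟨O, hO, hA.trans hAO, h⟩
    · rintro A A' ⟨O, hO, hAO, c, hc, s₀, h⟩ ⟨O', hO', hAO', c', hc', s₀', h'⟩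
      refine ⟨O ∪ O', hO.union hO', union_subset_union hAO hAO', max c c', le_max_of_le_left hc,
        max s₀ s₀', fun u hu q hq hqs huO => ?_⟩
      rcases huO with huO | huO
      · refine (h u hu q hq ((le_max_left _ _).trans hqs) huO).trans ?_
        gcongr
        exact le_max_left _ _
      · refine (h' u hu q hq ((le_max_right _ _).trans hqs) huO).trans ?_
        gcongr
        exact le_max_right _ _
    · intro y _
      obtain ⟨O, hO, hyO, h⟩ := exists_local_end_bound hF hS he hD j y
      exact ⟨O, mem_nhdsWithin_of_mem_nhds (hO.mem_nhds hyO), O, hO, subset_rfl, h⟩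
  choose O hO hxO c hc s₀ hbound using hend
  refine ⟨∑ j, c j, Finset.sum_nonneg fun j _ => hc j, fun u hu hux => ?_⟩
  have hlim : ∀ j, ∃ σ : ℝ, ∀ q ∈ endStrip j, σ ≤ |q.1| → u (S.strip j q) ∈ O j := by
    intro j
    have h1 : ∀ᶠ s in endFilter j, ∀ t ∈ Icc (0 : ℝ) 1, u (S.strip j (s, t)) ∈ O j := by
      refine isCompact_Icc.induction_on
        (p := fun A => ∀ᶠ s in endFilter j, ∀ t ∈ A, u (S.strip j (s, t)) ∈ O j) ?_ ?_ ?_ ?_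
      · exact Eventually.of_forall fun _ _ h => h.elim
      · exact fun A A' hA h => h.mono fun s hs t ht => hs t (hA ht)
      · rintro A A' h h'
        filter_upwards [h, h'] with s hs hs' t ht
        exact ht.elim (hs t) (hs' t)
      · intro t ht
        have h2 := (hux j t ht).eventually ((hO j).mem_nhds (hxO j (mem_image_of_mem _ ht)))
        obtain ⟨p, hp, A, hA, h3⟩ := eventually_prod_iff.1 h2
        exact ⟨{t | A t}, hA, hp.mono fun s hs t ht => h3 hs ht⟩
    unfold endFilter at h1
    split_ifs at h1 with hj
    · obtain ⟨σ, hσ⟩ := eventually_atBot.1 h1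
      refine ⟨-σ, fun q hq hqs => hσ q.1 ?_ q.2 hq.2⟩
      rw [abs_eq_endSign_mul hq.1, endSign, if_pos hj] at hqs
      linarith
    · obtain ⟨σ, hσ⟩ := eventually_atTop.1 h1
      refine ⟨σ, fun q hq hqs => hσ q.1 ?_ q.2 hq.2⟩
      rwa [abs_eq_endSign_mul hq.1, endSign, if_neg hj, one_mul] at hqs
  choose σ hσ using hlim
  refine ⟨∑ j, (|σ j| + |s₀ j|), fun j q hq hqs => ?_⟩
  have h1 : |σ j| + |s₀ j| ≤ |q.1| := (Finset.single_le_sum (f := fun j => |σ j| + |s₀ j|)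
    (fun i _ => by positivity) (Finset.mem_univ j)).trans hqs
  have h2 := hbound j u hu q hq (by linarith [le_abs_self (s₀ j), abs_nonneg (σ j)])
    (hσ j q hq (by linarith [le_abs_self (σ j), abs_nonneg (s₀ j)]))
  refine h2.trans ?_
  gcongr
  exact Finset.single_le_sum (fun i _ => hc i) (Finset.mem_univ j)

theorem exists_energy_bound [CompactSpace M] [T2Space E] (hF : F.IsTarget) (hS : S.IsPuncturedDisc)
    (he : ∀ j, (e j).IsAdmissible F) (hD : D.IsAdmissible F S e) {x : Fin (d + 1) → ℝ → E}
    (hx : ∀ j, IsChord F (e j) (x j)) : ∃ C : ℝ, ∀ u, IsSolution F S D u → HasLimits S u x →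
      geomEnergy F S D u ≤ ENNReal.ofReal C := by
  obtain ⟨c₁, hc₁, h1⟩ := exists_end_estimate hF hS he hD hx
  obtain ⟨c₂, h2⟩ := exists_circle_bound hF hS hD x
  obtain ⟨C, hC⟩ := exists_geomEnergy_le hF hS hD hc₁ c₂ (S.angle 0)
  refine ⟨C, fun u hu hux => hC u hu ?_⟩
  obtain ⟨σ₁, g1⟩ := h1 u hu hux
  obtain ⟨σ₂, hσ₂, g2⟩ := h2 u hu hux
  exact ⟨max σ₁ σ₂, lt_max_of_lt_right hσ₂,
    fun j q hq hqs => g1 j q hq ((le_max_left _ _).trans hqs),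
    fun σ hσ δ hδ => g2 σ ((le_max_right _ _).trans hσ) δ hδ⟩

end EndEstimate

end HalfPlaneFloer

end

theorem mainTheorem7
    {VE : Type*} [NormedAddCommGroup VE] [NormedSpace ℝ VE] [FiniteDimensional ℝ VE]
    {BE : Type*} [TopologicalSpace BE] {IE : ModelWithCorners ℝ VE BE}
    {E : Type*} [TopologicalSpace E] [ChartedSpace BE E] [IsManifold IE ∞ E]
    [T2Space E] [SecondCountableTopology E]
    {VM : Type*} [NormedAddCommGroup VM] [NormedSpace ℝ VM] [FiniteDimensional ℝ VM]
    {BM : Type*} [TopologicalSpace BM] {IM : ModelWithCorners ℝ VM BM}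
    {M : Type*} [TopologicalSpace M] [ChartedSpace BM M] [IsManifold IM ∞ M]
    [T2Space M] [SecondCountableTopology M] [CompactSpace M]
    (F : HalfPlaneFloer.FibrationData IE E IM M) (hF : F.IsTarget)
    (d : ℕ) (hd : 1 ≤ d) (S : HalfPlaneFloer.DiscData d) (hS : S.IsPuncturedDisc)
    (e : Fin (d + 1) → HalfPlaneFloer.EndData IE E) (he : ∀ j, (e j).IsAdmissible F)
    (D : HalfPlaneFloer.SurfaceData IE E) (hD : D.IsAdmissible F S e)
    (x : Fin (d + 1) → ℝ → E) (hx : ∀ j, HalfPlaneFloer.IsChord F (e j) (x j)) :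
    ∃ C : ℝ, ∀ u : ℂ → E, HalfPlaneFloer.IsSolution F S D u → HalfPlaneFloer.HasLimits S u x →
      HalfPlaneFloer.geomEnergy F S D u ≤ ENNReal.ofReal C := by
  obtain ⟨C, hC⟩ := HalfPlaneFloer.exists_energy_bound hF hS he hD hx
  exact ⟨C, hC⟩
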